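/- Let $n\ge 2$, $\rho_k=\frac{k}{n+1}$ ($k=1,\dots,n$), $C=(n+1)^{n+1}$, and let $Y^{(n-1)}_t$ be the mirror family of the deformed Fermat pencil, given by $f_n(x_1,\dots,x_n,t)=x_1\cdots x_n(x_1+\dots+x_n+1)+\frac{(-1)^{n+1}t}{(n+1)^{n+1}}=0$ in $\mathbb C^n$, with period $\omega_{n-1}(t)=\frac1{2\pi i}\oint_{|x_1|=\dots=|x_n|=\frac1{n+1}}\frac{dx_1\cdots dx_n}{f_n(x,t)}$ for $|t|<1$ (and likewise $f_{n-1},\omega_{n-2}$). **(1) The mixed-twist construction and the GKZ system.** With the generalized functional invariant $(1,n,1)$, i.e. $\tilde t(v)=-\frac{n^n t}{(n+1)^{n+1}v(v+1)^n}$, one has, for $v=x_n\neq 0,-1$, $f_n(x,t)=v(v+1)^n f_{n-1}\big(\tfrac{x_1}{v+1},\dots,\tfrac{x_{n-1}}{v+1},\tilde t(v)\big)$, and, for $|t|<1$, $\omega_{n-1}(t)=\oint_{|v|=\frac1{n+1}}\omega_{n-2}(\tilde t(v))\frac{dv}{v(v+1)}$. Moreover, for $|t|<1$, with an absolutely convergent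 integral on the right, $$\Big[\prod_{i=1}^{n-1}\Gamma(\rho_i)\Gamma(1-\rho_i)\Big]\omega_{n-1}(t)=(2\pi i)^{n-1}\int_{(0,1)^{n-1}}\prod_{i=1}^{n-1}z_i^{\rho_i-1}(1-z_i)^{-\rho_i}\,(1-t z_1\cdots z_{n-1})^{-\rho_n}\,dz .$$ The right-hand integral is the $\mathcal A$-hypergeometric Euler integral of the GKZ data $(\mathsf A,\alpha)$, where $\mathsf A\in\mathrm{Mat}(2n-1,2n;\mathbb Z)$ has the columns $a_i=(e_i;0)$, $a_{n+i}=(e_i;e_i)$ for $i<n$, $a_n=(e_n;1,\dots,1)$, $a_{2n}=(e_n;0)$ in $\mathbb Z^{n}\oplus\mathbb Z^{n-1}$, and $\alpha=(-\rho_1,\dots,-\rho_n,-\rho_1,\dots,-\rho_{n-1})$. In the rescaled variable, $\omega_{n-1}(Ct)$ is, for $|t|<1/C$, a solution of $$\big[\theta^n-C\,t\,(\theta+\rho_1)\cdots(\theta+\rho_n)\big]F=0,\qquad \theta=t\tfrac{d}{dt}.\qquad(*)$$ The columns of $\mathsf A$ generate $\mathbb Z^{2n-1}$ and lie on a hyperplane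 $h=1$ for some homomorphism $h:\mathbb Z^{2n-1}\to\mathbb Z$; their lattice of integral relations is $\mathbb Z\,b$ with $b=(1,\dots,1,-1,\dots,-1)$; $\alpha=\mathsf A\gamma_0$ for $\gamma_0=(0,\dots,0,-\rho_1,\dots,-\rho_n)$; and the system is non-resonant: $\alpha\notin\mathbb Z^{2n-1}+\mathrm{span}_{\mathbb C}F$ for every proper face $F$ of the cone spanned by the columns. **(2) Mellin–Barnes solutions.** Let $\gamma=\gamma_0+c\,b$ with $c\in\mathbb R$, and let $\sigma\in\mathbb R$ satisfy $\gamma_{n+i}<\sigma<-\gamma_i$ for $i=1,\dots,n$. The integral $$\mathsf M(u)=\int_{\sigma+i\mathbb R}\prod_{j=1}^{2n}\Gamma(-\gamma_j-b_js)\,u_j^{\gamma_j+b_js}\,ds,$$ where $u_j^a=e^{a\log u_j}$ for chosen logarithms of the $u_j$, converges absolutely if $\big|\mathrm{Im}\sum_j b_j\log u_j\big|<n\pi$, and on every open set with continuous branches $\log u_j$ subject to this bound it is a holomorphic solution of the GKZ system $\sum_j \mathsf A_{ij}u_j\partial_j\Phi=\alpha_i\Phi$, $\prod_{\ell_j>0}\partial_j^{\ell_j}\Phi=\prod_{\ell_j<0}\partial_j^{-\ell_j}\Phi$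 (all $\ell\in\mathbb Z^{2n}$ with $\mathsf A\ell=0$). On every connected non-empty open set with continuous branches such that $-n\pi<\mathrm{Im}\sum_j b_j\log u_j<-n\pi+2\pi$, the $n$ Mellin–Barnes integrals obtained from $\log u_1+2\pi i k$, $k=0,\dots,n-1$, form a basis of the space of solutions of the GKZ system. Restricted to $u=((-1)^nCt,1,\dots,1)$ with $\log u_1=\mathrm{Log}(-Ct)-(n-1)\pi i+2\pi i k$ ($k=0,\dots,n-1$, $\mathrm{Log}$ principal) and $\log u_j=0$ for $j>1$, they form a basis of solutions of $(*)$ on every connected non-empty open subset of $\mathbb C\setminus[0,\infty)$. **(3) Monodromy.** Let $B_k(\epsilon)=e^{-\pi i\epsilon}\Big[\prod_{i=1}^n\frac{\Gamma(\rho_i)\Gamma(1+\epsilon)}{\Gamma(\rho_i+\epsilon)}\Big]\frac{\sin\pi\rho_k}{\sin(\pi\rho_k+\pi\epsilon)}$ and let $\tilde{\mathsf P}$ be the $n\times n$ matrix with entry $\frac{1}{(2\pi i)^j j!}\frac{d^j}{d\epsilon^j}\big|_{\epsilon=0}\big[C^{-\epsilon}B_k(\epsilon)\big]$ in row $n-j$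 ($0\le j\le n-1$) and column $n+1-k$ ($1\le k\le n$). Then $\tilde{\mathsf P}$ is invertible. Put $$\mathsf m_0=\Big(\tfrac{1}{(b-a)!}\Big)_{a\le b}\ \text{(upper triangular)},\qquad \mathsf m_\infty=\tilde{\mathsf P}\,\mathrm{diag}(e^{-2\pi i\rho_n},\dots,e^{-2\pi i\rho_1})\,\tilde{\mathsf P}^{-1},\qquad \mathsf m_{1/C}=\mathsf m_\infty\mathsf m_0^{-1}.$$ The matrix $\mathsf m_0$ is maximally unipotent: $(\mathsf m_0-1)^n=0\ne(\mathsf m_0-1)^{n-1}$. There is an invertible matrix $Q$ (for each choice of $c,\sigma$) such that analytic continuation of the column vector of the $n$ Mellin–Barnes solutions of $(*)$ from (2) along the counterclockwise circles through the base point $\frac{1-i}{2C}$ with centres $0$, $\frac1C$ and $\frac{1+i}{2C}$ (encircling only $0$, only $1/C$, and both, the last being the loop around $\infty$ described by $t\mapsto te^{i\varphi}$, $|t|$ large) multiplies it from the left by $Q\mathsf m_0Q^{-1}$, $Q\mathsf m_{1/C}Q^{-1}$ and $Q\mathsf m_\infty Q^{-1}$, respectively. -/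

import Mathlib

open MeasureTheory Filter Topology

noncomputable section

/-! ### The mirror family, its mixed-twist fibration and its period -/

/-- The polynomial `f_n(x, t) = x₁ ⋯ x_n (x₁ + ⋯ + x_n + 1) + (-1)^(n+1) t / (n+1)^(n+1)`; the affine
hypersurface `f_n(·, t) = 0` in `ℂⁿ` is (the affine part of) the mirror Calabi-Yau `Y_t^{(n-1)}`. -/
def mirrorPoly (n : ℕ) (x : Fin n → ℂ) (t : ℂ) : ℂ :=
  (∏ i, x i) * ((∑ i, x i) + 1) + (-1) ^ (n + 1) * t / ((n : ℂ) + 1) ^ (n + 1)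

/-- The covering map of the base `ℙ¹` attached to the generalized functional invariant `(i, j, 1)`,
`[v : 1] ↦ [c_{ij} t : v^i (v+1)^j]`, in the affine coordinate `v`, with the normalizing constant
`c_{ij} = (-1)^i i^i j^j / (i+j)^(i+j)`. -/
def functionalInvariant (i j : ℕ) (t v : ℂ) : ℂ :=
  ((-1) ^ i * (i : ℂ) ^ i * (j : ℂ) ^ j / ((i : ℂ) + j) ^ (i + j)) * t / (v ^ i * (v + 1) ^ j)

/-- The period `ω_{n-1}(t)` of the family, written as the residue (tube) integral
`(2πi)⁻¹ ∮⋯∮ dx₁ ⋯ dx_n / f_n(x, t)` over the torus `|x₁| = ⋯ = |x_n| = 1/(n+1)`: taking the residue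
in `x₁` gives the integral of the holomorphic form `dx₂ ∧ ⋯ ∧ dx_n / ∂_{x₁} f_n`. -/
def mirrorPeriod (n : ℕ) (t : ℂ) : ℂ :=
  (2 * Real.pi * Complex.I)⁻¹ *
    torusIntegral (fun x : Fin n → ℂ => (mirrorPoly n x t)⁻¹) 0 (fun _ => 1 / ((n : ℝ) + 1))

/-! ### GKZ systems

A configuration of vectors `a_j` (`j : N`) in `ℤ^R` is given as the matrix `A` with columns `a_j`. -/

/-- The conditions on a GKZ configuration: the columns generate `ℤ^R`, and they lie on the affine
hyperplane `h = 1` for some homomorphism `h : ℤ^R → ℤ`. -/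
def IsGKZConfiguration {R N : Type*} (A : Matrix R N ℤ) : Prop :=
  Submodule.span ℤ (Set.range fun j : N => fun i : R => A i j) = ⊤ ∧
    ∃ h : (R → ℤ) →+ ℤ, ∀ j, h (fun i => A i j) = 1

/-- Non-resonance: for no proper face `F` of the cone spanned by the columns of `A` does `α` lie in
`ℤ^R + span_ℂ F`. Proper faces are cut out by linear functionals `φ` which are non-negative on all
columns and not zero on all of them. -/
def IsNonResonant {R N : Type*} [Fintype R] [Fintype N] (A : Matrix R N ℤ) (α : R → ℂ) : Prop :=
  ∀ φ : R → ℝ, (∀ j, 0 ≤ ∑ i, φ i * (A i j : ℝ)) → (∃ j, 0 < ∑ i, φ i * (A i j : ℝ)) →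
    ¬ ∃ (z : R → ℤ) (c : N → ℂ), (∀ j, 0 < ∑ i, φ i * (A i j : ℝ) → c j = 0) ∧
      ∀ i, α i = (z i : ℂ) + ∑ j, c j * (A i j : ℂ)

/-- The partial derivative `∂Φ/∂u_j`. -/
def partialDeriv {N : Type*} [Fintype N] [DecidableEq N] (j : N) (Φ : (N → ℂ) → ℂ) :
    (N → ℂ) → ℂ :=
  fun u => fderiv ℂ Φ u (Pi.single j 1)

/-- The iterated partial derivative `∏_j ∂_j^{p_j}` (the order of the factors is immaterial on
holomorphic functions). -/
def monomialDeriv {N : Type*} [Fintype N] [DecidableEq N] (p : N → ℕ) (Φ : (N → ℂ) → ℂ) :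
    (N → ℂ) → ℂ :=
  (Finset.univ : Finset N).toList.foldr (fun j g => (partialDeriv j)^[p j] g) Φ

/-- `Φ` is a holomorphic solution on the open set `U` of the GKZ system with data `(A, α)`: the
homogeneity equations `∑_j a_{ij} u_j ∂_j Φ = α_i Φ`, and the toric equations
`∏_{ℓ_j > 0} ∂_j^{ℓ_j} Φ = ∏_{ℓ_j < 0} ∂_j^{-ℓ_j} Φ` for every integral relation `A ℓ = 0`. -/
def IsGKZSolution {R N : Type*} [Fintype N] [DecidableEq N]
    (A : Matrix R N ℤ) (α : R → ℂ) (U : Set (N → ℂ)) (Φ : (N → ℂ) → ℂ) : Prop :=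
  DifferentiableOn ℂ Φ U ∧
  (∀ u ∈ U, ∀ i, ∑ j, (A i j : ℂ) * u j * partialDeriv j Φ u = α i * Φ u) ∧
  ∀ ℓ : N → ℤ, A.mulVec ℓ = 0 → ∀ u ∈ U,
    monomialDeriv (fun j => (ℓ j).toNat) Φ u = monomialDeriv (fun j => (-ℓ j).toNat) Φ u

/-- The integrand of the `A`-hypergeometric Euler integral of a Cayley configuration: the rows
`Sum.inl k` record to which polynomial `P_k` a column belongs, the rows `Sum.inr r` are exponents,
`P_k(z) = ∑_{j in block k} u_j z^{a_j}`, and the integrand is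
`∏_k P_k(z)^{α_k} ∏_r z_r^{-α_r - 1}` (principal powers). -/
def eulerIntegrand {K R N : Type*} [Fintype K] [Fintype R] [Fintype N]
    (A : Matrix (K ⊕ R) N ℤ) (α : K ⊕ R → ℂ) (u : N → ℂ) (z : R → ℝ) : ℂ :=
  (∏ k, (∑ j, (A (Sum.inl k) j : ℂ) * u j * ∏ r, (z r : ℂ) ^ A (Sum.inr r) j) ^ α (Sum.inl k)) *
    ∏ r, (z r : ℂ) ^ (-α (Sum.inr r) - 1)

/-- The Mellin-Barnes integrand `∏_j Γ(-γ_j - b_j s) u_j^{γ_j + b_j s}`, where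
`u_j^a = exp (a w_j)` for the chosen logarithm `w_j` of `u_j`. -/
def mellinBarnesIntegrand {N : Type*} [Fintype N] (b : N → ℤ) (γ : N → ℝ) (w : N → ℂ) (s : ℂ) : ℂ :=
  ∏ j, Complex.Gamma (-(γ j : ℂ) - (b j : ℂ) * s) *
    Complex.exp (w j * ((γ j : ℂ) + (b j : ℂ) * s))

/-- The Mellin-Barnes integral over the vertical line `s = σ + i y`, `ds = i dy`. -/
def mellinBarnes {N : Type*} [Fintype N] (b : N → ℤ) (γ : N → ℝ) (σ : ℝ) (w : N → ℂ) : ℂ :=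
  ∫ y : ℝ, Complex.I * mellinBarnesIntegrand b γ w ((σ : ℂ) + (y : ℂ) * Complex.I)

/-- The functions `Φ_k` form a basis, on the set `U`, of the space of solutions described by `S`. -/
def IsBasisOfSolutions {X : Type*} {n : ℕ} (S : (X → ℂ) → Prop) (U : Set X)
    (Φ : Fin n → X → ℂ) : Prop :=
  (∀ k, S (Φ k)) ∧
  (∀ c : Fin n → ℂ, (∀ x ∈ U, ∑ k, c k * Φ k x = 0) → c = 0) ∧
  ∀ F : X → ℂ, S F → ∃ c : Fin n → ℂ, ∀ x ∈ U, F x = ∑ k, c k * Φ k x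

/-! ### The GKZ data of the mirror family -/

/-- `ρ_k = k/(n+1)`, `k = 1, …, n`; the index of `Fin n` starts at `0`. -/
def rho (n : ℕ) (k : Fin n) : ℝ := ((k : ℝ) + 1) / ((n : ℝ) + 1)

/-- `C = (n+1)^(n+1)`. -/
def singC (n : ℕ) : ℕ := (n + 1) ^ (n + 1)

/-- The matrix `A` with `2n-1` rows and `2n` columns `a_1, …, a_n` (`Sum.inl`), `a_{n+1}, …, a_{2n}`
(`Sum.inr`): `a_i = (e_i; 0)` and `a_{n+i} = (e_i; e_i)` for `i < n`, `a_n = (e_n; 1, …, 1)`,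
`a_{2n} = (e_n; 0)`. It is the Cayley configuration of `u_i + u_{n+i} z_i` (`i < n`) and
`u_n z_1 ⋯ z_{n-1} + u_{2n}`. -/
def gkzMatrix (n : ℕ) : Matrix (Fin n ⊕ Fin (n - 1)) (Fin n ⊕ Fin n) ℤ
  | Sum.inl i, Sum.inl j => if i = j then 1 else 0
  | Sum.inl i, Sum.inr j => if i = j then 1 else 0
  | Sum.inr _, Sum.inl j => if (j : ℕ) + 1 = n then 1 else 0
  | Sum.inr i, Sum.inr j => if (j : ℕ) = (i : ℕ) then 1 else 0

/-- `α = (-ρ_1, …, -ρ_n, -ρ_1, …, -ρ_{n-1})`. -/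
def gkzAlpha (n : ℕ) : Fin n ⊕ Fin (n - 1) → ℂ
  | Sum.inl i => -(rho n i : ℂ)
  | Sum.inr i => -(rho n (Fin.castLE (Nat.sub_le n 1) i) : ℂ)

/-- `B = (1, …, 1, -1, …, -1)`, the generator of the lattice of relations. -/
def gkzB (n : ℕ) : Fin n ⊕ Fin n → ℤ
  | Sum.inl _ => 1
  | Sum.inr _ => -1

/-- `γ₀ = (0, …, 0, -ρ_1, …, -ρ_n)`. -/
def gkzGamma0 (n : ℕ) : Fin n ⊕ Fin n → ℝ
  | Sum.inl _ => 0
  | Sum.inr i => -rho n i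

/-- `γ₀ + c B`, the exponent vectors equivalent to `γ₀` modulo `𝕃 ⊗ ℝ`. -/
def gkzGamma (n : ℕ) (c : ℝ) : Fin n ⊕ Fin n → ℝ := fun j => gkzGamma0 n j + c * (gkzB n j : ℝ)

/-- The coefficients for which the polynomials are `1 - z_i` (`i < n`) and `1 - t z_1 ⋯ z_{n-1}`. -/
def eulerCoeffs (n : ℕ) (t : ℂ) : Fin n ⊕ Fin n → ℂ
  | Sum.inl i => if (i : ℕ) + 1 = n then -t else 1
  | Sum.inr i => if (i : ℕ) + 1 = n then 1 else -1

/-- Change of the branch of `log u_1` by `2πik`. -/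
def shiftLog (n : ℕ) (k : ℕ) (w : Fin n ⊕ Fin n → ℂ) : Fin n ⊕ Fin n → ℂ
  | Sum.inl i => if (i : ℕ) = 0 then w (Sum.inl i) + 2 * Real.pi * Complex.I * k else w (Sum.inl i)
  | Sum.inr i => w (Sum.inr i)

/-- The point `u = ((-1)^n C t, 1, …, 1)`. -/
def linePoint (n : ℕ) (t : ℂ) : Fin n ⊕ Fin n → ℂ
  | Sum.inl i => if (i : ℕ) = 0 then (-1) ^ n * (singC n : ℂ) * t else 1
  | Sum.inr _ => 1

/-- Logarithms of the coordinates of `linePoint n t` for `t ∉ [0, ∞)`. -/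
def lineLog (n : ℕ) (t : ℂ) : Fin n ⊕ Fin n → ℂ
  | Sum.inl i =>
      if (i : ℕ) = 0 then
        Complex.log (-((singC n : ℂ) * t)) - ((n : ℂ) - 1) * Real.pi * Complex.I
      else 0
  | Sum.inr _ => 0

/-- The Mellin-Barnes integrals in the variable `t`, for the `n` branches of `log u_1`. -/
def mbFunction (n : ℕ) (c σ : ℝ) (k : Fin n) (t : ℂ) : ℂ :=
  mellinBarnes (gkzB n) (gkzGamma n c) σ (shiftLog n k (lineLog n t))

/-- The plane slit along `[0, ∞)`. -/
def slitDomain : Set ℂ := {t | -t ∈ Complex.slitPlane}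

/-! ### The hypergeometric equation and monodromy -/

/-- `θ = t d/dt`. -/
def eulerTheta (F : ℂ → ℂ) : ℂ → ℂ := fun t => t * deriv F t

/-- `F` is holomorphic on the open set `V` and `(θⁿ - C t (θ + ρ_1) ⋯ (θ + ρ_n)) F = 0` there. -/
def IsHypergeometricSolution (n : ℕ) (V : Set ℂ) (F : ℂ → ℂ) : Prop :=
  DifferentiableOn ℂ F V ∧ ∀ t ∈ V,
    eulerTheta^[n] F t -
      (singC n : ℂ) * t *
        (List.finRange n).foldr (fun k g => fun t => eulerTheta g t + (rho n k : ℂ) * g t) F t = 0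

/-- The germ of `g` at `γ 1` is the analytic continuation of the germ of `f` at `γ 0` along the path
`γ : [0, 1] → ℂ`. -/
def ContinuesAlong (γ : ℝ → ℂ) (f g : ℂ → ℂ) : Prop :=
  ∃ F : ℝ → ℂ → ℂ,
    (∀ s ∈ Set.Icc (0 : ℝ) 1, AnalyticAt ℂ (F s) (γ s)) ∧
    (∀ s ∈ Set.Icc (0 : ℝ) 1, ∀ᶠ s' in 𝓝[Set.Icc 0 1] s, F s' =ᶠ[𝓝 (γ s')] F s) ∧
    F 0 =ᶠ[𝓝 (γ 0)] f ∧ F 1 =ᶠ[𝓝 (γ 1)] g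

/-- Continuation along the loop `γ` turns the column vector `y` into `m y`. -/
def HasMonodromy {n : ℕ} (y : Fin n → ℂ → ℂ) (γ : ℝ → ℂ) (m : Matrix (Fin n) (Fin n) ℂ) : Prop :=
  γ 0 = γ 1 ∧ ∀ i, ContinuesAlong γ (y i) (fun t => ∑ j, m i j * y j t)

/-- The loop that starts at `p` and runs once counterclockwise along the circle with centre `z`. -/
def circleLoop (p z : ℂ) (s : ℝ) : ℂ := z + (p - z) * Complex.exp (2 * Real.pi * Complex.I * s)

/-- `m₀`: the upper triangular matrix with entries `1/(b-a)!`. -/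
def mZero (n : ℕ) : Matrix (Fin n) (Fin n) ℂ :=
  Matrix.of fun a b => if a ≤ b then (1 : ℂ) / (Nat.factorial ((b : ℕ) - (a : ℕ)) : ℂ) else 0

/-- `B_k(ε) = e^{-πiε} (∏_i Γ(ρ_i) Γ(1+ε) / Γ(ρ_i+ε)) sin(πρ_k) / sin(πρ_k + πε)`. -/
def transitionB (n : ℕ) (k : Fin n) (ε : ℂ) : ℂ :=
  Complex.exp (-(Real.pi * Complex.I * ε)) *
    (∏ i, Complex.Gamma (rho n i) * Complex.Gamma (1 + ε) / Complex.Gamma (rho n i + ε)) *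
    (Complex.sin (Real.pi * rho n k) / Complex.sin (Real.pi * rho n k + Real.pi * ε))

/-- The matrix `P̃`: in the row `n-j` (`j = 0, …, n-1`) and the column `n+1-k` (`k = 1, …, n`) it has
the entry `(2πi)^{-j} (j!)⁻¹ (d/dε)^j [C^{-ε} B_k(ε)]` at `ε = 0`. -/
def transitionP (n : ℕ) : Matrix (Fin n) (Fin n) ℂ :=
  Matrix.of fun a b =>
    iteratedDeriv (Fin.rev a : ℕ) (fun ε : ℂ => (singC n : ℂ) ^ (-ε) * transitionB n (Fin.rev b) ε) 0 /
      ((2 * Real.pi * Complex.I) ^ (Fin.rev a : ℕ) * (Nat.factorial (Fin.rev a : ℕ) : ℂ))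

/-- `m_∞ = P̃ diag(e^{-2πiρ_n}, …, e^{-2πiρ_1}) P̃⁻¹`. -/
def mInfty (n : ℕ) : Matrix (Fin n) (Fin n) ℂ :=
  transitionP n *
    Matrix.diagonal (fun b => Complex.exp (-(2 * Real.pi * Complex.I * rho n (Fin.rev b)))) *
    (transitionP n)⁻¹

/-- `m_{1/C} = m_∞ m₀⁻¹`. -/
def mConifold (n : ℕ) : Matrix (Fin n) (Fin n) ℂ := mInfty n * (mZero n)⁻¹

/-- The base point `(1 - i)/(2C)` of the three loops. -/
def basePoint (n : ℕ) : ℂ := (1 - Complex.I) / (2 * (singC n : ℂ))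

end

/-! Everything reduces to one equation. In the logarithmic variable z, with C t = (-1)^n e^z and D =
d/dz, the hypergeometric equation reads D^n g = (-1)^n e^z ∏ (D + ρ_i) g (`IsExpODESolution`). Away
from the points with (-1)^n e^z = 1 a solution is determined by its first n derivatives at a point,
so n independent solutions form a basis.

The period is computed by expanding 1/f_n as a geometric series on the torus and taking residues;
its coefficients are ((n+1)k)! / (k!^(n+1) (n+1)^((n+1)k)), up to the factor (2πi)^(n-1)
(`hasSum_mirrorPeriod`). The iterated relation, the Euler integral (binomial series and Beta
integrals) and the differential equation are then comparisons of power series.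

The lattice of relations of the GKZ data has rank one. Hence the homogeneity equations force a
solution to be locally u^γ₀ ψ(∑ b_j log u_j), the toric equation of b is the equation above for ψ,
and the toric equations of the multiples of b are its iterates (`IsGKZSolution.exists_local_form`,
`polyD_fall_iterate`). The Mellin-Barnes integral is u^γ₀ J(∑ b_j log u_j) with J(z) = ∫ Γ(-s)^n ∏
Γ(ρ_i + s) e^(zs) ds. Moving the contour by one unit shows that J solves the equation. A linear
relation among the translates J(z + 2πik), k < n, becomes by injectivity of the Fourier transform a
polynomial vanishing at every e^(2πis) on the contour, hence trivial (`mbInt_shift_independent`).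

For the monodromy, let T be the translation by 2πi. On each of the half planes Re z < 0 and Re z > 0
all solutions extend and satisfy a characteristic equation χ(T) = 0, where χ is (X-1)^n on the left
and 1 + X + ... + X^n on the right. To see this, solutions are written as contour integrals of the
Frobenius series ∑ G_k(ε) e^((k+ε)z) against 1/P(ε), with P the indicial polynomial. Then T
multiplies the weight by e^(2πiε), and χ(e^(2πiε))/P(ε) is entire
(`FrobeniusData.exists_extension`). In the basis J, TJ, ..., T^(n-1)J, crossing the positive t-axis
to the left or to the right of 1/C is therefore given by the companion matrices of these two
polynomials, and each of the three loops is a product of such crossings.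

It remains to conjugate m₀ and m_∞ simultaneously into these companion matrices. With X = 2πiε, the
columns of P̃ are Taylor coefficients of const · G(ε)/(e^X - e^(-2πiρ_k)), and right multiplication
by m₀ is multiplication by e^X modulo X^n. The rows of `intertwiner` are the coefficients of w
e^(mX), where w is chosen so that its pairing with the columns of P̃ is a residue in the coordinate
Y = e^X - 1. The product with P̃ is then a Vandermonde matrix times an invertible diagonal matrix
(`intertwiner_mul_transitionP`), which also shows that P̃ is invertible. -/

open PowerSeries in
/-- The power series `(exp X - 1) / X`. -/
noncomputable def expQuot : PowerSeries ℂ := PowerSeries.mk fun j => 1 / ((j + 1).factorial : ℂ)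

/-! ### Formal residues in the coordinate Y = e^X - 1 -/

section FormalResidue
open PowerSeries

lemma exp_sub_one_eq_X_mul : exp ℂ - 1 = X * expQuot := by
  ext j
  rcases j with _ | j
  · simp
  · rw [coeff_succ_X_mul]
    simp [expQuot, coeff_exp, coeff_one]

lemma constantCoeff_expQuot : constantCoeff expQuot = 1 := by
  rw [← coeff_zero_eq_constantCoeff_apply]; simp [expQuot]

lemma expQuot_mul_inv : expQuot * expQuot⁻¹ = 1 :=
  PowerSeries.mul_inv_cancel _ (by rw [constantCoeff_expQuot]; exact one_ne_zero)

/-- This is the residue of dY / Y^(p+1) for Y = e^X - 1 = X · `expQuot`. For p > 0 the form is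
exact, which enters as the formula for the derivative of a power of `expQuot⁻¹`. -/
lemma coeff_exp_mul_expQuot_inv_pow (p : ℕ) :
    coeff p (exp ℂ * expQuot⁻¹ ^ (p + 1)) = if p = 0 then 1 else 0 := by
  set u := expQuot
  set v := expQuot⁻¹
  have huv : u * v = 1 := expQuot_mul_inv
  -- The derivative of Y = X u is e^X.
  have hd : exp ℂ = u + X * d⁄dX ℂ u := by
    have h1 : d⁄dX ℂ (exp ℂ - 1) = exp ℂ := by
      ext j
      rw [coeff_derivative]
      simp only [map_sub, coeff_exp, coeff_one, Nat.succ_ne_zero, if_false, sub_zero,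
        Nat.factorial_succ]
      simp
      field_simp
    rw [← h1, exp_sub_one_eq_X_mul, Derivation.leibniz]
    simp [u]
    ring
  rcases p with _ | p
  · have hv : constantCoeff v = 1 := by
      have := congrArg constantCoeff huv
      simpa [u, constantCoeff_expQuot] using this
    simp [hv]
  · have hdv : d⁄dX ℂ v = -(v ^ 2 * d⁄dX ℂ u) := by
      have h2 : u * d⁄dX ℂ v + v * d⁄dX ℂ u = 0 := by
        have := congrArg (d⁄dX ℂ) huv
        simpa [Derivation.leibniz] using this
      calc d⁄dX ℂ v = (u * v) * d⁄dX ℂ v := by rw [huv, one_mul]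
        _ = v * (u * d⁄dX ℂ v + v * d⁄dX ℂ u) - v ^ 2 * d⁄dX ℂ u := by ring
        _ = _ := by rw [h2]; ring
    have hdp : d⁄dX ℂ (v ^ (p + 1)) = -(C ((p : ℂ) + 1) * (d⁄dX ℂ u * v ^ (p + 2))) := by
      rw [Derivation.leibniz_pow, hdv]
      simp only [smul_eq_mul, nsmul_eq_mul, map_add, map_natCast, map_one, Nat.cast_add,
        Nat.cast_one, Nat.add_sub_cancel]
      ring
    have hc := congrArg (coeff p) hdp
    rw [coeff_derivative, map_neg, coeff_C_mul] at hc
    have hp : ((p : ℂ) + 1) ≠ 0 := by exact_mod_cast Nat.succ_ne_zero p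
    have hc' : coeff p (d⁄dX ℂ u * v ^ (p + 2)) = -coeff (p + 1) (v ^ (p + 1)) := by
      have : ((p : ℂ) + 1) * (coeff p (d⁄dX ℂ u * v ^ (p + 2)) + coeff (p + 1) (v ^ (p + 1))) = 0 := by
        linear_combination hc
      have := (mul_eq_zero.mp this).resolve_left hp
      linear_combination this
    have : exp ℂ * v ^ (p + 1 + 1) = v ^ (p + 1) + X * (d⁄dX ℂ u * v ^ (p + 2)) := by
      rw [hd]
      calc (u + X * d⁄dX ℂ u) * v ^ (p + 1 + 1) =
          (u * v) * v ^ (p + 1) + X * (d⁄dX ℂ u * v ^ (p + 2)) := by ring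
        _ = _ := by rw [huv, one_mul]
    rw [this, map_add, coeff_succ_X_mul, hc']
    simp

/-- The coefficient of `Y ^ (n - 1)` in the expansion of a power series in powers of
`Y = exp X - 1`, as a residue. -/
noncomputable def expResidue (n : ℕ) : PowerSeries ℂ →ₗ[ℂ] ℂ :=
  (coeff (n - 1)).comp (LinearMap.mulLeft ℂ (exp ℂ * expQuot⁻¹ ^ n))

lemma expResidue_apply (n : ℕ) (f : PowerSeries ℂ) :
    expResidue n f = coeff (n - 1) (exp ℂ * expQuot⁻¹ ^ n * f) := rfl

lemma expResidue_pow {n j : ℕ} (hj : j < n) :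
    expResidue n ((exp ℂ - 1) ^ j) = if j + 1 = n then 1 else 0 := by
  obtain ⟨p, rfl⟩ : ∃ p, n = j + p + 1 := ⟨n - j - 1, by omega⟩
  rw [expResidue_apply, exp_sub_one_eq_X_mul]
  have : exp ℂ * expQuot⁻¹ ^ (j + p + 1) * (X * expQuot) ^ j =
      X ^ j * (exp ℂ * expQuot⁻¹ ^ (p + 1)) := by
    calc _ = X ^ j * (exp ℂ * expQuot⁻¹ ^ (p + 1)) * (expQuot * expQuot⁻¹) ^ j := by ring
      _ = _ := by rw [expQuot_mul_inv]; ring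
  rw [this, show j + p + 1 - 1 = p + j by omega, coeff_X_pow_mul, coeff_exp_mul_expQuot_inv_pow]
  simp

lemma expResidue_pow_mul {n : ℕ} (hn : 0 < n) (f : PowerSeries ℂ) :
    expResidue n ((exp ℂ - 1) ^ n * f) = 0 := by
  rw [expResidue_apply, exp_sub_one_eq_X_mul]
  have : exp ℂ * expQuot⁻¹ ^ n * ((X * expQuot) ^ n * f) =
      X ^ n * (exp ℂ * (expQuot⁻¹ * expQuot) ^ n * f) := by ring
  rw [this, coeff_X_pow_mul', if_neg (by omega)]

/-- The power e^(mX) = (1 + Y)^m is a polynomial in Y of degree m, too small to reach Y^(n-1). -/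
lemma expResidue_exp_pow {n m : ℕ} (hm : m + 1 < n) : expResidue n (exp ℂ ^ m) = 0 := by
  have : exp ℂ ^ m = ∑ j ∈ Finset.range (m + 1), (m.choose j : ℂ) • (exp ℂ - 1) ^ j := by
    conv_lhs => rw [show exp ℂ = (exp ℂ - 1) + 1 by ring, add_pow]
    refine Finset.sum_congr rfl fun j _ => ?_
    rw [one_pow, mul_one, mul_comm, Nat.cast_smul_eq_nsmul, nsmul_eq_mul]
  rw [this, map_sum]
  refine Finset.sum_eq_zero fun j hj => ?_
  have := Finset.mem_range.mp hj
  rw [map_smul, expResidue_pow (by omega), if_neg (by omega), smul_zero]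

lemma exp_sub_C_mul_inv {l : ℂ} (hl : l ≠ 1) : (exp ℂ - C l) * (exp ℂ - C l)⁻¹ = 1 := by
  refine PowerSeries.mul_inv_cancel _ ?_
  simpa [sub_eq_zero] using hl.symm

/-- Division by e^X - l leaves a polynomial part e^(mX) of zero residue and a remainder with one
more factor l. As m varies, the residues of e^(mX)/(e^X - l) thus form a multiple of a Vandermonde
column. -/
lemma expResidue_exp_pow_mul_inv {n : ℕ} {l : ℂ} (hl : l ≠ 1) {m : ℕ} (hm : m < n) :
    expResidue n (exp ℂ ^ m * (exp ℂ - C l)⁻¹) = l ^ m * expResidue n (exp ℂ - C l)⁻¹ := by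
  induction m with
  | zero => simp
  | succ m ih =>
    have h : exp ℂ ^ (m + 1) * (exp ℂ - C l)⁻¹ =
        exp ℂ ^ m + l • (exp ℂ ^ m * (exp ℂ - C l)⁻¹) := by
      rw [smul_eq_C_mul]
      linear_combination exp ℂ ^ m * exp_sub_C_mul_inv hl
    rw [h, map_add, map_smul, expResidue_exp_pow hm, ih (by omega), smul_eq_mul]
    ring

/-- From Y^(j+1)/(e^X - l) = Y^j + (l - 1) Y^j/(e^X - l), a vanishing residue for j = 0 persists up
to j = n - 1. The last step, to Y^n where the residue always vanishes, would then give 0 = 1. -/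
lemma expResidue_inv_ne_zero {n : ℕ} (hn : 0 < n) {l : ℂ} (hl : l ≠ 1) :
    expResidue n (exp ℂ - C l)⁻¹ ≠ 0 := by
  intro h0
  have hrec : ∀ j, (exp ℂ - 1) ^ (j + 1) * (exp ℂ - C l)⁻¹ =
      (exp ℂ - 1) ^ j + (l - 1) • ((exp ℂ - 1) ^ j * (exp ℂ - C l)⁻¹) := by
    intro j
    rw [smul_eq_C_mul, map_sub, map_one]
    linear_combination (exp ℂ - 1) ^ j * exp_sub_C_mul_inv hl
  have hz : ∀ j, j < n → expResidue n ((exp ℂ - 1) ^ j * (exp ℂ - C l)⁻¹) = 0 := by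
    intro j
    induction j with
    | zero => intro _; simpa using h0
    | succ j ih =>
      intro hj
      rw [hrec, map_add, map_smul, ih (by omega), expResidue_pow (by omega), if_neg (by omega)]
      simp
  have h1 := expResidue_pow_mul hn (exp ℂ - C l)⁻¹
  obtain ⟨p, rfl⟩ : ∃ p, n = p + 1 := ⟨n - 1, by omega⟩
  rw [hrec, map_add, map_smul, hz p (by omega), expResidue_pow (by omega)] at h1
  simp at h1

end FormalResidue

/-! ### Taylor series of germs in the variable 2πiε -/

section GermSeries
open PowerSeries

/-- The Taylor series at `0` of a function of `ε`, in the variable `2πiε`. -/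
noncomputable def germSeries (f : ℂ → ℂ) : PowerSeries ℂ :=
  PowerSeries.mk fun j =>
    iteratedDeriv j f 0 / ((2 * Real.pi * Complex.I) ^ j * (Nat.factorial j : ℂ))

lemma germSeries_mul {f g : ℂ → ℂ} (hf : AnalyticAt ℂ f 0) (hg : AnalyticAt ℂ g 0) :
    germSeries (fun ε => f ε * g ε) = germSeries f * germSeries g := by
  ext j
  have h := iteratedDeriv_mul (n := j) (hf.contDiffAt) (hg.contDiffAt)
  rw [coeff_mul, germSeries, coeff_mk, show (fun ε => f ε * g ε) = f * g from rfl, h,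
    Finset.Nat.sum_antidiagonal_eq_sum_range_succ_mk, Finset.sum_div]
  refine Finset.sum_congr rfl fun i hi => ?_
  have hi' : i ≤ j := Nat.lt_succ_iff.mp (Finset.mem_range.mp hi)
  simp only [germSeries, coeff_mk]
  rw [Nat.cast_choose ℂ hi']
  have h1 : (2 * Real.pi * Complex.I : ℂ) ^ j =
      (2 * Real.pi * Complex.I) ^ i * (2 * Real.pi * Complex.I) ^ (j - i) := by
    rw [← pow_add]; congr 1; omega
  have := Complex.two_pi_I_ne_zero
  have := Nat.cast_ne_zero (R := ℂ).mpr (Nat.factorial_ne_zero i)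
  have := Nat.cast_ne_zero (R := ℂ).mpr (Nat.factorial_ne_zero j)
  have := Nat.cast_ne_zero (R := ℂ).mpr (Nat.factorial_ne_zero (j - i))
  rw [h1]
  field_simp

/-- The powers of 2πi in the entries of P̃ are exactly those that turn e^(2πiε) into the formal
exponential. -/
lemma germSeries_exp : germSeries (fun ε => Complex.exp (2 * Real.pi * Complex.I * ε)) = exp ℂ := by
  ext j
  rw [germSeries, coeff_mk, iteratedDeriv_cexp_const_mul, coeff_exp]
  have := Complex.two_pi_I_ne_zero
  simp
  field_simp

lemma germSeries_const (a : ℂ) : germSeries (fun _ => a) = C a := by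
  ext j
  rw [germSeries, coeff_mk, coeff_C, iteratedDeriv_const]
  split_ifs with h <;> simp [h]

lemma germSeries_sub {f g : ℂ → ℂ} (hf : AnalyticAt ℂ f 0) (hg : AnalyticAt ℂ g 0) :
    germSeries (fun ε => f ε - g ε) = germSeries f - germSeries g := by
  ext j
  simp only [germSeries, coeff_mk, map_sub]
  rw [show (fun ε => f ε - g ε) = f - g from rfl,
    iteratedDeriv_sub (hf.contDiffAt) (hg.contDiffAt), sub_div]

lemma germSeries_congr {f g : ℂ → ℂ} (h : f =ᶠ[𝓝 0] g) : germSeries f = germSeries g := by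
  ext j
  simp only [germSeries, coeff_mk]
  rw [h.iteratedDeriv_eq]

lemma constantCoeff_germSeries (f : ℂ → ℂ) : constantCoeff (germSeries f) = f 0 := by
  rw [← coeff_zero_eq_constantCoeff_apply]; simp [germSeries]

end GermSeries

/-! ### The functions C^(-ε) B_k(ε) -/

section Transition
open PowerSeries

lemma rho_pos (n : ℕ) (k : Fin n) : 0 < rho n k := by unfold rho; positivity

lemma rho_lt_one (n : ℕ) (k : Fin n) : rho n k < 1 := by
  unfold rho
  rw [div_lt_one (by positivity)]
  have : (k : ℝ) < n := by exact_mod_cast k.2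
  linarith

lemma singC_ne_zero (n : ℕ) : (singC n : ℂ) ≠ 0 := by
  unfold singC; exact_mod_cast pow_ne_zero _ (Nat.succ_ne_zero n)

lemma singC_pos (n : ℕ) : 0 < (singC n : ℝ) := by unfold singC; positivity

/-- The local exponent `e^{-2πiρ_k}` of the monodromy at infinity. -/
noncomputable def rhoExp (n : ℕ) (k : Fin n) : ℂ := Complex.exp (-(2 * Real.pi * Complex.I * rho n k))

lemma rhoExp_eq_one_imp {n : ℕ} {a b : Fin n} (h : rhoExp n a = rhoExp n b) : a = b := by
  unfold rhoExp at h
  rw [Complex.exp_eq_exp_iff_exists_int] at h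
  obtain ⟨m, hm⟩ := h
  have h2 : (rho n b : ℂ) - rho n a = m := by
    have := Complex.two_pi_I_ne_zero
    apply mul_left_cancel₀ this
    linear_combination hm
  have h3 : rho n b - rho n a = m := by exact_mod_cast h2
  have h4 : |(m : ℝ)| < 1 := by
    rw [← h3, abs_lt]
    constructor <;> linarith [rho_pos n a, rho_pos n b, rho_lt_one n a, rho_lt_one n b]
  have h5 : m = 0 := by
    rw [← Int.abs_lt_one_iff]; exact_mod_cast h4
  rw [h5] at h3
  unfold rho at h3
  have h6 : (0 : ℝ) < (n : ℝ) + 1 := by positivity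
  field_simp at h3
  have h7 : (b : ℝ) = a := by simp at h3; linarith
  exact Fin.ext (by exact_mod_cast h7.symm)

lemma rhoExp_ne_one (n : ℕ) (k : Fin n) : rhoExp n k ≠ 1 := by
  unfold rhoExp
  intro h
  rw [Complex.exp_eq_one_iff] at h
  obtain ⟨m, hm⟩ := h
  have h2 : -(rho n k : ℂ) = m := by
    have := Complex.two_pi_I_ne_zero
    apply mul_left_cancel₀ this
    linear_combination hm
  have h3 : -rho n k = m := by exact_mod_cast h2
  have h4 : |(m : ℝ)| < 1 := by
    rw [← h3, abs_lt]
    constructor <;> linarith [rho_pos n k, rho_lt_one n k]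
  have h5 : m = 0 := by
    rw [← Int.abs_lt_one_iff]; exact_mod_cast h4
  rw [h5] at h3
  have := rho_pos n k
  simp at h3; linarith

lemma rhoExp_pow (n : ℕ) (k : Fin n) : rhoExp n k ^ (n + 1) = 1 := by
  unfold rhoExp rho
  rw [← Complex.exp_nat_mul, Complex.exp_eq_one_iff]
  refine ⟨-((k : ℤ) + 1), ?_⟩
  have : ((n : ℂ) + 1) ≠ 0 := by exact_mod_cast Nat.succ_ne_zero n
  push_cast
  field_simp

lemma sum_rhoExp_pow (n : ℕ) (k : Fin n) : ∑ j ∈ Finset.range (n + 1), rhoExp n k ^ j = 0 := by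
  have h := mul_neg_geom_sum (rhoExp n k) (n + 1)
  rw [rhoExp_pow, sub_self] at h
  exact (mul_eq_zero.mp h).resolve_left (sub_ne_zero.mpr (rhoExp_ne_one n k).symm)

lemma analyticAt_Gamma {s : ℂ} (hs : ∀ m : ℕ, s ≠ -m) : AnalyticAt ℂ Complex.Gamma s := by
  have h := (Complex.differentiable_one_div_Gamma.analyticAt s).inv
    (inv_ne_zero (Complex.Gamma_ne_zero hs))
  convert! h using 1
  funext z
  simp

lemma analyticAt_Gamma_of_re_pos {s : ℂ} (hs : 0 < s.re) : AnalyticAt ℂ Complex.Gamma s := by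
  refine analyticAt_Gamma fun m h => ?_
  rw [h] at hs
  simp at hs
  have : (0 : ℝ) ≤ m := m.cast_nonneg
  linarith

/-- The common factor of the functions `C^{-ε} B_k(ε)`. -/
noncomputable def transitionG (n : ℕ) (ε : ℂ) : ℂ :=
  (singC n : ℂ) ^ (-ε) *
    ∏ i, Complex.Gamma (rho n i) * Complex.Gamma (1 + ε) / Complex.Gamma (rho n i + ε)

lemma transitionG_zero (n : ℕ) : transitionG n 0 = 1 := by
  unfold transitionG
  rw [neg_zero, Complex.cpow_zero, one_mul]
  refine Finset.prod_eq_one fun i _ => ?_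
  have : Complex.Gamma (rho n i) ≠ 0 := Complex.Gamma_ne_zero_of_re_pos (by simpa using rho_pos n i)
  simp [this]

lemma analyticAt_transitionG (n : ℕ) : AnalyticAt ℂ (transitionG n) 0 := by
  unfold transitionG
  refine AnalyticAt.mul ?_ ?_
  · have h : (fun ε : ℂ => (singC n : ℂ) ^ (-ε)) =
        fun ε => Complex.exp (Complex.log (singC n) * (-ε)) := by
      funext ε; rw [Complex.cpow_def_of_ne_zero (singC_ne_zero n)]
    rw [h]; fun_prop
  · refine Finset.analyticAt_fun_prod _ fun i _ => ?_
    have h1 : AnalyticAt ℂ (fun ε : ℂ => Complex.Gamma (1 + ε)) 0 :=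
      AnalyticAt.fun_comp (g := Complex.Gamma) (analyticAt_Gamma_of_re_pos (by simp)) (by fun_prop)
    have h2 : AnalyticAt ℂ (fun ε : ℂ => Complex.Gamma (rho n i + ε)) 0 :=
      AnalyticAt.fun_comp (g := Complex.Gamma)
        (analyticAt_Gamma_of_re_pos (by simpa using rho_pos n i)) (by fun_prop)
    refine (analyticAt_const.mul h1).div h2 ?_
    exact Complex.Gamma_ne_zero_of_re_pos (by simpa using rho_pos n i)

lemma sin_pi_rho_ne_zero (n : ℕ) (k : Fin n) : Complex.sin (Real.pi * rho n k) ≠ 0 := by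
  have h : 0 < Real.sin (Real.pi * rho n k) :=
    Real.sin_pos_of_pos_of_lt_pi (mul_pos Real.pi_pos (rho_pos n k))
      (by nlinarith [Real.pi_pos, rho_lt_one n k])
  rw [← Complex.ofReal_mul, ← Complex.ofReal_sin]
  exact_mod_cast h.ne'

/-- The factor relating `C^{-ε} B_k(ε)` to `transitionG` over `e^{2πiε} - e^{-2πiρ_k}`. -/
noncomputable def transitionConst (n : ℕ) (k : Fin n) : ℂ :=
  2 * Complex.I * Complex.sin (Real.pi * rho n k) * Complex.exp (-(Real.pi * Complex.I * rho n k))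

lemma transitionConst_ne_zero (n : ℕ) (k : Fin n) : transitionConst n k ≠ 0 := by
  unfold transitionConst
  have := sin_pi_rho_ne_zero n k
  have := Complex.exp_ne_zero (-(Real.pi * Complex.I * rho n k))
  simp only [ne_eq, mul_eq_zero, not_or]
  exact ⟨⟨⟨two_ne_zero, Complex.I_ne_zero⟩, by assumption⟩, by assumption⟩

/-- Since 2i sin(πρ_k + πε) e^(πiε) e^(-πiρ_k) = e^(2πiε) - e^(-2πiρ_k), the dependence on k is
confined to a constant and to the denominator e^(2πiε) - e^(-2πiρ_k); the rest is the common factor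
`transitionG`. -/
lemma transitionB_mul (n : ℕ) (k : Fin n) {ε : ℂ}
    (h : Complex.sin (Real.pi * rho n k + Real.pi * ε) ≠ 0) :
    (singC n : ℂ) ^ (-ε) * transitionB n k ε *
      (Complex.exp (2 * Real.pi * Complex.I * ε) - rhoExp n k) =
        transitionConst n k * transitionG n ε := by
  have key : Complex.exp (2 * Real.pi * Complex.I * ε) - rhoExp n k =
      2 * Complex.I * Complex.sin (Real.pi * rho n k + Real.pi * ε) *
        (Complex.exp (Real.pi * Complex.I * ε) * Complex.exp (-(Real.pi * Complex.I * rho n k))) := by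
    rw [Complex.sin, rhoExp, ← Complex.exp_add]
    have e1 : (2 * Real.pi * Complex.I * ε : ℂ) = (Real.pi * rho n k + Real.pi * ε) * Complex.I +
      (Real.pi * Complex.I * ε + -(Real.pi * Complex.I * rho n k)) := by ring
    have e2 : (-(2 * Real.pi * Complex.I * rho n k) : ℂ) =
      -(Real.pi * rho n k + Real.pi * ε) * Complex.I +
      (Real.pi * Complex.I * ε + -(Real.pi * Complex.I * rho n k)) := by ring
    rw [e1, e2, Complex.exp_add _ (Real.pi * Complex.I * ε + -(Real.pi * Complex.I * rho n k)),
      Complex.exp_add (-(Real.pi * rho n k + Real.pi * ε) * Complex.I)]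
    linear_combination (-(Complex.exp (-(Real.pi * rho n k + Real.pi * ε) * Complex.I) -
      Complex.exp ((Real.pi * rho n k + Real.pi * ε) * Complex.I)) *
      Complex.exp (Real.pi * Complex.I * ε + -(Real.pi * Complex.I * rho n k))) * Complex.I_sq
  have hE : Complex.exp (-(Real.pi * Complex.I * ε)) * Complex.exp (Real.pi * Complex.I * ε) = 1 := by
    rw [← Complex.exp_add]; simp
  rw [key, transitionB, transitionG, transitionConst]
  set P := ∏ i, Complex.Gamma (rho n i) * Complex.Gamma (1 + ε) / Complex.Gamma (rho n i + ε)
  have hdiv : Complex.sin (Real.pi * rho n k) / Complex.sin (Real.pi * rho n k + Real.pi * ε) *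
      Complex.sin (Real.pi * rho n k + Real.pi * ε) = Complex.sin (Real.pi * rho n k) :=
    div_mul_cancel₀ _ h
  linear_combination (2 * Complex.I * (singC n : ℂ) ^ (-ε) * P *
      Complex.exp (-(Real.pi * Complex.I * rho n k))) *
    (Complex.sin (Real.pi * rho n k) * hE +
      Complex.exp (-(Real.pi * Complex.I * ε)) * Complex.exp (Real.pi * Complex.I * ε) * hdiv)

lemma analyticAt_transitionB (n : ℕ) (k : Fin n) :
    AnalyticAt ℂ (fun ε : ℂ => (singC n : ℂ) ^ (-ε) * transitionB n k ε) 0 := by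
  have h := (((analyticAt_transitionG n).mul
    (show AnalyticAt ℂ (fun ε : ℂ => Complex.exp (-(Real.pi * Complex.I * ε))) 0 by fun_prop)).mul
    (AnalyticAt.div (analyticAt_const (v := Complex.sin (Real.pi * rho n k)))
      (show AnalyticAt ℂ (fun ε : ℂ => Complex.sin (Real.pi * rho n k + Real.pi * ε)) 0 by
        fun_prop)
      (by simpa using sin_pi_rho_ne_zero n k)))
  refine h.congr (Eventually.of_forall fun ε => ?_)
  simp only [Pi.mul_apply, Pi.div_apply, transitionB, transitionG]
  ring

/-- The sine does not vanish at ε = 0 because 0 < ρ_k < 1, so `transitionB_mul` holds near 0. It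
passes to Taylor series, where the denominator has the invertible constant term 1 - e^(-2πiρ_k). -/
lemma germSeries_transitionB (n : ℕ) (k : Fin n) :
    germSeries (fun ε : ℂ => (singC n : ℂ) ^ (-ε) * transitionB n k ε) =
      C (transitionConst n k) * germSeries (transitionG n) * (exp ℂ - C (rhoExp n k))⁻¹ := by
  have hexp : AnalyticAt ℂ (fun ε : ℂ => Complex.exp (2 * Real.pi * Complex.I * ε)) 0 := by fun_prop
  have hcont : ContinuousAt (fun ε : ℂ => Complex.sin (Real.pi * rho n k + Real.pi * ε)) 0 := by
    fun_prop
  have hne : ∀ᶠ ε in 𝓝 (0 : ℂ), Complex.sin (Real.pi * rho n k + Real.pi * ε) ≠ 0 :=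
    hcont.eventually_ne (by simpa using sin_pi_rho_ne_zero n k)
  have h1 := germSeries_congr (hne.mono fun ε hε => transitionB_mul n k hε)
  have h2 := germSeries_mul (analyticAt_transitionB n k) (hexp.fun_sub (analyticAt_const (v := rhoExp n k)))
  have h3 := germSeries_mul (analyticAt_const (v := transitionConst n k)) (analyticAt_transitionG n)
  have h4 := germSeries_sub hexp (analyticAt_const (v := rhoExp n k))
  rw [germSeries_exp, germSeries_const] at h4
  rw [germSeries_const] at h3
  have h5 : germSeries (fun ε : ℂ => (singC n : ℂ) ^ (-ε) * transitionB n k ε) *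
      (exp ℂ - C (rhoExp n k)) = C (transitionConst n k) * germSeries (transitionG n) := by
    rw [← h4, ← h3, ← h1]; exact h2.symm
  rw [← h5, mul_assoc, exp_sub_C_mul_inv (rhoExp_ne_one n k), mul_one]

end Transition

/-- The matrix of the shift `y_i ↦ y_{i+1}`, where `y_n = -∑_{j<n} c_j y_j`. -/
def shiftCompanion (n : ℕ) (c : ℕ → ℂ) : Matrix (Fin n) (Fin n) ℂ :=
  Matrix.of fun i j => if (i : ℕ) + 1 < n then (if (j : ℕ) = i + 1 then 1 else 0) else -c j

lemma sum_shiftCompanion (n : ℕ) (c : ℕ → ℂ) (i : Fin n) (y : ℕ → ℂ) :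
    ∑ j, shiftCompanion n c i j * y j =
      if (i : ℕ) + 1 < n then y (i + 1) else -∑ j ∈ Finset.range n, c j * y j := by
  simp only [shiftCompanion, Matrix.of_apply]
  split_ifs with h
  · rw [Finset.sum_eq_single ⟨i + 1, h⟩]
    · simp
    · intro b _ hb
      rw [if_neg (fun h' => hb (Fin.ext h')), zero_mul]
    · simp
  · rw [← Fin.sum_univ_eq_sum_range (fun j => c j * y j), ← Finset.sum_neg_distrib]
    exact Finset.sum_congr rfl fun j _ => by ring

/-- The coefficients of `(X - 1)^n`. -/
noncomputable def unipotentCoeff (n k : ℕ) : ℂ := (-1) ^ (n - k) * (n.choose k : ℂ)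

lemma sum_unipotentCoeff {R : Type*} [CommRing R] [Algebra ℂ R] (n : ℕ) (x : R) :
    ∑ k ∈ Finset.range (n + 1), algebraMap ℂ R (unipotentCoeff n k) * x ^ k = (x - 1) ^ n := by
  rw [sub_eq_add_neg, add_pow]
  refine Finset.sum_congr rfl fun k _ => ?_
  simp [unipotentCoeff]
  ring

/-! ### Simultaneous conjugation of m₀ and m_∞ into companion matrices -/

section Intertwiner
open PowerSeries

/-- The row reversal in the definition of P̃ makes the product of a row of coefficients with a
column of P̃ a single Cauchy product coefficient, of degree n - 1. -/
lemma sum_fin_coeff_mul_rev {n : ℕ} (hn : 0 < n) (f g : PowerSeries ℂ) :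
    ∑ a : Fin n, coeff (a : ℕ) f * coeff (Fin.rev a : ℕ) g = coeff (n - 1) (f * g) := by
  obtain ⟨p, rfl⟩ : ∃ p, n = p + 1 := ⟨n - 1, by omega⟩
  rw [coeff_mul, Nat.add_sub_cancel, Finset.Nat.sum_antidiagonal_eq_sum_range_succ_mk,
    ← Fin.sum_univ_eq_sum_range (fun a => coeff a f * coeff (p - a) g)]
  refine Finset.sum_congr rfl fun a _ => ?_
  rw [Fin.val_rev]
  congr 3
  omega

/-- The entries 1/(b-a)! are the coefficients of the exponential: on rows of coefficients modulo
X^n, right multiplication by m₀ is multiplication by e^X. -/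
lemma sum_coeff_mul_mZero (n : ℕ) (f : PowerSeries ℂ) (b : Fin n) :
    ∑ a : Fin n, coeff (a : ℕ) f * mZero n a b = coeff (b : ℕ) (f * exp ℂ) := by
  rw [coeff_mul, Finset.Nat.sum_antidiagonal_eq_sum_range_succ_mk]
  have h : ∀ a : Fin n, coeff (a : ℕ) f * mZero n a b =
      (fun a : ℕ => if a ≤ (b : ℕ) then coeff a f * coeff (b - a) (exp ℂ) else 0) (a : ℕ) := by
    intro a
    simp only [mZero, Matrix.of_apply, Fin.le_def]
    split_ifs with h
    · simp [coeff_exp]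
    · simp
  rw [Finset.sum_congr rfl fun a _ => h a,
    Fin.sum_univ_eq_sum_range (fun a : ℕ => if a ≤ (b : ℕ) then
      coeff a f * coeff (b - a) (exp ℂ) else 0)]
  symm
  have hs : Finset.range ((b : ℕ) + 1) ⊆ Finset.range n :=
    Finset.range_subset_range.mpr b.2
  rw [← Finset.sum_subset hs]
  · refine Finset.sum_congr rfl fun a ha => ?_
    rw [if_pos (Nat.lt_succ_iff.mp (Finset.mem_range.mp ha))]
  · intro a _ ha
    rw [if_neg (by simpa [Nat.lt_succ_iff] using ha)]

/-- The weight of the rows of `intertwiner`. -/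
noncomputable def intertwinerSeries (n : ℕ) : PowerSeries ℂ :=
  (germSeries (transitionG n))⁻¹ * exp ℂ * expQuot⁻¹ ^ n

/-- A matrix conjugating `m₀` and `m_∞` into companion matrices. -/
noncomputable def intertwiner (n : ℕ) : Matrix (Fin n) (Fin n) ℂ :=
  Matrix.of fun m b => coeff (b : ℕ) (intertwinerSeries n * exp ℂ ^ (m : ℕ))

/-- Row m holds the coefficients of w e^(mX), so multiplication by e^X moves it to row m + 1. For
the last row the relation (e^X - 1)^n ≡ 0 modulo X^n expresses e^(nX) through the lower powers. -/
lemma intertwiner_mul_mZero (n : ℕ) :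
    intertwiner n * mZero n = shiftCompanion n (unipotentCoeff n) * intertwiner n := by
  ext m b
  have h1 : (intertwiner n * mZero n) m b =
      coeff (b : ℕ) (intertwinerSeries n * exp ℂ ^ ((m : ℕ) + 1)) := by
    rw [Matrix.mul_apply]
    simp only [intertwiner, Matrix.of_apply]
    rw [sum_coeff_mul_mZero, mul_assoc, pow_succ]
  rw [h1, Matrix.mul_apply]
  simp only [intertwiner, Matrix.of_apply]
  rw [sum_shiftCompanion n _ m
    (fun k => coeff (b : ℕ) (intertwinerSeries n * exp ℂ ^ k))]
  split_ifs with h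
  · rfl
  · have hm : (m : ℕ) + 1 = n := by have := m.2; omega
    rw [hm, eq_neg_iff_add_eq_zero, add_comm]
    have h2 := congrArg (coeff (b : ℕ)) (congrArg (intertwinerSeries n * ·)
      (sum_unipotentCoeff n (exp ℂ)))
    rw [exp_sub_one_eq_X_mul, Finset.sum_range_succ] at h2
    have h3 : unipotentCoeff n n = 1 := by simp [unipotentCoeff]
    simp only [h3, map_one, one_mul, mul_add, map_add, Finset.mul_sum, map_sum] at h2
    -- Y^n = X^n u^n has no coefficient in the degrees b < n.
    have h4 : coeff (b : ℕ) (intertwinerSeries n * (X * expQuot) ^ n) = 0 := by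
      rw [mul_pow, mul_left_comm, coeff_X_pow_mul', if_neg (by have := b.2; omega)]
    rw [h4] at h2
    rw [← h2]
    congr 1
    refine Finset.sum_congr rfl fun k _ => ?_
    rw [mul_left_comm]
    rw [show (algebraMap ℂ (PowerSeries ℂ)) (unipotentCoeff n k) = C (unipotentCoeff n k) from rfl,
      coeff_C_mul]

/-- The scalars in `intertwiner_mul_transitionP`. -/
noncomputable def intertwinerScalar (n : ℕ) (k : Fin n) : ℂ :=
  transitionConst n k * expResidue n (exp ℂ - C (rhoExp n k))⁻¹

lemma intertwinerScalar_ne_zero (n : ℕ) (k : Fin n) : intertwinerScalar n k ≠ 0 :=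
  mul_ne_zero (transitionConst_ne_zero n k)
    (expResidue_inv_ne_zero (lt_of_le_of_lt (Nat.zero_le _) k.2) (rhoExp_ne_one n k))

/-- The weight of the rows cancels the common factor `transitionG` and supplies e^X u^(-n), so each
entry is the residue `expResidue` of e^(mX)/(e^X - e^(-2πiρ_k)) up to a constant. By
`expResidue_exp_pow_mul_inv` this is a scalar times the m-th power of e^(-2πiρ_k). -/
lemma intertwiner_mul_transitionP (n : ℕ) :
    intertwiner n * transitionP n =
      (Matrix.vandermonde fun b => rhoExp n (Fin.rev b)).transpose *
        Matrix.diagonal fun b => intertwinerScalar n (Fin.rev b) := by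
  ext m b
  have hn : 0 < n := lt_of_le_of_lt (Nat.zero_le _) m.2
  have hG : germSeries (transitionG n) * (germSeries (transitionG n))⁻¹ = 1 :=
    PowerSeries.mul_inv_cancel _ (by
      rw [constantCoeff_germSeries, transitionG_zero]; exact one_ne_zero)
  set k := Fin.rev b
  have hP : ∀ a, transitionP n a b = coeff (Fin.rev a : ℕ)
      (germSeries (fun ε : ℂ => (singC n : ℂ) ^ (-ε) * transitionB n k ε)) := by
    intro a
    rw [germSeries, coeff_mk]; rfl
  rw [Matrix.mul_apply, Matrix.mul_diagonal, Matrix.transpose_apply, Matrix.vandermonde_apply]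
  simp only [hP]
  simp only [intertwiner, Matrix.of_apply]
  rw [sum_fin_coeff_mul_rev hn, germSeries_transitionB]
  have h1 : intertwinerSeries n * exp ℂ ^ (m : ℕ) *
      (C (transitionConst n k) * germSeries (transitionG n) * (exp ℂ - C (rhoExp n k))⁻¹) =
      C (transitionConst n k) * (exp ℂ * expQuot⁻¹ ^ n *
        (exp ℂ ^ (m : ℕ) * (exp ℂ - C (rhoExp n k))⁻¹)) := by
    rw [intertwinerSeries]
    linear_combination (C (transitionConst n k) * (exp ℂ * expQuot⁻¹ ^ n *
        (exp ℂ ^ (m : ℕ) * (exp ℂ - C (rhoExp n k))⁻¹))) * hG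
  rw [h1, coeff_C_mul, ← expResidue_apply, expResidue_exp_pow_mul_inv (rhoExp_ne_one n k) m.2,
    intertwinerScalar]
  ring

/-- The Vandermonde nodes e^(-2πiρ_k) are distinct and the scalars are non-zero. Invertibility of
the product gives that of both factors, in particular of P̃. -/
lemma isUnit_det_intertwiner_mul (n : ℕ) : IsUnit (intertwiner n * transitionP n).det := by
  rw [intertwiner_mul_transitionP, Matrix.det_mul, Matrix.det_transpose, Matrix.det_diagonal,
    isUnit_iff_ne_zero]
  refine mul_ne_zero (Matrix.det_vandermonde_ne_zero_iff.mpr fun a b h => ?_)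
    (Finset.prod_ne_zero_iff.mpr fun b _ => intertwinerScalar_ne_zero n _)
  exact Fin.rev_injective (rhoExp_eq_one_imp h)

lemma isUnit_det_intertwiner (n : ℕ) : IsUnit (intertwiner n).det :=
  isUnit_of_mul_isUnit_left (Matrix.det_mul (intertwiner n) (transitionP n) ▸
    isUnit_det_intertwiner_mul n)

lemma isUnit_det_transitionP (n : ℕ) : IsUnit (transitionP n).det :=
  isUnit_of_mul_isUnit_right (Matrix.det_mul (intertwiner n) (transitionP n) ▸
    isUnit_det_intertwiner_mul n)

lemma intertwiner_conj_mZero (n : ℕ) :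
    intertwiner n * mZero n * (intertwiner n)⁻¹ = shiftCompanion n (unipotentCoeff n) := by
  rw [intertwiner_mul_mZero, Matrix.mul_assoc, Matrix.mul_nonsing_inv _ (isUnit_det_intertwiner n),
    Matrix.mul_one]

/-- Each l = e^(-2πiρ_k) is a nontrivial (n+1)-st root of unity, a root of 1 + X + ... + X^n, so the
column (1, l, ..., l^(n-1)) is an eigenvector of the companion matrix with eigenvalue l. -/
lemma shiftCompanion_mul_vandermonde (n : ℕ) :
    shiftCompanion n (fun _ => 1) * (Matrix.vandermonde fun b => rhoExp n (Fin.rev b)).transpose =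
      (Matrix.vandermonde fun b => rhoExp n (Fin.rev b)).transpose *
        Matrix.diagonal fun b => rhoExp n (Fin.rev b) := by
  ext m b
  rw [Matrix.mul_apply, Matrix.mul_diagonal]
  simp only [Matrix.transpose_apply, Matrix.vandermonde_apply]
  rw [sum_shiftCompanion n _ m (fun k => rhoExp n (Fin.rev b) ^ k)]
  split_ifs with h
  · rw [pow_succ]
  · have hm : (m : ℕ) + 1 = n := by have := m.2; omega
    have h1 := sum_rhoExp_pow n (Fin.rev b)
    rw [Finset.sum_range_succ] at h1
    rw [← pow_succ, hm]
    simp only [one_mul]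
    linear_combination -h1

/-- The columns of `intertwiner n * transitionP n` are multiples of the Vandermonde eigenvectors,
and P̃ diagonalises m_∞ with the same eigenvalues in the same order. -/
lemma intertwiner_conj_mInfty (n : ℕ) :
    intertwiner n * mInfty n * (intertwiner n)⁻¹ = shiftCompanion n (fun _ => 1) := by
  have h1 : shiftCompanion n (fun _ => 1) * (intertwiner n * transitionP n) =
      (intertwiner n * transitionP n) * Matrix.diagonal fun b => rhoExp n (Fin.rev b) := by
    rw [intertwiner_mul_transitionP, ← Matrix.mul_assoc, shiftCompanion_mul_vandermonde,
      Matrix.mul_assoc, Matrix.mul_assoc, Matrix.diagonal_mul_diagonal,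
      Matrix.diagonal_mul_diagonal]
    simp only [mul_comm]
  have h2 : intertwiner n * mInfty n = shiftCompanion n (fun _ => 1) * intertwiner n := by
    rw [mInfty]
    change intertwiner n * (transitionP n * Matrix.diagonal (fun b => rhoExp n (Fin.rev b)) *
      (transitionP n)⁻¹) = _
    rw [← Matrix.mul_assoc, ← Matrix.mul_assoc, ← h1, Matrix.mul_assoc, Matrix.mul_assoc,
      Matrix.mul_nonsing_inv _ (isUnit_det_transitionP n), Matrix.mul_one]
  rw [h2, Matrix.mul_assoc, Matrix.mul_nonsing_inv _ (isUnit_det_intertwiner n), Matrix.mul_one]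

end Intertwiner

/-- The matrix m₀ - 1 is strictly upper triangular with first superdiagonal 1/1! = 1. On the k-th
superdiagonal of its k-th power only one path of unit steps contributes. -/
lemma mZero_sub_one_pow_apply (n k : ℕ) (a b : Fin n) :
    ((b : ℕ) < a + k → ((mZero n - 1) ^ k) a b = 0) ∧
      ((b : ℕ) = a + k → ((mZero n - 1) ^ k) a b = 1) := by
  have hN : ∀ a b : Fin n, ((b : ℕ) ≤ a → (mZero n - 1) a b = 0) ∧
      ((b : ℕ) = a + 1 → (mZero n - 1) a b = 1) := by
    intro a b
    constructor
    · intro h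
      rw [Matrix.sub_apply]
      rcases eq_or_ne a b with rfl | hab
      · simp [mZero]
      · have : ¬ a ≤ b := fun h' => hab (Fin.ext (le_antisymm h' h))
        simp [mZero, this, hab]
    · intro h
      have h1 : a ≤ b := by rw [Fin.le_def]; omega
      have h2 : a ≠ b := by rintro rfl; omega
      simp [mZero, h1, h2, h]
  induction k generalizing a b with
  | zero =>
    rw [pow_zero]
    refine ⟨fun h => Matrix.one_apply_ne ?_, fun h => ?_⟩
    · rintro rfl; omega
    · have : a = b := Fin.ext (by omega)
      rw [this, Matrix.one_apply_eq]
  | succ k ih =>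
    rw [pow_succ, Matrix.mul_apply]
    refine ⟨fun h => Finset.sum_eq_zero fun c _ => ?_, fun h => ?_⟩
    · rcases lt_or_ge (c : ℕ) (a + k) with hc | hc
      · rw [(ih a c).1 hc, zero_mul]
      · rw [(hN c b).1 (by omega), mul_zero]
    · have hlt : (a : ℕ) + k < n := by have := b.2; omega
      rw [Finset.sum_eq_single ⟨a + k, hlt⟩]
      · rw [(ih a ⟨a + k, hlt⟩).2 rfl, (hN ⟨a + k, hlt⟩ b).2 (by simp; omega), one_mul]
      · intro c _ hc
        rcases lt_or_ge (c : ℕ) (a + k) with hc' | hc'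
        · rw [(ih a c).1 hc', zero_mul]
        · have : (c : ℕ) ≠ a + k := fun h' => hc (Fin.ext h')
          rw [(hN c b).1 (by omega), mul_zero]
      · simp

lemma mZero_sub_one_pow_eq_zero (n : ℕ) : (mZero n - 1) ^ n = 0 := by
  ext a b
  exact (mZero_sub_one_pow_apply n n a b).1 (by have := b.2; omega)

lemma mZero_sub_one_pow_ne_zero {n : ℕ} (hn : 0 < n) : (mZero n - 1) ^ (n - 1) ≠ 0 := by
  intro h
  have h1 := (mZero_sub_one_pow_apply n (n - 1) ⟨0, hn⟩ ⟨n - 1, by omega⟩).2 (by simp)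
  rw [h] at h1
  simp at h1

/-! ### The GKZ data: relations, lattice, non-resonance -/

section GKZData

variable {n : ℕ}

/-- The last index of `Fin n`. -/
def lastIdx (hn : 0 < n) : Fin n := ⟨n - 1, by omega⟩

/-- The inclusion of the first `n - 1` indices. -/
abbrev initIdx (r : Fin (n - 1)) : Fin n := Fin.castLE (Nat.sub_le n 1) r

lemma eq_lastIdx_or (hn : 0 < n) (i : Fin n) : i = lastIdx hn ∨ ∃ r : Fin (n - 1), i = initIdx r := by
  by_cases h : (i : ℕ) = n - 1
  · exact Or.inl (Fin.ext h)
  · exact Or.inr ⟨⟨i, by have := i.2; omega⟩, Fin.ext rfl⟩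

lemma sum_gkzMatrix_inl {K : Type*} [CommRing K] (i : Fin n) (v : Fin n ⊕ Fin n → K) :
    ∑ j, (gkzMatrix n (Sum.inl i) j : K) * v j = v (Sum.inl i) + v (Sum.inr i) := by
  rw [Fintype.sum_sum_type]
  simp [gkzMatrix]

lemma sum_gkzMatrix_inr {K : Type*} [CommRing K] (hn : 0 < n) (r : Fin (n - 1))
    (v : Fin n ⊕ Fin n → K) :
    ∑ j, (gkzMatrix n (Sum.inr r) j : K) * v j =
      v (Sum.inl (lastIdx hn)) + v (Sum.inr (initIdx r)) := by
  rw [Fintype.sum_sum_type]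
  congr 1
  · rw [Finset.sum_eq_single (lastIdx hn)]
    · simp [gkzMatrix, lastIdx, Nat.sub_add_cancel hn]
    · intro b _ hb
      have : ¬ ((b : ℕ) + 1 = n) := fun h => hb (Fin.ext (by simp [lastIdx]; omega))
      simp [gkzMatrix, this]
    · simp
  · rw [Finset.sum_eq_single (initIdx r)]
    · simp [gkzMatrix]
    · intro b _ hb
      have : ¬ ((b : ℕ) = r) := fun h => hb (Fin.ext (by simpa using h))
      simp [gkzMatrix, this]
    · simp

/-- The first n rows say that paired entries are opposite, and the remaining rows say that the
entries n+1, ..., 2n-1 are all opposite to the n-th one. Together they leave one free parameter. -/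
lemma gkzMatrix_mulVec_eq_zero_iff (hn : 0 < n) (l : Fin n ⊕ Fin n → ℤ) :
    (gkzMatrix n).mulVec l = 0 ↔ ∃ c : ℤ, l = c • gkzB n := by
  have h1 : ∀ i, (gkzMatrix n).mulVec l (Sum.inl i) = l (Sum.inl i) + l (Sum.inr i) := by
    intro i
    have := sum_gkzMatrix_inl (K := ℤ) i l
    simpa [Matrix.mulVec, dotProduct] using this
  have h2 : ∀ r, (gkzMatrix n).mulVec l (Sum.inr r) =
      l (Sum.inl (lastIdx hn)) + l (Sum.inr (initIdx r)) := by
    intro r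
    have := sum_gkzMatrix_inr (K := ℤ) hn r l
    simpa [Matrix.mulVec, dotProduct] using this
  constructor
  · intro h
    refine ⟨l (Sum.inl (lastIdx hn)), ?_⟩
    have hr : ∀ i, l (Sum.inr i) = -l (Sum.inl (lastIdx hn)) := by
      intro i
      rcases eq_lastIdx_or hn i with rfl | ⟨r, rfl⟩
      · have := congrFun h (Sum.inl (lastIdx hn))
        rw [h1] at this
        simp only [Pi.zero_apply] at this
        linarith
      · have := congrFun h (Sum.inr r)
        rw [h2] at this
        simp only [Pi.zero_apply] at this
        linarith
    funext j
    rcases j with i | i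
    · have := congrFun h (Sum.inl i)
      rw [h1, hr] at this
      simp only [Pi.zero_apply] at this
      simp [gkzB]; linarith
    · simp [gkzB, hr]
  · rintro ⟨c, rfl⟩
    funext i
    rcases i with i | r
    · rw [h1]; simp [gkzB]
    · rw [h2]; simp [gkzB]

lemma gkzAlpha_eq (hn : 0 < n) (i : Fin n ⊕ Fin (n - 1)) :
    gkzAlpha n i = ∑ j, (gkzMatrix n i j : ℂ) * (gkzGamma0 n j : ℂ) := by
  rcases i with i | r
  · rw [sum_gkzMatrix_inl (K := ℂ) i (fun j => (gkzGamma0 n j : ℂ))]; simp [gkzAlpha, gkzGamma0]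
  · rw [sum_gkzMatrix_inr (K := ℂ) hn r (fun j => (gkzGamma0 n j : ℂ))]
    simp [gkzAlpha, gkzGamma0]

/-- The unit vectors of the first block are the columns a_i (i < n) and a_(2n); those of the second
block are the differences a_(n+r) - a_r. The functional h is the sum of the first n coordinates. -/
lemma isGKZConfiguration_gkzMatrix (hn : 0 < n) : IsGKZConfiguration (gkzMatrix n) := by
  constructor
  · set S := Submodule.span ℤ (Set.range fun j : Fin n ⊕ Fin n => fun i => gkzMatrix n i j)
    have hcol : ∀ j, (fun i => gkzMatrix n i j) ∈ S := fun j => Submodule.subset_span ⟨j, rfl⟩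
    have hlast : ∀ r : Fin (n - 1), initIdx r ≠ lastIdx hn := by
      intro r h
      have h' := congrArg Fin.val h
      have := r.2
      simp [lastIdx] at h'
      omega
    have hl : ∀ i : Fin n, Pi.single (Sum.inl i) 1 ∈ S := by
      intro i
      rcases eq_lastIdx_or hn i with rfl | ⟨r, rfl⟩
      · convert! hcol (Sum.inr (lastIdx hn)) using 1
        funext k
        rcases k with k | k
        · by_cases hk : k = lastIdx hn
          · simp [gkzMatrix, hk]
          · simp [gkzMatrix, hk]
        · have := k.2
          have h' : ¬ (n - 1 = (k : ℕ)) := by omega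
          simp [gkzMatrix, lastIdx, h']
      · convert! hcol (Sum.inl (initIdx r)) using 1
        funext k
        rcases k with k | k
        · by_cases hk : k = initIdx r
          · simp [gkzMatrix, hk]
          · simp [gkzMatrix, hk]
        · have := r.2
          have h' : ¬ ((r : ℕ) + 1 = n) := by omega
          simp [gkzMatrix, h']
    have hr : ∀ r : Fin (n - 1), Pi.single (Sum.inr r) 1 ∈ S := by
      intro r
      have h1 := S.sub_mem (hcol (Sum.inr (initIdx r))) (hcol (Sum.inl (initIdx r)))
      convert! h1 using 1
      funext k
      rcases k with k | k
      · simp [gkzMatrix]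
      · have := r.2
        have h' : ¬ ((r : ℕ) + 1 = n) := by omega
        by_cases hk : k = r
        · simp [gkzMatrix, hk, h']
        · have hk' : ¬ ((r : ℕ) = k) := fun h => hk (Fin.ext h.symm)
          simp [gkzMatrix, h', hk', hk]
    rw [eq_top_iff]
    intro v _
    rw [pi_eq_sum_univ v]
    refine S.sum_mem fun k _ => S.smul_mem _ ?_
    have hk : (fun j => if k = j then (1 : ℤ) else 0) = Pi.single k 1 := by
      funext j; simp [Pi.single_apply, eq_comm]
    rw [hk]
    rcases k with k | k
    · exact hl k
    · exact hr k
  · refine ⟨∑ i : Fin n, Pi.evalAddMonoidHom (fun _ : Fin n ⊕ Fin (n - 1) => ℤ) (Sum.inl i), ?_⟩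
    intro j
    rcases j with j | j <;> simp [gkzMatrix]

/-- The columns a_1, ..., a_n and a_(n+1), ..., a_(2n) have equal sums. So a functional that is
non-negative on the cone and positive on one column is positive on some a_p of the first half and
some a_(n+q) of the second, and both coefficients vanish on the face. The equations then force ρ_q
to be an integer. -/
lemma isNonResonant_gkz (hn : 0 < n) : IsNonResonant (gkzMatrix n) (gkzAlpha n) := by
  rintro φ hφ ⟨j0, hj0⟩ ⟨z, c, hc, hα⟩
  set S : Fin n ⊕ Fin n → ℝ := fun j => ∑ i, φ i * (gkzMatrix n i j : ℝ) with hS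
  have hrel : ∑ i : Fin n, S (Sum.inl i) = ∑ i : Fin n, S (Sum.inr i) := by
    have h1 : ∑ j, S j * (gkzB n j : ℝ) = 0 := by
      simp only [hS, Finset.sum_mul]
      rw [Finset.sum_comm]
      refine Finset.sum_eq_zero fun i _ => ?_
      have h2 : ∑ j, (gkzMatrix n i j : ℝ) * (gkzB n j : ℝ) = 0 := by
        rcases i with i | r
        · rw [sum_gkzMatrix_inl (K := ℝ) i (fun j => (gkzB n j : ℝ))]; simp [gkzB]
        · rw [sum_gkzMatrix_inr (K := ℝ) hn r (fun j => (gkzB n j : ℝ))]; simp [gkzB]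
      simp only [mul_assoc]
      rw [← Finset.mul_sum, h2, mul_zero]
    rw [Fintype.sum_sum_type] at h1
    simp only [gkzB, Int.cast_one, mul_one, Int.cast_neg, mul_neg, Finset.sum_neg_distrib] at h1
    linarith
  have hpos : 0 < ∑ i : Fin n, S (Sum.inl i) := by
    rcases j0 with i | i
    · exact Finset.sum_pos' (fun k _ => hφ _) ⟨i, Finset.mem_univ _, hj0⟩
    · rw [hrel]; exact Finset.sum_pos' (fun k _ => hφ _) ⟨i, Finset.mem_univ _, hj0⟩
  obtain ⟨p, -, hp⟩ := Finset.exists_lt_of_sum_lt (s := Finset.univ) (f := fun _ : Fin n => (0 : ℝ))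
    (g := fun i => S (Sum.inl i)) (by simpa using hpos)
  obtain ⟨q, -, hq⟩ := Finset.exists_lt_of_sum_lt (s := Finset.univ) (f := fun _ : Fin n => (0 : ℝ))
    (g := fun i => S (Sum.inr i)) (by simpa using hrel ▸ hpos)
  have hp0 := hc _ hp
  have hq0 := hc _ hq
  have hl : ∀ i : Fin n, c (Sum.inl i) + c (Sum.inr i) = -(rho n i : ℂ) - z (Sum.inl i) := by
    intro i
    have h1 := hα (Sum.inl i)
    simp only [mul_comm (c _)] at h1
    rw [sum_gkzMatrix_inl i c, gkzAlpha] at h1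
    linear_combination -h1
  have hr : ∀ r : Fin (n - 1), c (Sum.inl (lastIdx hn)) + c (Sum.inr (initIdx r)) =
      -(rho n (initIdx r) : ℂ) - z (Sum.inr r) := by
    intro r
    have h1 := hα (Sum.inr r)
    simp only [mul_comm (c _)] at h1
    rw [sum_gkzMatrix_inr hn r c, gkzAlpha] at h1
    linear_combination -h1
  -- Comparing the two equations that contain c_(n+i) removes ρ_i: all coefficients of the first
  -- half agree modulo ℤ.
  have hint : ∀ i : Fin n, ∃ m : ℤ, c (Sum.inl i) = c (Sum.inl (lastIdx hn)) + m := by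
    intro i
    rcases eq_lastIdx_or hn i with rfl | ⟨r, rfl⟩
    · exact ⟨0, by simp⟩
    · refine ⟨z (Sum.inr r) - z (Sum.inl (initIdx r)), ?_⟩
      push_cast
      linear_combination hl (initIdx r) - hr r
  obtain ⟨m1, hm1⟩ := hint p
  obtain ⟨m2, hm2⟩ := hint q
  have h3 := hl q
  rw [hq0, hm2] at h3
  rw [hp0] at hm1
  have h4 : (rho n q : ℂ) = ((m1 - m2 - z (Sum.inl q) : ℤ) : ℂ) := by
    push_cast
    linear_combination h3 + hm1
  have h5 : rho n q = ((m1 - m2 - z (Sum.inl q) : ℤ) : ℝ) := by exact_mod_cast h4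
  have h6 := rho_pos n q
  have h7 := rho_lt_one n q
  rw [h5] at h6 h7
  have h8 : 0 < m1 - m2 - z (Sum.inl q) := by exact_mod_cast h6
  have h9 : m1 - m2 - z (Sum.inl q) < 1 := by exact_mod_cast h7
  omega

end GKZData

/-! ### Power series of the period -/

section Period

lemma iteratedDeriv_inv_add_pow (a : ℂ) (m k : ℕ) {x : ℂ} (hx : a + x ≠ 0) :
    iteratedDeriv k (fun x : ℂ => ((a + x) ^ (m + 1))⁻¹) x =
      (-1) ^ k * ((m + k).factorial / m.factorial : ℂ) * ((a + x) ^ (m + k + 1))⁻¹ := by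
  have hm := Nat.cast_ne_zero (R := ℂ).mpr (Nat.factorial_ne_zero m)
  induction k generalizing x with
  | zero => simp [hm]
  | succ k ih =>
    rw [iteratedDeriv_succ]
    have hev : ∀ᶠ y in 𝓝 x, a + y ≠ 0 :=
      (show ContinuousAt (fun y : ℂ => a + y) x by fun_prop).eventually_ne hx
    rw [Filter.EventuallyEq.deriv_eq (hev.mono fun y hy => ih hy)]
    have h1 : HasDerivAt (fun y : ℂ => (a + y) ^ (m + k + 1))
        (((m + k + 1 : ℕ) : ℂ) * (a + x) ^ (m + k) * 1) x :=
      HasDerivAt.fun_pow ((hasDerivAt_id' x).const_add a) (m + k + 1)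
    have h2 := (h1.fun_inv (pow_ne_zero _ hx)).const_mul
      ((-1) ^ k * ((m + k).factorial / m.factorial : ℂ))
    rw [h2.deriv, show m + (k + 1) = m + k + 1 by ring, Nat.factorial_succ]
    push_cast
    field_simp
    ring

/-- Cauchy's formula for the k-th derivative at the centre; R < ‖a‖ keeps the pole -a outside the
circle. -/
lemma circleIntegral_inv_pow_mul_inv_add_pow {a : ℂ} {R : ℝ} (hR : 0 < R) (ha : R < ‖a‖) (m k : ℕ) :
    (∮ x in C(0, R), (x ^ (k + 1))⁻¹ * ((a + x) ^ (m + 1))⁻¹) =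
      2 * Real.pi * Complex.I * ((-1) ^ k * ((m + k).factorial / (m.factorial * k.factorial) : ℂ)) *
        (a ^ (m + k + 1))⁻¹ := by
  have hne : ∀ x ∈ Metric.closedBall (0 : ℂ) R, a + x ≠ 0 := by
    intro x hx h
    rw [Metric.mem_closedBall, dist_zero_right] at hx
    have : a = -x := by linear_combination h
    rw [this, norm_neg] at ha
    linarith
  have hd : DifferentiableOn ℂ (fun x : ℂ => ((a + x) ^ (m + 1))⁻¹) (Metric.closedBall 0 R) := by
    intro x hx
    have := hne x hx
    exact (DifferentiableAt.fun_inv (show DifferentiableAt ℂ (fun x : ℂ => (a + x) ^ (m + 1)) x by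
      fun_prop) (pow_ne_zero _ this)).differentiableWithinAt
  have h := hd.circleIntegral_one_div_sub_center_pow_smul hR k
  rw [iteratedDeriv_inv_add_pow a m k (hne 0 (by simp [hR.le]))] at h
  simp only [sub_zero, one_div, smul_eq_mul, add_zero] at h
  rw [h]
  have hm := Nat.cast_ne_zero (R := ℂ).mpr (Nat.factorial_ne_zero m)
  have hk := Nat.cast_ne_zero (R := ℂ).mpr (Nat.factorial_ne_zero k)
  field_simp

lemma norm_torusMap_zero_apply {n : ℕ} {R : ℝ} (hR : 0 ≤ R) (θ : Fin n → ℝ) (i : Fin n) :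
    ‖torusMap 0 (fun _ => R) θ i‖ = R := by
  simp [torusMap, Complex.norm_exp_ofReal_mul_I, abs_of_nonneg hR]

lemma continuous_torusMap {n : ℕ} (c : Fin n → ℂ) (R : Fin n → ℝ) : Continuous (torusMap c R) := by
  unfold torusMap; fun_prop

lemma torusIntegrable_of_continuousOn {n : ℕ} {f : (Fin n → ℂ) → ℂ} {R : ℝ} (hR : 0 ≤ R)
    (hf : ContinuousOn f {x | ∀ i, ‖x i‖ = R}) : TorusIntegrable f 0 (fun _ => R) := by
  unfold TorusIntegrable
  refine ContinuousOn.integrableOn_compact isCompact_Icc ?_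
  exact hf.comp (continuous_torusMap _ _).continuousOn
    fun θ _ i => norm_torusMap_zero_apply hR θ i

lemma hasSum_torusIntegral {n : ℕ} {R : ℝ} (hR : 0 ≤ R) {F : ℕ → (Fin n → ℂ) → ℂ}
    {f : (Fin n → ℂ) → ℂ} (hF : ∀ k, ContinuousOn (F k) {x | ∀ i, ‖x i‖ = R}) {u : ℕ → ℝ}
    (hu : Summable u) (hb : ∀ k x, (∀ i, ‖x i‖ = R) → ‖F k x‖ ≤ u k)
    (hs : ∀ x, (∀ i, ‖x i‖ = R) → HasSum (fun k => F k x) (f x)) :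
    HasSum (fun k => torusIntegral (F k) 0 (fun _ => R)) (torusIntegral f 0 (fun _ => R)) := by
  unfold torusIntegral
  have hfin : (volume.restrict (Set.Icc (0 : Fin n → ℝ) fun _ => 2 * Real.pi)) Set.univ < ⊤ := by
    rw [Measure.restrict_apply_univ]; exact isCompact_Icc.measure_lt_top
  have : IsFiniteMeasure (volume.restrict (Set.Icc (0 : Fin n → ℝ) fun _ => 2 * Real.pi)) := ⟨hfin⟩
  refine hasSum_integral_of_dominated_convergence (fun k _ => R ^ n * u k) (fun k => ?_)
    (fun k => Eventually.of_forall fun θ => ?_) (Eventually.of_forall fun θ => hu.mul_left _)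
    (integrable_const _) (Eventually.of_forall fun θ => ?_)
  · exact (torusIntegrable_of_continuousOn hR (hF k)).function_integrable.aestronglyMeasurable
  · rw [norm_smul]
    have h1 : ‖∏ i : Fin n, (R : ℂ) * Complex.exp (θ i * Complex.I) * Complex.I‖ = R ^ n := by
      simp [Complex.norm_exp_ofReal_mul_I, abs_of_nonneg hR]
    rw [h1]
    exact mul_le_mul_of_nonneg_left (hb k _ fun i => norm_torusMap_zero_apply hR θ i) (by positivity)
  · exact (hs _ fun i => norm_torusMap_zero_apply hR θ i).const_smul _

lemma add_sum_ne_zero {n : ℕ} {a : ℂ} {R : ℝ} (ha : n * R < ‖a‖) {x : Fin n → ℂ}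
    (hx : ∀ i, ‖x i‖ = R) : a + ∑ i, x i ≠ 0 := by
  intro h
  have h1 : ‖∑ i, x i‖ ≤ n * R := by
    refine (norm_sum_le _ _).trans ?_
    simp [hx]
  have h2 : a = -∑ i, x i := by linear_combination h
  rw [h2, norm_neg] at ha
  linarith

lemma continuousOn_torus_kernel {n : ℕ} {a : ℂ} {R : ℝ} (hR : 0 < R) (ha : n * R < ‖a‖) (m k : ℕ) :
    ContinuousOn (fun x : Fin n → ℂ => (∏ i, x i ^ (k + 1))⁻¹ * ((a + ∑ i, x i) ^ (m + 1))⁻¹)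
      {x | ∀ i, ‖x i‖ = R} := by
  intro x hx
  refine ContinuousAt.continuousWithinAt ?_
  have h1 : ∏ i, x i ^ (k + 1) ≠ 0 := Finset.prod_ne_zero_iff.mpr fun i _ =>
    pow_ne_zero _ (norm_pos_iff.mp (by rw [hx i]; exact hR))
  have h2 := pow_ne_zero (m + 1) (add_sum_ne_zero ha hx)
  have c1 : Continuous fun x : Fin n → ℂ => ∏ i, x i ^ (k + 1) := by fun_prop
  have c2 : Continuous fun x : Fin n → ℂ => (a + ∑ i, x i) ^ (m + 1) := by fun_prop
  exact (c1.continuousAt.inv₀ h1).mul (c2.continuousAt.inv₀ h2)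

/-- Induction on the number of variables: the variable integrated last is absorbed into the constant
a, and each integration raises the exponent of the linear form by k. The hypothesis on ‖a‖ leaves
room R for this shift. -/
lemma torusIntegral_kernel (n : ℕ) {a : ℂ} {R : ℝ} (hR : 0 < R) (ha : n * R < ‖a‖) (m k : ℕ) :
    torusIntegral (fun x : Fin n → ℂ => (∏ i, x i ^ (k + 1))⁻¹ * ((a + ∑ i, x i) ^ (m + 1))⁻¹)
        0 (fun _ => R) =
      (2 * Real.pi * Complex.I) ^ n *
        ((-1) ^ (n * k) * ((m + n * k).factorial / (m.factorial * k.factorial ^ n) : ℂ)) *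
        (a ^ (m + n * k + 1))⁻¹ := by
  have hm := Nat.cast_ne_zero (R := ℂ).mpr (Nat.factorial_ne_zero m)
  have hk := Nat.cast_ne_zero (R := ℂ).mpr (Nat.factorial_ne_zero k)
  induction n generalizing a with
  | zero => rw [torusIntegral_dim0]; simp [hm]
  | succ n ih =>
    rw [torusIntegral_succ (torusIntegrable_of_continuousOn hR.le (continuousOn_torus_kernel hR ha m k))]
    have ha' : n * R + R < ‖a‖ := by push_cast at ha; linarith
    have hnR : 0 ≤ n * R := by positivity
    have hin : ∀ x ∈ Metric.sphere (0 : ℂ) R,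
        torusIntegral (fun y : Fin n → ℂ => (∏ i, (Fin.cons x y : Fin (n + 1) → ℂ) i ^ (k + 1))⁻¹ *
          ((a + ∑ i, (Fin.cons x y : Fin (n + 1) → ℂ) i) ^ (m + 1))⁻¹) 0 (fun _ => R) =
        ((2 * Real.pi * Complex.I) ^ n *
        ((-1) ^ (n * k) * ((m + n * k).factorial / (m.factorial * k.factorial ^ n) : ℂ))) *
        ((x ^ (k + 1))⁻¹ * ((a + x) ^ (m + n * k + 1))⁻¹) := by
      intro x hx
      have hx' : ‖x‖ = R := by simpa using hx
      have hax : n * R < ‖a + x‖ := by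
        have := norm_sub_norm_le a (-x)
        rw [norm_neg, sub_neg_eq_add] at this
        linarith
      have h1 : (fun y : Fin n → ℂ => (∏ i, (Fin.cons x y : Fin (n + 1) → ℂ) i ^ (k + 1))⁻¹ *
          ((a + ∑ i, (Fin.cons x y : Fin (n + 1) → ℂ) i) ^ (m + 1))⁻¹) =
          fun y => (x ^ (k + 1))⁻¹ * ((∏ i, y i ^ (k + 1))⁻¹ * ((a + x + ∑ i, y i) ^ (m + 1))⁻¹) := by
        funext y
        rw [Fin.prod_univ_succ, Fin.sum_univ_succ]
        simp only [Fin.cons_zero, Fin.cons_succ, mul_inv]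
        ring
      rw [h1, torusIntegral_const_mul, ih hax]
      ring
    have h2 := circleIntegral.integral_congr (c := (0 : ℂ)) hR.le hin
    refine h2.trans ?_
    rw [circleIntegral.integral_const_mul,
      circleIntegral_inv_pow_mul_inv_add_pow hR (by linarith) (m + n * k) k]
    have hmk := Nat.cast_ne_zero (R := ℂ).mpr (Nat.factorial_ne_zero (m + n * k))
    rw [show m + (n + 1) * k = m + n * k + k by ring, show (n + 1) * k = n * k + k by ring]
    rw [pow_add (-1 : ℂ), pow_succ (2 * Real.pi * Complex.I : ℂ), pow_succ (k.factorial : ℂ)]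
    field_simp

/-- The coefficients of the period, `((n+1)k)! / (k!^(n+1) (n+1)^((n+1)k))`. -/
noncomputable def periodCoeff (n k : ℕ) : ℂ :=
  ((n + 1) * k).factorial / ((k.factorial : ℂ) ^ (n + 1) * ((n : ℂ) + 1) ^ ((n + 1) * k))

/-- On the torus ∏ x_i (1 + ∑ x_i) has modulus at least R^(n+1) with R = 1/(n+1), while the constant
term of f_n has modulus |t| R^(n+1). Hence 1/f_n is a uniformly convergent geometric series,
integrated term by term by `torusIntegral_kernel`. -/
lemma hasSum_mirrorPeriod {n : ℕ} (hn : 0 < n) {t : ℂ} (ht : ‖t‖ < 1) :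
    HasSum (fun k => (2 * Real.pi * Complex.I) ^ (n - 1) * (periodCoeff n k * t ^ k))
      (mirrorPeriod n t) := by
  have hn1 : (0 : ℝ) < (n : ℝ) + 1 := by positivity
  have hnc : ((n : ℂ) + 1) ≠ 0 := by exact_mod_cast Nat.succ_ne_zero n
  have hR : (0 : ℝ) < 1 / ((n : ℝ) + 1) := by positivity
  set R := 1 / ((n : ℝ) + 1) with hRdef
  have ha : n * R < ‖(1 : ℂ)‖ := by
    rw [norm_one, hRdef, mul_one_div, div_lt_one hn1]; linarith
  -- The constant term of the polynomial is -w, so 1/f_n = ∑ w^k / D^(k+1) with D = ∏ x_i (1 + ∑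
  -- x_i).
  obtain ⟨w, hw⟩ : ∃ w : ℂ, w = (-1) ^ n * t / ((n : ℂ) + 1) ^ (n + 1) := ⟨_, rfl⟩
  have hwn : ‖w‖ = ‖t‖ * R ^ (n + 1) := by
    rw [hw, norm_div, norm_mul, norm_pow, norm_pow, norm_neg, norm_one, one_pow, one_mul, hRdef,
      one_div, inv_pow, div_eq_mul_inv]
    congr 3
    rw [show ((n : ℂ) + 1) = ((n + 1 : ℝ) : ℂ) by push_cast; ring, Complex.norm_real,
      Real.norm_of_nonneg hn1.le]
  have hlow : ∀ x : Fin n → ℂ, (∀ i, ‖x i‖ = R) → R ^ (n + 1) ≤ ‖(∏ i, x i) * (1 + ∑ i, x i)‖ := by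
    intro x hx
    rw [norm_mul, norm_prod]
    simp only [hx, Finset.prod_const, Finset.card_univ, Fintype.card_fin]
    rw [pow_succ]
    refine mul_le_mul_of_nonneg_left ?_ (by positivity)
    have h1 : ‖∑ i, x i‖ ≤ n * R := by
      refine (norm_sum_le _ _).trans ?_
      simp [hx]
    have h2 := norm_sub_norm_le (1 : ℂ) (-∑ i, x i)
    rw [norm_neg, sub_neg_eq_add, norm_one] at h2
    -- The radius is the one for which the lower bound 1 - nR of |1 + ∑ x_i| equals R.
    have h3 : n * R + R = 1 := by rw [hRdef]; field_simp
    linarith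
  have hsum := hasSum_torusIntegral (n := n) hR.le
    (F := fun k x => w ^ k * ((∏ i, x i ^ (k + 1))⁻¹ * ((1 + ∑ i, x i) ^ (k + 1))⁻¹))
    (f := fun x => (mirrorPoly n x t)⁻¹) (u := fun k => (R ^ (n + 1))⁻¹ * ‖t‖ ^ k)
    (fun k => continuousOn_const.mul (continuousOn_torus_kernel hR ha k k))
    ((summable_geometric_of_lt_one (norm_nonneg _) ht).mul_left _)
    (fun k x hx => by
      have h1 := hlow x hx
      have h0 : 0 < R ^ (n + 1) := by positivity
      rw [Finset.prod_pow, ← mul_inv, ← mul_pow, norm_mul, norm_inv, norm_pow, norm_pow, hwn,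
        mul_pow]
      calc ‖t‖ ^ k * (R ^ (n + 1)) ^ k * (‖(∏ i, x i) * (1 + ∑ i, x i)‖ ^ (k + 1))⁻¹
          ≤ ‖t‖ ^ k * (R ^ (n + 1)) ^ k * ((R ^ (n + 1)) ^ (k + 1))⁻¹ := by gcongr
        _ = (R ^ (n + 1))⁻¹ * ‖t‖ ^ k := by rw [pow_succ (R ^ (n + 1))]; field_simp)
    (fun x hx => by
      have h1 := hlow x hx
      have h0 : 0 < R ^ (n + 1) := by positivity
      set D := (∏ i, x i) * (1 + ∑ i, x i) with hD
      have hD0 : D ≠ 0 := norm_pos_iff.mp (h0.trans_le h1)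
      have hlt : ‖w / D‖ < 1 := by
        rw [norm_div, div_lt_one (h0.trans_le h1), hwn]
        calc ‖t‖ * R ^ (n + 1) < 1 * R ^ (n + 1) := by gcongr
          _ ≤ ‖D‖ := by rw [one_mul]; exact h1
      have h2 := (hasSum_geometric_of_norm_lt_one hlt).mul_left D⁻¹
      have h4 : w ≠ D := by
        intro h; rw [h, div_self hD0, norm_one] at hlt; exact lt_irrefl _ hlt
      have h3 : mirrorPoly n x t = D - w := by
        rw [mirrorPoly, hD, hw, pow_succ]; ring
      convert! h2 using 1
      · funext k
        rw [Finset.prod_pow, ← mul_inv, ← mul_pow, ← hD, div_pow, pow_succ]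
        field_simp
      · rw [h3, ← mul_inv]
        congr 1
        field_simp)
  have hfin := hsum.mul_left (2 * Real.pi * Complex.I)⁻¹
  rw [mirrorPeriod]
  convert! hfin using 1
  funext k
  rw [torusIntegral_const_mul, torusIntegral_kernel n hR ha k k]
  obtain ⟨p, rfl⟩ : ∃ p, n = p + 1 := ⟨n - 1, by omega⟩
  have h2 := Complex.two_pi_I_ne_zero
  -- The sign of w^k cancels the sign of the residue.
  have hs : ((-1 : ℂ) ^ (p + 1)) ^ k * (-1) ^ ((p + 1) * k) = 1 := by
    rw [← pow_mul, ← mul_pow]; simp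
  have hk := Nat.cast_ne_zero (R := ℂ).mpr (Nat.factorial_ne_zero k)
  rw [hw, periodCoeff, div_pow, mul_pow, show k + (p + 1) * k = (p + 1 + 1) * k by ring, one_pow,
    inv_one, mul_one, Nat.add_sub_cancel, pow_succ (2 * Real.pi * Complex.I : ℂ), ← pow_mul]
  push_cast
  push_cast at hs hnc
  field_simp
  linear_combination (-((2 * Real.pi * Complex.I) ^ p * t ^ k * (((p + 1 + 1) * k).factorial : ℂ) *
    (k.factorial : ℂ) ^ (p + 2))) * hs

end Period

/-! ### The mixed-twist fibration and the iterated period relation -/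

section MixedTwist

lemma prod_fin_eq_init_mul_last {K : Type*} [CommMonoid K] {n : ℕ} (hn : 0 < n) (f : Fin n → K) :
    ∏ i, f i = (∏ r : Fin (n - 1), f (initIdx r)) * f (lastIdx hn) := by
  obtain ⟨p, rfl⟩ : ∃ p, n = p + 1 := ⟨n - 1, by omega⟩
  rw [Fin.prod_univ_castSucc]
  rfl

lemma sum_fin_eq_init_add_last {K : Type*} [AddCommMonoid K] {n : ℕ} (hn : 0 < n) (f : Fin n → K) :
    ∑ i, f i = (∑ r : Fin (n - 1), f (initIdx r)) + f (lastIdx hn) := by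
  obtain ⟨p, rfl⟩ : ∃ p, n = p + 1 := ⟨n - 1, by omega⟩
  rw [Fin.sum_univ_castSucc]
  rfl

lemma functionalInvariant_one (n : ℕ) (t v : ℂ) :
    functionalInvariant 1 n t v =
      -((n : ℂ) ^ n * t / (((n : ℂ) + 1) ^ (n + 1) * (v * (v + 1) ^ n))) := by
  unfold functionalInvariant
  rw [show ((1 : ℕ) : ℂ) + n = (n : ℂ) + 1 by push_cast; ring, show 1 + n = n + 1 by ring]
  have h2 : (-1 : ℂ) ^ 1 * ((1 : ℕ) : ℂ) ^ 1 * (n : ℂ) ^ n = -(n : ℂ) ^ n := by simp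
  rw [h2, pow_one, div_mul_eq_mul_div, div_div, neg_mul, neg_div]

/-- Substituting x_i = (v+1) y_i for i < n, the n - 1 factors x_i and the linear form supply
(v+1)^n; the functional invariant is made so that the constant terms match. -/
lemma mirrorPoly_eq_mul {n : ℕ} (hn : 2 ≤ n) (x : Fin n → ℂ) (v t : ℂ)
    (hv : v = x (lastIdx (two_pos.trans_le hn))) (h0 : v ≠ 0) (h1 : v ≠ -1) :
    mirrorPoly n x t =
      v * (v + 1) ^ n *
        mirrorPoly (n - 1) (fun i => x (Fin.castLE (Nat.sub_le n 1) i) / (v + 1))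
          (functionalInvariant 1 n t v) := by
  have hn0 : 0 < n := by omega
  have hv1 : v + 1 ≠ 0 := fun h => h1 (by linear_combination h)
  have hlast : x (lastIdx hn0) = v := hv.symm
  rw [functionalInvariant_one, mirrorPoly, mirrorPoly, prod_fin_eq_init_mul_last hn0,
    sum_fin_eq_init_add_last hn0, hlast, Finset.prod_div_distrib, ← Finset.sum_div]
  set P := ∏ r : Fin (n - 1), x (initIdx r)
  set S := ∑ r : Fin (n - 1), x (initIdx r)
  obtain ⟨p, rfl⟩ : ∃ p, n = p + 2 := ⟨n - 2, by omega⟩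
  have hc : ((p : ℂ) + 2) ≠ 0 := by exact_mod_cast Nat.succ_ne_zero (p + 1)
  have hc' : ((p : ℂ) + 3) ≠ 0 := by exact_mod_cast Nat.succ_ne_zero (p + 2)
  simp only [Finset.prod_const, Finset.card_univ, Fintype.card_fin,
    show p + 2 - 1 = p + 1 by omega]
  push_cast
  rw [show (p : ℂ) + 1 + 1 = p + 2 by ring, show (p : ℂ) + 2 + 1 = p + 3 by ring]
  field_simp
  ring

lemma hasSum_circleIntegral {R : ℝ} (hR : 0 ≤ R) {F : ℕ → ℂ → ℂ} {f : ℂ → ℂ} {c : ℂ}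
    (hF : ∀ k, ContinuousOn (F k) (Metric.sphere c R)) {u : ℕ → ℝ} (hu : Summable u)
    (hb : ∀ k, ∀ x ∈ Metric.sphere c R, ‖F k x‖ ≤ u k)
    (hs : ∀ x ∈ Metric.sphere c R, HasSum (fun k => F k x) (f x)) :
    HasSum (fun k => circleIntegral (F k) c R) (circleIntegral f c R) := by
  unfold circleIntegral
  have hmem : ∀ θ, circleMap c R θ ∈ Metric.sphere c R := fun θ => circleMap_mem_sphere c hR θ
  refine intervalIntegral.hasSum_integral_of_dominated_convergence (fun k _ => R * u k) (fun k => ?_)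
    (fun k => Eventually.of_forall fun θ _ => ?_) (Eventually.of_forall fun θ _ => hu.mul_left _)
    intervalIntegrable_const (Eventually.of_forall fun θ _ => ?_)
  · refine Continuous.aestronglyMeasurable ?_
    have h1 : Continuous fun θ => F k (circleMap c R θ) :=
      (hF k).comp_continuous (continuous_circleMap c R) hmem
    have h2 : Continuous (deriv (circleMap c R)) := by
      rw [funext (deriv_circleMap c R)]; fun_prop
    exact h2.smul h1
  · rw [norm_smul, deriv_circleMap]
    simp only [norm_mul, norm_circleMap_zero, Complex.norm_I, mul_one, abs_of_nonneg hR]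
    exact mul_le_mul_of_nonneg_left (hb k _ (hmem θ)) hR
  · exact (hs _ (hmem θ)).const_smul _

/-- On |v| = R one has |v+1| ≥ 1 - R = nR, hence |t̃(v)| ≤ |t|, and the series of the smaller period
may be integrated termwise. The integral of v^(-k-1) (1+v)^(-nk-1) contributes the binomial
coefficient ((n+1)k)!/((nk)! k!) that takes one coefficient sequence to the other. -/
lemma mirrorPeriod_eq_circleIntegral {n : ℕ} (hn : 2 ≤ n) {t : ℂ} (ht : ‖t‖ < 1) :
    mirrorPeriod n t =
      circleIntegral (fun v => mirrorPeriod (n - 1) (functionalInvariant 1 n t v) / (v * (v + 1)))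
        0 (1 / ((n : ℝ) + 1)) := by
  have hn0 : 0 < n := by omega
  have hn1 : (0 : ℝ) < (n : ℝ) + 1 := by positivity
  have hnr : (0 : ℝ) < (n : ℝ) := by exact_mod_cast hn0
  obtain ⟨R, hRdef⟩ : ∃ R : ℝ, R = 1 / ((n : ℝ) + 1) := ⟨_, rfl⟩
  have hR : (0 : ℝ) < R := by rw [hRdef]; positivity
  have hnR : 1 - R = n * R := by rw [hRdef]; field_simp; ring
  have hRlt : R < 1 := by nlinarith
  rw [← hRdef]
  have hlow : ∀ v : ℂ, ‖v‖ = R → n * R ≤ ‖v + 1‖ := by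
    intro v hv
    have h2 := norm_sub_norm_le (1 : ℂ) (-v)
    rw [norm_neg, sub_neg_eq_add, norm_one, hv, add_comm] at h2
    linarith
  have hinv : ∀ v : ℂ, ‖v‖ = R → ‖functionalInvariant 1 n t v‖ ≤ ‖t‖ := by
    intro v hv
    have h1 := hlow v hv
    have h3 : ‖(n : ℂ) + 1‖ = (n : ℝ) + 1 := by
      rw [show ((n : ℂ) + 1) = ((n + 1 : ℝ) : ℂ) by push_cast; ring, Complex.norm_real,
        Real.norm_of_nonneg hn1.le]
    rw [functionalInvariant_one, norm_neg, norm_div, norm_mul, norm_mul, norm_mul, norm_pow,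
      norm_pow, norm_pow, h3, hv, Complex.norm_natCast]
    have h4 : (n * R : ℝ) ^ n ≤ ‖v + 1‖ ^ n := by gcongr
    have h5 : (0 : ℝ) < ((n : ℝ) + 1) ^ (n + 1) * (R * ‖v + 1‖ ^ n) := by
      have : 0 < ‖v + 1‖ := lt_of_lt_of_le (by positivity) h1
      positivity
    rw [div_le_iff₀ h5]
    -- At v = -R, where |v+1| = nR, the normalising constant of the invariant gives |t̃(v)| = |t|
    -- exactly.
    have h6 : ((n : ℝ) + 1) ^ (n + 1) * (R * (n * R) ^ n) = (n : ℝ) ^ n := by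
      rw [hRdef, mul_one_div, div_pow, pow_succ]; field_simp
    calc (n : ℝ) ^ n * ‖t‖ = ‖t‖ * (((n : ℝ) + 1) ^ (n + 1) * (R * (n * R) ^ n)) := by
          rw [h6]; ring
      _ ≤ ‖t‖ * (((n : ℝ) + 1) ^ (n + 1) * (R * ‖v + 1‖ ^ n)) := by gcongr
  have hne : ∀ v : ℂ, ‖v‖ = R → v ≠ 0 ∧ v + 1 ≠ 0 := by
    intro v hv
    refine ⟨norm_pos_iff.mp (by rw [hv]; exact hR), norm_pos_iff.mp ?_⟩
    exact lt_of_lt_of_le (by positivity) (hlow v hv)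
  -- The absolutely convergent period series at the point |t| is the majorant on the whole circle.
  have hsumm : Summable fun k => ‖(2 * Real.pi * Complex.I) ^ (n - 1 - 1) *
      (periodCoeff (n - 1) k * ((‖t‖ : ℝ) : ℂ) ^ k)‖ :=
    (hasSum_mirrorPeriod (n := n - 1) (by omega) (t := ((‖t‖ : ℝ) : ℂ))
      (by simpa using ht)).summable.norm
  obtain ⟨K, hK⟩ : ∃ K : ℂ, K = -((n : ℂ) ^ n / ((n : ℂ) + 1) ^ (n + 1)) := ⟨_, rfl⟩
  have hfun : ∀ v : ℂ, ‖v‖ = R → ∀ k : ℕ, functionalInvariant 1 n t v ^ k / (v * (v + 1)) =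
      K ^ k * t ^ k * ((v ^ (k + 1))⁻¹ * ((1 + v) ^ (n * k + 1))⁻¹) := by
    intro v hv k
    obtain ⟨h1, h2⟩ := hne v hv
    have hc : ((n : ℂ) + 1) ≠ 0 := by exact_mod_cast Nat.succ_ne_zero n
    have h3 : functionalInvariant 1 n t v = K * t * (v⁻¹ * ((1 + v) ^ n)⁻¹) := by
      rw [functionalInvariant_one, hK, add_comm 1 v]
      field_simp
    rw [h3, add_comm 1 v, mul_pow, mul_pow, mul_pow, inv_pow, inv_pow, pow_succ, pow_succ, pow_mul]
    field_simp
  have hS := hasSum_circleIntegral (c := 0) hR.le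
    (F := fun k v => (2 * Real.pi * Complex.I) ^ (n - 1 - 1) * periodCoeff (n - 1) k * K ^ k * t ^ k *
      ((v ^ (k + 1))⁻¹ * ((1 + v) ^ (n * k + 1))⁻¹))
    (f := fun v => mirrorPeriod (n - 1) (functionalInvariant 1 n t v) / (v * (v + 1)))
    (u := fun k => ‖(2 * Real.pi * Complex.I) ^ (n - 1 - 1) *
      (periodCoeff (n - 1) k * ((‖t‖ : ℝ) : ℂ) ^ k)‖ * (R * (n * R))⁻¹)
    (fun k => by
      intro v hv
      obtain ⟨h1, h2⟩ := hne v (by simpa using hv)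
      have h2' : 1 + v ≠ 0 := by rwa [add_comm]
      refine ContinuousAt.continuousWithinAt ?_
      have e1 : ContinuousAt (fun v : ℂ => (v ^ (k + 1))⁻¹) v :=
        ContinuousAt.inv₀ (by fun_prop) (pow_ne_zero _ h1)
      have e2 : ContinuousAt (fun v : ℂ => ((1 + v) ^ (n * k + 1))⁻¹) v :=
        ContinuousAt.inv₀ (by fun_prop) (pow_ne_zero _ h2')
      exact continuousAt_const.mul (e1.mul e2))
    (hsumm.mul_right _)
    (fun k v hv => by
      have hv' : ‖v‖ = R := by simpa using hv
      have e1 : (2 * Real.pi * Complex.I) ^ (n - 1 - 1) * periodCoeff (n - 1) k * K ^ k * t ^ k *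
          ((v ^ (k + 1))⁻¹ * ((1 + v) ^ (n * k + 1))⁻¹) =
          (2 * Real.pi * Complex.I) ^ (n - 1 - 1) * (periodCoeff (n - 1) k *
          functionalInvariant 1 n t v ^ k) * (v * (v + 1))⁻¹ := by
        have := hfun v hv' k
        rw [div_eq_mul_inv] at this
        linear_combination -((2 * Real.pi * Complex.I) ^ (n - 1 - 1) * periodCoeff (n - 1) k) * this
      rw [e1]
      generalize (2 * Real.pi * Complex.I : ℂ) ^ (n - 1 - 1) = A
      simp only [norm_mul, norm_inv, norm_pow, Complex.norm_real, norm_norm, hv']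
      have h1 := hinv v hv'
      have h2 := hlow v hv'
      have : 0 < n * R := by positivity
      gcongr)
    (fun v hv => by
      have hv' : ‖v‖ = R := by simpa using hv
      have h1 := (hasSum_mirrorPeriod (n := n - 1) (by omega)
        (lt_of_le_of_lt (hinv v hv') ht)).div_const (v * (v + 1))
      convert! h1 using 1
      funext k
      have := hfun v hv' k
      linear_combination -((2 * Real.pi * Complex.I) ^ (n - 1 - 1) * periodCoeff (n - 1) k) * this)
  refine (hasSum_mirrorPeriod hn0 ht).unique ?_
  convert! hS using 1
  funext k
  rw [circleIntegral.integral_const_mul,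
    circleIntegral_inv_pow_mul_inv_add_pow hR (by simpa using hRlt), one_pow, inv_one, mul_one, hK]
  obtain ⟨p, rfl⟩ : ∃ p, n = p + 2 := ⟨n - 2, by omega⟩
  have h2 := Complex.two_pi_I_ne_zero
  have hk := Nat.cast_ne_zero (R := ℂ).mpr (Nat.factorial_ne_zero k)
  have hnk := Nat.cast_ne_zero (R := ℂ).mpr (Nat.factorial_ne_zero ((p + 2) * k))
  have hc : ((p : ℂ) + 2) ≠ 0 := by exact_mod_cast Nat.succ_ne_zero (p + 1)
  have hc' : ((p : ℂ) + 3) ≠ 0 := by exact_mod_cast Nat.succ_ne_zero (p + 2)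
  have hs : (-1 : ℂ) ^ k * (-1) ^ k = 1 := by rw [← mul_pow]; simp
  rw [periodCoeff, periodCoeff, show p + 2 - 1 = p + 1 by omega, show p + 1 - 1 = p by omega,
    show (p + 2) * k + k = (p + 2 + 1) * k by ring, pow_succ (2 * Real.pi * Complex.I : ℂ),
    neg_pow, div_pow, ← pow_mul, ← pow_mul]
  push_cast
  rw [show (p : ℂ) + 1 + 1 = p + 2 by ring, show (p : ℂ) + 2 + 1 = p + 3 by ring,
    show p + 1 + 1 = p + 2 by ring]
  field_simp
  linear_combination (-((((p + 2 + 1) * k).factorial : ℂ) * t ^ k *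
    (k.factorial : ℂ) ^ (p + 3))) * hs

end MixedTwist

/-! ### The period as an Euler integral -/

section EulerIntegral

lemma periodCoeff_zero (n : ℕ) : periodCoeff n 0 = 1 := by simp [periodCoeff]

/-- Of the n + 1 new factors (n+1)k + i of the factorial, those with i ≤ n are (n+1)(k + ρ_i) and
the last is (n+1)(k+1). -/
lemma periodCoeff_succ (n k : ℕ) :
    periodCoeff n (k + 1) * ((k : ℂ) + 1) ^ n = periodCoeff n k * ∏ i : Fin n, ((k : ℂ) + rho n i) := by
  have hc : ((n : ℂ) + 1) ≠ 0 := by exact_mod_cast Nat.succ_ne_zero n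
  have hk := Nat.cast_ne_zero (R := ℂ).mpr (Nat.factorial_ne_zero k)
  have hk1 : ((k : ℂ) + 1) ≠ 0 := by exact_mod_cast Nat.succ_ne_zero k
  have h1 : (((n + 1) * (k + 1)).factorial : ℂ) = ((n + 1) * k).factorial *
      (((n : ℂ) + 1) ^ (n + 1) * ((k : ℂ) + 1) * ∏ i : Fin n, ((k : ℂ) + rho n i)) := by
    have h2 := Nat.factorial_mul_ascFactorial ((n + 1) * k) (n + 1)
    rw [show (n + 1) * k + (n + 1) = (n + 1) * (k + 1) by ring] at h2
    rw [← h2, Nat.ascFactorial_eq_prod_range, Finset.prod_range_succ, Nat.cast_mul, Nat.cast_mul,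
      Nat.cast_prod]
    congr 1
    rw [← Fin.prod_univ_eq_prod_range (fun i => (((n + 1) * k + 1 + i : ℕ) : ℂ)) n]
    have h3 : ∀ i : Fin n, (((n + 1) * k + 1 + (i : ℕ) : ℕ) : ℂ) =
        ((n : ℂ) + 1) * ((k : ℂ) + rho n i) := by
      intro i
      rw [rho]
      push_cast
      field_simp
      ring
    rw [Finset.prod_congr rfl fun i _ => h3 i, Finset.prod_mul_distrib]
    simp only [Finset.prod_const, Finset.card_univ, Fintype.card_fin]
    push_cast
    ring
  rw [periodCoeff, periodCoeff, h1, Nat.factorial_succ, show (n + 1) * (k + 1) = (n + 1) * k + (n + 1) by ring,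
    pow_add ((n : ℂ) + 1)]
  push_cast
  rw [mul_pow]
  field_simp
  ring

lemma periodCoeff_mul_prod_Gamma (n k : ℕ) :
    periodCoeff n k * (k.factorial : ℂ) ^ n * ∏ i : Fin n, Complex.Gamma (rho n i) =
      ∏ i : Fin n, Complex.Gamma (rho n i + k) := by
  induction k with
  | zero => simp [periodCoeff_zero]
  | succ k ih =>
    have h1 : ∀ i : Fin n, Complex.Gamma (rho n i + ((k + 1 : ℕ) : ℂ)) =
        ((k : ℂ) + rho n i) * Complex.Gamma (rho n i + k) := by
      intro i
      rw [show (rho n i + ((k + 1 : ℕ) : ℂ)) = (rho n i + k) + 1 by push_cast; ring,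
        Complex.Gamma_add_one, add_comm (k : ℂ)]
      intro h
      have h2 := congrArg Complex.re h
      simp at h2
      have := rho_pos n i
      have : (0 : ℝ) ≤ k := k.cast_nonneg
      linarith
    rw [Finset.prod_congr rfl fun i _ => h1 i, Finset.prod_mul_distrib, ← ih, Nat.factorial_succ]
    push_cast
    rw [mul_pow]
    linear_combination ((k.factorial : ℂ) ^ n * ∏ i : Fin n, Complex.Gamma (rho n i)) *
      periodCoeff_succ n k

lemma hasSum_one_sub_cpow_neg (a : ℂ) {x : ℂ} (hx : ‖x‖ < 1) :
    HasSum (fun k : ℕ => Ring.choose (a + k - 1) k * x ^ k) ((1 - x) ^ (-a)) := by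
  have h := (Complex.one_div_one_sub_cpow_hasFPowerSeriesOnBall_zero a).hasSum (y := x)
    (by rw [← ENNReal.ofReal_one, Metric.eball_ofReal]; simpa using hx)
  simp only [zero_add, one_div] at h
  rw [Complex.cpow_neg]
  convert! h using 1
  funext k
  simp [mul_comm]

lemma choose_mul_factorial_mul_Gamma {a : ℝ} (ha : 0 < a) (k : ℕ) :
    Ring.choose ((a : ℂ) + k - 1) k * (k.factorial : ℂ) * Complex.Gamma a = Complex.Gamma (a + k) := by
  have h1 : Ring.choose ((a : ℂ) + k - 1) k * (k.factorial : ℂ) =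
      Polynomial.eval (a : ℂ) (ascPochhammer ℂ k) := by
    have h2 := Ring.factorial_nsmul_multichoose_eq_ascPochhammer (a : ℂ) k
    rw [Polynomial.ascPochhammer_smeval_eq_eval] at h2
    rw [← h2, Ring.choose, show (a : ℂ) + k - 1 - k + 1 = a by ring, nsmul_eq_mul, mul_comm]
  rw [h1]
  clear h1
  induction k with
  | zero => simp
  | succ k ih =>
    rw [ascPochhammer_succ_eval]
    have h2 : (a : ℂ) + k ≠ 0 := by
      have : (0 : ℝ) < a + k := by positivity
      exact_mod_cast this.ne'
    rw [show ((a : ℂ) + ((k + 1 : ℕ) : ℂ)) = (a + k) + 1 by push_cast; ring,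
      Complex.Gamma_add_one _ h2, ← ih]
    ring

lemma eulerIntegrand_gkz {n : ℕ} (hn : 0 < n) (t : ℂ) (z : Fin (n - 1) → ℝ) :
    eulerIntegrand (gkzMatrix n) (gkzAlpha n) (eulerCoeffs n t) z =
      (1 - t * ∏ r, (z r : ℂ)) ^ (-(rho n (lastIdx hn) : ℂ)) *
        ∏ r, (z r : ℂ) ^ ((rho n (initIdx r) : ℂ) - 1) *
          (1 - (z r : ℂ)) ^ (-(rho n (initIdx r) : ℂ)) := by
  unfold eulerIntegrand
  have h1 : ∀ k : Fin n, (∑ j, (gkzMatrix n (Sum.inl k) j : ℂ) * eulerCoeffs n t j *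
      ∏ r, (z r : ℂ) ^ gkzMatrix n (Sum.inr r) j) =
      eulerCoeffs n t (Sum.inl k) * ∏ r, (z r : ℂ) ^ gkzMatrix n (Sum.inr r) (Sum.inl k) +
      eulerCoeffs n t (Sum.inr k) * ∏ r, (z r : ℂ) ^ gkzMatrix n (Sum.inr r) (Sum.inr k) := by
    intro k
    simp only [mul_assoc]
    exact sum_gkzMatrix_inl (K := ℂ) k fun j =>
      eulerCoeffs n t j * ∏ r, (z r : ℂ) ^ gkzMatrix n (Sum.inr r) j
  simp only [h1]
  rw [prod_fin_eq_init_mul_last hn]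
  have h2 : ∀ r : Fin (n - 1), ¬ ((r : ℕ) + 1 = n) := fun r => by have := r.2; omega
  have h3 : ∀ r : Fin (n - 1), ∏ s, (z s : ℂ) ^ gkzMatrix n (Sum.inr s) (Sum.inr (initIdx r)) =
      z r := by
    intro r
    rw [Finset.prod_eq_single r]
    · simp [gkzMatrix]
    · intro s _ hs
      have : ¬ ((r : ℕ) = s) := fun h => hs (Fin.ext h.symm)
      simp [gkzMatrix, this]
    · simp
  have h4 : ∀ r : Fin (n - 1), ¬ (n - 1 = (r : ℕ)) := fun r => by have := r.2; omega
  have h5 : ∏ s : Fin (n - 1), (z s : ℂ) ^ gkzMatrix n (Sum.inr s) (Sum.inr (lastIdx hn)) = 1 :=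
    Finset.prod_eq_one fun s _ => by simp [gkzMatrix, lastIdx, h4]
  have h6 : ∀ r s : Fin (n - 1), gkzMatrix n (Sum.inr s) (Sum.inl (initIdx r)) = 0 := by
    intro r s; simp [gkzMatrix, h2]
  have h7 : ∀ s : Fin (n - 1), gkzMatrix n (Sum.inr s) (Sum.inl (lastIdx hn)) = 1 := by
    intro s; simp [gkzMatrix, lastIdx, Nat.sub_add_cancel hn]
  simp only [h3, h5, h6, h7, zpow_zero, zpow_one, Finset.prod_const_one, mul_one]
  have h8 : ∀ r : Fin (n - 1), eulerCoeffs n t (Sum.inl (initIdx r)) +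
      eulerCoeffs n t (Sum.inr (initIdx r)) * (z r : ℂ) = 1 - z r := by
    intro r; simp [eulerCoeffs, h2, sub_eq_add_neg]
  have h9 : eulerCoeffs n t (Sum.inl (lastIdx hn)) * ∏ s, (z s : ℂ) +
      eulerCoeffs n t (Sum.inr (lastIdx hn)) = 1 - t * ∏ s, (z s : ℂ) := by
    simp [eulerCoeffs, lastIdx, Nat.sub_add_cancel hn]; ring
  simp only [h8, h9, gkzAlpha, neg_neg]
  rw [Finset.prod_mul_distrib]
  ring

lemma integrableOn_beta {u v : ℂ} (hu : 0 < u.re) (hv : 0 < v.re) :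
    IntegrableOn (fun x : ℝ => (x : ℂ) ^ (u - 1) * (1 - (x : ℂ)) ^ (v - 1)) (Set.Ioo 0 1) := by
  have h := Complex.betaIntegral_convergent hu hv
  rw [intervalIntegrable_iff_integrableOn_Ioo_of_le zero_le_one] at h
  exact h

lemma setIntegral_beta {u v : ℂ} (hu : 0 < u.re) (hv : 0 < v.re) :
    ∫ x in Set.Ioo (0 : ℝ) 1, (x : ℂ) ^ (u - 1) * (1 - (x : ℂ)) ^ (v - 1) =
      Complex.Gamma u * Complex.Gamma v / Complex.Gamma (u + v) := by
  rw [Complex.Gamma_mul_Gamma_eq_betaIntegral hu hv, Complex.betaIntegral,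
    intervalIntegral.integral_of_le zero_le_one, integral_Ioc_eq_integral_Ioo]
  have : Complex.Gamma (u + v) ≠ 0 := Complex.Gamma_ne_zero_of_re_pos (by simp; linarith)
  field_simp

/-- Expand (1 - t z_1 ⋯ z_(n-1))^(-ρ_n) in its binomial series. By Fubini each term is a product of
Beta integrals with parameters ρ_r + k and 1 - ρ_r, whose denominators are Γ(k+1) = k!. The result
is the period coefficient written with Gamma functions. -/
lemma mirrorPeriod_eq_eulerIntegral {n : ℕ} (hn : 2 ≤ n) {t : ℂ} (ht : ‖t‖ < 1) :
    IntegrableOn (eulerIntegrand (gkzMatrix n) (gkzAlpha n) (eulerCoeffs n t))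
        (Set.univ.pi fun _ => Set.Ioo (0 : ℝ) 1) ∧
      (∏ i : Fin (n - 1),
          Complex.Gamma (rho n (Fin.castLE (Nat.sub_le n 1) i)) *
            Complex.Gamma (1 - rho n (Fin.castLE (Nat.sub_le n 1) i))) * mirrorPeriod n t =
        (2 * Real.pi * Complex.I) ^ (n - 1) *
          ∫ z in Set.univ.pi fun _ : Fin (n - 1) => Set.Ioo (0 : ℝ) 1,
            eulerIntegrand (gkzMatrix n) (gkzAlpha n) (eulerCoeffs n t) z := by
  have hn0 : 0 < n := by omega
  rw [funext (eulerIntegrand_gkz hn0 t)]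
  set ρ : Fin (n - 1) → ℝ := fun r => rho n (initIdx r) with hρ
  set ρ' : ℝ := rho n (lastIdx hn0) with hρ'
  have hρ0 : ∀ r, 0 < ρ r := fun r => rho_pos n _
  have hρ1 : ∀ r, ρ r < 1 := fun r => rho_lt_one n _
  set S : Set (Fin (n - 1) → ℝ) := Set.univ.pi fun _ => Set.Ioo (0 : ℝ) 1 with hS
  have hSm : MeasurableSet S := MeasurableSet.univ_pi fun _ => measurableSet_Ioo
  have hμ : (volume.restrict S : Measure (Fin (n - 1) → ℝ)) =
      Measure.pi fun _ => volume.restrict (Set.Ioo (0 : ℝ) 1) := by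
    rw [hS, volume_pi, Measure.restrict_pi_pi]
  set g : (Fin (n - 1) → ℝ) → ℂ := fun z =>
    ∏ r, (z r : ℂ) ^ ((ρ r : ℂ) - 1) * (1 - (z r : ℂ)) ^ (-(ρ r : ℂ)) with hg
  have hgk : ∀ k : ℕ, ∀ z ∈ S, (∏ r, (z r : ℂ)) ^ k * g z =
      ∏ r, (z r : ℂ) ^ (((ρ r : ℂ) + k) - 1) * (1 - (z r : ℂ)) ^ ((1 - (ρ r : ℂ)) - 1) := by
    intro k z hz
    rw [hg, ← Finset.prod_pow, ← Finset.prod_mul_distrib]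
    refine Finset.prod_congr rfl fun r _ => ?_
    have hz0 : (z r : ℂ) ≠ 0 := by exact_mod_cast (hz r (Set.mem_univ r)).1.ne'
    rw [show ((ρ r : ℂ) + k) - 1 = ((ρ r : ℂ) - 1) + k by ring, Complex.cpow_add _ _ hz0,
      Complex.cpow_natCast, show (1 - (ρ r : ℂ)) - 1 = -ρ r by ring]
    ring
  have hre : ∀ r (k : ℕ), 0 < ((ρ r : ℂ) + k).re := fun r k => by
    have := hρ0 r
    have : (0 : ℝ) ≤ k := k.cast_nonneg
    simp; linarith
  have hre' : ∀ r, 0 < (1 - (ρ r : ℂ)).re := fun r => by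
    have := hρ1 r
    simp; linarith
  have hgi : ∀ k : ℕ, Integrable (fun z : Fin (n - 1) → ℝ =>
      ∏ r, (z r : ℂ) ^ (((ρ r : ℂ) + k) - 1) * (1 - (z r : ℂ)) ^ ((1 - (ρ r : ℂ)) - 1))
      (volume.restrict S) := by
    intro k
    rw [hμ]
    exact Integrable.fintype_prod (f := fun r (x : ℝ) =>
      (x : ℂ) ^ (((ρ r : ℂ) + k) - 1) * (1 - (x : ℂ)) ^ ((1 - (ρ r : ℂ)) - 1))
      fun r => integrableOn_beta (hre r k) (hre' r)
  have hgint : Integrable g (volume.restrict S) := by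
    refine (hgi 0).congr ?_
    filter_upwards [ae_restrict_mem hSm] with z hz
    rw [← hgk 0 z hz]; simp
  have hprod : ∀ z ∈ S, ‖∏ r, (z r : ℂ)‖ ≤ 1 := by
    intro z hz
    rw [norm_prod]
    refine Finset.prod_le_one (fun r _ => norm_nonneg _) fun r _ => ?_
    have := hz r (Set.mem_univ r)
    rw [Complex.norm_real, Real.norm_of_nonneg this.1.le]
    exact this.2.le
  have htp : ∀ z ∈ S, ‖t * ∏ r, (z r : ℂ)‖ ≤ ‖t‖ := by
    intro z hz
    rw [norm_mul]
    exact mul_le_of_le_one_right (norm_nonneg _) (hprod z hz)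
  have hmeas : Measurable fun z : Fin (n - 1) → ℝ => (1 - t * ∏ r, (z r : ℂ)) ^ (-(ρ' : ℂ)) := by
    fun_prop
  obtain ⟨d, hd⟩ : ∃ d : ℕ → ℂ, d = fun k : ℕ => Ring.choose ((ρ' : ℂ) + k - 1) k := ⟨_, rfl⟩
  have hbin : ∀ x : ℂ, ‖x‖ < 1 → HasSum (fun k : ℕ => d k * x ^ k) ((1 - x) ^ (-(ρ' : ℂ))) := by
    intro x hx; rw [hd]; exact hasSum_one_sub_cpow_neg _ hx
  have hdsum : Summable fun k => ‖d k‖ * ‖t‖ ^ k := by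
    have := (hbin ((‖t‖ : ℝ) : ℂ) (by simpa using ht)).summable.norm
    simpa using this
  -- On the unit cube |t z_1 ⋯ z_(n-1)| ≤ |t| < 1, so the binomial factor is bounded and only the
  -- Beta weight matters for integrability.
  have hbound : ∀ z ∈ S, ‖(1 - t * ∏ r, (z r : ℂ)) ^ (-(ρ' : ℂ))‖ ≤ ∑' k, ‖d k‖ * ‖t‖ ^ k := by
    intro z hz
    have h1 := hbin _ (lt_of_le_of_lt (htp z hz) ht)
    rw [← h1.tsum_eq]
    refine tsum_of_norm_bounded hdsum.hasSum fun k => ?_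
    rw [norm_mul, norm_pow]
    have := htp z hz
    gcongr
  constructor
  · refine Integrable.bdd_mul hgint hmeas.aestronglyMeasurable (c := ∑' k, ‖d k‖ * ‖t‖ ^ k) ?_
    filter_upwards [ae_restrict_mem hSm] with z hz
    exact hbound z hz
  · have hsum := hasSum_integral_of_dominated_convergence (μ := volume.restrict S)
      (F := fun k z => d k * (t * ∏ r, (z r : ℂ)) ^ k * g z)
      (f := fun z => (1 - t * ∏ r, (z r : ℂ)) ^ (-(ρ' : ℂ)) * g z)
      (fun k z => ‖d k‖ * ‖t‖ ^ k * ‖g z‖)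
      (fun k => by
        refine AEStronglyMeasurable.mul ?_ hgint.aestronglyMeasurable
        refine Continuous.aestronglyMeasurable ?_
        fun_prop)
      (fun k => by
        filter_upwards [ae_restrict_mem hSm] with z hz
        rw [norm_mul, norm_mul, norm_pow]
        have := htp z hz
        gcongr)
      (Eventually.of_forall fun z => hdsum.mul_right _)
      (by
        simp only [tsum_mul_right]
        exact hgint.norm.const_mul _)
      (by
        filter_upwards [ae_restrict_mem hSm] with z hz
        exact (hbin _ (lt_of_le_of_lt (htp z hz) ht)).mul_right _)
    have hterm : ∀ k : ℕ, ∫ z in S, d k * (t * ∏ r, (z r : ℂ)) ^ k * g z =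
        d k * t ^ k * ∏ r, (Complex.Gamma ((ρ r : ℂ) + k) * Complex.Gamma (1 - (ρ r : ℂ)) /
          (k.factorial : ℂ)) := by
      intro k
      have e1 : ∫ z in S, d k * (t * ∏ r, (z r : ℂ)) ^ k * g z =
          ∫ z in S, d k * t ^ k * ∏ r, (z r : ℂ) ^ (((ρ r : ℂ) + k) - 1) *
            (1 - (z r : ℂ)) ^ ((1 - (ρ r : ℂ)) - 1) := by
        refine setIntegral_congr_fun hSm fun z hz => ?_
        rw [← hgk k z hz, mul_pow]
        ring
      rw [e1, integral_const_mul, hμ, integral_fintype_prod_eq_prod (f := fun r (x : ℝ) =>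
        (x : ℂ) ^ (((ρ r : ℂ) + k) - 1) * (1 - (x : ℂ)) ^ ((1 - (ρ r : ℂ)) - 1))]
      congr 1
      refine Finset.prod_congr rfl fun r _ => ?_
      rw [setIntegral_beta (hre r k) (hre' r),
        show (ρ r : ℂ) + k + (1 - ρ r) = k + 1 by ring, Complex.Gamma_nat_eq_factorial]
    simp only [hterm] at hsum
    have h1 := (hasSum_mirrorPeriod hn0 ht).mul_left (∏ r : Fin (n - 1),
      Complex.Gamma (ρ r) * Complex.Gamma (1 - (ρ r : ℂ)))
    refine h1.unique ?_
    convert! hsum.mul_left ((2 * Real.pi * Complex.I : ℂ) ^ (n - 1)) using 1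
    funext k
    have h2 := periodCoeff_mul_prod_Gamma n k
    rw [prod_fin_eq_init_mul_last hn0, prod_fin_eq_init_mul_last hn0] at h2
    have h3 : d k * (k.factorial : ℂ) * Complex.Gamma ρ' = Complex.Gamma (ρ' + k) := by
      rw [hd]; exact choose_mul_factorial_mul_Gamma (rho_pos n _) k
    have hk := Nat.cast_ne_zero (R := ℂ).mpr (Nat.factorial_ne_zero k)
    have hG : Complex.Gamma ρ' ≠ 0 :=
      Complex.Gamma_ne_zero_of_re_pos (by simpa using rho_pos n (lastIdx hn0))
    have h4 : periodCoeff n k * (k.factorial : ℂ) ^ n * ∏ r, Complex.Gamma (ρ r) =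
        (∏ r, Complex.Gamma ((ρ r : ℂ) + k)) * (d k * (k.factorial : ℂ)) := by
      refine mul_right_cancel₀ hG ?_
      linear_combination h2 - (∏ r, Complex.Gamma ((ρ r : ℂ) + k)) * h3
    rw [Finset.prod_div_distrib, Finset.prod_mul_distrib, Finset.prod_mul_distrib,
      Finset.prod_const, Finset.card_univ, Fintype.card_fin]
    have h5 : (k.factorial : ℂ) ^ n = (k.factorial : ℂ) ^ (n - 1) * k.factorial := by
      rw [← pow_succ]; congr 1; omega
    rw [h5] at h4
    have h6 : periodCoeff n k * ∏ r, Complex.Gamma (ρ r) =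
        (∏ r, Complex.Gamma ((ρ r : ℂ) + k)) * d k / (k.factorial : ℂ) ^ (n - 1) := by
      rw [eq_div_iff (pow_ne_zero _ hk)]
      refine mul_right_cancel₀ hk ?_
      linear_combination h4
    linear_combination ((2 * Real.pi * Complex.I : ℂ) ^ (n - 1) * t ^ k *
      ∏ r, Complex.Gamma (1 - (ρ r : ℂ))) * h6

end EulerIntegral

/-! ### Constant coefficient differential operators -/

section PolyD
open Polynomial

/-- The constant coefficient differential operator `p(d/dz)` applied to `g`. -/
noncomputable def polyD (p : ℂ[X]) (g : ℂ → ℂ) (z : ℂ) : ℂ := p.sum fun j a => a * iteratedDeriv j g z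

lemma polyD_add (p q : ℂ[X]) (g : ℂ → ℂ) (z : ℂ) : polyD (p + q) g z = polyD p g z + polyD q g z :=
  Polynomial.sum_add_index p q _ (fun _ => zero_mul _) fun _ _ _ => add_mul _ _ _

lemma polyD_monomial (j : ℕ) (a : ℂ) (g : ℂ → ℂ) (z : ℂ) :
    polyD (monomial j a) g z = a * iteratedDeriv j g z :=
  Polynomial.sum_monomial_index a _ (zero_mul _)

lemma polyD_C_mul (a : ℂ) (p : ℂ[X]) (g : ℂ → ℂ) (z : ℂ) : polyD (C a * p) g z = a * polyD p g z := by
  induction p using Polynomial.induction_on' with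
  | add p q hp hq => rw [mul_add, polyD_add, polyD_add, hp, hq, mul_add]
  | monomial j b => rw [C_mul_monomial, polyD_monomial, polyD_monomial, mul_assoc]

lemma polyD_one (g : ℂ → ℂ) (z : ℂ) : polyD 1 g z = g z := by
  have := polyD_monomial 0 1 g z
  simpa using this

lemma polyD_C (a : ℂ) (g : ℂ → ℂ) (z : ℂ) : polyD (C a) g z = a * g z := by
  have := polyD_monomial 0 a g z
  simpa using this

lemma polyD_X_pow (j : ℕ) (g : ℂ → ℂ) (z : ℂ) : polyD (X ^ j) g z = iteratedDeriv j g z := by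
  rw [← monomial_one_right_eq_X_pow, polyD_monomial, one_mul]

lemma polyD_congr {f g : ℂ → ℂ} {z : ℂ} (h : f =ᶠ[𝓝 z] g) (p : ℂ[X]) : polyD p f z = polyD p g z := by
  unfold polyD
  simp only [h.iteratedDeriv_eq]

lemma analyticAt_iteratedDeriv {g : ℂ → ℂ} {z : ℂ} (hg : AnalyticAt ℂ g z) (j : ℕ) :
    AnalyticAt ℂ (iteratedDeriv j g) z := by
  induction j with
  | zero => rwa [iteratedDeriv_zero]
  | succ j ih => rw [iteratedDeriv_succ]; exact ih.deriv

lemma analyticAt_polyD {g : ℂ → ℂ} {z : ℂ} (hg : AnalyticAt ℂ g z) (p : ℂ[X]) :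
    AnalyticAt ℂ (polyD p g) z := by
  unfold polyD Polynomial.sum
  exact Finset.analyticAt_fun_sum _ fun j _ => analyticAt_const.mul (analyticAt_iteratedDeriv hg j)

lemma polyD_X_mul {g : ℂ → ℂ} {z : ℂ} (hg : AnalyticAt ℂ g z) (p : ℂ[X]) :
    polyD (X * p) g z = deriv (polyD p g) z := by
  induction p using Polynomial.induction_on' with
  | add p q hp hq =>
    have h : polyD (p + q) g = fun y => polyD p g y + polyD q g y := funext (polyD_add p q g)
    rw [mul_add, polyD_add, h, deriv_fun_add (analyticAt_polyD hg p).differentiableAt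
      (analyticAt_polyD hg q).differentiableAt, hp, hq]
  | monomial j a =>
    have h : polyD (monomial j a) g = fun y => a * iteratedDeriv j g y :=
      funext (polyD_monomial j a g)
    rw [X_mul_monomial, polyD_monomial, h, deriv_const_mul _
      (analyticAt_iteratedDeriv hg j).differentiableAt, iteratedDeriv_succ]

lemma polyD_X_pow_mul {g : ℂ → ℂ} {z : ℂ} (hg : AnalyticAt ℂ g z) (k : ℕ) (p : ℂ[X]) :
    polyD (X ^ k * p) g z = iteratedDeriv k (polyD p g) z := by
  induction k generalizing z with
  | zero => simp
  | succ k ih =>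
    rw [pow_succ', mul_assoc, polyD_X_mul hg, iteratedDeriv_succ]
    exact Filter.EventuallyEq.deriv_eq (hg.eventually_analyticAt.mono fun y hy => ih hy)

lemma polyD_mul {g : ℂ → ℂ} {z : ℂ} (hg : AnalyticAt ℂ g z) (p q : ℂ[X]) :
    polyD (p * q) g z = polyD p (polyD q g) z := by
  induction p using Polynomial.induction_on' with
  | add p r hp hr => rw [add_mul, polyD_add, polyD_add, hp, hr]
  | monomial j a =>
    rw [← C_mul_X_pow_eq_monomial, mul_assoc, polyD_C_mul, polyD_X_pow_mul hg, polyD_C_mul,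
      polyD_X_pow]

lemma polyD_X_add_C_mul {g : ℂ → ℂ} {z : ℂ} (hg : AnalyticAt ℂ g z) (a : ℂ) (p : ℂ[X]) :
    polyD ((X + C a) * p) g z = deriv (polyD p g) z + a * polyD p g z := by
  rw [add_mul, polyD_add, polyD_X_mul hg, polyD_C_mul]

lemma polyD_zero_fun (p : ℂ[X]) (z : ℂ) : polyD p (fun _ => 0) z = 0 := by
  unfold polyD Polynomial.sum
  refine Finset.sum_eq_zero fun j _ => ?_
  beta_reduce
  rw [iteratedDeriv_const]; simp

lemma polyD_fun_add {f g : ℂ → ℂ} {z : ℂ} (hf : AnalyticAt ℂ f z) (hg : AnalyticAt ℂ g z)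
    (p : ℂ[X]) : polyD p (fun y => f y + g y) z = polyD p f z + polyD p g z := by
  unfold polyD Polynomial.sum
  rw [← Finset.sum_add_distrib]
  refine Finset.sum_congr rfl fun j _ => ?_
  beta_reduce
  rw [iteratedDeriv_fun_add hf.contDiffAt hg.contDiffAt, mul_add]

lemma polyD_fun_const_mul {f : ℂ → ℂ} {z : ℂ} (hf : AnalyticAt ℂ f z) (c : ℂ)
    (p : ℂ[X]) : polyD p (fun y => c * f y) z = c * polyD p f z := by
  unfold polyD Polynomial.sum
  rw [Finset.mul_sum]
  refine Finset.sum_congr rfl fun j _ => ?_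
  beta_reduce
  rw [iteratedDeriv_const_mul c hf.contDiffAt]
  ring

lemma polyD_fun_sum {ι : Type*} (s : Finset ι) {f : ι → ℂ → ℂ} {z : ℂ}
    (hf : ∀ k ∈ s, AnalyticAt ℂ (f k) z) (c : ι → ℂ) (p : ℂ[X]) :
    polyD p (fun y => ∑ k ∈ s, c k * f k y) z = ∑ k ∈ s, c k * polyD p (f k) z := by
  classical
  induction s using Finset.induction_on with
  | empty => simp [polyD_zero_fun]
  | insert k s hk ih =>
    simp only [Finset.sum_insert hk]
    have hs : ∀ k ∈ s, AnalyticAt ℂ (f k) z := fun j hj => hf j (Finset.mem_insert_of_mem hj)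
    have hk' := hf k (Finset.mem_insert_self k s)
    rw [polyD_fun_add (analyticAt_const.fun_mul hk')
      (Finset.analyticAt_fun_sum s fun j hj => analyticAt_const.fun_mul (hs j hj)), ih hs,
      polyD_fun_const_mul hk']

lemma polyD_comp_add_const (p : ℂ[X]) (g : ℂ → ℂ) (a z : ℂ) :
    polyD p (fun y => g (y + a)) z = polyD p g (z + a) := by
  unfold polyD
  simp only [iteratedDeriv_comp_add_const]

lemma polyD_comp_neg (p : ℂ[X]) (g : ℂ → ℂ) (z : ℂ) :
    polyD p (fun y => g (-y)) z = polyD (p.comp (-X)) g (-z) := by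
  induction p using Polynomial.induction_on' with
  | add p q hp hq => rw [polyD_add, add_comp, polyD_add, hp, hq]
  | monomial j a =>
    rw [polyD_monomial, monomial_comp, neg_pow, show ((-1 : ℂ[X]) ^ j) = C ((-1) ^ j) by simp,
      polyD_C_mul, polyD_C_mul, polyD_X_pow, iteratedDeriv_comp_neg]
    simp

/-- The rule e^(-ay) D e^(ay) = D + a; it moves e^(kz) past an operator when the differential
equation is iterated in `polyD_fall_iterate`. -/
lemma polyD_exp_mul {g : ℂ → ℂ} {z : ℂ} (hg : AnalyticAt ℂ g z) (a : ℂ) (p : ℂ[X]) :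
    polyD p (fun y => Complex.exp (a * y) * g y) z =
      Complex.exp (a * z) * polyD (p.comp (X + C a)) g z := by
  have hE : ∀ y, AnalyticAt ℂ (fun y : ℂ => Complex.exp (a * y)) y := fun y => by fun_prop
  induction p using Polynomial.induction_on' generalizing z with
  | add p q hp hq => rw [polyD_add, add_comp, polyD_add, hp hg, hq hg, mul_add]
  | monomial j b =>
    rw [polyD_monomial, monomial_comp, polyD_C_mul]
    have h : iteratedDeriv j (fun y => Complex.exp (a * y) * g y) z =
        Complex.exp (a * z) * polyD ((X + C a) ^ j) g z := by
      induction j generalizing z with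
      | zero => simp [polyD_one]
      | succ j ih =>
        rw [iteratedDeriv_succ, Filter.EventuallyEq.deriv_eq
          (hg.eventually_analyticAt.mono fun y hy => ih hy), pow_succ', polyD_X_add_C_mul hg]
        have h1 : HasDerivAt (fun y : ℂ => Complex.exp (a * y)) (Complex.exp (a * z) * (a * 1)) z :=
          ((hasDerivAt_id' z).const_mul a).cexp
        rw [(h1.fun_mul (analyticAt_polyD hg _).differentiableAt.hasDerivAt).deriv]
        ring
    rw [h]
    ring

end PolyD

/-! ### Uniqueness and bases for P(D) g = κ e^z R(D) g -/

section ODE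
open Polynomial

/-- `g` is a holomorphic solution of `P(d/dz) g = κ e^z R(d/dz) g` on `W`. -/
def IsExpODESolution (P R : ℂ[X]) (κ : ℂ) (W : Set ℂ) (g : ℂ → ℂ) : Prop :=
  AnalyticOnNhd ℂ g W ∧ ∀ z ∈ W, polyD P g z = κ * Complex.exp z * polyD R g z

lemma IsExpODESolution.mono {P R : ℂ[X]} {κ : ℂ} {W V : Set ℂ} {g : ℂ → ℂ}
    (h : IsExpODESolution P R κ W g) (hV : V ⊆ W) : IsExpODESolution P R κ V g :=
  ⟨h.1.mono hV, fun z hz => h.2 z (hV hz)⟩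

lemma IsExpODESolution.congr {P R : ℂ[X]} {κ : ℂ} {W : Set ℂ} {f g : ℂ → ℂ}
    (h : IsExpODESolution P R κ W f) (hW : IsOpen W) (hfg : ∀ z ∈ W, f z = g z) :
    IsExpODESolution P R κ W g := by
  have hev : ∀ z ∈ W, f =ᶠ[𝓝 z] g := fun z hz =>
    Filter.eventually_of_mem (hW.mem_nhds hz) hfg
  refine ⟨fun z hz => (h.1 z hz).congr (hev z hz), fun z hz => ?_⟩
  rw [← polyD_congr (hev z hz), ← polyD_congr (hev z hz)]
  exact h.2 z hz

lemma isExpODESolution_sum {ι : Type*} {P R : ℂ[X]} {κ : ℂ} {W : Set ℂ} (s : Finset ι)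
    {g : ι → ℂ → ℂ} (h : ∀ k ∈ s, IsExpODESolution P R κ W (g k)) (c : ι → ℂ) :
    IsExpODESolution P R κ W (fun z => ∑ k ∈ s, c k * g k z) := by
  refine ⟨fun z hz => Finset.analyticAt_fun_sum s fun k hk =>
    analyticAt_const.mul ((h k hk).1 z hz), fun z hz => ?_⟩
  rw [polyD_fun_sum s (fun k hk => (h k hk).1 z hz), polyD_fun_sum s (fun k hk => (h k hk).1 z hz),
    Finset.mul_sum]
  refine Finset.sum_congr rfl fun k hk => ?_
  rw [(h k hk).2 z hz]
  ring

lemma IsExpODESolution.sub {P R : ℂ[X]} {κ : ℂ} {W : Set ℂ} {f g : ℂ → ℂ}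
    (hf : IsExpODESolution P R κ W f) (hg : IsExpODESolution P R κ W g) :
    IsExpODESolution P R κ W (fun z => f z - g z) := by
  have h := isExpODESolution_sum (Finset.univ : Finset (Fin 2)) (g := ![f, g])
    (fun k _ => by fin_cases k <;> assumption) ![1, -1]
  simpa [Fin.sum_univ_two, sub_eq_add_neg] using h

lemma iteratedDeriv_mul_of_vanish {f h : ℂ → ℂ} {z : ℂ} (hf : AnalyticAt ℂ f z)
    (hh : AnalyticAt ℂ h z) {m : ℕ} (hv : ∀ l < m, iteratedDeriv l h z = 0) :
    iteratedDeriv m (fun y => f y * h y) z = f z * iteratedDeriv m h z := by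
  rw [show (fun y => f y * h y) = f * h from rfl, iteratedDeriv_mul hf.contDiffAt hh.contDiffAt,
    Finset.sum_eq_single 0]
  · simp
  · intro i hi hi0
    rw [hv (m - i) (by have := Finset.mem_range.mp hi; omega), mul_zero]
  · simp

lemma polyD_X_pow_mul_of_vanish {P : ℂ[X]} {n : ℕ} (hP : P.Monic) (hPn : P.natDegree = n)
    {g : ℂ → ℂ} {z : ℂ} (m : ℕ) (hv : ∀ j < n + m, iteratedDeriv j g z = 0) :
    polyD (X ^ m * P) g z = iteratedDeriv (n + m) g z := by
  unfold polyD
  rw [Polynomial.sum_over_range _ (fun _ => zero_mul _)]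
  have hd : (X ^ m * P).natDegree = n + m := by
    rw [natDegree_X_pow_mul _ hP.ne_zero, hPn]
  rw [hd, Finset.sum_range_succ, Finset.sum_eq_zero, zero_add, add_comm n m, coeff_X_pow_mul',
    if_pos (by omega), Nat.add_sub_cancel_left, ← hPn, hP.coeff_natDegree, one_mul]
  intro j hj
  rw [hv j (Finset.mem_range.mp hj), mul_zero]

lemma eventually_eq_zero_of_iteratedDeriv {g : ℂ → ℂ} {z : ℂ} (hg : AnalyticAt ℂ g z)
    (h : ∀ j, iteratedDeriv j g z = 0) : ∀ᶠ y in 𝓝 z, g y = 0 := by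
  have h1 := hg.hasFPowerSeriesAt
  have h2 : (FormalMultilinearSeries.ofScalars ℂ fun n => iteratedDeriv n g z / (n.factorial : ℂ)) =
      0 := by
    simp only [h, zero_div]
    ext n
    simp [FormalMultilinearSeries.ofScalars]
  rw [h2] at h1
  exact h1.eventually_eq_zero

/-- Both operators are monic of order n, so the leading coefficient of the equation is 1 - κ e^z.
Where it is non-zero, the derivatives of order at least n are determined recursively by those below
n. If these vanish, so does the whole Taylor series, and the identity theorem applies. -/
lemma IsExpODESolution.eq_zero {P R : ℂ[X]} {κ : ℂ} {W : Set ℂ} {g : ℂ → ℂ} {n : ℕ}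
    (hg : IsExpODESolution P R κ W g) (hP : P.Monic) (hPn : P.natDegree = n) (hR : R.Monic)
    (hRn : R.natDegree = n) (hW : IsOpen W) (hWc : IsPreconnected W) {z : ℂ} (hz : z ∈ W)
    (hκ : κ * Complex.exp z ≠ 1) (hv : ∀ j < n, iteratedDeriv j g z = 0) :
    ∀ y ∈ W, g y = 0 := by
  have han := hg.1 z hz
  have hall : ∀ m, ∀ j < n + m, iteratedDeriv j g z = 0 := by
    intro m
    induction m with
    | zero => simpa using hv
    | succ m ih =>
      intro j hj
      rcases Nat.lt_succ_iff_lt_or_eq.mp (show j < (n + m) + 1 by omega) with h | h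
      · exact ih j h
      · rw [h]
        -- Differentiate the equation m times at z: all derivatives of order below n + m vanish, so
        -- only the leading terms survive and (1 - κ e^z) g^(n+m)(z) = 0.
        have hev : polyD P g =ᶠ[𝓝 z] fun y => κ * Complex.exp y * polyD R g y :=
          Filter.eventually_of_mem (hW.mem_nhds hz) hg.2
        have h1 := hev.iteratedDeriv_eq m
        have hE : AnalyticAt ℂ (fun y : ℂ => κ * Complex.exp y) z := by fun_prop
        rw [iteratedDeriv_mul_of_vanish hE (analyticAt_polyD han R), ← polyD_X_pow_mul han,
          ← polyD_X_pow_mul han, polyD_X_pow_mul_of_vanish hP hPn m ih,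
          polyD_X_pow_mul_of_vanish hR hRn m ih] at h1
        · have h2 : (1 - κ * Complex.exp z) * iteratedDeriv (n + m) g z = 0 := by
            linear_combination h1
          exact (mul_eq_zero.mp h2).resolve_left (sub_ne_zero.mpr hκ.symm)
        · intro l hl
          rw [← polyD_X_pow_mul han, polyD_X_pow_mul_of_vanish hR hRn l
            (fun j hj => ih j (by omega))]
          exact ih _ (by omega)
  have hev := eventually_eq_zero_of_iteratedDeriv han fun j => hall (j + 1) j (by omega)
  exact hg.1.eqOn_zero_of_preconnected_of_eventuallyEq_zero hWc hz hev

/-- By `IsExpODESolution.eq_zero` taking the first n derivatives at z is injective on solutions, so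
those of n independent solutions span ℂ^n; match those of f. -/
lemma IsExpODESolution.exists_eq_sum {P R : ℂ[X]} {κ : ℂ} {W : Set ℂ} {n : ℕ}
    {g : Fin n → ℂ → ℂ} {f : ℂ → ℂ}
    (hf : IsExpODESolution P R κ W f) (hg : ∀ k, IsExpODESolution P R κ W (g k))
    (hP : P.Monic) (hPn : P.natDegree = n) (hR : R.Monic)
    (hRn : R.natDegree = n) (hW : IsOpen W) (hWc : IsPreconnected W) {z : ℂ} (hz : z ∈ W)
    (hκ : κ * Complex.exp z ≠ 1)
    (hind : ∀ c : Fin n → ℂ, (∀ y ∈ W, ∑ k, c k * g k y = 0) → c = 0) :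
    ∃ c : Fin n → ℂ, ∀ y ∈ W, f y = ∑ k, c k * g k y := by
  set v : Fin n → (Fin n → ℂ) := fun k j => iteratedDeriv (j : ℕ) (g k) z with hv
  have hsum : ∀ (c : Fin n → ℂ) (j : ℕ), iteratedDeriv j (fun y => ∑ k, c k * g k y) z =
      ∑ k, c k * iteratedDeriv j (g k) z := by
    intro c j
    have := polyD_fun_sum Finset.univ (fun k _ => (hg k).1 z hz) c (X ^ j)
    simpa only [polyD_X_pow] using this
  have hli : LinearIndependent ℂ v := by
    rw [Fintype.linearIndependent_iff]
    intro c hc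
    refine congrFun (hind c ?_)
    refine (isExpODESolution_sum Finset.univ (fun k _ => hg k) c).eq_zero hP hPn hR hRn hW hWc hz hκ
      fun j hj => ?_
    rw [hsum]
    have := congrFun hc ⟨j, hj⟩
    simpa [hv] using this
  have hspan := hli.span_eq_top_of_card_eq_finrank' (by simp)
  have hmem : (fun j : Fin n => iteratedDeriv (j : ℕ) f z) ∈ Submodule.span ℂ (Set.range v) := by
    rw [hspan]; trivial
  rw [Submodule.mem_span_range_iff_exists_fun] at hmem
  obtain ⟨c, hc⟩ := hmem
  refine ⟨c, fun y hy => ?_⟩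
  have hs := isExpODESolution_sum Finset.univ (fun k _ => hg k) c
  have h0 := (hf.sub hs).eq_zero hP hPn hR hRn hW hWc hz hκ (fun j hj => by
    have h1 := iteratedDeriv_fun_sub (n := j) (hf.1 z hz).contDiffAt (hs.1 z hz).contDiffAt
    rw [h1, hsum]
    have := congrFun hc ⟨j, hj⟩
    simp only [hv, Finset.sum_apply, Pi.smul_apply, smul_eq_mul] at this
    rw [this, sub_self]) y hy
  exact sub_eq_zero.mp h0

end ODE

/-! ### Frobenius series as contour integrals over the exponents -/

section Frobenius
open Polynomial

/-- The data of an equation `∏ (d/dz - r_i) g = κ e^z ∏ (d/dz - a_i) g` whose exponents `r_i` lie in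
an open disc of radius `1/2`. -/
structure FrobeniusData (n : ℕ) where
  /-- the exponents -/
  r : Fin n → ℂ
  /-- the roots of the operator on the right -/
  a : Fin n → ℂ
  /-- the constant factor -/
  κ : ℂ
  /-- the centre of a disc containing the exponents -/
  c : ℂ
  norm_κ : ‖κ‖ = 1
  norm_r : ∀ i, ‖r i - c‖ < 1 / 2

namespace FrobeniusData

variable {n : ℕ} (D : FrobeniusData n)

/-- The indicial polynomial. -/
noncomputable def P : ℂ[X] := ∏ i, (X - C (D.r i))

/-- The polynomial of the operator on the right. -/
noncomputable def R : ℂ[X] := ∏ i, (X - C (D.a i))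

lemma eval_P (x : ℂ) : D.P.eval x = ∏ i, (x - D.r i) := by simp [P, eval_prod]

lemma eval_R (x : ℂ) : D.R.eval x = ∏ i, (x - D.a i) := by simp [R, eval_prod]

lemma monic_P : D.P.Monic := monic_prod_of_monic _ _ fun _ _ => monic_X_sub_C _

lemma monic_R : D.R.Monic := monic_prod_of_monic _ _ fun _ _ => monic_X_sub_C _

lemma natDegree_P : D.P.natDegree = n := by
  rw [P, natDegree_prod_of_monic _ _ fun _ _ => monic_X_sub_C _]; simp

lemma natDegree_R : D.R.natDegree = n := by
  rw [R, natDegree_prod_of_monic _ _ fun _ _ => monic_X_sub_C _]; simp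

/-- The coefficients of the Frobenius series `∑_k G_k(ε) e^{(k+ε)z}`. -/
noncomputable def G : ℕ → ℂ → ℂ
  | 0, _ => 1
  | k + 1, ε => G k ε * (D.κ * ∏ i, (((k : ℂ) + ε - D.a i) / ((k : ℂ) + 1 + ε - D.r i)))

lemma exists_gap : ∃ η : ℝ, 0 < η ∧ ∀ i, ‖D.r i - D.c‖ ≤ 1 / 2 - η := by
  have h : ∀ᶠ η : ℝ in 𝓝[>] 0, ∀ i, ‖D.r i - D.c‖ ≤ 1 / 2 - η := by
    rw [eventually_all]
    intro i
    have h1 : 0 < 1 / 2 - ‖D.r i - D.c‖ := by linarith [D.norm_r i]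
    filter_upwards [Ioo_mem_nhdsGT h1] with η hη
    linarith [hη.2]
  obtain ⟨η, h1, h2⟩ := (h.and self_mem_nhdsWithin).exists
  exact ⟨η, h2, h1⟩

lemma norm_sub_lt {ε : ℂ} (hε : ε ∈ Metric.closedBall D.c (1 / 2)) (i : Fin n) :
    ‖ε - D.r i‖ < 1 := by
  rw [mem_closedBall_iff_norm] at hε
  have h1 := D.norm_r i
  have h2 := norm_sub_le (ε - D.c) (D.r i - D.c)
  rw [sub_sub_sub_cancel_right] at h2
  linarith

/-- The exponents lie in the open disc of radius 1/2 and ε in its closure, so |ε - r_i| < 1 and no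
denominator k + 1 + ε - r_i can vanish. -/
lemma denom_ne_zero (k : ℕ) {ε : ℂ} (hε : ε ∈ Metric.closedBall D.c (1 / 2)) (i : Fin n) :
    (k : ℂ) + 1 + ε - D.r i ≠ 0 := by
  intro h
  have h1 := D.norm_sub_lt hε i
  have h2 : ε - D.r i = -(((k + 1 : ℕ) : ℂ)) := by push_cast; linear_combination h
  rw [h2, norm_neg, Complex.norm_natCast] at h1
  push_cast at h1
  have : (0 : ℝ) ≤ k := k.cast_nonneg
  linarith

lemma differentiableOn_G (k : ℕ) : DifferentiableOn ℂ (D.G k) (Metric.closedBall D.c (1 / 2)) := by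
  induction k with
  | zero => exact differentiableOn_const 1
  | succ k ih =>
    refine ih.mul ((differentiableOn_const _).mul ?_)
    refine DifferentiableOn.fun_finsetProd fun i _ => ?_
    refine DifferentiableOn.div ?_ ?_ fun ε hε => D.denom_ne_zero k hε i
    · exact ((differentiableOn_id.const_add _).sub_const _)
    · exact ((differentiableOn_id.const_add _).sub_const _)

/-- Each factor of G_(k+1)/G_k differs from 1 by O(1/k), uniformly on the closed disc, so the ratios
of the majorant tend to 1. This is what gives convergence for Re z < 0. -/
lemma exists_majorant : ∃ M : ℕ → ℝ, (∀ k, 0 < M k) ∧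
    Tendsto (fun k => M (k + 1) / M k) atTop (𝓝 1) ∧
    ∀ k, ∀ ε ∈ Metric.closedBall D.c (1 / 2), ‖D.G k ε‖ ≤ M k := by
  obtain ⟨η, hη, hr⟩ := D.exists_gap
  obtain ⟨B, hB0, hB⟩ : ∃ B : ℝ, 0 ≤ B ∧ ∀ i, ‖D.r i - D.a i - 1‖ ≤ B :=
    ⟨∑ i, ‖D.r i - D.a i - 1‖, Finset.sum_nonneg fun _ _ => norm_nonneg _, fun i =>
      Finset.single_le_sum (f := fun i => ‖D.r i - D.a i - 1‖) (fun _ _ => norm_nonneg _)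
        (Finset.mem_univ i)⟩
  -- Here B bounds |r_i - a_i - 1| and k + η bounds |k + 1 + ε - r_i| from below.
  set q : ℕ → ℝ := fun k => (1 + B / (k + η)) ^ n with hq
  have hk : ∀ k : ℕ, 0 < (k : ℝ) + η := fun k => by positivity
  have hqpos : ∀ k, 0 < q k := fun k => by have := hk k; positivity
  have hlim : Tendsto q atTop (𝓝 1) := by
    have h1 : Tendsto (fun k : ℕ => (k : ℝ) + η) atTop atTop :=
      tendsto_atTop_add_const_right _ _ tendsto_natCast_atTop_atTop
    have h2 : Tendsto (fun k : ℕ => B / ((k : ℝ) + η)) atTop (𝓝 0) := h1.const_div_atTop B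
    have h3 := (h2.const_add 1).pow n
    simpa using h3
  refine ⟨fun k => ∏ m ∈ Finset.range k, q m, fun k => Finset.prod_pos fun m _ => hqpos m, ?_, ?_⟩
  · refine hlim.congr fun k => ?_
    have : ∏ m ∈ Finset.range k, q m ≠ 0 := (Finset.prod_pos fun m _ => hqpos m).ne'
    beta_reduce
    rw [Finset.prod_range_succ]
    field_simp
  · intro k ε hε
    induction k with
    | zero => simp [G]
    | succ k ih =>
      beta_reduce at ih ⊢
      rw [Finset.prod_range_succ, G, norm_mul, norm_mul, D.norm_κ, one_mul, norm_prod]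
      refine mul_le_mul ih ?_ (Finset.prod_nonneg fun _ _ => norm_nonneg _)
        (Finset.prod_pos fun m _ => hqpos m).le
      have h1 : ∀ i ∈ Finset.univ, ‖((k : ℂ) + ε - D.a i) / ((k : ℂ) + 1 + ε - D.r i)‖ ≤
          1 + B / (k + η) := by
        intro i _
        have hd := D.denom_ne_zero k hε i
        have h2 : ((k : ℂ) + ε - D.a i) / ((k : ℂ) + 1 + ε - D.r i) =
            1 + (D.r i - D.a i - 1) / ((k : ℂ) + 1 + ε - D.r i) := by
          field_simp; ring
        rw [h2]
        refine (norm_add_le _ _).trans ?_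
        rw [norm_one, norm_div]
        have h3 : (k : ℝ) + η ≤ ‖(k : ℂ) + 1 + ε - D.r i‖ := by
          have h4 : ‖ε - D.r i‖ ≤ 1 - η := by
            rw [mem_closedBall_iff_norm] at hε
            have h5 := norm_sub_le (ε - D.c) (D.r i - D.c)
            rw [sub_sub_sub_cancel_right] at h5
            linarith [hr i]
          have h6 := norm_sub_norm_le (((k + 1 : ℕ) : ℂ)) (-(ε - D.r i))
          rw [norm_neg, Complex.norm_natCast, sub_neg_eq_add] at h6
          have h7 : ((k + 1 : ℕ) : ℂ) + (ε - D.r i) = (k : ℂ) + 1 + ε - D.r i := by push_cast; ring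
          rw [h7] at h6
          push_cast at h6
          linarith
        have := hk k
        gcongr
        exact hB i
      refine (Finset.prod_le_prod (fun _ _ => norm_nonneg _) h1).trans ?_
      simp [hq]

lemma summable_majorant {M : ℕ → ℝ} (hM : ∀ k, 0 < M k)
    (hlim : Tendsto (fun k => M (k + 1) / M k) atTop (𝓝 1)) {x : ℝ} (hx : x < 0) :
    Summable fun k : ℕ => M k * Real.exp (k * x) := by
  refine summable_of_ratio_test_tendsto_lt_one (l := Real.exp x) (Real.exp_lt_one_iff.mpr hx)
    (Eventually.of_forall fun k => (mul_pos (hM k) (Real.exp_pos _)).ne') ?_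
  have h := hlim.mul_const (Real.exp x)
  rw [one_mul] at h
  refine h.congr fun k => ?_
  rw [Real.norm_of_nonneg (mul_pos (hM _) (Real.exp_pos _)).le,
    Real.norm_of_nonneg (mul_pos (hM _) (Real.exp_pos _)).le]
  have h1 : Real.exp (((k + 1 : ℕ) : ℝ) * x) = Real.exp (k * x) * Real.exp x := by
    rw [← Real.exp_add]; congr 1; push_cast; ring
  rw [h1]
  have := (hM k).ne'
  have := (Real.exp_pos (k * x)).ne'
  field_simp

/-- The contour integral of `ψ(ε) e^{(k+ε)z}` over the circle around the exponents. -/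
noncomputable def laplace (ψ : ℂ → ℂ) (k : ℕ) (z : ℂ) : ℂ :=
  circleIntegral (fun ε => ψ ε * Complex.exp (((k : ℂ) + ε) * z)) D.c (1 / 2)

lemma hasDerivAt_laplace {ψ : ℂ → ℂ} (hψ : ContinuousOn ψ (Metric.sphere D.c (1 / 2))) (k : ℕ)
    (z : ℂ) : HasDerivAt (D.laplace ψ k) (D.laplace (fun ε => ((k : ℂ) + ε) * ψ ε) k z) z := by
  have hmem : ∀ θ, circleMap D.c (1 / 2) θ ∈ Metric.sphere D.c (1 / 2) :=
    fun θ => circleMap_mem_sphere _ (by norm_num) θ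
  have hψc : Continuous fun θ => ψ (circleMap D.c (1 / 2) θ) :=
    hψ.comp_continuous (continuous_circleMap _ _) hmem
  have hcm := continuous_circleMap D.c (1 / 2)
  have hdc : Continuous (deriv (circleMap D.c (1 / 2))) := by
    rw [funext (deriv_circleMap _ _)]; fun_prop
  obtain ⟨A, hA⟩ := (isCompact_sphere D.c (1 / 2)).exists_bound_of_continuousOn hψ
  have hA0 : 0 ≤ A := (norm_nonneg _).trans (hA _ (hmem 0))
  set L : ℝ := k + (‖D.c‖ + 1 / 2) with hL
  have hnorm : ∀ θ, ‖(k : ℂ) + circleMap D.c (1 / 2) θ‖ ≤ L := by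
    intro θ
    have h1 := hmem θ
    rw [mem_sphere_iff_norm] at h1
    have h2 := norm_add_le (circleMap D.c (1 / 2) θ - D.c) D.c
    rw [sub_add_cancel] at h2
    refine (norm_add_le _ _).trans ?_
    rw [Complex.norm_natCast]
    linarith
  have hL0 : 0 ≤ L := (norm_nonneg _).trans (hnorm 0)
  have h := intervalIntegral.hasDerivAt_integral_of_dominated_loc_of_deriv_le
    (μ := volume) (a := 0) (b := 2 * Real.pi) (x₀ := z) (s := Metric.ball z 1)
    (F := fun z θ => deriv (circleMap D.c (1 / 2)) θ • (ψ (circleMap D.c (1 / 2) θ) *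
      Complex.exp (((k : ℂ) + circleMap D.c (1 / 2) θ) * z)))
    (F' := fun z θ => deriv (circleMap D.c (1 / 2)) θ • ((((k : ℂ) + circleMap D.c (1 / 2) θ) *
      ψ (circleMap D.c (1 / 2) θ)) * Complex.exp (((k : ℂ) + circleMap D.c (1 / 2) θ) * z)))
    (bound := fun _ => (1 / 2) * (L * A * Real.exp (L * (‖z‖ + 1))))
    (Metric.ball_mem_nhds z one_pos)
    (Eventually.of_forall fun w => Continuous.aestronglyMeasurable
      (hdc.smul (hψc.mul (by fun_prop))))
    (Continuous.intervalIntegrable (hdc.smul (hψc.mul (by fun_prop))) _ _)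
    (Continuous.aestronglyMeasurable (hdc.smul (((by fun_prop : Continuous fun θ =>
      (k : ℂ) + circleMap D.c (1 / 2) θ).mul hψc).mul (by fun_prop))))
    (Eventually.of_forall fun θ _ w hw => ?_)
    intervalIntegrable_const
    (Eventually.of_forall fun θ _ w _ => ?_)
  · exact h.2
  · have hw' : ‖w‖ ≤ ‖z‖ + 1 := by
      have h1 := norm_add_le (w - z) z
      rw [sub_add_cancel] at h1
      have h2 := mem_ball_iff_norm.mp hw
      linarith
    have h3 : ‖Complex.exp (((k : ℂ) + circleMap D.c (1 / 2) θ) * w)‖ ≤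
        Real.exp (L * (‖z‖ + 1)) := by
      refine (Complex.norm_exp_le_exp_norm _).trans (Real.exp_le_exp.mpr ?_)
      rw [norm_mul]
      have := hnorm θ
      gcongr
    rw [norm_smul, deriv_circleMap]
    simp only [norm_mul, norm_circleMap_zero, Complex.norm_I, mul_one]
    have h4 := hA _ (hmem θ)
    have h5 := hnorm θ
    rw [abs_of_pos (by norm_num : (0 : ℝ) < 1 / 2)]
    gcongr
  · have h1 : HasDerivAt (fun w : ℂ => Complex.exp (((k : ℂ) + circleMap D.c (1 / 2) θ) * w))
        (Complex.exp (((k : ℂ) + circleMap D.c (1 / 2) θ) * w) *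
          (((k : ℂ) + circleMap D.c (1 / 2) θ) * 1)) w := ((hasDerivAt_id' w).const_mul _).cexp
    convert! (h1.const_mul (ψ (circleMap D.c (1 / 2) θ))).const_smul
      (deriv (circleMap D.c (1 / 2)) θ) using 2
    ring

lemma differentiable_laplace {ψ : ℂ → ℂ} (hψ : ContinuousOn ψ (Metric.sphere D.c (1 / 2))) (k : ℕ) :
    Differentiable ℂ (D.laplace ψ k) := fun z => (D.hasDerivAt_laplace hψ k z).differentiableAt

lemma laplace_add {ψ φ : ℂ → ℂ} (hψ : ContinuousOn ψ (Metric.sphere D.c (1 / 2)))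
    (hφ : ContinuousOn φ (Metric.sphere D.c (1 / 2))) (k : ℕ) (z : ℂ) :
    D.laplace (fun ε => ψ ε + φ ε) k z = D.laplace ψ k z + D.laplace φ k z := by
  have hE : ContinuousOn (fun ε : ℂ => Complex.exp (((k : ℂ) + ε) * z))
    (Metric.sphere D.c (1 / 2)) := by fun_prop
  unfold laplace
  rw [← circleIntegral.integral_add]
  · simp only [add_mul]
  · exact (hψ.mul hE).circleIntegrable (by norm_num)
  · exact (hφ.mul hE).circleIntegrable (by norm_num)

lemma laplace_const_mul (b : ℂ) (ψ : ℂ → ℂ) (k : ℕ) (z : ℂ) :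
    D.laplace (fun ε => b * ψ ε) k z = b * D.laplace ψ k z := by
  unfold laplace
  simp only [mul_assoc]
  rw [circleIntegral.integral_const_mul]

lemma laplace_congr {ψ φ : ℂ → ℂ} (h : ∀ ε ∈ Metric.sphere D.c (1 / 2), ψ ε = φ ε) (k : ℕ) (z : ℂ) :
    D.laplace ψ k z = D.laplace φ k z :=
  circleIntegral.integral_congr (by norm_num) fun ε hε => by
    rw [h ε hε]

/-- Under the contour integral p(D) acts on e^((k+ε)z) as multiplication by p(k+ε). -/
lemma polyD_laplace {ψ : ℂ → ℂ} (hψ : ContinuousOn ψ (Metric.sphere D.c (1 / 2))) (k : ℕ) (p : ℂ[X])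
    (z : ℂ) : polyD p (D.laplace ψ k) z = D.laplace (fun ε => p.eval ((k : ℂ) + ε) * ψ ε) k z := by
  have hp : ∀ p : ℂ[X], ContinuousOn (fun ε => p.eval ((k : ℂ) + ε) * ψ ε)
      (Metric.sphere D.c (1 / 2)) := fun p => by
    refine ContinuousOn.mul (Continuous.continuousOn ?_) hψ
    exact p.continuous.comp (by fun_prop)
  induction p using Polynomial.induction_on' generalizing z with
  | add p q ihp ihq =>
    rw [polyD_add, ihp, ihq, ← D.laplace_add (hp p) (hp q)]
    exact D.laplace_congr (fun ε _ => by rw [eval_add]; ring) k z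
  | monomial j b =>
    rw [polyD_monomial]
    have h : ∀ z, iteratedDeriv j (D.laplace ψ k) z =
        D.laplace (fun ε => ((k : ℂ) + ε) ^ j * ψ ε) k z := by
      induction j with
      | zero => intro z; simp
      | succ j ih =>
        intro z
        rw [iteratedDeriv_succ, funext ih]
        have hj := hp (X ^ j)
        simp only [eval_pow, eval_X] at hj
        rw [(D.hasDerivAt_laplace hj k z).deriv]
        exact D.laplace_congr (fun ε _ => by ring) k z
    rw [h, ← D.laplace_const_mul]
    exact D.laplace_congr (fun ε _ => by rw [eval_monomial]; ring) k z

lemma laplace_succ (ψ : ℂ → ℂ) (k : ℕ) (z : ℂ) :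
    D.laplace ψ (k + 1) z = Complex.exp z * D.laplace ψ k z := by
  unfold laplace
  rw [← circleIntegral.integral_const_mul]
  congr 1
  funext ε
  rw [show (((k + 1 : ℕ) : ℂ) + ε) * z = ((k : ℂ) + ε) * z + z by push_cast; ring, Complex.exp_add]
  ring

/-- Since e^(2πik) = 1, translation by 2πi multiplies the weight by e^(2πiε), independently of k; so
it acts on the whole series through its weight. -/
lemma laplace_add_two_pi_mul_I (ψ : ℂ → ℂ) (k : ℕ) (z : ℂ) :
    D.laplace ψ k (z + 2 * Real.pi * Complex.I) =
      D.laplace (fun ε => Complex.exp (2 * Real.pi * Complex.I * ε) * ψ ε) k z := by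
  unfold laplace
  congr 1
  funext ε
  rw [show ((k : ℂ) + ε) * (z + 2 * Real.pi * Complex.I) =
    2 * Real.pi * Complex.I * ε + ((k : ℂ) + ε) * z + k * (2 * Real.pi * Complex.I) by ring,
    Complex.exp_add, Complex.exp_nat_mul_two_pi_mul_I, Complex.exp_add]
  ring

/-- The `k`-th term of the Frobenius series with weight `φ`. -/
noncomputable def term (φ : ℂ → ℂ) (k : ℕ) (z : ℂ) : ℂ := D.laplace (fun ε => φ ε * D.G k ε) k z

/-- The Frobenius series with weight `φ`. -/
noncomputable def series (φ : ℂ → ℂ) (z : ℂ) : ℂ := ∑' k, D.term φ k z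

lemma continuousOn_mul_G {φ : ℂ → ℂ} (hφ : ContinuousOn φ (Metric.sphere D.c (1 / 2))) (k : ℕ) :
    ContinuousOn (fun ε => φ ε * D.G k ε) (Metric.sphere D.c (1 / 2)) :=
  hφ.mul ((D.differentiableOn_G k).continuousOn.mono Metric.sphere_subset_closedBall)

lemma norm_term_le {φ : ℂ → ℂ} {A : ℝ} (hA0 : 0 ≤ A)
    (hA : ∀ ε ∈ Metric.sphere D.c (1 / 2), ‖φ ε‖ ≤ A) {M : ℕ → ℝ} (hM : ∀ k, 0 < M k)
    (hG : ∀ k, ∀ ε ∈ Metric.closedBall D.c (1 / 2), ‖D.G k ε‖ ≤ M k) (k : ℕ) {z : ℂ} {x Z : ℝ}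
    (hx : z.re ≤ x) (hZ : ‖z‖ ≤ Z) :
    ‖D.term φ k z‖ ≤ 2 * Real.pi * (1 / 2) * A * Real.exp ((‖D.c‖ + 1 / 2) * Z) *
      (M k * Real.exp (k * x)) := by
  have h := circleIntegral.norm_integral_le_of_norm_le_const (c := D.c) (R := 1 / 2)
    (f := fun ε => φ ε * D.G k ε * Complex.exp (((k : ℂ) + ε) * z))
    (C := A * M k * (Real.exp (k * x) * Real.exp ((‖D.c‖ + 1 / 2) * Z))) (by norm_num)
    (fun ε hε => by
      have h1 := hA ε hε
      have h2 := hG k ε (Metric.sphere_subset_closedBall hε)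
      have h3 : ‖Complex.exp (((k : ℂ) + ε) * z)‖ ≤
          Real.exp (k * x) * Real.exp ((‖D.c‖ + 1 / 2) * Z) := by
        rw [add_mul, Complex.exp_add, norm_mul]
        have h4 : ‖Complex.exp ((k : ℂ) * z)‖ ≤ Real.exp (k * x) := by
          rw [Complex.norm_exp]
          refine Real.exp_le_exp.mpr ?_
          simp only [Complex.mul_re, Complex.natCast_re, Complex.natCast_im, zero_mul, sub_zero]
          gcongr
        have h5 : ‖Complex.exp (ε * z)‖ ≤ Real.exp ((‖D.c‖ + 1 / 2) * Z) := by
          refine (Complex.norm_exp_le_exp_norm _).trans (Real.exp_le_exp.mpr ?_)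
          rw [norm_mul]
          have h6 : ‖ε‖ ≤ ‖D.c‖ + 1 / 2 := by
            have h7 := norm_add_le (ε - D.c) D.c
            rw [sub_add_cancel, mem_sphere_iff_norm.mp hε] at h7
            linarith
          gcongr
        gcongr
      rw [norm_mul, norm_mul]
      have := (hM k).le
      gcongr)
  refine h.trans (le_of_eq ?_)
  ring

/-- The half plane `Re z < 0`. -/
def halfPlane : Set ℂ := {z | z.re < 0}

lemma isOpen_halfPlane : IsOpen halfPlane := isOpen_lt Complex.continuous_re continuous_const

lemma exists_local_bound {φ : ℂ → ℂ} (hφ : ContinuousOn φ (Metric.sphere D.c (1 / 2))) {z : ℂ}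
    (hz : z ∈ halfPlane) : ∃ u : ℕ → ℝ, Summable u ∧ ∃ V ∈ 𝓝 z, IsOpen V ∧ V ⊆ halfPlane ∧
      ∀ k, ∀ w ∈ V, ‖D.term φ k w‖ ≤ u k := by
  obtain ⟨M, hM, hlim, hG⟩ := D.exists_majorant
  obtain ⟨A, hA⟩ := (isCompact_sphere D.c (1 / 2)).exists_bound_of_continuousOn hφ
  have hA0 : 0 ≤ A := (norm_nonneg _).trans (hA _ (circleMap_mem_sphere D.c (by norm_num) 0))
  have hz' : z.re < 0 := hz
  refine ⟨_, (summable_majorant hM hlim (x := z.re / 2) (by linarith)).mul_left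
    (2 * Real.pi * (1 / 2) * A * Real.exp ((‖D.c‖ + 1 / 2) * (‖z‖ + 1))),
    {w | w.re < z.re / 2} ∩ Metric.ball z 1, ?_, ?_, ?_, ?_⟩
  · refine Filter.inter_mem ((isOpen_lt Complex.continuous_re continuous_const).mem_nhds ?_)
      (Metric.ball_mem_nhds z one_pos)
    change z.re < z.re / 2
    linarith
  · exact (isOpen_lt Complex.continuous_re continuous_const).inter Metric.isOpen_ball
  · intro w hw
    have : w.re < z.re / 2 := hw.1
    change w.re < 0
    linarith
  · intro k w hw
    refine D.norm_term_le hA0 hA hM hG k (le_of_lt hw.1) ?_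
    have h1 := norm_add_le (w - z) z
    rw [sub_add_cancel] at h1
    have h2 := mem_ball_iff_norm.mp hw.2
    linarith

lemma hasSum_term {φ : ℂ → ℂ} (hφ : ContinuousOn φ (Metric.sphere D.c (1 / 2))) {z : ℂ}
    (hz : z ∈ halfPlane) : HasSum (fun k => D.term φ k z) (D.series φ z) := by
  obtain ⟨u, hu, V, hV, -, -, hb⟩ := D.exists_local_bound hφ hz
  exact (Summable.of_norm_bounded hu fun k => hb k z (mem_of_mem_nhds hV)).hasSum

lemma tendstoLocallyUniformlyOn_series {φ : ℂ → ℂ} (hφ : ContinuousOn φ (Metric.sphere D.c (1 / 2))) :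
    TendstoLocallyUniformlyOn (fun N z => ∑ k ∈ Finset.range N, D.term φ k z) (D.series φ) atTop
      halfPlane := by
  rw [tendstoLocallyUniformlyOn_iff_forall_isCompact isOpen_halfPlane]
  intro K hK hKc
  rw [← tendstoLocallyUniformlyOn_iff_tendstoUniformlyOn_of_compact hKc]
  intro s hs z hz
  obtain ⟨u, hu, V, hV, -, -, hb⟩ := D.exists_local_bound hφ (hK hz)
  exact ⟨V, mem_nhdsWithin_of_mem_nhds hV, (tendstoUniformlyOn_tsum_nat hu hb) s hs⟩

lemma differentiable_term {φ : ℂ → ℂ} (hφ : ContinuousOn φ (Metric.sphere D.c (1 / 2))) (k : ℕ) :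
    Differentiable ℂ (D.term φ k) := D.differentiable_laplace (D.continuousOn_mul_G hφ k) k

lemma analyticOnNhd_series {φ : ℂ → ℂ} (hφ : ContinuousOn φ (Metric.sphere D.c (1 / 2))) :
    AnalyticOnNhd ℂ (D.series φ) halfPlane := by
  have h := (D.tendstoLocallyUniformlyOn_series hφ).differentiableOn
    (Eventually.of_forall fun N => ?_) isOpen_halfPlane
  · exact h.analyticOnNhd isOpen_halfPlane
  · exact (Differentiable.fun_sum fun k _ => D.differentiable_term hφ k).differentiableOn

/-- Locally uniform convergence of holomorphic functions is inherited by all derivatives. -/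
lemma tendsto_polyD_series {φ : ℂ → ℂ} (hφ : ContinuousOn φ (Metric.sphere D.c (1 / 2))) (p : ℂ[X])
    {z : ℂ} (hz : z ∈ halfPlane) :
    Tendsto (fun N => polyD p (fun z => ∑ k ∈ Finset.range N, D.term φ k z) z) atTop
      (𝓝 (polyD p (D.series φ) z)) := by
  have hd : ∀ j N, Differentiable ℂ
      (iteratedDeriv j (fun z => ∑ k ∈ Finset.range N, D.term φ k z)) := by
    intro j N z
    refine (analyticAt_iteratedDeriv ?_ j).differentiableAt
    exact (Differentiable.fun_sum fun k _ => D.differentiable_term hφ k).analyticAt z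
  have h : ∀ j, TendstoLocallyUniformlyOn
      (fun N => iteratedDeriv j (fun z => ∑ k ∈ Finset.range N, D.term φ k z))
      (iteratedDeriv j (D.series φ)) atTop halfPlane := by
    intro j
    induction j with
    | zero => simpa using D.tendstoLocallyUniformlyOn_series hφ
    | succ j ih =>
      have := ih.deriv (Eventually.of_forall fun N => (hd j N).differentiableOn) isOpen_halfPlane
      simp only [iteratedDeriv_succ]
      exact this
  unfold polyD Polynomial.sum
  exact tendsto_finsetSum _ fun j _ => ((h j).tendsto_at hz).const_mul _

end FrobeniusData

end Frobenius

/-! ### Frobenius series as solutions, and polynomials in the translation -/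

section FrobeniusSolutions
open Polynomial

namespace FrobeniusData

variable {n : ℕ} (D : FrobeniusData n)

lemma diffContOnCl_of_closedBall {f : ℂ → ℂ} {c : ℂ} {ρ : ℝ} (hρ : ρ ≠ 0)
    (hf : DifferentiableOn ℂ f (Metric.closedBall c ρ)) : DiffContOnCl ℂ f (Metric.ball c ρ) :=
  DifferentiableOn.diffContOnCl (by rwa [closure_ball c hρ])

lemma mul_G_succ (k : ℕ) {ε : ℂ} (hε : ε ∈ Metric.closedBall D.c (1 / 2)) :
    D.P.eval (((k + 1 : ℕ) : ℂ) + ε) * D.G (k + 1) ε =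
      D.κ * (D.R.eval ((k : ℂ) + ε) * D.G k ε) := by
  have h : (∏ i, ((k : ℂ) + 1 + ε - D.r i)) ≠ 0 :=
    Finset.prod_ne_zero_iff.mpr fun i _ => D.denom_ne_zero k hε i
  rw [eval_P, eval_R, G, Finset.prod_div_distrib]
  push_cast
  field_simp

/-- The recursion P(k+1+ε) G_(k+1) = κ R(k+ε) G_k under the integral sign; raising the exponent by
one contributes e^z. -/
lemma polyD_term_succ {φ : ℂ → ℂ} (hφ : ContinuousOn φ (Metric.sphere D.c (1 / 2))) (k : ℕ) (z : ℂ) :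
    polyD D.P (D.term φ (k + 1)) z = D.κ * Complex.exp z * polyD D.R (D.term φ k) z := by
  unfold term
  rw [D.polyD_laplace (D.continuousOn_mul_G hφ _), D.polyD_laplace (D.continuousOn_mul_G hφ _),
    laplace_succ, mul_comm D.κ, mul_assoc, ← D.laplace_const_mul D.κ]
  congr 1
  refine D.laplace_congr (fun ε hε => ?_) k z
  have := D.mul_G_succ k (Metric.sphere_subset_closedBall hε)
  linear_combination φ ε * this

lemma laplace_eq_zero {ψ : ℂ → ℂ} (hψ : DifferentiableOn ℂ ψ (Metric.closedBall D.c (1 / 2))) (k : ℕ)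
    (z : ℂ) : D.laplace ψ k z = 0 := by
  refine DiffContOnCl.circleIntegral_eq_zero (by norm_num)
    (diffContOnCl_of_closedBall (by norm_num) (hψ.mul ?_))
  exact Differentiable.differentiableOn (by fun_prop)

/-- P(D) multiplies the weight by P(ε); if the product is entire, its contour integral vanishes by
Cauchy. -/
lemma polyD_term_zero {φ f : ℂ → ℂ} (hφ : ContinuousOn φ (Metric.sphere D.c (1 / 2)))
    (hf : Differentiable ℂ f) (h : ∀ ε ∈ Metric.sphere D.c (1 / 2), D.P.eval ε * φ ε = f ε) (z : ℂ) :
    polyD D.P (D.term φ 0) z = 0 := by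
  unfold term
  rw [D.polyD_laplace (D.continuousOn_mul_G hφ _), ← D.laplace_eq_zero hf.differentiableOn 0 z]
  refine D.laplace_congr (fun ε hε => ?_) 0 z
  rw [← h ε hε, G]
  simp

lemma polyD_sum_term {φ : ℂ → ℂ} (hφ : ContinuousOn φ (Metric.sphere D.c (1 / 2))) (p : ℂ[X]) (N : ℕ)
    (z : ℂ) : polyD p (fun z => ∑ k ∈ Finset.range N, D.term φ k z) z =
      ∑ k ∈ Finset.range N, polyD p (D.term φ k) z := by
  have := polyD_fun_sum (Finset.range N) (f := D.term φ)
    (fun k _ => (D.differentiable_term hφ k).analyticAt z) (fun _ => 1) p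
  simpa only [one_mul] using this

/-- The terms telescope: P(D) kills the first term and maps every later one to κ e^z R(D) of its
predecessor. On partial sums this relates N + 1 terms on the left to N terms on the right. -/
lemma isExpODESolution_series {φ f : ℂ → ℂ} (hφ : ContinuousOn φ (Metric.sphere D.c (1 / 2)))
    (hf : Differentiable ℂ f) (h : ∀ ε ∈ Metric.sphere D.c (1 / 2), D.P.eval ε * φ ε = f ε) :
    IsExpODESolution D.P D.R D.κ halfPlane (D.series φ) := by
  refine ⟨D.analyticOnNhd_series hφ, fun z hz => ?_⟩
  refine tendsto_nhds_unique ((D.tendsto_polyD_series hφ D.P hz).comp (tendsto_add_atTop_nat 1)) ?_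
  refine ((D.tendsto_polyD_series hφ D.R hz).const_mul (D.κ * Complex.exp z)).congr fun N => ?_
  rw [Function.comp_apply, D.polyD_sum_term hφ, D.polyD_sum_term hφ, Finset.sum_range_succ',
    D.polyD_term_zero hφ hf h, add_zero, Finset.mul_sum]
  exact Finset.sum_congr rfl fun k _ => (D.polyD_term_succ hφ k z).symm

lemma series_congr {φ ψ : ℂ → ℂ} (h : ∀ ε ∈ Metric.sphere D.c (1 / 2), φ ε = ψ ε) (z : ℂ) :
    D.series φ z = D.series ψ z :=
  tsum_congr fun k => D.laplace_congr (fun ε hε => by rw [h ε hε]) k z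

lemma series_add {φ ψ : ℂ → ℂ} (hφ : ContinuousOn φ (Metric.sphere D.c (1 / 2)))
    (hψ : ContinuousOn ψ (Metric.sphere D.c (1 / 2))) {z : ℂ} (hz : z ∈ halfPlane) :
    D.series (fun ε => φ ε + ψ ε) z = D.series φ z + D.series ψ z := by
  refine (D.hasSum_term (hφ.add hψ) hz).unique ?_
  refine ((D.hasSum_term hφ hz).add (D.hasSum_term hψ hz)).congr_fun fun k => ?_
  rw [term, term, term, ← D.laplace_add (D.continuousOn_mul_G hφ k) (D.continuousOn_mul_G hψ k)]
  simp only [Pi.add_apply, add_mul]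

lemma series_const_mul (b : ℂ) (φ : ℂ → ℂ) (z : ℂ) :
    D.series (fun ε => b * φ ε) z = b * D.series φ z := by
  unfold series
  rw [← tsum_mul_left]
  refine tsum_congr fun k => ?_
  unfold term
  rw [← D.laplace_const_mul]
  simp only [mul_assoc]

lemma series_add_two_pi_mul_I_mul (φ : ℂ → ℂ) (j : ℕ) (z : ℂ) :
    D.series φ (z + 2 * Real.pi * Complex.I * j) =
      D.series (fun ε => Complex.exp (2 * Real.pi * Complex.I * ε) ^ j * φ ε) z := by
  induction j generalizing z φ with
  | zero => simp
  | succ j ih =>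
    have h : D.series φ (z + 2 * Real.pi * Complex.I * j + 2 * Real.pi * Complex.I) =
        D.series (fun ε => Complex.exp (2 * Real.pi * Complex.I * ε) * φ ε)
          (z + 2 * Real.pi * Complex.I * j) :=
      tsum_congr fun k => by
        unfold term
        rw [laplace_add_two_pi_mul_I]
        simp only [mul_assoc]
    rw [Nat.cast_succ, mul_add, mul_one, ← add_assoc, h, ih]
    simp only [pow_succ, mul_assoc]

end FrobeniusData

/-- The operator `q(T)`, where `T` is the translation by `2πi`. -/
noncomputable def shiftSum (q : ℂ[X]) (g : ℂ → ℂ) (z : ℂ) : ℂ :=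
  q.sum fun j b => b * g (z + 2 * Real.pi * Complex.I * j)

lemma shiftSum_add (p q : ℂ[X]) (g : ℂ → ℂ) (z : ℂ) :
    shiftSum (p + q) g z = shiftSum p g z + shiftSum q g z :=
  Polynomial.sum_add_index p q _ (fun _ => zero_mul _) fun _ _ _ => add_mul _ _ _

lemma shiftSum_monomial (j : ℕ) (b : ℂ) (g : ℂ → ℂ) (z : ℂ) :
    shiftSum (monomial j b) g z = b * g (z + 2 * Real.pi * Complex.I * j) :=
  Polynomial.sum_monomial_index b _ (zero_mul _)

lemma shiftSum_eq_sum_range {n : ℕ} {q : ℂ[X]} (hq : q.natDegree < n) (g : ℂ → ℂ) (z : ℂ) :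
    shiftSum q g z = ∑ j ∈ Finset.range n, q.coeff j * g (z + 2 * Real.pi * Complex.I * j) :=
  Polynomial.sum_over_range' _ (fun _ => zero_mul _) _ hq

namespace FrobeniusData

variable {n : ℕ} (D : FrobeniusData n)

lemma continuousOn_eval_exp_mul (q : ℂ[X]) {φ : ℂ → ℂ}
    (hφ : ContinuousOn φ (Metric.sphere D.c (1 / 2))) :
    ContinuousOn (fun ε => q.eval (Complex.exp (2 * Real.pi * Complex.I * ε)) * φ ε)
      (Metric.sphere D.c (1 / 2)) :=
  (Continuous.continuousOn (q.continuous.comp (by fun_prop))).mul hφ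

lemma shiftSum_series (q : ℂ[X]) {φ : ℂ → ℂ} (hφ : ContinuousOn φ (Metric.sphere D.c (1 / 2))) {z : ℂ}
    (hz : z ∈ halfPlane) : shiftSum q (D.series φ) z =
      D.series (fun ε => q.eval (Complex.exp (2 * Real.pi * Complex.I * ε)) * φ ε) z := by
  induction q using Polynomial.induction_on' with
  | add p q hp hq =>
    rw [shiftSum_add, hp, hq, ← D.series_add (D.continuousOn_eval_exp_mul p hφ)
      (D.continuousOn_eval_exp_mul q hφ) hz]
    simp only [eval_add, add_mul]
  | monomial j b =>
    rw [shiftSum_monomial, series_add_two_pi_mul_I_mul, ← D.series_const_mul]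
    simp only [eval_monomial, mul_assoc]

lemma series_eq_zero {φ : ℂ → ℂ} (hφ : Differentiable ℂ φ) (z : ℂ) : D.series φ z = 0 := by
  refine (tsum_congr fun k => ?_).trans tsum_zero
  exact D.laplace_eq_zero (hφ.differentiableOn.mul (D.differentiableOn_G k)) k z

lemma r_mem_ball (i : Fin n) : D.r i ∈ Metric.ball D.c (1 / 2) := by
  rw [mem_ball_iff_norm]; exact D.norm_r i

lemma sub_r_ne_zero {ε : ℂ} (hε : ε ∈ Metric.sphere D.c (1 / 2)) (i : Fin n) : ε - D.r i ≠ 0 := by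
  intro h
  rw [sub_eq_zero] at h
  have h1 := D.norm_r i
  rw [← h, mem_sphere_iff_norm.mp hε] at h1
  exact lt_irrefl _ h1

lemma term_div_sub {h : ℂ → ℂ} (hh : Differentiable ℂ h) (i : Fin n) (k : ℕ) (z : ℂ) :
    D.term (fun ε => h ε / (ε - D.r i)) k z =
      2 * Real.pi * Complex.I * (h (D.r i) * D.G k (D.r i) * Complex.exp ((k + D.r i) * z)) := by
  have hd : DifferentiableOn ℂ (fun ε => h ε * D.G k ε * Complex.exp (((k : ℂ) + ε) * z))
      (Metric.closedBall D.c (1 / 2)) :=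
    (hh.differentiableOn.mul (D.differentiableOn_G k)).mul
      (Differentiable.differentiableOn (by fun_prop))
  have := (diffContOnCl_of_closedBall (by norm_num) hd).circleIntegral_sub_inv_smul
    (D.r_mem_ball i)
  rw [smul_eq_mul] at this
  rw [← this]
  unfold term laplace
  congr 1
  funext ε
  rw [smul_eq_mul]
  ring

/-- By Cauchy's formula the series equals 2πi h(r_i) e^(r_i z) ∑ G_k(r_i) e^(kz). As z → -∞ the sum
tends to G_0 = 1, so the vanishing must come from h(r_i). -/
lemma eval_eq_zero_of_series_div_sub {h : ℂ → ℂ} (hh : Differentiable ℂ h) (i : Fin n)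
    (h0 : ∀ z ∈ halfPlane, D.series (fun ε => h ε / (ε - D.r i)) z = 0) : h (D.r i) = 0 := by
  by_contra hne
  obtain ⟨M, hM, hlim, hG⟩ := D.exists_majorant
  -- The limit is taken along z = -(m+1), with the value of the majorant series at z = -1 as
  -- domination.
  have hsum : Tendsto (fun m : ℕ => ∑' k : ℕ, D.G k (D.r i) *
      Complex.exp ((k : ℂ) * ((-(m + 1 : ℝ) : ℝ) : ℂ))) atTop
      (𝓝 (∑' k : ℕ, if k = 0 then (1 : ℂ) else 0)) := by
    refine tendsto_tsum_of_dominated_convergence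
      (summable_majorant hM hlim (x := -1) (by norm_num)) (fun k => ?_)
      (Eventually.of_forall fun m k => ?_)
    · rcases k with _ | k
      · simp [G]
      · rw [if_neg (Nat.succ_ne_zero k), ← mul_zero (D.G (k + 1) (D.r i))]
        refine Tendsto.const_mul _ ?_
        rw [tendsto_zero_iff_norm_tendsto_zero]
        simp only [Complex.norm_exp]
        refine Real.tendsto_exp_atBot.comp ?_
        have h1 : Tendsto (fun m : ℕ => (m : ℝ) + 1) atTop atTop :=
          tendsto_atTop_add_const_right _ _ tendsto_natCast_atTop_atTop
        have h2 := (h1.const_mul_atTop (by positivity : (0 : ℝ) < (k : ℝ) + 1))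
        refine (tendsto_neg_atTop_atBot.comp h2).congr fun m => ?_
        rw [← Complex.ofReal_natCast, ← Complex.ofReal_mul, Complex.ofReal_re]
        simp
        ring
    · rw [norm_mul, ← Complex.ofReal_natCast, ← Complex.ofReal_mul, Complex.norm_exp_ofReal]
      have h1 := hG k _ (Metric.ball_subset_closedBall (D.r_mem_ball i))
      have h2 := (hM k).le
      have : (0 : ℝ) ≤ m := m.cast_nonneg
      gcongr
      linarith
  rw [tsum_ite_eq] at hsum
  have hz : ∀ m : ℕ, ∑' k : ℕ, D.G k (D.r i) * Complex.exp ((k : ℂ) * ((-(m + 1 : ℝ) : ℝ) : ℂ)) =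
      0 := by
    intro m
    have hm : ((-(m + 1 : ℝ) : ℝ) : ℂ) ∈ halfPlane := by
      change Complex.re _ < 0
      rw [Complex.ofReal_re]
      have : (0 : ℝ) ≤ m := m.cast_nonneg
      linarith
    have h1 := h0 _ hm
    unfold series at h1
    simp only [D.term_div_sub hh] at h1
    have h2 : ∀ k : ℕ, 2 * Real.pi * Complex.I * (h (D.r i) * D.G k (D.r i) *
        Complex.exp ((k + D.r i) * ((-(m + 1 : ℝ) : ℝ) : ℂ))) =
        (2 * Real.pi * Complex.I * h (D.r i) * Complex.exp (D.r i * ((-(m + 1 : ℝ) : ℝ) : ℂ))) *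
        (D.G k (D.r i) * Complex.exp ((k : ℂ) * ((-(m + 1 : ℝ) : ℝ) : ℂ))) := by
      intro k
      rw [add_mul, Complex.exp_add]
      ring
    simp only [h2] at h1
    rw [tsum_mul_left] at h1
    refine (mul_eq_zero.mp h1).resolve_left ?_
    simp [hne, Real.pi_ne_zero, Complex.exp_ne_zero]
  simp only [hz] at hsum
  exact zero_ne_one (tendsto_nhds_unique tendsto_const_nhds hsum)

end FrobeniusData

end FrobeniusSolutions

/-! ### The translates of the Frobenius solution span all solutions -/

section FrobeniusBasis
open Polynomial

namespace FrobeniusData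

variable {n : ℕ} (D : FrobeniusData n)

/-- The monodromy eigenvalues `e^{2πi r_i}`. -/
noncomputable def eigenvalue (i : Fin n) : ℂ := Complex.exp (2 * Real.pi * Complex.I * D.r i)

/-- The characteristic polynomial of the translation by `2πi`. -/
noncomputable def χ : ℂ[X] := ∏ i, (X - C (D.eigenvalue i))

lemma monic_χ : D.χ.Monic := monic_prod_of_monic _ _ fun _ _ => monic_X_sub_C _

lemma natDegree_χ : D.χ.natDegree = n := by
  rw [χ, natDegree_prod_of_monic _ _ fun _ _ => monic_X_sub_C _]; simp

/-- The entire function `(e^{2πiε} - e^{2πi r_i}) / (ε - r_i)`. -/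
noncomputable def quot (i : Fin n) : ℂ → ℂ :=
  dslope (fun ε => Complex.exp (2 * Real.pi * Complex.I * ε)) (D.r i)

lemma hasDerivAt_exp_two_pi (ε : ℂ) :
    HasDerivAt (fun ε => Complex.exp (2 * Real.pi * Complex.I * ε))
      (Complex.exp (2 * Real.pi * Complex.I * ε) * (2 * Real.pi * Complex.I)) ε := by
  have := ((hasDerivAt_id' ε).const_mul (2 * Real.pi * Complex.I)).cexp
  simpa using this

lemma differentiable_quot (i : Fin n) : Differentiable ℂ (D.quot i) := by
  rw [← differentiableOn_univ]
  refine (Complex.differentiableOn_dslope univ_mem).mpr ?_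
  exact fun ε _ => (hasDerivAt_exp_two_pi ε).differentiableAt.differentiableWithinAt

lemma sub_mul_quot (i : Fin n) (ε : ℂ) :
    (ε - D.r i) * D.quot i ε = Complex.exp (2 * Real.pi * Complex.I * ε) - D.eigenvalue i :=
  sub_smul_dslope (fun ε => Complex.exp (2 * Real.pi * Complex.I * ε)) (D.r i) ε

/-- The eigenvalues of r_i and r_j coincide only if r_j - r_i is an integer, and |r_j - r_i| < 1
then makes the exponents equal; in that case the value is the derivative of e^(2πiε), which is
non-zero. -/
lemma quot_ne_zero (i j : Fin n) : D.quot i (D.r j) ≠ 0 := by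
  by_cases h : D.r j = D.r i
  · rw [h, quot, dslope_same, (hasDerivAt_exp_two_pi _).deriv]
    simp [Real.pi_ne_zero, Complex.exp_ne_zero]
  · intro h0
    have h1 := D.sub_mul_quot i (D.r j)
    rw [h0, mul_zero, eq_comm, sub_eq_zero, eigenvalue, Complex.exp_eq_exp_iff_exists_int] at h1
    obtain ⟨m, hm⟩ := h1
    have hpi := Complex.two_pi_I_ne_zero
    have h2 : D.r j - D.r i = m := by
      apply mul_left_cancel₀ hpi
      linear_combination hm
    have h3 := D.norm_sub_lt (Metric.ball_subset_closedBall (D.r_mem_ball j)) i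
    rw [h2, Complex.norm_intCast] at h3
    have h4 : m = 0 := by
      rw [← Int.abs_lt_one_iff]
      exact_mod_cast h3
    rw [h4, Int.cast_zero, sub_eq_zero] at h2
    exact h h2

/-- The Frobenius solution. -/
noncomputable def sol : ℂ → ℂ := D.series fun ε => (D.P.eval ε)⁻¹

lemma eval_P_ne_zero {ε : ℂ} (hε : ε ∈ Metric.sphere D.c (1 / 2)) : D.P.eval ε ≠ 0 := by
  rw [eval_P]
  exact Finset.prod_ne_zero_iff.mpr fun i _ => D.sub_r_ne_zero hε i

lemma continuousOn_inv_P : ContinuousOn (fun ε => (D.P.eval ε)⁻¹) (Metric.sphere D.c (1 / 2)) :=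
  ContinuousOn.inv₀ D.P.continuous.continuousOn fun _ hε => D.eval_P_ne_zero hε

lemma shiftSum_sol (q : ℂ[X]) {z : ℂ} (hz : z ∈ halfPlane) : shiftSum q D.sol z =
    D.series (fun ε => q.eval (Complex.exp (2 * Real.pi * Complex.I * ε)) * (D.P.eval ε)⁻¹) z :=
  D.shiftSum_series q D.continuousOn_inv_P hz

lemma isExpODESolution_shift (j : ℕ) : IsExpODESolution D.P D.R D.κ halfPlane
    (fun z => D.sol (z + 2 * Real.pi * Complex.I * j)) := by
  have h : (fun z => D.sol (z + 2 * Real.pi * Complex.I * j)) =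
      D.series (fun ε => Complex.exp (2 * Real.pi * Complex.I * ε) ^ j * (D.P.eval ε)⁻¹) :=
    funext fun z => D.series_add_two_pi_mul_I_mul _ j z
  rw [h]
  refine D.isExpODESolution_series (f := fun ε => Complex.exp (2 * Real.pi * Complex.I * ε) ^ j)
    ?_ (by fun_prop) fun ε hε => ?_
  · exact (Continuous.continuousOn (by fun_prop)).mul D.continuousOn_inv_P
  · have := D.eval_P_ne_zero hε
    field_simp

lemma eval_χ_mul_inv_P {ε : ℂ} (hε : ε ∈ Metric.sphere D.c (1 / 2)) :
    D.χ.eval (Complex.exp (2 * Real.pi * Complex.I * ε)) * (D.P.eval ε)⁻¹ = ∏ i, D.quot i ε := by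
  rw [eval_P, χ, eval_prod, ← Finset.prod_inv_distrib, ← Finset.prod_mul_distrib]
  refine Finset.prod_congr rfl fun i _ => ?_
  have := D.sub_r_ne_zero hε i
  rw [eval_sub, eval_X, eval_C, ← D.sub_mul_quot]
  field_simp

/-- The zeros of χ(e^(2πiε)) cancel those of P(ε), with multiplicity, so the weight is entire and
the contour integrals vanish. -/
lemma shiftSum_mul_χ_sol (q : ℂ[X]) {z : ℂ} (hz : z ∈ halfPlane) :
    shiftSum (q * D.χ) D.sol z = 0 := by
  rw [D.shiftSum_sol _ hz, D.series_congr (ψ := fun ε =>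
    q.eval (Complex.exp (2 * Real.pi * Complex.I * ε)) * ∏ i, D.quot i ε)]
  · refine D.series_eq_zero (Differentiable.fun_mul ?_ ?_) z
    · exact q.differentiable.comp fun ε => (hasDerivAt_exp_two_pi ε).differentiableAt
    · exact Differentiable.fun_finsetProd fun i _ => D.differentiable_quot i
  · intro ε hε
    rw [eval_mul, mul_assoc, D.eval_χ_mul_inv_P hε]

lemma add_two_pi_mem_halfPlane {z : ℂ} (hz : z ∈ halfPlane) (j : ℕ) :
    z + 2 * Real.pi * Complex.I * j ∈ halfPlane := by
  change Complex.re _ < 0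
  have : z.re < 0 := hz
  simpa using this

lemma shiftSum_mul_sol_eq_zero {q : ℂ[X]} (hq : ∀ z ∈ halfPlane, shiftSum q D.sol z = 0) (p : ℂ[X])
    {z : ℂ} (hz : z ∈ halfPlane) : shiftSum (p * q) D.sol z = 0 := by
  have h : shiftSum (p * q) D.sol z = shiftSum p (shiftSum q D.sol) z := by
    induction p using Polynomial.induction_on' with
    | add p r hp hr => rw [add_mul, shiftSum_add, shiftSum_add, hp, hr]
    | monomial j b =>
      rw [shiftSum_monomial, D.shiftSum_sol _ hz, D.shiftSum_sol _ (add_two_pi_mem_halfPlane hz j),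
        D.series_add_two_pi_mul_I_mul, ← D.series_const_mul]
      simp only [eval_mul, eval_monomial, mul_assoc]
  rw [h]
  refine Finset.sum_eq_zero fun j _ => ?_
  beta_reduce
  rw [hq _ (add_two_pi_mem_halfPlane hz j), mul_zero]

/-- The polynomials annihilating the solution form an ideal. If it contained q ≠ 0 of degree below
n, it would contain the proper divisor gcd(q, χ) of χ, hence χ/(X - λ_i) for some i. With this
polynomial the weight has a single simple pole, at r_i, with non-zero residue, contradicting
`eval_eq_zero_of_series_div_sub`. Coinciding exponents are allowed. -/
lemma shiftSum_sol_ne_zero {q : ℂ[X]} (hq0 : q ≠ 0) (hqn : q.natDegree < n) :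
    ¬ ∀ z ∈ halfPlane, shiftSum q D.sol z = 0 := by
  intro h0
  obtain ⟨g, hg⟩ : ∃ g, g = EuclideanDomain.gcd q D.χ := ⟨_, rfl⟩
  obtain ⟨k, hk⟩ : g ∣ D.χ := hg ▸ EuclideanDomain.gcd_dvd_right q D.χ
  have hbez := EuclideanDomain.gcd_eq_gcd_ab q D.χ
  rw [← hg] at hbez
  have hgq : g ∣ q := hg ▸ EuclideanDomain.gcd_dvd_left q D.χ
  have hχ0 := D.monic_χ.ne_zero
  have hk0 : k ≠ 0 := by rintro rfl; exact hχ0 (by rw [hk, mul_zero])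
  have hg0 : g ≠ 0 := by rintro rfl; exact hχ0 (by rw [hk, zero_mul])
  have hkdeg : 0 < k.natDegree := by
    have h1 := natDegree_le_of_dvd hgq hq0
    have h2 := D.natDegree_χ
    rw [hk, natDegree_mul hg0 hk0] at h2
    omega
  obtain ⟨l, hl⟩ := Complex.exists_root (natDegree_pos_iff_degree_pos.mp hkdeg)
  obtain ⟨m, hm⟩ := dvd_iff_isRoot.mpr hl
  have hroot : D.χ.IsRoot l := by rw [hk]; exact root_mul_left_of_isRoot g hl
  obtain ⟨i, hi⟩ : ∃ i, l = D.eigenvalue i := by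
    rw [IsRoot.def, χ, eval_prod, Finset.prod_eq_zero_iff] at hroot
    obtain ⟨i, -, hi⟩ := hroot
    exact ⟨i, by simpa [sub_eq_zero] using hi⟩
  have hgm : g * m = ∏ j ∈ Finset.univ.erase i, (X - C (D.eigenvalue j)) := by
    apply mul_left_cancel₀ (X_sub_C_ne_zero l)
    rw [hi, Finset.mul_prod_erase Finset.univ (fun j => X - C (D.eigenvalue j)) (Finset.mem_univ i)]
    change _ = D.χ
    rw [hk, hm, hi]
    ring
  have hz : ∀ z ∈ halfPlane, shiftSum (g * m) D.sol z = 0 := by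
    intro z hz
    -- Bézout, times the cofactor m.
    have h1 : g * m = (m * EuclideanDomain.gcdA q D.χ) * q + (m * EuclideanDomain.gcdB q D.χ) * D.χ := by
      rw [hbez]; ring
    rw [h1, shiftSum_add, D.shiftSum_mul_χ_sol _ hz, D.shiftSum_mul_sol_eq_zero h0 _ hz, add_zero]
  have hd : Differentiable ℂ (fun ε => ∏ j ∈ Finset.univ.erase i, D.quot j ε) :=
    Differentiable.fun_finsetProd fun j _ => D.differentiable_quot j
  have h2 := D.eval_eq_zero_of_series_div_sub hd i fun z hzz => by
    rw [← hz z hzz, D.shiftSum_sol _ hzz]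
    refine D.series_congr (fun ε hε => ?_) z
    have hi0 := D.sub_r_ne_zero hε i
    rw [hgm, eval_prod, eval_P, ← Finset.mul_prod_erase Finset.univ (fun j => ε - D.r j)
      (Finset.mem_univ i), mul_inv, ← Finset.prod_inv_distrib, div_eq_mul_inv, mul_comm (ε - D.r i)⁻¹,
      ← mul_assoc, ← Finset.prod_mul_distrib]
    congr 1
    refine Finset.prod_congr rfl fun j _ => ?_
    have := D.sub_r_ne_zero hε j
    rw [eval_sub, eval_X, eval_C, ← D.sub_mul_quot]
    field_simp
  rw [Finset.prod_eq_zero_iff] at h2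
  obtain ⟨j, -, hj⟩ := h2
  exact D.quot_ne_zero j i hj

lemma isPreconnected_halfPlane : IsPreconnected halfPlane :=
  (convex_halfSpace_re_lt 0).isPreconnected

/-- A solution near a point of the half plane extends to the half plane, and the extension is
annihilated by the characteristic polynomial of the translation by `2πi`. -/
lemma exists_extension {W : Set ℂ} (hW : IsOpen W) (hWc : IsConnected W) (hWH : W ⊆ halfPlane)
    {f : ℂ → ℂ} (hf : IsExpODESolution D.P D.R D.κ W f) :
    ∃ F : ℂ → ℂ, AnalyticOnNhd ℂ F halfPlane ∧ (∀ z ∈ W, F z = f z) ∧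
      ∀ z ∈ halfPlane, ∑ j ∈ Finset.range (n + 1),
        D.χ.coeff j * F (z + 2 * Real.pi * Complex.I * j) = 0 := by
  obtain ⟨z, hz⟩ := hWc.nonempty
  -- |κ e^z| < 1 in the half plane, so the leading coefficient 1 - κ e^z has no zero there.
  have hκ : D.κ * Complex.exp z ≠ 1 := by
    intro h
    have h1 := congrArg norm h
    rw [norm_mul, D.norm_κ, one_mul, Complex.norm_exp, norm_one, Real.exp_eq_one_iff] at h1
    have : z.re < 0 := hWH hz
    linarith
  have hsol : ∀ j : Fin n, IsExpODESolution D.P D.R D.κ halfPlane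
      (fun z => D.sol (z + 2 * Real.pi * Complex.I * (j : ℕ))) :=
    fun j => D.isExpODESolution_shift j
  -- The n translates of the Frobenius solution are independent on W: a relation spreads to the half
  -- plane by the identity theorem and is a polynomial of degree below n annihilating the solution.
  obtain ⟨c, hc⟩ := hf.exists_eq_sum (fun j => (hsol j).mono hWH) D.monic_P D.natDegree_P D.monic_R
    D.natDegree_R hW hWc.isPreconnected hz hκ fun c hc => by
      have hc' : ∀ y ∈ halfPlane, ∑ j : Fin n,
          c j * D.sol (y + 2 * Real.pi * Complex.I * (j : ℕ)) = 0 :=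
        (isExpODESolution_sum Finset.univ (fun j _ => hsol j) c).1
          |>.eqOn_zero_of_preconnected_of_eventuallyEq_zero isPreconnected_halfPlane (hWH hz)
          (Filter.eventually_of_mem (hW.mem_nhds hz) hc)
      by_contra hne
      obtain ⟨q, hq⟩ : ∃ q : ℂ[X], q = ∑ j : Fin n, monomial (j : ℕ) (c j) := ⟨_, rfl⟩
      have hcoeff : ∀ j : Fin n, q.coeff j = c j := by
        intro j
        rw [hq, finsetSum_coeff, Finset.sum_eq_single j]
        · simp
        · intro b _ hb
          rw [coeff_monomial, if_neg fun h => hb (Fin.ext h)]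
        · simp
      have hq0 : q ≠ 0 := by
        rintro h
        apply hne
        funext j
        rw [← hcoeff, h, coeff_zero, Pi.zero_apply]
      have hqn : q.natDegree < n := by
        rw [natDegree_lt_iff_degree_lt hq0, hq]
        simp only [← C_mul_X_pow_eq_monomial]
        exact degree_sum_fin_lt c
      refine D.shiftSum_sol_ne_zero hq0 hqn fun y hy => ?_
      rw [shiftSum_eq_sum_range hqn, Finset.sum_range, ← hc' y hy]
      exact Finset.sum_congr rfl fun j _ => by rw [hcoeff]
  refine ⟨fun y => ∑ j : Fin n, c j * D.sol (y + 2 * Real.pi * Complex.I * (j : ℕ)),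
    (isExpODESolution_sum Finset.univ (fun j _ => hsol j) c).1, fun y hy => (hc y hy).symm, ?_⟩
  intro y hy
  simp only [Finset.mul_sum]
  rw [Finset.sum_comm]
  refine Finset.sum_eq_zero fun j _ => ?_
  have h := D.shiftSum_mul_χ_sol 1 (add_two_pi_mem_halfPlane hy (j : ℕ))
  rw [one_mul, shiftSum_eq_sum_range (Nat.lt_succ_of_le D.natDegree_χ.le)] at h
  rw [← mul_zero (c j), ← h, Finset.mul_sum]
  refine Finset.sum_congr rfl fun k _ => ?_
  rw [add_right_comm]
  ring

end FrobeniusData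

end FrobeniusBasis

/-! ### Extension of solutions to Re z < 0 and to Re z > 0 -/

section HypergeometricExtension
open Polynomial

/-- The polynomial `∏ (X + ρ_i)`. -/
noncomputable def rhoPoly (n : ℕ) : ℂ[X] := ∏ i : Fin n, (X + C (rho n i : ℂ))

lemma monic_rhoPoly (n : ℕ) : (rhoPoly n).Monic :=
  monic_prod_of_monic _ _ fun _ _ => monic_X_add_C _

lemma natDegree_rhoPoly (n : ℕ) : (rhoPoly n).natDegree = n := by
  rw [rhoPoly, natDegree_prod_of_monic _ _ fun _ _ => monic_X_add_C _]; simp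

/-- The Frobenius data of the hypergeometric equation at `t = 0`. -/
noncomputable def zeroData (n : ℕ) : FrobeniusData n where
  r := 0
  a := fun i => -(rho n i : ℂ)
  κ := (-1) ^ n
  c := 0
  norm_κ := by simp
  norm_r := fun i => by simp

/-- The Frobenius data of the hypergeometric equation at `t = ∞`. -/
noncomputable def inftyData (n : ℕ) : FrobeniusData n where
  r := fun i => (rho n i : ℂ)
  a := 0
  κ := (-1) ^ n
  c := 1 / 2
  norm_κ := by simp
  norm_r := fun i => by
    have h : ((rho n i : ℂ) - 1 / 2) = ((rho n i - 1 / 2 : ℝ) : ℂ) := by push_cast; rfl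
    rw [h, Complex.norm_real, Real.norm_eq_abs, abs_lt]
    have h1 := rho_pos n i
    have h2 := rho_lt_one n i
    constructor <;> linarith

lemma zeroData_χ_coeff (n k : ℕ) (hk : k ∈ Finset.range (n + 1)) :
    (zeroData n).χ.coeff k = unipotentCoeff n k := by
  have h : (zeroData n).χ = ∑ k ∈ Finset.range (n + 1), algebraMap ℂ ℂ[X] (unipotentCoeff n k) * X ^ k := by
    rw [sum_unipotentCoeff]
    simp [FrobeniusData.χ, FrobeniusData.eigenvalue, zeroData]
  rw [h, finsetSum_coeff, Finset.sum_eq_single k]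
  · simp [algebraMap_eq]
  · intro b _ hb
    rw [algebraMap_eq, coeff_C_mul_X_pow, if_neg (Ne.symm hb)]
  · exact fun h => absurd hk h

lemma inftyData_eigenvalue (n : ℕ) (k : Fin n) : (inftyData n).eigenvalue k = (rhoExp n k)⁻¹ := by
  rw [FrobeniusData.eigenvalue, rhoExp, ← Complex.exp_neg, neg_neg]
  rfl

/-- The eigenvalues e^(2πiρ_k) are the n nontrivial (n+1)-st roots of unity. -/
lemma inftyData_χ (n : ℕ) : (inftyData n).χ = ∑ k ∈ Finset.range (n + 1), X ^ k := by
  have hdeg : (∑ k ∈ Finset.range (n + 1), (X : ℂ[X]) ^ k).natDegree = n ∧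
      (∑ k ∈ Finset.range (n + 1), (X : ℂ[X]) ^ k).Monic := by
    refine ⟨?_, Polynomial.Monic.geom_sum' (by simp) ?_ (Nat.succ_ne_zero n)⟩
    · refine natDegree_eq_of_le_of_coeff_ne_zero
        (natDegree_sum_le_of_forall_le _ _ fun k hk => ?_) ?_
      · rw [natDegree_X_pow]
        exact Nat.lt_succ_iff.mp (Finset.mem_range.mp hk)
      · rw [finsetSum_coeff, Finset.sum_eq_single n]
        · simp
        · intro b _ hb
          rw [coeff_X_pow, if_neg (Ne.symm hb)]
        · simp
    · simp
  symm
  refine eq_of_monic_of_dvd_of_natDegree_le ((inftyData n).monic_χ) hdeg.2 ?_ ?_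
  · refine Finset.prod_dvd_of_coprime (fun i _ j _ hij => ?_) fun i _ => ?_
    · refine isCoprime_X_sub_C_of_isUnit_sub (sub_ne_zero.mpr fun h => hij ?_).isUnit
      rw [inftyData_eigenvalue, inftyData_eigenvalue, inv_inj] at h
      exact rhoExp_eq_one_imp h
    · rw [dvd_iff_isRoot, IsRoot.def, inftyData_eigenvalue, eval_geom_sum]
      have h1 : (rhoExp n i)⁻¹ ≠ 1 := by
        rw [Ne, inv_eq_one]; exact rhoExp_ne_one n i
      rw [geom_sum_eq h1, inv_pow, rhoExp_pow]
      simp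
  · rw [hdeg.1, FrobeniusData.natDegree_χ]

lemma exists_extension_zero {n : ℕ} {W : Set ℂ} (hW : IsOpen W) (hWc : IsConnected W)
    (hWH : ∀ z ∈ W, z.re < 0) {f : ℂ → ℂ}
    (hf : IsExpODESolution (X ^ n) (rhoPoly n) ((-1) ^ n) W f) :
    ∃ F : ℂ → ℂ, AnalyticOnNhd ℂ F {z | z.re < 0} ∧ (∀ z ∈ W, F z = f z) ∧
      ∀ z : ℂ, z.re < 0 → ∑ j ∈ Finset.range (n + 1),
        unipotentCoeff n j * F (z + 2 * Real.pi * Complex.I * j) = 0 := by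
  have hP : (zeroData n).P = X ^ n := by simp [FrobeniusData.P, zeroData]
  have hR : (zeroData n).R = rhoPoly n := by simp [FrobeniusData.R, zeroData, rhoPoly]
  obtain ⟨F, h1, h2, h3⟩ := (zeroData n).exists_extension hW hWc hWH (f := f)
    (by rw [hP, hR]; exact hf)
  refine ⟨F, h1, h2, fun z hz => ?_⟩
  rw [← h3 z hz]
  exact Finset.sum_congr rfl fun j hj => by rw [zeroData_χ_coeff n j hj]

/-- The substitution z ↦ -z turns D into -D and e^z into e^(-z), so the two sides of the equation
exchange roles; the exponents at infinity become the ρ_i. -/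
lemma IsExpODESolution.comp_neg {n : ℕ} {W : Set ℂ} {f : ℂ → ℂ}
    (hf : IsExpODESolution (X ^ n) (rhoPoly n) ((-1) ^ n) W f) :
    IsExpODESolution (inftyData n).P (inftyData n).R ((-1) ^ n) (-W) (fun z => f (-z)) := by
  refine ⟨fun z hz => (hf.1 (-z) hz).fun_comp (f := fun z => -z) (by fun_prop), fun z hz => ?_⟩
  have hR : (inftyData n).R = X ^ n := by simp [FrobeniusData.R, inftyData]
  have hP : (inftyData n).P.comp (-X) = C ((-1) ^ n) * rhoPoly n := by
    rw [FrobeniusData.P, prod_comp, rhoPoly]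
    have : ∀ i : Fin n, (X - C ((inftyData n).r i)).comp (-X) = C (-1) * (X + C (rho n i : ℂ)) := by
      intro i
      simp [inftyData]
      ring
    simp only [this]
    rw [Finset.prod_mul_distrib]
    simp
  have hX : ((X : ℂ[X]) ^ n).comp (-X) = C ((-1) ^ n) * X ^ n := by
    rw [pow_comp, X_comp, neg_pow]; simp
  rw [polyD_comp_neg, hP, polyD_C_mul, hR, polyD_comp_neg, hX, polyD_C_mul, hf.2 (-z) hz]
  have hE : Complex.exp z * Complex.exp (-z) = 1 := by rw [← Complex.exp_add]; simp
  have h1 : ((-1 : ℂ) ^ n) * (-1) ^ n = 1 := by rw [← mul_pow]; simp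
  linear_combination (-((-1) ^ n * (-1) ^ n * (-1) ^ n) * polyD (rhoPoly n) f (-z)) * hE -
    ((-1) ^ n * polyD (rhoPoly n) f (-z)) * h1

lemma exists_extension_infty {n : ℕ} {W : Set ℂ} (hW : IsOpen W) (hWc : IsConnected W)
    (hWH : ∀ z ∈ W, 0 < z.re) {f : ℂ → ℂ}
    (hf : IsExpODESolution (X ^ n) (rhoPoly n) ((-1) ^ n) W f) :
    ∃ F : ℂ → ℂ, AnalyticOnNhd ℂ F {z | 0 < z.re} ∧ (∀ z ∈ W, F z = f z) ∧
      ∀ z : ℂ, 0 < z.re → ∑ j ∈ Finset.range (n + 1), F (z + 2 * Real.pi * Complex.I * j) = 0 := by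
  obtain ⟨F, h1, h2, h3⟩ := (inftyData n).exists_extension (W := -W) hW.neg
    (by rw [← Set.image_neg_eq_neg]; exact hWc.image _ continuous_neg.continuousOn)
    (fun z hz => by have := hWH _ hz; rw [Complex.neg_re] at this; change z.re < 0; linarith)
    hf.comp_neg
  refine ⟨fun z => F (-z), fun z hz => ?_, fun z hz => ?_, fun z hz => ?_⟩
  · have hz' : -z ∈ FrobeniusData.halfPlane := by
      change (-z).re < 0
      have : 0 < z.re := hz
      simpa using this
    exact (h1 (-z) hz').fun_comp (f := fun z => -z) (by fun_prop)
  · beta_reduce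
    rw [h2 (-z) (by simpa using hz), neg_neg]
  · have hz' : -(z + 2 * Real.pi * Complex.I * n) ∈ FrobeniusData.halfPlane := by
      change (-(z + 2 * Real.pi * Complex.I * n)).re < 0
      simpa using hz
    rw [← h3 _ hz', ← Finset.sum_range_reflect]
    refine Finset.sum_congr rfl fun j hj => ?_
    have hj' : j ≤ n := Nat.lt_succ_iff.mp (Finset.mem_range.mp hj)
    have hc : (inftyData n).χ.coeff j = 1 := by
      rw [inftyData_χ, finsetSum_coeff, Finset.sum_eq_single j]
      · simp
      · intro b _ hb
        rw [coeff_X_pow, if_neg (Ne.symm hb)]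
      · exact fun h => absurd hj h
    rw [hc, one_mul, show n + 1 - 1 - j = n - j by omega, Nat.cast_sub hj']
    beta_reduce
    congr 1
    ring

end HypergeometricExtension

/-! ### Integrals over vertical lines -/

section VerticalIntegrals
open Polynomial

/-- The point `σ + iy` of the vertical line `Re s = σ`. -/
def linePt (σ y : ℝ) : ℂ := (σ : ℂ) + (y : ℂ) * Complex.I

@[simp] lemma linePt_re (σ y : ℝ) : (linePt σ y).re = σ := by simp [linePt]

@[simp] lemma linePt_im (σ y : ℝ) : (linePt σ y).im = y := by simp [linePt]

@[fun_prop] lemma continuous_linePt (σ : ℝ) : Continuous (linePt σ) := by unfold linePt; fun_prop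

/-- Continuous functions on the real line of exponential decay of every rate below `A`. -/
structure ExpDecay (A : ℝ) (φ : ℝ → ℂ) : Prop where
  cont : Continuous φ
  bound : ∀ a < A, ∃ K : ℝ, ∀ y, ‖φ y‖ ≤ K * Real.exp (-(a * |y|))

lemma integrable_exp_neg_mul_abs {a : ℝ} (ha : 0 < a) : Integrable fun y : ℝ => Real.exp (-(a * |y|)) := by
  rw [← integrableOn_univ, ← Set.Iic_union_Ioi (a := (0 : ℝ))]
  refine IntegrableOn.union ?_ ?_
  · refine (integrableOn_exp_mul_Iic ha 0).congr_fun (fun y hy => ?_) measurableSet_Iic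
    have hy' : y ≤ 0 := hy
    simp [abs_of_nonpos hy']
  · refine (integrableOn_exp_mul_Ioi (neg_lt_zero.mpr ha) 0).congr_fun (fun y hy => ?_)
      measurableSet_Ioi
    have hy' : 0 < y := hy
    simp [abs_of_pos hy']

lemma ExpDecay.add {A : ℝ} {φ ψ : ℝ → ℂ} (hφ : ExpDecay A φ) (hψ : ExpDecay A ψ) :
    ExpDecay A fun y => φ y + ψ y := by
  refine ⟨hφ.cont.add hψ.cont, fun a ha => ?_⟩
  obtain ⟨K, hK⟩ := hφ.bound a ha
  obtain ⟨L, hL⟩ := hψ.bound a ha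
  refine ⟨K + L, fun y => (norm_add_le _ _).trans ?_⟩
  rw [add_mul]
  exact add_le_add (hK y) (hL y)

lemma ExpDecay.const_mul {A : ℝ} {φ : ℝ → ℂ} (hφ : ExpDecay A φ) (c : ℂ) :
    ExpDecay A fun y => c * φ y := by
  refine ⟨continuous_const.mul hφ.cont, fun a ha => ?_⟩
  obtain ⟨K, hK⟩ := hφ.bound a ha
  refine ⟨‖c‖ * K, fun y => ?_⟩
  rw [norm_mul, mul_assoc]
  exact mul_le_mul_of_nonneg_left (hK y) (norm_nonneg c)

/-- A factor of linear growth costs an arbitrarily small part of the rate. This is why the decay is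
required for every rate below A and not at A. -/
lemma ExpDecay.linePt_mul {A : ℝ} {φ : ℝ → ℂ} (hφ : ExpDecay A φ) (σ : ℝ) :
    ExpDecay A fun y => linePt σ y * φ y := by
  refine ⟨(continuous_linePt σ).mul hφ.cont, fun a ha => ?_⟩
  obtain ⟨K, hK⟩ := hφ.bound ((a + A) / 2) (by linarith)
  obtain ⟨δ, hδ⟩ : ∃ δ, δ = (A - a) / 2 := ⟨_, rfl⟩
  have hδ0 : 0 < δ := by rw [hδ]; linarith
  refine ⟨(|σ| + 1 / δ) * K, fun y => ?_⟩
  have hK0 : 0 ≤ K := by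
    have := (norm_nonneg _).trans (hK 0)
    simpa using this
  have h1 : ‖linePt σ y‖ ≤ (|σ| + 1 / δ) * Real.exp (δ * |y|) := by
    have h2 : ‖linePt σ y‖ ≤ |σ| + |y| := by
      refine (norm_add_le _ _).trans ?_
      simp
    have h3 : |y| ≤ 1 / δ * Real.exp (δ * |y|) := by
      have := Real.add_one_le_exp (δ * |y|)
      rw [one_div, inv_mul_eq_div, le_div_iff₀ hδ0]
      linarith
    have h4 : |σ| ≤ |σ| * Real.exp (δ * |y|) :=
      le_mul_of_one_le_right (abs_nonneg _) (Real.one_le_exp (by positivity))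
    rw [add_mul]
    linarith
  rw [norm_mul]
  calc ‖linePt σ y‖ * ‖φ y‖ ≤ ((|σ| + 1 / δ) * Real.exp (δ * |y|)) *
      (K * Real.exp (-((a + A) / 2 * |y|))) :=
        mul_le_mul h1 (hK y) (norm_nonneg _) (by positivity)
    _ = (|σ| + 1 / δ) * K * (Real.exp (δ * |y|) * Real.exp (-((a + A) / 2 * |y|))) := by ring
    _ = _ := by rw [← Real.exp_add, hδ]; congr 2; ring

lemma ExpDecay.eval_mul {A : ℝ} {φ : ℝ → ℂ} (hφ : ExpDecay A φ) (σ : ℝ) (p : ℂ[X]) :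
    ExpDecay A fun y => p.eval (linePt σ y) * φ y := by
  induction p using Polynomial.induction_on' with
  | add p q hp hq => simpa only [eval_add, add_mul] using hp.add hq
  | monomial j b =>
    have h : ExpDecay A fun y => linePt σ y ^ j * φ y := by
      induction j with
      | zero => simpa using hφ
      | succ j ih => simpa only [pow_succ', mul_assoc] using ih.linePt_mul σ
    simpa only [eval_monomial, mul_assoc] using h.const_mul b

lemma norm_mul_exp_le {K a : ℝ} {φ : ℂ} {y : ℝ} (h : ‖φ‖ ≤ K * Real.exp (-(a * |y|))) (σ : ℝ) (z : ℂ) :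
    ‖φ * Complex.exp (z * linePt σ y)‖ ≤
      K * Real.exp (|z.re| * |σ|) * Real.exp (-((a - |z.im|) * |y|)) := by
  rw [norm_mul, Complex.norm_exp]
  have h1 : (z * linePt σ y).re ≤ |z.re| * |σ| + |z.im| * |y| := by
    rw [Complex.mul_re, linePt_re, linePt_im]
    have h2 := le_abs_self (z.re * σ)
    have h3 := neg_abs_le (z.im * y)
    rw [abs_mul] at h2 h3
    linarith
  calc ‖φ‖ * Real.exp (z * linePt σ y).re ≤
      (K * Real.exp (-(a * |y|))) * Real.exp (|z.re| * |σ| + |z.im| * |y|) :=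
        mul_le_mul h (Real.exp_le_exp.mpr h1) (Real.exp_pos _).le ((norm_nonneg _).trans h)
    _ = K * (Real.exp (-(a * |y|)) * Real.exp (|z.re| * |σ| + |z.im| * |y|)) := by ring
    _ = K * (Real.exp (|z.re| * |σ|) * Real.exp (-((a - |z.im|) * |y|))) := by
      rw [← Real.exp_add, ← Real.exp_add]; congr 2; ring
    _ = _ := by ring

lemma ExpDecay.integrable {A : ℝ} {φ : ℝ → ℂ} (hφ : ExpDecay A φ) (σ : ℝ) {z : ℂ} (hz : |z.im| < A) :
    Integrable fun y => φ y * Complex.exp (z * linePt σ y) := by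
  obtain ⟨K, hK⟩ := hφ.bound ((|z.im| + A) / 2) (by linarith)
  refine Integrable.mono' ((integrable_exp_neg_mul_abs
    (a := (|z.im| + A) / 2 - |z.im|) (by linarith)).const_mul (K * Real.exp (|z.re| * |σ|)))
    (hφ.cont.mul (by fun_prop)).aestronglyMeasurable
    (Eventually.of_forall fun y => norm_mul_exp_le (hK y) σ z)

/-- The integral `∫ φ e^{zs} ds` over the vertical line `Re s = σ`. -/
noncomputable def verticalIntegral (σ : ℝ) (φ : ℝ → ℂ) (z : ℂ) : ℂ :=
  ∫ y : ℝ, Complex.I * (φ y * Complex.exp (z * linePt σ y))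

lemma ExpDecay.hasDerivAt {A : ℝ} {φ : ℝ → ℂ} (hφ : ExpDecay A φ) (σ : ℝ) {z : ℂ} (hz : |z.im| < A) :
    HasDerivAt (verticalIntegral σ φ) (verticalIntegral σ (fun y => linePt σ y * φ y) z) z := by
  -- One third of the available rate goes to the neighbourhood of z, one to the loss in the bound,
  -- and one remains for integrability.
  obtain ⟨δ, hδ⟩ : ∃ δ, δ = (A - |z.im|) / 3 := ⟨_, rfl⟩
  have hδ0 : 0 < δ := by rw [hδ]; linarith
  obtain ⟨K, hK⟩ := (hφ.linePt_mul σ).bound (A - δ) (by linarith)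
  have hK0 : 0 ≤ K := by
    have := (norm_nonneg _).trans (hK 0)
    simpa using this
  refine (hasDerivAt_integral_of_dominated_loc_of_deriv_le
    (F' := fun w y => Complex.I * ((linePt σ y * φ y) * Complex.exp (w * linePt σ y)))
    (bound := fun y => K * Real.exp ((|z.re| + δ) * |σ|) * Real.exp (-(δ * |y|)))
    (Metric.ball_mem_nhds z hδ0) ?_ ((hφ.integrable σ hz).const_mul _) ?_ ?_
    ((integrable_exp_neg_mul_abs hδ0).const_mul _) ?_).2
  · exact Eventually.of_forall fun w => Continuous.aestronglyMeasurable
      (continuous_const.mul (hφ.cont.mul (by fun_prop)))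
  · exact Continuous.aestronglyMeasurable
      (continuous_const.mul ((hφ.linePt_mul σ).cont.mul (by fun_prop)))
  · refine Eventually.of_forall fun y w hw => ?_
    rw [norm_mul, Complex.norm_I, one_mul]
    refine (norm_mul_exp_le (hK y) σ w).trans ?_
    have hd := mem_ball_iff_norm.mp hw
    have h1 : |w.re| ≤ |z.re| + δ := by
      have h2 := (Complex.abs_re_le_norm (w - z)).trans hd.le
      have h3 := abs_add_le (w - z).re z.re
      rw [Complex.sub_re, sub_add_cancel] at h3
      rw [Complex.sub_re] at h2
      linarith
    have h4 : |w.im| ≤ |z.im| + δ := by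
      have h2 := (Complex.abs_im_le_norm (w - z)).trans hd.le
      have h3 := abs_add_le (w - z).im z.im
      rw [Complex.sub_im, sub_add_cancel] at h3
      rw [Complex.sub_im] at h2
      linarith
    have h5 : δ ≤ A - δ - |w.im| := by linarith
    gcongr
  · refine Eventually.of_forall fun y w _ => ?_
    have h1 : HasDerivAt (fun w : ℂ => Complex.exp (w * linePt σ y))
        (Complex.exp (w * linePt σ y) * (1 * linePt σ y)) w := ((hasDerivAt_id' w).mul_const _).cexp
    convert! (h1.const_mul (φ y)).const_mul Complex.I using 1
    ring

lemma isOpen_strip (A : ℝ) : IsOpen {z : ℂ | |z.im| < A} :=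
  isOpen_lt Complex.continuous_im.abs continuous_const

lemma ExpDecay.analyticOnNhd {A : ℝ} {φ : ℝ → ℂ} (hφ : ExpDecay A φ) (σ : ℝ) :
    AnalyticOnNhd ℂ (verticalIntegral σ φ) {z | |z.im| < A} :=
  DifferentiableOn.analyticOnNhd
    (fun _ hz => (hφ.hasDerivAt σ hz).differentiableAt.differentiableWithinAt) (isOpen_strip A)

lemma ExpDecay.polyD {A : ℝ} {φ : ℝ → ℂ} (hφ : ExpDecay A φ) (σ : ℝ) (p : ℂ[X]) {z : ℂ}
    (hz : |z.im| < A) : polyD p (verticalIntegral σ φ) z =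
      verticalIntegral σ (fun y => p.eval (linePt σ y) * φ y) z := by
  induction p using Polynomial.induction_on' with
  | add p q hp hq =>
    rw [polyD_add, hp, hq, verticalIntegral, verticalIntegral, ← integral_add
      (((hφ.eval_mul σ p).integrable σ hz).const_mul _)
      (((hφ.eval_mul σ q).integrable σ hz).const_mul _)]
    unfold verticalIntegral
    congr 1
    funext y
    beta_reduce
    rw [eval_add]
    ring
  | monomial j b =>
    have h : iteratedDeriv j (verticalIntegral σ φ) z =
        verticalIntegral σ (fun y => linePt σ y ^ j * φ y) z := by
      induction j generalizing z with
      | zero => simp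
      | succ j ih =>
        have hev : iteratedDeriv j (verticalIntegral σ φ) =ᶠ[𝓝 z]
            verticalIntegral σ (fun y => linePt σ y ^ j * φ y) :=
          Filter.eventually_of_mem ((isOpen_strip A).mem_nhds hz) fun w hw => ih hw
        have hj := hφ.eval_mul σ (X ^ j)
        simp only [eval_pow, eval_X] at hj
        rw [iteratedDeriv_succ, hev.deriv_eq, (hj.hasDerivAt σ hz).deriv]
        simp only [pow_succ', mul_assoc]
    rw [polyD_monomial, h, verticalIntegral, ← integral_const_mul]
    unfold verticalIntegral
    congr 1
    funext y
    beta_reduce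
    rw [eval_monomial]
    ring

/-- Contour shift for functions that decay exponentially in a vertical strip. -/
lemma integral_vertical_eq {f : ℂ → ℂ} {σ τ K δ : ℝ} (hστ : σ ≤ τ) (hδ : 0 < δ)
    (hf : DifferentiableOn ℂ f {s | σ ≤ s.re ∧ s.re ≤ τ})
    (hb : ∀ s : ℂ, σ ≤ s.re → s.re ≤ τ → ‖f s‖ ≤ K * Real.exp (-(δ * |s.im|))) :
    ∫ y : ℝ, f (linePt σ y) = ∫ y : ℝ, f (linePt τ y) := by
  have hint : ∀ x, σ ≤ x → x ≤ τ → Integrable fun y : ℝ => f (linePt x y) := by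
    intro x h1 h2
    refine Integrable.mono' ((integrable_exp_neg_mul_abs hδ).const_mul K)
      (Continuous.aestronglyMeasurable ?_) (Eventually.of_forall fun y => ?_)
    · exact hf.continuousOn.comp_continuous (continuous_linePt x) fun y => by simp [h1, h2]
    · simpa using hb (linePt x y) (by simpa using h1) (by simpa using h2)
  have hlim : ∀ x, σ ≤ x → x ≤ τ → Tendsto (fun T : ℝ => ∫ y in (-T)..T, f (linePt x y)) atTop
      (𝓝 (∫ y : ℝ, f (linePt x y))) := fun x h1 h2 =>
    intervalIntegral_tendsto_integral (hint x h1 h2) tendsto_neg_atTop_atBot tendsto_id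
  -- The signs s = 1 and s = -1 stand for the top and bottom edges of the rectangle; both integrals
  -- tend to zero.
  have hhor : ∀ s : ℝ, |s| = 1 →
      Tendsto (fun T : ℝ => ∫ x in σ..τ, f (x + ((s * T : ℝ) : ℂ) * Complex.I)) atTop (𝓝 0) := by
    intro s hs
    have h0 : Tendsto (fun T : ℝ => K * Real.exp (-(δ * |T|)) * |τ - σ|) atTop (𝓝 0) := by
      have h1 : Tendsto (fun T : ℝ => Real.exp (-(δ * |T|))) atTop (𝓝 0) :=
        Real.tendsto_exp_neg_atTop_nhds_zero.comp (tendsto_abs_atTop_atTop.const_mul_atTop hδ)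
      simpa using (h1.const_mul K).mul_const |τ - σ|
    refine squeeze_zero_norm (fun T => ?_) h0
    refine intervalIntegral.norm_integral_le_of_norm_le_const fun x hx => ?_
    rw [Set.uIoc_of_le hστ] at hx
    have := hb (x + ((s * T : ℝ) : ℂ) * Complex.I) (by simpa using hx.1.le) (by simpa using hx.2)
    simpa [abs_mul, hs] using this
  have hrect : ∀ T : ℝ, ((∫ x in σ..τ, f (x + (((-1) * T : ℝ) : ℂ) * Complex.I)) -
      ∫ x in σ..τ, f (x + ((1 * T : ℝ) : ℂ) * Complex.I)) +
      Complex.I * (∫ y in (-T)..T, f (linePt τ y)) -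
      Complex.I * (∫ y in (-T)..T, f (linePt σ y)) = 0 := by
    intro T
    have h := Complex.integral_boundary_rect_eq_zero_of_differentiableOn f (linePt σ (-T))
      (linePt τ T) (hf.mono fun s hs => by
        have := hs.1
        rw [Set.mem_preimage, linePt_re, linePt_re, Set.uIcc_of_le hστ] at this
        exact this)
    simpa [linePt] using h
  have hl := (((hhor (-1) (by simp)).sub (hhor 1 (by simp))).add
    ((hlim τ hστ le_rfl).const_mul Complex.I)).sub ((hlim σ le_rfl hστ).const_mul Complex.I)
  have h0 := tendsto_nhds_unique (hl.congr hrect) tendsto_const_nhds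
  have h1 : Complex.I * ((∫ y : ℝ, f (linePt τ y)) - ∫ y : ℝ, f (linePt σ y)) = 0 := by
    linear_combination h0
  exact (sub_eq_zero.mp ((mul_eq_zero.mp h1).resolve_left Complex.I_ne_zero)).symm

/-- A continuous integrable function all of whose Fourier coefficients vanish is zero. -/
lemma eq_zero_of_forall_integral_exp {g : ℝ → ℂ} (hg : Continuous g) (hi : Integrable g)
    (h : ∀ x : ℝ, ∫ y : ℝ, g y * Complex.exp (x * y * Complex.I) = 0) (y : ℝ) : g y = 0 := by
  have hF : FourierTransform.fourier g = 0 := by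
    funext w
    rw [Real.fourier_real_eq_integral_exp_smul, Pi.zero_apply, ← h (-2 * Real.pi * w)]
    congr 1
    funext v
    rw [smul_eq_mul, mul_comm]
    congr 2
    push_cast
    ring
  have h1 := hg.fourierInv_fourier_eq hi (by rw [hF]; exact integrable_zero _ _ _)
  rw [← h1, hF, Real.fourierInv_eq']
  simp

end VerticalIntegrals

/-! ### Bounds for Gamma functions on vertical strips -/

section GammaBounds

/-- The quotient Γ(ρ+s)Γ(1-ρ)/Γ(1+s) is a Beta integral, and for Re(ρ+s) ≥ δ its integrand is
dominated by the one with ρ+s replaced by δ. This compares Γ(ρ+s) with Γ(1+s) without Stirling's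
formula. -/
lemma exists_norm_Gamma_add_le {ρ δ : ℝ} (h1 : ρ < 1) (hδ : 0 < δ) :
    ∃ K : ℝ, ∀ s : ℂ, δ ≤ ((ρ : ℂ) + s).re →
      ‖Complex.Gamma (ρ + s)‖ ≤ K * ‖Complex.Gamma (1 + s)‖ := by
  have hv : 0 < (1 - (ρ : ℂ)).re := by simpa using h1
  have hG : Complex.Gamma (1 - (ρ : ℂ)) ≠ 0 := Complex.Gamma_ne_zero_of_re_pos hv
  have hint := (Complex.betaIntegral_convergent (u := (δ : ℂ)) (v := 1 - (ρ : ℂ))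
    (by simpa using hδ) hv).norm
  refine ⟨(∫ x : ℝ in (0 : ℝ)..1, ‖(x : ℂ) ^ ((δ : ℂ) - 1) * (1 - (x : ℂ)) ^ (1 - (ρ : ℂ) - 1)‖) /
    ‖Complex.Gamma (1 - (ρ : ℂ))‖, fun s hs => ?_⟩
  have hB : ‖Complex.betaIntegral (ρ + s) (1 - (ρ : ℂ))‖ ≤
      ∫ x : ℝ in (0 : ℝ)..1, ‖(x : ℂ) ^ ((δ : ℂ) - 1) * (1 - (x : ℂ)) ^ (1 - (ρ : ℂ) - 1)‖ := by
    refine intervalIntegral.norm_integral_le_of_norm_le zero_le_one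
      (Eventually.of_forall fun x hx => ?_) hint
    rw [norm_mul, norm_mul]
    refine mul_le_mul_of_nonneg_right ?_ (norm_nonneg _)
    rw [Complex.norm_cpow_eq_rpow_re_of_pos hx.1, Complex.norm_cpow_eq_rpow_re_of_pos hx.1]
    refine Real.rpow_le_rpow_of_exponent_ge hx.1 hx.2 ?_
    simp only [Complex.sub_re, Complex.ofReal_re, Complex.one_re]
    linarith
  have h := Complex.Gamma_mul_Gamma_eq_betaIntegral (hδ.trans_le hs) hv
  rw [show (ρ : ℂ) + s + (1 - ρ) = 1 + s by ring] at h
  have hn := congrArg norm h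
  rw [norm_mul, norm_mul] at hn
  rw [div_mul_eq_mul_div, le_div_iff₀ (norm_pos_iff.mpr hG), hn, mul_comm]
  exact mul_le_mul_of_nonneg_right hB (norm_nonneg _)

lemma norm_sin_ge {w : ℂ} (hw : 1 / 2 ≤ |w.im|) : Real.exp |w.im| / 4 ≤ ‖Complex.sin w‖ := by
  have h1 : ‖Complex.exp (-w * Complex.I)‖ = Real.exp w.im := by
    rw [Complex.norm_exp]; simp
  have h2 : ‖Complex.exp (w * Complex.I)‖ = Real.exp (-w.im) := by
    rw [Complex.norm_exp]; simp
  have h3 : Real.exp |w.im| - Real.exp (-|w.im|) ≤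
      ‖Complex.exp (-w * Complex.I) - Complex.exp (w * Complex.I)‖ := by
    rcases abs_cases w.im with ⟨h, -⟩ | ⟨h, -⟩
    · rw [h, ← h1, ← h2]; exact norm_sub_norm_le _ _
    · rw [h, neg_neg, ← h1, ← h2, norm_sub_rev]; exact norm_sub_norm_le _ _
  have h4 : Real.exp (-|w.im|) ≤ Real.exp |w.im| / 2 := by
    have h5 := Real.add_one_le_exp (2 * |w.im|)
    have h6 : Real.exp (2 * |w.im|) * Real.exp (-|w.im|) = Real.exp |w.im| := by
      rw [← Real.exp_add]; congr 1; ring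
    have h7 := Real.exp_pos (-|w.im|)
    nlinarith
  rw [Complex.sin, norm_div, norm_mul, Complex.norm_I, mul_one, Complex.norm_ofNat]
  linarith

/-- By reflection the product is πs / sin πs, and the sine grows like e^(π|Im s|). -/
lemma norm_Gamma_one_sub_mul_le {s : ℂ} (h1 : |s.re| ≤ 1) (h2 : 1 ≤ |s.im|) :
    ‖Complex.Gamma (1 - s) * Complex.Gamma (1 + s)‖ ≤
      4 * Real.pi * ((1 + |s.im|) * Real.exp (-(Real.pi * |s.im|))) := by
  have hs : s ≠ 0 := by
    rintro rfl
    simp at h2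
    linarith
  have hpi := Real.pi_gt_three
  have hG : Complex.Gamma (1 - s) * Complex.Gamma (1 + s) =
      s * (Real.pi / Complex.sin (Real.pi * s)) := by
    rw [← Complex.Gamma_mul_Gamma_one_sub, add_comm 1 s, Complex.Gamma_add_one s hs]
    ring
  have him : ((Real.pi : ℂ) * s).im = Real.pi * s.im := by simp
  have habs : |((Real.pi : ℂ) * s).im| = Real.pi * |s.im| := by
    rw [him, abs_mul, abs_of_pos Real.pi_pos]
  have hsin := norm_sin_ge (w := Real.pi * s) (by rw [habs]; nlinarith)
  rw [habs] at hsin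
  have hE := Real.exp_pos (Real.pi * |s.im|)
  have hnorm : ‖s‖ ≤ 1 + |s.im| := (Complex.norm_le_abs_re_add_abs_im s).trans (by linarith)
  rw [hG, norm_mul, norm_div, Complex.norm_real, Real.norm_of_nonneg Real.pi_pos.le, Real.exp_neg]
  calc ‖s‖ * (Real.pi / ‖Complex.sin (Real.pi * s)‖) ≤
      (1 + |s.im|) * (Real.pi / (Real.exp (Real.pi * |s.im|) / 4)) := by
        gcongr
    _ = _ := by field_simp

end GammaBounds

/-! ### The function J(z): equation and independence of its translates -/

section MellinBarnesKernel
open Polynomial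

variable {n : ℕ}

/-- The Mellin-Barnes kernel `Γ(-s)^n ∏ Γ(ρ_i + s)`. -/
noncomputable def mbKernel (n : ℕ) (s : ℂ) : ℂ :=
  Complex.Gamma (-s) ^ n * ∏ i, Complex.Gamma (rho n i + s)

/-- The function `Γ(1-s)^n ∏ Γ(ρ_i + s) = (-s)^n mbKernel n s`. -/
noncomputable def mbKernelAux (n : ℕ) (s : ℂ) : ℂ :=
  Complex.Gamma (1 - s) ^ n * ∏ i, Complex.Gamma (rho n i + s)

lemma mbKernelAux_eq {s : ℂ} (hs : s ≠ 0) : mbKernelAux n s = (-s) ^ n * mbKernel n s := by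
  rw [mbKernelAux, mbKernel, sub_eq_neg_add, Complex.Gamma_add_one _ (neg_ne_zero.mpr hs), mul_pow,
    mul_assoc]

/-- The auxiliary function at s is (-s)^n times the kernel, and at s + 1 it is ∏ (s + ρ_i) times the
kernel. It has no pole at s = 0, so the contour can move from Re s = σ to σ + 1 through it. -/
lemma mbKernelAux_add_one {s : ℂ} (hs : ∀ i, (rho n i : ℂ) + s ≠ 0) :
    mbKernelAux n (s + 1) = (rhoPoly n).eval s * mbKernel n s := by
  have h : ∀ i : Fin n, Complex.Gamma (rho n i + (s + 1)) =
      (rho n i + s) * Complex.Gamma (rho n i + s) := fun i => by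
    rw [← add_assoc, Complex.Gamma_add_one _ (hs i)]
  rw [mbKernelAux, mbKernel, rhoPoly, eval_prod]
  simp only [h, Finset.prod_mul_distrib, eval_add, eval_X, eval_C]
  rw [show (1 : ℂ) - (s + 1) = -s by ring]
  simp only [add_comm s]
  ring

lemma mbKernel_ne_zero {s : ℂ} (h0 : s.re < 0) (h1 : ∀ i, -rho n i < s.re) : mbKernel n s ≠ 0 := by
  refine mul_ne_zero (pow_ne_zero _ (Complex.Gamma_ne_zero_of_re_pos (by simpa using h0)))
    (Finset.prod_ne_zero_iff.mpr fun i _ => Complex.Gamma_ne_zero_of_re_pos ?_)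
  have := h1 i
  simp only [Complex.add_re, Complex.ofReal_re]
  linarith

lemma differentiableOn_mbKernelAux {σ : ℝ} (h0 : σ < 0) (h1 : ∀ i, -rho n i < σ) :
    DifferentiableOn ℂ (mbKernelAux n) {s | σ ≤ s.re ∧ s.re ≤ σ + 1} := by
  intro s hs
  refine DifferentiableAt.differentiableWithinAt ?_
  refine DifferentiableAt.fun_mul (DifferentiableAt.fun_pow ?_ n)
    (DifferentiableAt.fun_finsetProd fun i _ => ?_)
  · refine DifferentiableAt.fun_comp' s (g := Complex.Gamma)
      (analyticAt_Gamma_of_re_pos ?_).differentiableAt (by fun_prop)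
    simp only [Complex.sub_re, Complex.one_re]
    linarith [hs.2]
  · refine DifferentiableAt.fun_comp' s (g := Complex.Gamma)
      (analyticAt_Gamma_of_re_pos ?_).differentiableAt (by fun_prop)
    simp only [Complex.add_re, Complex.ofReal_re]
    linarith [hs.1, h1 i]

/-- Each Γ(ρ_i + s) is replaced by Γ(1 + s) and paired with one of the n factors Γ(1 - s); every
pair decays like e^(-π|Im s|) up to a linear factor. The part |Im s| ≤ 1 is handled by compactness.
-/
lemma exists_norm_mbKernelAux_le (hn : 0 < n) {σ : ℝ} (h0 : σ < 0) (h1 : ∀ i, -rho n i < σ) {a : ℝ}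
    (ha : a < n * Real.pi) : ∃ K : ℝ, ∀ s : ℂ, σ ≤ s.re → s.re ≤ σ + 1 →
      ‖mbKernelAux n s‖ ≤ K * Real.exp (-(a * |s.im|)) := by
  have hσ : -1 < σ := by linarith [h1 ⟨0, hn⟩, rho_lt_one n ⟨0, hn⟩]
  obtain ⟨B, hB⟩ := (isCompact_Icc.reProdIm isCompact_Icc :
    IsCompact (Set.Icc σ (σ + 1) ×ℂ Set.Icc (-1 : ℝ) 1)).exists_bound_of_continuousOn
    ((differentiableOn_mbKernelAux h0 h1).continuousOn.mono fun s hs => hs.1)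
  choose K hK using fun i : Fin n =>
    exists_norm_Gamma_add_le (rho_lt_one n i) (by linarith [h1 i] : 0 < σ + rho n i)
  -- The spare rate nπ - a is shared among the n pairs: n(π - d) = a, and d absorbs the linear
  -- factor of each pair.
  obtain ⟨d, hd⟩ : ∃ d, d = (n * Real.pi - a) / n := ⟨_, rfl⟩
  have hn' : (0 : ℝ) < n := by exact_mod_cast hn
  have hd0 : 0 < d := by rw [hd]; exact div_pos (by linarith) hn'
  have hB0 : 0 ≤ B := (norm_nonneg _).trans (hB (σ : ℂ) ⟨by simp, by simp⟩)
  obtain ⟨L, hL⟩ : ∃ L, L = (∏ i, |K i|) * (4 * Real.pi * (Real.exp d / d)) ^ n := ⟨_, rfl⟩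
  have hpi := Real.pi_pos
  have hL0 : 0 ≤ L := by
    rw [hL]
    have : 0 ≤ ∏ i, |K i| := Finset.prod_nonneg fun _ _ => abs_nonneg _
    positivity
  refine ⟨B * Real.exp |a| + L, fun s hs1 hs2 => ?_⟩
  have hre : |s.re| ≤ 1 := abs_le.mpr ⟨by linarith, by linarith⟩
  rcases le_total |s.im| 1 with him | him
  · have h2 := hB s ⟨⟨hs1, hs2⟩, abs_le.mp him⟩
    have h3 : 1 ≤ Real.exp |a| * Real.exp (-(a * |s.im|)) := by
      rw [← Real.exp_add]
      refine Real.one_le_exp ?_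
      have h4 : a * |s.im| ≤ |a| * 1 :=
        (mul_le_mul_of_nonneg_right (le_abs_self a) (abs_nonneg _)).trans
          (mul_le_mul_of_nonneg_left him (abs_nonneg a))
      linarith
    have h5 : 0 ≤ L * Real.exp (-(a * |s.im|)) := by positivity
    nlinarith
  · have h2 : ‖mbKernelAux n s‖ ≤
        (∏ i, |K i|) * ‖Complex.Gamma (1 - s) * Complex.Gamma (1 + s)‖ ^ n := by
      rw [mbKernelAux, norm_mul, norm_pow, norm_prod, norm_mul, mul_pow, mul_left_comm]
      refine mul_le_mul_of_nonneg_left ?_ (by positivity)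
      calc ∏ i, ‖Complex.Gamma (rho n i + s)‖ ≤ ∏ i, |K i| * ‖Complex.Gamma (1 + s)‖ := by
            refine Finset.prod_le_prod (fun _ _ => norm_nonneg _) fun i _ => ?_
            refine (hK i s ?_).trans (mul_le_mul_of_nonneg_right (le_abs_self _) (norm_nonneg _))
            simp only [Complex.add_re, Complex.ofReal_re]
            linarith
        _ = _ := by simp [Finset.prod_mul_distrib]
    have h3 : ‖Complex.Gamma (1 - s) * Complex.Gamma (1 + s)‖ ≤
        4 * Real.pi * (Real.exp d / d) * Real.exp ((d - Real.pi) * |s.im|) := by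
      refine (norm_Gamma_one_sub_mul_le hre him).trans ?_
      have h4 : 1 + |s.im| ≤ Real.exp d / d * Real.exp (d * |s.im|) := by
        rw [div_mul_eq_mul_div, le_div_iff₀ hd0, ← Real.exp_add]
        have := Real.add_one_le_exp (d + d * |s.im|)
        linarith
      rw [show Real.exp ((d - Real.pi) * |s.im|) =
        Real.exp (d * |s.im|) * Real.exp (-(Real.pi * |s.im|)) by
          rw [← Real.exp_add]; congr 1; ring, mul_assoc (4 * Real.pi),
        ← mul_assoc (Real.exp d / d)]
      gcongr
    have h5 : (∏ i, |K i|) * ‖Complex.Gamma (1 - s) * Complex.Gamma (1 + s)‖ ^ n ≤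
        L * Real.exp (-(a * |s.im|)) := by
      have h6 : Real.exp (-(a * |s.im|)) = Real.exp ((d - Real.pi) * |s.im|) ^ n := by
        rw [← Real.exp_nat_mul]
        congr 1
        rw [hd]
        field_simp
        ring
      rw [hL, h6, mul_assoc, ← mul_pow]
      refine mul_le_mul_of_nonneg_left (pow_le_pow_left₀ (norm_nonneg _) h3 n)
        (Finset.prod_nonneg fun _ _ => abs_nonneg _)
    have h7 : 0 ≤ B * Real.exp |a| * Real.exp (-(a * |s.im|)) := by positivity
    nlinarith

lemma linePt_ne_zero {σ : ℝ} (h0 : σ < 0) (y : ℝ) : linePt σ y ≠ 0 := by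
  intro h
  have := congrArg Complex.re h
  rw [linePt_re, Complex.zero_re] at this
  exact h0.ne this

lemma expDecay_mbKernel (hn : 0 < n) {σ : ℝ} (h0 : σ < 0) (h1 : ∀ i, -rho n i < σ) :
    ExpDecay (n * Real.pi) fun y => mbKernel n (linePt σ y) := by
  have heq : ∀ y, mbKernel n (linePt σ y) = mbKernelAux n (linePt σ y) / (-linePt σ y) ^ n := by
    intro y
    have := pow_ne_zero n (neg_ne_zero.mpr (linePt_ne_zero h0 y))
    rw [mbKernelAux_eq (linePt_ne_zero h0 y)]
    field_simp
  refine ⟨?_, fun a ha => ?_⟩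
  · simp only [heq]
    refine Continuous.div ?_ (by fun_prop)
      fun y => pow_ne_zero n (neg_ne_zero.mpr (linePt_ne_zero h0 y))
    exact (differentiableOn_mbKernelAux h0 h1).continuousOn.comp_continuous (continuous_linePt σ)
      fun y => by simp
  · obtain ⟨K, hK⟩ := exists_norm_mbKernelAux_le hn h0 h1 ha
    refine ⟨K / |σ| ^ n, fun y => ?_⟩
    have hσ : 0 < |σ| := abs_pos.mpr h0.ne
    have h2 := hK (linePt σ y) (by simp) (by simp)
    rw [linePt_im] at h2
    have h3 : |σ| ≤ ‖linePt σ y‖ := by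
      simpa using Complex.abs_re_le_norm (linePt σ y)
    rw [heq, norm_div, norm_pow, norm_neg, div_mul_eq_mul_div]
    exact div_le_div₀ ((norm_nonneg _).trans h2) h2 (by positivity) (pow_le_pow_left₀ hσ.le h3 n)

/-- The Mellin-Barnes integral `∫ Γ(-s)^n ∏ Γ(ρ_i + s) e^{zs} ds`. -/
noncomputable def mbInt (n : ℕ) (σ : ℝ) : ℂ → ℂ := verticalIntegral σ fun y => mbKernel n (linePt σ y)

/-- D^n multiplies the integrand by s^n, and the factor e^z amounts to replacing s by s + 1. So the
two sides are, up to the same sign, integrals of one pole-free function over Re s = σ and Re s = σ +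
1. -/
lemma isExpODESolution_mbInt (hn : 0 < n) {σ : ℝ} (h0 : σ < 0) (h1 : ∀ i, -rho n i < σ) :
    IsExpODESolution (X ^ n) (rhoPoly n) ((-1) ^ n) {z | |z.im| < n * Real.pi} (mbInt n σ) := by
  have hdec := expDecay_mbKernel hn h0 h1
  refine ⟨hdec.analyticOnNhd σ, fun z hz => ?_⟩
  have hz' : |z.im| < n * Real.pi := hz
  obtain ⟨K, hK⟩ := exists_norm_mbKernelAux_le hn h0 h1
    (a := (|z.im| + n * Real.pi) / 2) (by linarith)
  have hK0 : 0 ≤ K := by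
    have := (norm_nonneg _).trans (hK σ (by simp) (by simp))
    simpa using this
  have hσ : -1 < σ := by linarith [h1 ⟨0, hn⟩, rho_lt_one n ⟨0, hn⟩]
  have hshift := integral_vertical_eq (f := fun s => mbKernelAux n s * Complex.exp (z * s))
    (σ := σ) (τ := σ + 1) (K := K * Real.exp (|z.re| * 1))
    (δ := (|z.im| + n * Real.pi) / 2 - |z.im|) (by linarith) (by linarith)
    ((differentiableOn_mbKernelAux h0 h1).mul (Differentiable.differentiableOn (by fun_prop)))
    (fun s hs1 hs2 => by
      have h2 := norm_mul_exp_le (hK s hs1 hs2) s.re z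
      have hs : linePt s.re s.im = s := Complex.re_add_im s
      have hre : |s.re| ≤ 1 := abs_le.mpr ⟨by linarith, by linarith⟩
      rw [hs] at h2
      refine h2.trans ?_
      gcongr)
  rw [mbInt, hdec.polyD σ _ hz', hdec.polyD σ _ hz']
  have hL : verticalIntegral σ (fun y => (X ^ n : ℂ[X]).eval (linePt σ y) * mbKernel n (linePt σ y)) z =
      (-1) ^ n * (Complex.I * ∫ y : ℝ, mbKernelAux n (linePt σ y) * Complex.exp (z * linePt σ y)) := by
    rw [verticalIntegral, integral_const_mul, ← mul_assoc, mul_comm _ Complex.I, mul_assoc,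
      ← integral_const_mul ((-1 : ℂ) ^ n)]
    congr 2
    funext y
    have hs : ((-1 : ℂ) ^ n) * (-1) ^ n = 1 := by rw [← mul_pow]; simp
    rw [mbKernelAux_eq (linePt_ne_zero h0 y), eval_pow, eval_X, neg_pow]
    linear_combination (-(linePt σ y ^ n * mbKernel n (linePt σ y) * Complex.exp (z * linePt σ y))) * hs
  have hR : Complex.exp z *
      verticalIntegral σ (fun y => (rhoPoly n).eval (linePt σ y) * mbKernel n (linePt σ y)) z =
      Complex.I * ∫ y : ℝ, mbKernelAux n (linePt (σ + 1) y) * Complex.exp (z * linePt (σ + 1) y) := by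
    rw [verticalIntegral, integral_const_mul, mul_left_comm, ← integral_const_mul (Complex.exp z)]
    congr 2
    funext y
    have hs : linePt (σ + 1) y = linePt σ y + 1 := by unfold linePt; push_cast; ring
    rw [hs, mbKernelAux_add_one, mul_add, mul_one, Complex.exp_add]
    · ring
    · intro i h
      have h2 := congrArg Complex.re h
      simp only [Complex.add_re, Complex.ofReal_re, linePt_re, Complex.zero_re] at h2
      linarith [h1 i]
  rw [hL, hshift, ← hR]
  ring

lemma abs_im_add_lt {z : ℂ} (hz : -(n * Real.pi) < z.im ∧ z.im < -(n * Real.pi) + 2 * Real.pi)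
    (k : Fin n) : |(z + 2 * Real.pi * Complex.I * (k : ℕ)).im| < n * Real.pi := by
  have hpi := Real.pi_pos
  have hk : ((k : ℕ) : ℝ) + 1 ≤ n := by exact_mod_cast k.2
  have hk0 : (0 : ℝ) ≤ (k : ℕ) := Nat.cast_nonneg _
  have him : (z + 2 * Real.pi * Complex.I * (k : ℕ)).im = z.im + 2 * Real.pi * (k : ℕ) := by simp
  rw [him, abs_lt]
  constructor
  · nlinarith [hz.1]
  · nlinarith [hz.2]

/-- The branches `mbInt n σ (z + 2πik)`, `k < n`, are linearly independent. -/
lemma mbInt_shift_independent (hn : 0 < n) {σ : ℝ} (h0 : σ < 0) (h1 : ∀ i, -rho n i < σ) {W : Set ℂ}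
    (hW : IsOpen W) (hWn : W.Nonempty)
    (hWs : ∀ z ∈ W, -(n * Real.pi) < z.im ∧ z.im < -(n * Real.pi) + 2 * Real.pi) {c : Fin n → ℂ}
    (hc : ∀ z ∈ W, ∑ k : Fin n, c k * mbInt n σ (z + 2 * Real.pi * Complex.I * (k : ℕ)) = 0) :
    c = 0 := by
  have hdec := expDecay_mbKernel hn h0 h1
  have hpi := Real.pi_pos
  obtain ⟨S, hS⟩ : ∃ S : Set ℂ, S = {z | -(n * Real.pi) < z.im ∧ z.im < -(n * Real.pi) + 2 * Real.pi} :=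
    ⟨_, rfl⟩
  have hSc : IsPreconnected S := by
    rw [hS]
    exact ((convex_halfSpace_im_gt _).inter (convex_halfSpace_im_lt _)).isPreconnected
  have hshift : ∀ z ∈ S, ∀ k : Fin n, |(z + 2 * Real.pi * Complex.I * (k : ℕ)).im| < n * Real.pi :=
    fun z hz k => by
      rw [hS] at hz
      exact abs_im_add_lt hz k
  have hzero : ∀ z ∈ S, ∑ k : Fin n, c k * mbInt n σ (z + 2 * Real.pi * Complex.I * (k : ℕ)) = 0 := by
    obtain ⟨z, hz⟩ := hWn
    have han : AnalyticOnNhd ℂ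
        (fun z => ∑ k : Fin n, c k * mbInt n σ (z + 2 * Real.pi * Complex.I * (k : ℕ))) S :=
      fun z hz => Finset.analyticAt_fun_sum _ fun k _ => analyticAt_const.fun_mul
        (AnalyticAt.fun_comp (g := mbInt n σ) (hdec.analyticOnNhd σ _ (hshift z hz k)) (by fun_prop))
    exact han.eqOn_zero_of_preconnected_of_eventuallyEq_zero hSc (hS ▸ hWs z hz)
      (Filter.eventually_of_mem (hW.mem_nhds hz) hc)
  -- The middle line of the strip; any horizontal line inside would do.
  obtain ⟨μ, hμ⟩ : ∃ μ : ℝ, μ = -(n * Real.pi) + Real.pi := ⟨_, rfl⟩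
  have hμS : ∀ x : ℝ, (x : ℂ) + μ * Complex.I ∈ S := by
    intro x
    rw [hS, hμ]
    constructor <;> simp <;> linarith
  obtain ⟨q, hq⟩ : ∃ q : ℂ[X], q = ∑ k : Fin n, C (c k) * X ^ (k : ℕ) := ⟨_, rfl⟩
  have hqe : ∀ x, q.eval x = ∑ k : Fin n, c k * x ^ (k : ℕ) := by
    intro x
    rw [hq, eval_finsetSum]
    simp
  -- On this line the relation is, up to a non-vanishing factor, the Fourier integral of g, so g =
  -- 0.
  obtain ⟨g, hg⟩ : ∃ g : ℝ → ℂ, g = fun y => ∑ k : Fin n, c k * (mbKernel n (linePt σ y) *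
      Complex.exp ((μ * Complex.I + 2 * Real.pi * Complex.I * (k : ℕ)) * linePt σ y)) := ⟨_, rfl⟩
  have hgc : Continuous g := by
    rw [hg]
    exact continuous_finsetSum _ fun k _ => continuous_const.mul (hdec.cont.mul (by fun_prop))
  have hstrip : ∀ k : Fin n, |(μ * Complex.I + 2 * Real.pi * Complex.I * (k : ℕ)).im| < n * Real.pi :=
    fun k => by
      have := hshift _ (hμS 0) k
      simpa using this
  have hgi : Integrable g := by
    rw [hg]
    exact integrable_finsetSum _ fun k _ => (hdec.integrable σ (hstrip k)).const_mul _
  have hg0 := eq_zero_of_forall_integral_exp hgc hgi fun x => by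
    have h2 := hzero _ (hμS x)
    have h3 : ∑ k : Fin n, c k * mbInt n σ ((x : ℂ) + μ * Complex.I +
        2 * Real.pi * Complex.I * (k : ℕ)) =
        (Complex.I * Complex.exp (x * σ)) * ∫ y : ℝ, g y * Complex.exp (x * y * Complex.I) := by
      rw [← integral_const_mul]
      have h4 : ∀ k : Fin n, c k * mbInt n σ ((x : ℂ) + μ * Complex.I +
          2 * Real.pi * Complex.I * (k : ℕ)) = ∫ y : ℝ, c k * (Complex.I *
          (mbKernel n (linePt σ y) * Complex.exp (((x : ℂ) + μ * Complex.I +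
          2 * Real.pi * Complex.I * (k : ℕ)) * linePt σ y))) := fun k => by
        rw [integral_const_mul]; rfl
      simp only [h4]
      rw [← integral_finsetSum _ fun k _ =>
        ((hdec.integrable σ (hshift _ (hμS x) k)).const_mul _).const_mul _]
      congr 1
      funext y
      rw [hg, Finset.sum_mul, Finset.mul_sum]
      refine Finset.sum_congr rfl fun k _ => ?_
      have h5 : Complex.exp (((x : ℂ) + μ * Complex.I + 2 * Real.pi * Complex.I * (k : ℕ)) *
          linePt σ y) = Complex.exp (x * σ) * Complex.exp (x * y * Complex.I) *
          Complex.exp ((μ * Complex.I + 2 * Real.pi * Complex.I * (k : ℕ)) * linePt σ y) := by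
        rw [← Complex.exp_add, ← Complex.exp_add]
        congr 1
        unfold linePt
        ring
      rw [h5]
      ring
    rw [h3] at h2
    exact (mul_eq_zero.mp h2).resolve_left (mul_ne_zero Complex.I_ne_zero (Complex.exp_ne_zero _))
  -- g is the product of the kernel, an exponential and q(e^(2πis)); the first two never vanish on
  -- the line.
  have hroots : ∀ y : ℝ, q.IsRoot (Complex.exp (2 * Real.pi * Complex.I * linePt σ y)) := by
    intro y
    have h2 := hg0 y
    have h3 : g y = mbKernel n (linePt σ y) * Complex.exp (μ * Complex.I * linePt σ y) *
        q.eval (Complex.exp (2 * Real.pi * Complex.I * linePt σ y)) := by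
      rw [hg, hqe, Finset.mul_sum]
      refine Finset.sum_congr rfl fun k _ => ?_
      rw [add_mul, Complex.exp_add, ← Complex.exp_nat_mul,
        show 2 * Real.pi * Complex.I * (k : ℕ) * linePt σ y =
          (k : ℕ) * (2 * Real.pi * Complex.I * linePt σ y) by ring]
      ring
    rw [h3] at h2
    exact (mul_eq_zero.mp h2).resolve_left (mul_ne_zero
      (mbKernel_ne_zero (by simpa using h0) (by simpa using h1)) (Complex.exp_ne_zero _))
  have hq0 : q = 0 := by
    refine eq_zero_of_infinite_isRoot q ?_
    -- The moduli e^(-2πy) are already pairwise distinct.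
    refine (Set.infinite_range_of_injective (f := fun y : ℝ =>
      Complex.exp (2 * Real.pi * Complex.I * linePt σ y)) fun y y' h => ?_).mono ?_
    · have h2 := congrArg norm h
      rw [Complex.norm_exp, Complex.norm_exp, Real.exp_eq_exp] at h2
      simpa [Real.pi_ne_zero] using h2
    · rintro _ ⟨y, rfl⟩
      exact hroots y
  funext k
  have h2 : q.coeff k = c k := by
    rw [hq, finsetSum_coeff, Finset.sum_eq_single k]
    · simp
    · intro b _ hb
      rw [coeff_C_mul_X_pow, if_neg fun h => hb (Fin.ext h.symm)]
    · simp
  rw [← h2, hq0, coeff_zero, Pi.zero_apply]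

lemma isExpODESolution_mbInt_shift (hn : 0 < n) {σ : ℝ} (h0 : σ < 0) (h1 : ∀ i, -rho n i < σ)
    (k : Fin n) : IsExpODESolution (X ^ n) (rhoPoly n) ((-1) ^ n)
      {z | -(n * Real.pi) < z.im ∧ z.im < -(n * Real.pi) + 2 * Real.pi}
      (fun z => mbInt n σ (z + 2 * Real.pi * Complex.I * (k : ℕ))) := by
  have h := isExpODESolution_mbInt hn h0 h1
  refine ⟨fun z hz => AnalyticAt.fun_comp (g := mbInt n σ) (h.1 _ (abs_im_add_lt hz k))
    (by fun_prop), fun z hz => ?_⟩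
  rw [polyD_comp_add_const, polyD_comp_add_const, h.2 _ (abs_im_add_lt hz k), Complex.exp_add,
    mul_comm _ ((k : ℕ) : ℂ), Complex.exp_nat_mul_two_pi_mul_I, mul_one]

end MellinBarnesKernel

/-! ### Reduction of the Mellin-Barnes integral to J -/

section MellinBarnesReduction

variable {n : ℕ}

/-- The linear form `∑ b_j w_j`. -/
noncomputable def logB (n : ℕ) (w : Fin n ⊕ Fin n → ℂ) : ℂ := ∑ j, (gkzB n j : ℂ) * w j

/-- The linear form `∑ (γ₀)_j w_j`. -/
noncomputable def logGamma0 (n : ℕ) (w : Fin n ⊕ Fin n → ℂ) : ℂ := ∑ j, (gkzGamma0 n j : ℂ) * w j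

lemma logB_eq (w : Fin n ⊕ Fin n → ℂ) : logB n w = ∑ i, w (Sum.inl i) - ∑ i, w (Sum.inr i) := by
  simp [logB, gkzB, sub_eq_add_neg]

lemma logGamma0_eq (w : Fin n ⊕ Fin n → ℂ) : logGamma0 n w = -∑ i, (rho n i : ℂ) * w (Sum.inr i) := by
  simp [logGamma0, gkzGamma0]

/-- Replacing γ₀ by γ₀ + c b only replaces s by s + c, so it moves the contour to Re s = σ + c. The
variables enter only through u^γ₀ and ∑ b_j log u_j. -/
lemma mellinBarnesIntegrand_gkz (c : ℝ) (w : Fin n ⊕ Fin n → ℂ) (s : ℂ) :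
    mellinBarnesIntegrand (gkzB n) (gkzGamma n c) w s =
      Complex.exp (logGamma0 n w) * (mbKernel n (s + c) * Complex.exp (logB n w * (s + c))) := by
  rw [mellinBarnesIntegrand, Finset.prod_mul_distrib, ← Complex.exp_sum, mul_left_comm,
    ← Complex.exp_add]
  congr 1
  · rw [Fintype.prod_sum_type, mbKernel]
    congr 1
    · rw [Finset.prod_congr rfl (g := fun _ => Complex.Gamma (-(s + c))) fun i _ => by
        simp only [gkzGamma, gkzGamma0, gkzB]; congr 1; push_cast; ring]
      simp
    · refine Finset.prod_congr rfl fun i _ => ?_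
      simp only [gkzGamma, gkzGamma0, gkzB]
      congr 1
      push_cast
      ring
  · congr 1
    rw [logGamma0, logB, Finset.sum_mul, ← Finset.sum_add_distrib]
    refine Finset.sum_congr rfl fun j _ => ?_
    rw [gkzGamma]
    push_cast
    ring

lemma linePt_add (σ c y : ℝ) : (σ : ℂ) + y * Complex.I + c = linePt (σ + c) y := by
  rw [linePt]; push_cast; ring

lemma mellinBarnes_gkz (c σ : ℝ) (w : Fin n ⊕ Fin n → ℂ) :
    mellinBarnes (gkzB n) (gkzGamma n c) σ w =
      Complex.exp (logGamma0 n w) * mbInt n (σ + c) (logB n w) := by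
  rw [mellinBarnes, mbInt, verticalIntegral, ← integral_const_mul]
  congr 1
  funext y
  rw [mellinBarnesIntegrand_gkz, linePt_add]
  ring

/-- The line Re s = σ + c separates the poles of Γ(-s) from those of all Γ(ρ_i + s). -/
lemma gkzGamma_bounds (hn : 0 < n) {c σ : ℝ}
    (h : ∀ i, gkzGamma n c (Sum.inr i) < σ ∧ σ < -gkzGamma n c (Sum.inl i)) :
    σ + c < 0 ∧ ∀ i, -rho n i < σ + c := by
  simp only [gkzGamma, gkzGamma0, gkzB] at h
  push_cast at h
  exact ⟨by linarith [(h ⟨0, hn⟩).2], fun i => by linarith [(h i).1]⟩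

lemma integrable_mellinBarnesIntegrand (hn : 0 < n) {c σ : ℝ} (h0 : σ + c < 0)
    (h1 : ∀ i, -rho n i < σ + c) {w : Fin n ⊕ Fin n → ℂ} (hw : |(logB n w).im| < n * Real.pi) :
    Integrable fun y : ℝ => Complex.I *
      mellinBarnesIntegrand (gkzB n) (gkzGamma n c) w ((σ : ℂ) + (y : ℂ) * Complex.I) := by
  simp only [mellinBarnesIntegrand_gkz, linePt_add]
  exact (((expDecay_mbKernel hn h0 h1).integrable (σ + c) hw).const_mul _).const_mul _

lemma logB_shiftLog (hn : 0 < n) (k : ℕ) (w : Fin n ⊕ Fin n → ℂ) :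
    logB n (shiftLog n k w) = logB n w + 2 * Real.pi * Complex.I * k := by
  have h : ∀ i : Fin n, shiftLog n k w (Sum.inl i) =
      w (Sum.inl i) + if i = ⟨0, hn⟩ then 2 * Real.pi * Complex.I * k else 0 := by
    intro i
    by_cases hi : (i : ℕ) = 0
    · have : i = ⟨0, hn⟩ := Fin.ext hi
      simp [shiftLog, this]
    · have : i ≠ ⟨0, hn⟩ := fun h => hi (by rw [h])
      simp [shiftLog, hi, this]
  rw [logB_eq, logB_eq]
  simp only [h, Finset.sum_add_distrib, Finset.sum_ite_eq', Finset.mem_univ, if_true]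
  simp only [shiftLog]
  ring

lemma logGamma0_shiftLog (k : ℕ) (w : Fin n ⊕ Fin n → ℂ) :
    logGamma0 n (shiftLog n k w) = logGamma0 n w := by
  rw [logGamma0_eq, logGamma0_eq]; rfl

end MellinBarnesReduction

/-! ### Continuous branches of the logarithms -/

section LogBranches

variable {N : Type*}

/-- The values lie in the discrete set 2πiℤ, whose only point of modulus below 1 is 0. -/
lemma eventually_eq_zero_of_exp_eq_one {X : Type*} [TopologicalSpace X] {f : X → ℂ} {x : X}
    (hf : ContinuousAt f x) (h0 : f x = 0) (hexp : ∀ᶠ y in 𝓝 x, Complex.exp (f y) = 1) :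
    ∀ᶠ y in 𝓝 x, f y = 0 := by
  have h1 : ∀ᶠ y in 𝓝 x, ‖f y‖ < 1 := by
    have := hf.norm.tendsto
    beta_reduce at this
    rw [h0, norm_zero] at this
    exact this.eventually (gt_mem_nhds one_pos)
  filter_upwards [h1, hexp] with y hy1 hy2
  obtain ⟨m, hm⟩ := Complex.exp_eq_one_iff.mp hy2
  have hpi := Real.pi_gt_three
  by_cases hm0 : m = 0
  · rw [hm, hm0]; simp
  · exfalso
    have h2 : (1 : ℝ) ≤ |(m : ℝ)| := by exact_mod_cast Int.one_le_abs hm0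
    rw [hm] at hy1
    have h3 : ‖(m : ℂ) * (2 * Real.pi * Complex.I)‖ = |(m : ℝ)| * (2 * Real.pi) := by
      simp [abs_of_pos Real.pi_pos]
    rw [h3] at hy1
    nlinarith

/-- A continuous branch `L` of the coordinatewise logarithm on an open set. -/
structure IsLogBranch (U : Set (N → ℂ)) (L : (N → ℂ) → (N → ℂ)) : Prop where
  isOpen : IsOpen U
  cont : ContinuousOn L U
  exp_eq : ∀ u ∈ U, ∀ j, Complex.exp (L u j) = u j

variable {U : Set (N → ℂ)} {L : (N → ℂ) → (N → ℂ)}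

lemma IsLogBranch.mono (h : IsLogBranch U L) {V : Set (N → ℂ)} (hV : IsOpen V) (hVU : V ⊆ U) :
    IsLogBranch V L :=
  ⟨hV, h.cont.mono hVU, fun u hu => h.exp_eq u (hVU hu)⟩

lemma IsLogBranch.ne_zero (h : IsLogBranch U L) {u : N → ℂ} (hu : u ∈ U) (j : N) : u j ≠ 0 := by
  rw [← h.exp_eq u hu j]; exact Complex.exp_ne_zero _

/-- Near u the branch equals L u j + Log(v_j/u_j): the difference is continuous, takes values in
2πiℤ and vanishes at u. -/
lemma IsLogBranch.hasStrictFDerivAt [Fintype N] (h : IsLogBranch U L) {u : N → ℂ} (hu : u ∈ U) (j : N) :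
    HasStrictFDerivAt (fun v => L v j)
      ((u j)⁻¹ • (ContinuousLinearMap.proj j : (N → ℂ) →L[ℂ] ℂ)) u := by
  have hj := h.ne_zero hu j
  have hproj : HasStrictFDerivAt (fun v : N → ℂ => v j)
    (ContinuousLinearMap.proj j : (N → ℂ) →L[ℂ] ℂ) u :=
      (ContinuousLinearMap.proj j : (N → ℂ) →L[ℂ] ℂ).hasStrictFDerivAt
  have hdiv : HasStrictFDerivAt (fun v : N → ℂ => v j * (u j)⁻¹)
      ((u j)⁻¹ • (ContinuousLinearMap.proj j : (N → ℂ) →L[ℂ] ℂ)) u := hproj.mul_const _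
  have hlog := hdiv.clog (by rw [mul_inv_cancel₀ hj]; exact Complex.one_mem_slitPlane)
  rw [mul_inv_cancel₀ hj, inv_one, one_smul] at hlog
  refine (hlog.const_add (L u j)).congr_of_eventuallyEq ?_
  have hcont : ContinuousAt (fun v => L v j - (L u j + Complex.log (v j * (u j)⁻¹))) u := by
    refine ContinuousAt.sub ?_ (continuousAt_const.add hlog.continuousAt)
    exact (continuous_apply j).continuousAt.comp (h.cont.continuousAt (h.isOpen.mem_nhds hu))
  have hev := eventually_eq_zero_of_exp_eq_one hcont (by
    rw [mul_inv_cancel₀ hj, Complex.log_one]; ring) (by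
    filter_upwards [h.isOpen.mem_nhds hu] with v hv
    have hvj := h.ne_zero hv j
    rw [Complex.exp_sub, Complex.exp_add, h.exp_eq v hv, h.exp_eq u hu,
      Complex.exp_log (mul_ne_zero hvj (inv_ne_zero hj))]
    field_simp)
  filter_upwards [hev] with v hv
  exact (sub_eq_zero.mp hv).symm

end LogBranches

/-! ### Partial derivatives of u^γ g(∑ b_j log u_j) -/

section GKZCalculus
open Polynomial

variable {n : ℕ} {U : Set (Fin n ⊕ Fin n → ℂ)} {L : (Fin n ⊕ Fin n → ℂ) → (Fin n ⊕ Fin n → ℂ)}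

lemma IsLogBranch.hasStrictFDerivAt_sum (h : IsLogBranch U L) {u : Fin n ⊕ Fin n → ℂ} (hu : u ∈ U)
    (γ : Fin n ⊕ Fin n → ℂ) : HasStrictFDerivAt (fun v => ∑ j, γ j * L v j)
      (∑ j, γ j • ((u j)⁻¹ • (ContinuousLinearMap.proj j : (Fin n ⊕ Fin n → ℂ) →L[ℂ] ℂ))) u :=
  HasStrictFDerivAt.fun_sum fun j _ => (h.hasStrictFDerivAt hu j).const_mul (γ j)

/-- The function `u^γ (p(d/dz) J)(∑ b_j log u_j)`. -/
noncomputable def powFun (L : (Fin n ⊕ Fin n → ℂ) → (Fin n ⊕ Fin n → ℂ)) (J : ℂ → ℂ)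
    (γ : Fin n ⊕ Fin n → ℂ) (p : ℂ[X]) (u : Fin n ⊕ Fin n → ℂ) : ℂ :=
  Complex.exp (∑ j, γ j * L u j) * polyD p J (logB n (L u))

/-- This class of functions is closed under differentiation: ∂_j lowers γ_j by one and composes the
operator p with b_j D + γ_j. Monomial derivatives are thereby reduced to polynomial algebra. -/
lemma hasFDerivAt_powFun (h : IsLogBranch U L) {J : ℂ → ℂ} {u : Fin n ⊕ Fin n → ℂ} (hu : u ∈ U)
    (hJ : AnalyticAt ℂ J (logB n (L u))) (γ : Fin n ⊕ Fin n → ℂ) (p : ℂ[X]) :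
    HasFDerivAt (powFun L J γ p)
      (∑ j, powFun L J (γ - Pi.single j 1) ((C (gkzB n j : ℂ) * X + C (γ j)) * p) u •
        (ContinuousLinearMap.proj j : (Fin n ⊕ Fin n → ℂ) →L[ℂ] ℂ)) u := by
  have h1 := (h.hasStrictFDerivAt_sum hu γ).hasFDerivAt.cexp
  have h2 := (h.hasStrictFDerivAt_sum hu fun j => (gkzB n j : ℂ)).hasFDerivAt
  have h3 : HasDerivAt (polyD p J) (polyD (X * p) J (logB n (L u))) (logB n (L u)) := by
    rw [polyD_X_mul hJ]
    exact (analyticAt_polyD hJ p).differentiableAt.hasDerivAt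
  have h4 := h1.fun_mul (HasDerivAt.comp_hasFDerivAt (f := fun v => logB n (L v)) u h3 h2)
  refine h4.congr_fderiv ?_
  ext v
  have hexp : ∀ j, Complex.exp (∑ i, (γ - Pi.single j 1 : Fin n ⊕ Fin n → ℂ) i * L u i) =
      Complex.exp (∑ i, γ i * L u i) * (u j)⁻¹ := by
    intro j
    rw [← h.exp_eq u hu j, ← Complex.exp_neg, ← Complex.exp_add]
    congr 1
    simp only [Pi.sub_apply, sub_mul, Finset.sum_sub_distrib, Pi.single_apply, ite_mul, one_mul,
      zero_mul, Finset.sum_ite_eq', Finset.mem_univ, if_true]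
    ring
  have hpoly : ∀ j, polyD ((C (gkzB n j : ℂ) * X + C (γ j)) * p) J (logB n (L u)) =
      (gkzB n j : ℂ) * polyD (X * p) J (logB n (L u)) + γ j * polyD p J (logB n (L u)) := by
    intro j
    rw [add_mul, mul_assoc, polyD_add, polyD_C_mul, polyD_C_mul]
  simp only [powFun, hexp, hpoly, add_apply, smul_apply,
    sum_apply, ContinuousLinearMap.proj_apply, smul_eq_mul, Finset.mul_sum,
    Function.comp_apply]
  rw [← Finset.sum_add_distrib]
  refine Finset.sum_congr rfl fun j _ => ?_
  ring

lemma partialDeriv_powFun (h : IsLogBranch U L) {J : ℂ → ℂ} {u : Fin n ⊕ Fin n → ℂ} (hu : u ∈ U)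
    (hJ : AnalyticAt ℂ J (logB n (L u))) (γ : Fin n ⊕ Fin n → ℂ) (p : ℂ[X]) (j : Fin n ⊕ Fin n) :
    partialDeriv j (powFun L J γ p) u =
      powFun L J (γ - Pi.single j 1) ((C (gkzB n j : ℂ) * X + C (γ j)) * p) u := by
  rw [partialDeriv, (hasFDerivAt_powFun h hu hJ γ p).fderiv]
  rw [sum_apply, Finset.sum_eq_single j]
  · simp
  · intro i _ hij
    simp [hij]
  · simp

lemma partialDeriv_congr {N : Type*} [Fintype N] [DecidableEq N] {U : Set (N → ℂ)} (hU : IsOpen U)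
    {Φ Ψ : (N → ℂ) → ℂ} (h : ∀ u ∈ U, Φ u = Ψ u) (j : N) :
    ∀ u ∈ U, partialDeriv j Φ u = partialDeriv j Ψ u := by
  intro u hu
  unfold partialDeriv
  rw [Filter.EventuallyEq.fderiv_eq (Filter.eventually_of_mem (hU.mem_nhds hu) h)]

lemma partialDeriv_iterate_congr {N : Type*} [Fintype N] [DecidableEq N] {U : Set (N → ℂ)}
    (hU : IsOpen U) {Φ Ψ : (N → ℂ) → ℂ} (h : ∀ u ∈ U, Φ u = Ψ u) (j : N) (m : ℕ) :
    ∀ u ∈ U, (partialDeriv j)^[m] Φ u = (partialDeriv j)^[m] Ψ u := by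
  induction m with
  | zero => exact h
  | succ m ih =>
    simp only [Function.iterate_succ_apply']
    exact partialDeriv_congr hU ih j

lemma monomialDeriv_congr {N : Type*} [Fintype N] [DecidableEq N] {U : Set (N → ℂ)}
    (hU : IsOpen U) {Φ Ψ : (N → ℂ) → ℂ} (h : ∀ u ∈ U, Φ u = Ψ u) (p : N → ℕ) :
    ∀ u ∈ U, monomialDeriv p Φ u = monomialDeriv p Ψ u := by
  unfold monomialDeriv
  induction (Finset.univ : Finset N).toList with
  | nil => exact h
  | cons j l ih => exact partialDeriv_iterate_congr hU ih j (p j)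

/-- The polynomial `∏_{i < m} (b X + g - i)`. -/
noncomputable def fallPoly (b g : ℂ) (m : ℕ) : ℂ[X] :=
  ∏ i ∈ Finset.range m, (C b * X + C (g - i))

lemma iterate_partialDeriv_powFun (h : IsLogBranch U L) {J : ℂ → ℂ}
    (hJ : ∀ u ∈ U, AnalyticAt ℂ J (logB n (L u))) (γ : Fin n ⊕ Fin n → ℂ) (p : ℂ[X])
    (j : Fin n ⊕ Fin n) (m : ℕ) : ∀ u ∈ U, (partialDeriv j)^[m] (powFun L J γ p) u =
      powFun L J (γ - Pi.single j (m : ℂ)) (fallPoly (gkzB n j) (γ j) m * p) u := by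
  induction m with
  | zero => intro u _; simp [fallPoly]
  | succ m ih =>
    intro u hu
    rw [Function.iterate_succ_apply', partialDeriv_congr h.isOpen ih j u hu,
      partialDeriv_powFun h hu (hJ u hu)]
    congr 1
    · rw [sub_sub, ← Pi.single_add]
      push_cast
      rfl
    · rw [fallPoly, fallPoly, Finset.prod_range_succ]
      simp only [Pi.sub_apply, Pi.single_eq_same]
      ring

/-- Derivatives in other variables leave γ_j unchanged, so the falling factorials of the different
variables simply multiply. -/
lemma monomialDeriv_powFun (h : IsLogBranch U L) {J : ℂ → ℂ}
    (hJ : ∀ u ∈ U, AnalyticAt ℂ J (logB n (L u))) (γ : Fin n ⊕ Fin n → ℂ)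
    (q : Fin n ⊕ Fin n → ℕ) : ∀ u ∈ U, monomialDeriv q (powFun L J γ 1) u =
      powFun L J (fun j => γ j - q j) (∏ j, fallPoly (gkzB n j) (γ j) (q j)) u := by
  classical
  have key : ∀ l : List (Fin n ⊕ Fin n), l.Nodup → ∀ u ∈ U,
      l.foldr (fun j g => (partialDeriv j)^[q j] g) (powFun L J γ 1) u =
        powFun L J (fun j => γ j - if j ∈ l then (q j : ℂ) else 0)
          ((l.map fun j => fallPoly (gkzB n j) (γ j) (q j)).prod) u := by
    intro l hl
    induction l with
    | nil => intro u _; simp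
    | cons j l ih =>
      intro u hu
      obtain ⟨hjl, hl'⟩ := List.nodup_cons.mp hl
      rw [List.foldr_cons, partialDeriv_iterate_congr h.isOpen (ih hl') j (q j) u hu,
        iterate_partialDeriv_powFun h hJ _ _ j _ u hu, List.map_cons, List.prod_cons]
      congr 1
      · funext i
        rcases eq_or_ne i j with rfl | hij
        · simp [hjl]
        · simp [hij]
      · simp [hjl]
  intro u hu
  rw [monomialDeriv, key _ (Finset.nodup_toList _) u hu]
  congr 1
  · funext j; simp
  · rw [Finset.prod_map_toList]

end GKZCalculus

/-! ### From the hypergeometric equation to the GKZ system -/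

section GKZSolutions
open Polynomial

variable {n : ℕ} {U : Set (Fin n ⊕ Fin n → ℂ)} {L : (Fin n ⊕ Fin n → ℂ) → (Fin n ⊕ Fin n → ℂ)}

/-- Iteration of the equation: in the step from k to k + 1 the factor (D - k)^n, moved past e^(kz),
becomes D^n, to which the equation applies once more. These are the toric equations of the relations
k b. -/
lemma polyD_fall_iterate {J : ℂ → ℂ} {Z : Set ℂ}
    (hJ : IsExpODESolution (X ^ n) (rhoPoly n) ((-1) ^ n) Z J) (hZ : IsOpen Z) (k : ℕ) :
    ∀ z ∈ Z, polyD ((∏ i ∈ Finset.range k, (X - C (i : ℂ))) ^ n) J z =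
      (-1) ^ (n * k) * Complex.exp (k * z) *
        polyD (∏ i ∈ Finset.range k, (rhoPoly n).comp (X + C (i : ℂ))) J z := by
  induction k with
  | zero => intro z _; simp
  | succ k ih =>
    intro z hz
    have hJz := hJ.1 z hz
    obtain ⟨R, hR⟩ : ∃ R, R = ∏ i ∈ Finset.range k, (rhoPoly n).comp (X + C (i : ℂ)) := ⟨_, rfl⟩
    rw [← hR] at ih
    have h1 : polyD ((∏ i ∈ Finset.range k, (X - C (i : ℂ))) ^ n) J =ᶠ[𝓝 z]
        fun y => (-1) ^ (n * k) * (Complex.exp (k * y) * polyD R J y) :=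
      Filter.eventually_of_mem (hZ.mem_nhds hz) fun y hy => by rw [ih y hy, mul_assoc]
    have h2 : polyD (X ^ n) J =ᶠ[𝓝 z]
        fun y => (-1) ^ n * (Complex.exp (1 * y) * polyD (rhoPoly n) J y) :=
      Filter.eventually_of_mem (hZ.mem_nhds hz) fun y hy => by
        beta_reduce; rw [hJ.2 y hy, one_mul, mul_assoc]
    have hE : ∀ a : ℂ, AnalyticAt ℂ (fun y => Complex.exp (a * y)) z := fun a => by fun_prop
    rw [Finset.prod_range_succ, mul_pow, mul_comm, polyD_mul hJz, polyD_congr h1,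
      polyD_fun_const_mul ((hE k).fun_mul (analyticAt_polyD hJz R)),
      polyD_exp_mul (analyticAt_polyD hJz R)]
    have h3 : ((X - C (k : ℂ)) ^ n).comp (X + C (k : ℂ)) = X ^ n := by simp
    rw [h3, ← polyD_mul hJz, mul_comm (X ^ n), polyD_mul hJz, polyD_congr h2,
      polyD_fun_const_mul ((hE 1).fun_mul (analyticAt_polyD hJz _)),
      polyD_exp_mul (analyticAt_polyD hJz _), ← polyD_mul hJz]
    have h4 : R.comp (X + C 1) * rhoPoly n =
        ∏ i ∈ Finset.range (k + 1), (rhoPoly n).comp (X + C (i : ℂ)) := by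
      rw [Finset.prod_range_succ', hR, prod_comp]
      congr 1
      · refine Finset.prod_congr rfl fun i _ => ?_
        rw [comp_assoc]
        congr 1
        simp
        ring
      · simp
    rw [h4, Nat.cast_succ, add_mul, Complex.exp_add, Nat.mul_succ, pow_add]
    ring

/-- `γ₀` as a complex vector. -/
noncomputable def cGamma0 (n : ℕ) : Fin n ⊕ Fin n → ℂ := fun j => (gkzGamma0 n j : ℂ)

lemma powFun_cGamma0 (L : (Fin n ⊕ Fin n → ℂ) → (Fin n ⊕ Fin n → ℂ)) (J : ℂ → ℂ) :
    powFun L J (cGamma0 n) 1 = fun u => Complex.exp (logGamma0 n (L u)) * J (logB n (L u)) := by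
  funext u
  rw [powFun, polyD_one]
  rfl

lemma monomialDeriv_powFun_inl (h : IsLogBranch U L) {J : ℂ → ℂ}
    (hJ : ∀ u ∈ U, AnalyticAt ℂ J (logB n (L u))) (k : ℕ) {u : Fin n ⊕ Fin n → ℂ} (hu : u ∈ U) :
    monomialDeriv (Sum.elim (fun _ => k) fun _ => 0) (powFun L J (cGamma0 n) 1) u =
      Complex.exp (logGamma0 n (L u) - k * ∑ i, L u (Sum.inl i)) *
        polyD ((∏ i ∈ Finset.range k, (X - C (i : ℂ))) ^ n) J (logB n (L u)) := by
  rw [monomialDeriv_powFun h hJ _ _ u hu, powFun]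
  congr 2
  · rw [logGamma0]
    simp only [sub_mul, Finset.sum_sub_distrib]
    congr 1
    rw [Fintype.sum_sum_type, Finset.mul_sum]
    simp
  · rw [Fintype.prod_sum_type]
    simp [fallPoly, cGamma0, gkzGamma0, gkzB, sub_eq_add_neg]

lemma monomialDeriv_powFun_inr (h : IsLogBranch U L) {J : ℂ → ℂ}
    (hJ : ∀ u ∈ U, AnalyticAt ℂ J (logB n (L u))) (k : ℕ) {u : Fin n ⊕ Fin n → ℂ} (hu : u ∈ U) :
    monomialDeriv (Sum.elim (fun _ => 0) fun _ => k) (powFun L J (cGamma0 n) 1) u =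
      Complex.exp (logGamma0 n (L u) - k * ∑ i, L u (Sum.inr i)) *
        ((-1) ^ (n * k) *
          polyD (∏ i ∈ Finset.range k, (rhoPoly n).comp (X + C (i : ℂ))) J (logB n (L u))) := by
  rw [monomialDeriv_powFun h hJ _ _ u hu, powFun, ← polyD_C_mul ((-1) ^ (n * k))]
  congr 2
  · rw [logGamma0]
    simp only [sub_mul, Finset.sum_sub_distrib]
    congr 1
    rw [Fintype.sum_sum_type, Finset.mul_sum]
    simp
  · have h1 : ∀ i : ℕ, (rhoPoly n).comp (X + C (i : ℂ)) =
        C ((-1) ^ n) * ∏ j : Fin n, (C (-1) * X + C (-(rho n j : ℂ) - i)) := by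
      intro i
      have h2 : ∀ j : Fin n, C (-1) * X + C (-(rho n j : ℂ) - i) =
          C (-1) * (X + C (i : ℂ) + C (rho n j : ℂ)) := by
        intro j
        simp only [map_sub, map_neg, map_one]
        ring
      simp only [h2, Finset.prod_mul_distrib, Finset.prod_const, Finset.card_univ, Fintype.card_fin,
        ← C_pow]
      rw [← mul_assoc, ← C_mul, ← mul_pow, rhoPoly, prod_comp]
      simp
    simp only [h1, Finset.prod_mul_distrib, Finset.prod_const, Finset.card_range, ← C_pow]
    rw [← mul_assoc, ← C_mul, ← pow_mul, ← mul_pow, Finset.prod_comm, Fintype.prod_sum_type]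
    simp [fallPoly, cGamma0, gkzGamma0, gkzB]

lemma toNat_smul_gkzB (k : ℕ) :
    (fun j => (((k : ℤ) • gkzB n) j).toNat) = Sum.elim (fun _ => k) fun _ => 0 := by
  funext j
  rcases j with j | j <;> simp [gkzB]

lemma toNat_neg_smul_gkzB (k : ℕ) :
    (fun j => (-((k : ℤ) • gkzB n) j).toNat) = Sum.elim (fun _ => 0) fun _ => k := by
  funext j
  rcases j with j | j <;> simp [gkzB]

lemma sum_gkzMatrix_gkzB (hn : 0 < n) (i : Fin n ⊕ Fin (n - 1)) :
    ∑ j, (gkzMatrix n i j : ℂ) * (gkzB n j : ℂ) = 0 := by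
  rcases i with i | r
  · rw [sum_gkzMatrix_inl (K := ℂ) i (fun j => (gkzB n j : ℂ))]; simp [gkzB]
  · rw [sum_gkzMatrix_inr (K := ℂ) hn r (fun j => (gkzB n j : ℂ))]; simp [gkzB]

/-- Homogeneity follows from A b = 0 and A γ₀ = α. Every relation is a multiple of b, so the toric
equations are those of `polyD_fall_iterate`, up to exchanging the sides. -/
lemma isGKZSolution_of_isExpODESolution (hn : 0 < n) (h : IsLogBranch U L) {J : ℂ → ℂ} {Z : Set ℂ}
    (hJ : IsExpODESolution (X ^ n) (rhoPoly n) ((-1) ^ n) Z J) (hZ : IsOpen Z)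
    (hUZ : ∀ u ∈ U, logB n (L u) ∈ Z) :
    IsGKZSolution (gkzMatrix n) (gkzAlpha n) U
      (fun u => Complex.exp (logGamma0 n (L u)) * J (logB n (L u))) := by
  have hJu : ∀ u ∈ U, AnalyticAt ℂ J (logB n (L u)) := fun u hu => hJ.1 _ (hUZ u hu)
  rw [← powFun_cGamma0]
  have htoric : ∀ k : ℕ, ∀ u ∈ U,
      monomialDeriv (Sum.elim (fun _ => k) fun _ => 0) (powFun L J (cGamma0 n) 1) u =
        monomialDeriv (Sum.elim (fun _ => 0) fun _ => k) (powFun L J (cGamma0 n) 1) u := by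
    intro k u hu
    rw [monomialDeriv_powFun_inl h hJu k hu, monomialDeriv_powFun_inr h hJu k hu,
      polyD_fall_iterate hJ hZ k _ (hUZ u hu)]
    have h1 : Complex.exp (logGamma0 n (L u) - k * ∑ i, L u (Sum.inr i)) =
        Complex.exp (logGamma0 n (L u) - k * ∑ i, L u (Sum.inl i)) *
          Complex.exp (k * logB n (L u)) := by
      rw [← Complex.exp_add, logB_eq]; congr 1; ring
    rw [h1]
    ring
  refine ⟨fun u hu =>
    (hasFDerivAt_powFun h hu (hJu u hu) _ _).differentiableAt.differentiableWithinAt, ?_, ?_⟩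
  · intro u hu i
    have h1 : ∀ j, (gkzMatrix n i j : ℂ) * u j * partialDeriv j (powFun L J (cGamma0 n) 1) u =
        Complex.exp (logGamma0 n (L u)) * deriv J (logB n (L u)) *
          ((gkzMatrix n i j : ℂ) * (gkzB n j : ℂ)) +
        powFun L J (cGamma0 n) 1 u * ((gkzMatrix n i j : ℂ) * (gkzGamma0 n j : ℂ)) := by
      intro j
      have hexp : u j * Complex.exp (∑ i, (cGamma0 n - Pi.single j 1 : Fin n ⊕ Fin n → ℂ) i * L u i) =
          Complex.exp (logGamma0 n (L u)) := by
        rw [← h.exp_eq u hu j, ← Complex.exp_add, logGamma0]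
        congr 1
        simp only [Pi.sub_apply, sub_mul, Finset.sum_sub_distrib, Pi.single_apply, ite_mul, one_mul,
          zero_mul, Finset.sum_ite_eq', Finset.mem_univ, if_true, cGamma0]
        ring
      have hX : polyD X J (logB n (L u)) = deriv J (logB n (L u)) := by
        have := polyD_X_pow 1 J (logB n (L u))
        rwa [pow_one, iteratedDeriv_one] at this
      rw [partialDeriv_powFun h hu (hJu u hu), powFun_cGamma0, powFun, mul_one, polyD_add,
        polyD_C_mul, polyD_C, hX]
      beta_reduce
      rw [← hexp, cGamma0]
      ring
    simp only [h1]
    rw [Finset.sum_add_distrib, ← Finset.mul_sum, ← Finset.mul_sum, sum_gkzMatrix_gkzB hn,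
      ← gkzAlpha_eq hn]
    ring
  · intro l hl u hu
    obtain ⟨c, rfl⟩ := (gkzMatrix_mulVec_eq_zero_iff hn l).mp hl
    obtain ⟨k, rfl | rfl⟩ := Int.eq_nat_or_neg c
    · rw [toNat_smul_gkzB, toNat_neg_smul_gkzB]
      exact htoric k u hu
    · simp only [neg_smul, Pi.neg_apply, neg_neg]
      rw [toNat_smul_gkzB, toNat_neg_smul_gkzB]
      exact (htoric k u hu).symm

lemma hasStrictFDerivAt_logB (h : IsLogBranch U L) {u : Fin n ⊕ Fin n → ℂ} (hu : u ∈ U) :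
    HasStrictFDerivAt (fun v => logB n (L v)) (∑ j, (gkzB n j : ℂ) •
      ((u j)⁻¹ • (ContinuousLinearMap.proj j : (Fin n ⊕ Fin n → ℂ) →L[ℂ] ℂ))) u :=
  h.hasStrictFDerivAt_sum hu _

/-- The map u ↦ ∑ b_j log u_j is open, its differential being surjective already in the first
coordinate. -/
lemma image_logB_mem_nhds (hn : 0 < n) (h : IsLogBranch U L) {u : Fin n ⊕ Fin n → ℂ} (hu : u ∈ U) :
    (fun v => logB n (L v)) '' U ∈ 𝓝 (logB n (L u)) := by
  have h1 := hasStrictFDerivAt_logB h hu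
  have h2 := h1.map_nhds_eq_of_surj ?_
  · rw [← h2]
    exact image_mem_map (h.isOpen.mem_nhds hu)
  · rw [LinearMap.range_eq_top]
    intro z
    refine ⟨Pi.single (Sum.inl ⟨0, hn⟩) (z * u (Sum.inl ⟨0, hn⟩)), ?_⟩
    have hne := h.ne_zero hu (Sum.inl ⟨0, hn⟩)
    rw [ContinuousLinearMap.coe_coe, sum_apply, Finset.sum_eq_single (Sum.inl ⟨0, hn⟩)]
    · simp [gkzB]
      field_simp
    · intro j _ hj
      simp [hj]
    · simp

end GKZSolutions

/-! ### Local form of an arbitrary GKZ solution -/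

section GKZLocalForm
open Polynomial

variable {n : ℕ} {U : Set (Fin n ⊕ Fin n → ℂ)} {L : (Fin n ⊕ Fin n → ℂ) → (Fin n ⊕ Fin n → ℂ)}

/-- `logB` as a continuous linear map. -/
noncomputable def logBL (n : ℕ) : (Fin n ⊕ Fin n → ℂ) →L[ℂ] ℂ :=
  ∑ j, (gkzB n j : ℂ) • (ContinuousLinearMap.proj j : (Fin n ⊕ Fin n → ℂ) →L[ℂ] ℂ)

lemma logBL_apply (w : Fin n ⊕ Fin n → ℂ) : logBL n w = logB n w := by
  simp [logBL, logB, sum_apply]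

/-- A vector annihilated by the matrix is a multiple of `b`. -/
lemma exists_eq_mul_gkzB (hn : 0 < n) {v : Fin n ⊕ Fin n → ℂ}
    (hv : ∀ i, ∑ j, (gkzMatrix n i j : ℂ) * v j = 0) : ∃ q : ℂ, ∀ j, v j = q * (gkzB n j : ℂ) := by
  have h1 : ∀ i, v (Sum.inl i) = -v (Sum.inr i) := fun i => by
    have := hv (Sum.inl i)
    rw [sum_gkzMatrix_inl] at this
    linear_combination this
  have h2 : ∀ i, v (Sum.inr i) = -v (Sum.inl (lastIdx hn)) := fun i => by
    rcases eq_lastIdx_or hn i with rfl | ⟨r, rfl⟩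
    · rw [h1, neg_neg]
    · have := hv (Sum.inr r)
      rw [sum_gkzMatrix_inr hn] at this
      linear_combination this
  refine ⟨v (Sum.inl (lastIdx hn)), fun j => ?_⟩
  rcases j with i | i
  · rw [h1, h2]; simp [gkzB]
  · rw [h2]; simp [gkzB]

/-- The coordinatewise exponential. -/
noncomputable def expVec {N : Type*} (w : N → ℂ) : N → ℂ := fun j => Complex.exp (w j)

/-- A solution of the homogeneity equations, in logarithmic coordinates and divided by `u^{γ₀}`, has
its differential proportional to `b`. -/
lemma exists_hasFDerivAt_log (hn : 0 < n) (hU : IsOpen U) {F : (Fin n ⊕ Fin n → ℂ) → ℂ}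
    (hF : IsGKZSolution (gkzMatrix n) (gkzAlpha n) U F) {w : Fin n ⊕ Fin n → ℂ} (hw : expVec w ∈ U) :
    ∃ Q : ℂ, HasFDerivAt (fun w => F (expVec w) * Complex.exp (-logGamma0 n w)) (Q • logBL n) w := by
  have hdF : HasFDerivAt F (fderiv ℂ F (expVec w)) (expVec w) :=
    (hF.1.differentiableAt (hU.mem_nhds hw)).hasFDerivAt
  obtain ⟨q, hq⟩ := exists_eq_mul_gkzB hn (v := fun j => expVec w j * partialDeriv j F (expVec w) -
    (gkzGamma0 n j : ℂ) * F (expVec w)) fun i => by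
      have h1 := hF.2.1 _ hw i
      rw [gkzAlpha_eq hn, Finset.sum_mul] at h1
      simp only [mul_sub, Finset.sum_sub_distrib, ← mul_assoc]
      rw [h1, sub_self]
  have hE : HasFDerivAt (fun w : Fin n ⊕ Fin n → ℂ => expVec w) (ContinuousLinearMap.pi fun j =>
      Complex.exp (w j) • (ContinuousLinearMap.proj j : (Fin n ⊕ Fin n → ℂ) →L[ℂ] ℂ)) w := by
    rw [hasFDerivAt_pi]
    exact fun j => (ContinuousLinearMap.proj j : (Fin n ⊕ Fin n → ℂ) →L[ℂ] ℂ).hasFDerivAt.cexp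
  have hG : HasFDerivAt (fun w : Fin n ⊕ Fin n → ℂ => -logGamma0 n w)
      (-∑ j, (gkzGamma0 n j : ℂ) • (ContinuousLinearMap.proj j : (Fin n ⊕ Fin n → ℂ) →L[ℂ] ℂ)) w := by
    refine HasFDerivAt.fun_neg (HasFDerivAt.fun_sum fun j _ => ?_)
    exact (ContinuousLinearMap.proj j : (Fin n ⊕ Fin n → ℂ) →L[ℂ] ℂ).hasFDerivAt.const_mul _
  refine ⟨Complex.exp (-logGamma0 n w) * q,
    ((hdF.comp w hE).fun_mul hG.cexp).congr_fderiv ?_⟩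
  ext v
  have hsum : (fderiv ℂ F (expVec w)) (fun j => Complex.exp (w j) * v j) =
      ∑ j, Complex.exp (w j) * v j * partialDeriv j F (expVec w) := by
    rw [← ContinuousLinearMap.coe_coe, LinearMap.pi_apply_eq_sum_univ]
    refine Finset.sum_congr rfl fun j _ => ?_
    have : (fun i => if j = i then (1 : ℂ) else 0) = Pi.single j 1 := by
      funext i
      simp [Pi.single_apply, eq_comm]
    rw [this]
    rfl
  have hv : (ContinuousLinearMap.pi fun j => Complex.exp (w j) •
      (ContinuousLinearMap.proj j : (Fin n ⊕ Fin n → ℂ) →L[ℂ] ℂ)) v =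
      fun j => Complex.exp (w j) * v j := by
    funext j; simp
  simp only [add_apply, smul_apply, ContinuousLinearMap.comp_apply, neg_apply, sum_apply, hv, hsum,
    logBL, ContinuousLinearMap.proj_apply, smul_eq_mul, Function.comp_apply]
  rw [mul_neg, mul_neg, Finset.mul_sum, Finset.mul_sum, Finset.mul_sum, Finset.mul_sum,
    neg_add_eq_sub, ← Finset.sum_sub_distrib]
  refine Finset.sum_congr rfl fun j _ => ?_
  have := hq j
  simp only [expVec] at this ⊢
  linear_combination Complex.exp (-logGamma0 n w) * v j * this

lemma logB_add (w v : Fin n ⊕ Fin n → ℂ) : logB n (w + v) = logB n w + logB n v := by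
  rw [← logBL_apply, ← logBL_apply, ← logBL_apply, map_add]

lemma logB_smul (a : ℂ) (v : Fin n ⊕ Fin n → ℂ) : logB n (a • v) = a * logB n v := by
  rw [← logBL_apply, ← logBL_apply, map_smul, smul_eq_mul]

/-- Along the segment joining two points of a fibre of `logB` the derivative vanishes; convexity
keeps the segment inside B. -/
lemma eq_of_logB_eq {g : (Fin n ⊕ Fin n → ℂ) → ℂ} {B : Set (Fin n ⊕ Fin n → ℂ)} (hB : Convex ℝ B)
    (hg : ∀ w ∈ B, ∃ Q : ℂ, HasFDerivAt g (Q • logBL n) w) {w v : Fin n ⊕ Fin n → ℂ} (hw : w ∈ B)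
    (hv : v ∈ B) (h : logB n w = logB n v) : g v = g w := by
  have hseg : ∀ τ ∈ Set.Icc (0 : ℝ) 1, w + τ • (v - w) ∈ B := fun τ hτ =>
    hB.add_smul_sub_mem hw hv hτ
  have hd : ∀ τ ∈ Set.Icc (0 : ℝ) 1,
      HasDerivAt (fun τ : ℝ => g (w + τ • (v - w))) 0 τ := by
    intro τ hτ
    obtain ⟨Q, hQ⟩ := hg _ (hseg τ hτ)
    have hp : HasDerivAt (fun τ : ℝ => w + τ • (v - w)) (v - w) τ := by
      simpa using ((hasDerivAt_id' τ).smul_const (v - w)).const_add w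
    have h2 := (hQ.restrictScalars ℝ).comp_hasDerivAt τ hp
    have h3 : (Q • logBL n) (v - w) = 0 := by
      rw [smul_apply, map_sub, logBL_apply, logBL_apply, h, sub_self, smul_zero]
    rw [ContinuousLinearMap.coe_restrictScalars', h3] at h2
    exact h2
  have h1 := constant_of_has_deriv_right_zero
    (fun τ hτ => (hd τ hτ).continuousAt.continuousWithinAt)
    (fun τ hτ => (hd τ (Set.Ico_subset_Icc_self hτ)).hasDerivWithinAt) 1
    (Set.right_mem_Icc.mpr zero_le_one)
  simpa using h1

/-- Near every point, a solution of the GKZ system is `u^{γ₀} ψ(∑ b_j log u_j)` for a solution `ψ` of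
the hypergeometric equation. -/
lemma IsGKZSolution.exists_local_form (hn : 0 < n) (h : IsLogBranch U L)
    {F : (Fin n ⊕ Fin n → ℂ) → ℂ} (hF : IsGKZSolution (gkzMatrix n) (gkzAlpha n) U F)
    {u₀ : Fin n ⊕ Fin n → ℂ} (hu₀ : u₀ ∈ U) {S : Set ℂ} (hS : S ∈ 𝓝 (logB n (L u₀))) :
    ∃ (r : ℝ) (ψ : ℂ → ℂ) (V : Set (Fin n ⊕ Fin n → ℂ)), 0 < r ∧
      Metric.ball (logB n (L u₀)) r ⊆ S ∧
      IsExpODESolution (X ^ n) (rhoPoly n) ((-1) ^ n) (Metric.ball (logB n (L u₀)) r) ψ ∧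
      IsOpen V ∧ u₀ ∈ V ∧ V ⊆ U ∧ (∀ u ∈ V, logB n (L u) ∈ Metric.ball (logB n (L u₀)) r) ∧
      ∀ u ∈ V, F u = Complex.exp (logGamma0 n (L u)) * ψ (logB n (L u)) := by
  obtain ⟨w₀, hw₀⟩ : ∃ w₀, w₀ = L u₀ := ⟨_, rfl⟩
  obtain ⟨z₀, hz₀⟩ : ∃ z₀, z₀ = logB n w₀ := ⟨_, rfl⟩
  -- A direction transversal to the fibres of `logB`.
  obtain ⟨e, he⟩ : ∃ e : Fin n ⊕ Fin n → ℂ, logB n e = 1 := by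
    refine ⟨Pi.single (Sum.inl ⟨0, hn⟩) 1, ?_⟩
    rw [logB, Finset.sum_eq_single (Sum.inl ⟨0, hn⟩)]
    · simp [gkzB]
    · intro j _ hj; simp [hj]
    · simp
  obtain ⟨g, hg⟩ : ∃ g : (Fin n ⊕ Fin n → ℂ) → ℂ,
    g = fun w => F (expVec w) * Complex.exp (-logGamma0 n w) := ⟨_, rfl⟩
  have hexpVec : Continuous fun w : Fin n ⊕ Fin n → ℂ => expVec w := by
    unfold expVec; fun_prop
  have hlogB : Continuous (logB n) := by unfold logB; fun_prop
  have hexp : ∀ u ∈ U, expVec (L u) = u := fun u hu => funext fun j => h.exp_eq u hu j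
  obtain ⟨ε, hε, hεU⟩ := Metric.isOpen_iff.mp (h.isOpen.preimage hexpVec) w₀ (by
    rw [Set.mem_preimage, hw₀, hexp _ hu₀]; exact hu₀)
  have hgd : ∀ w ∈ Metric.ball w₀ ε, ∃ Q : ℂ, HasFDerivAt g (Q • logBL n) w := fun w hw => by
    rw [hg]; exact exists_hasFDerivAt_log hn h.isOpen hF (hεU hw)
  have hline : Continuous fun ζ : ℂ => w₀ + (ζ - z₀) • e := by fun_prop
  obtain ⟨r₁, hr₁, hr₁B⟩ := Metric.isOpen_iff.mp (Metric.isOpen_ball.preimage hline :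
    IsOpen ((fun ζ : ℂ => w₀ + (ζ - z₀) • e) ⁻¹' Metric.ball w₀ ε)) z₀ (by simpa using hε)
  -- `logB` takes the value ζ at w₀ + (ζ - z₀) e, so ψ records the value of g on each fibre.
  obtain ⟨ψ, hψ⟩ : ∃ ψ : ℂ → ℂ, ψ = fun ζ => g (w₀ + (ζ - z₀) • e) := ⟨_, rfl⟩
  have hψd : DifferentiableOn ℂ ψ (Metric.ball z₀ r₁) := by
    intro ζ hζ
    obtain ⟨Q, hQ⟩ := hgd _ (hr₁B hζ)
    rw [hψ]
    refine (DifferentiableAt.fun_comp' ζ (g := g) hQ.differentiableAt ?_).differentiableWithinAt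
    fun_prop
  have hψa := hψd.analyticOnNhd Metric.isOpen_ball
  obtain ⟨V, hV⟩ : ∃ V, V = U ∩ L ⁻¹' (Metric.ball w₀ ε ∩ logB n ⁻¹' Metric.ball z₀ r₁) := ⟨_, rfl⟩
  have hVo : IsOpen V := by
    rw [hV]
    exact h.cont.isOpen_inter_preimage h.isOpen
      (Metric.isOpen_ball.inter (Metric.isOpen_ball.preimage hlogB))
  have hVU : V ⊆ U := hV ▸ Set.inter_subset_left
  have hu₀V : u₀ ∈ V := by
    rw [hV]
    refine ⟨hu₀, ?_, ?_⟩
    · rw [← hw₀]; exact Metric.mem_ball_self hε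
    · rw [Set.mem_preimage, ← hw₀, ← hz₀]; exact Metric.mem_ball_self hr₁
  have hFV : ∀ u ∈ V, F u = Complex.exp (logGamma0 n (L u)) * ψ (logB n (L u)) := by
    intro u hu
    rw [hV] at hu
    obtain ⟨hu1, hu2, hu3⟩ := hu
    have h1 := eq_of_logB_eq (convex_ball w₀ ε) hgd hu2 (hr₁B hu3) (by
      rw [logB_add, logB_smul, he, ← hz₀]; ring)
    rw [hψ]
    beta_reduce
    rw [h1, hg]
    beta_reduce
    rw [hexp u hu1, mul_left_comm, ← Complex.exp_add, add_neg_cancel, Complex.exp_zero, mul_one]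
  have hbV := h.mono hVo hVU
  have hψu : ∀ u ∈ V, AnalyticAt ℂ ψ (logB n (L u)) := fun u hu => hψa _ (by
    rw [hV] at hu; exact hu.2.2)
  have hode : ∀ u ∈ V, polyD (X ^ n) ψ (logB n (L u)) =
      (-1) ^ n * Complex.exp (logB n (L u)) * polyD (rhoPoly n) ψ (logB n (L u)) := by
    intro u hu
    -- The toric equation of the generator b suffices; it is written as 1 • b to use the formulas
    -- for k • b.
    have h1 := hF.2.2 (((1 : ℕ) : ℤ) • gkzB n)
      ((gkzMatrix_mulVec_eq_zero_iff hn _).mpr ⟨_, rfl⟩) u (hVU hu)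
    have hFV' : ∀ u ∈ V, F u = powFun L ψ (cGamma0 n) 1 u := fun u hu => by
      rw [hFV u hu, powFun_cGamma0]
    rw [toNat_smul_gkzB, toNat_neg_smul_gkzB, monomialDeriv_congr hVo hFV' _ u hu,
      monomialDeriv_congr hVo hFV' _ u hu, monomialDeriv_powFun_inl hbV hψu 1 hu,
      monomialDeriv_powFun_inr hbV hψu 1 hu] at h1
    simp only [Finset.range_one, Finset.prod_singleton, Nat.cast_zero, map_zero, sub_zero, add_zero,
      comp_X, Nat.cast_one, one_mul, mul_one] at h1
    have h2 : Complex.exp (logGamma0 n (L u) - ∑ i, L u (Sum.inr i)) =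
        Complex.exp (logGamma0 n (L u) - ∑ i, L u (Sum.inl i)) * Complex.exp (logB n (L u)) := by
      rw [← Complex.exp_add, logB_eq]; congr 1; ring
    rw [h2] at h1
    apply mul_left_cancel₀ (Complex.exp_ne_zero (logGamma0 n (L u) - ∑ i, L u (Sum.inl i)))
    rw [h1]
    ring
  have hz : logB n (L u₀) = z₀ := by rw [hz₀, hw₀]
  have himg := image_logB_mem_nhds hn hbV hu₀V
  rw [hz] at hS himg ⊢
  -- The equation for ψ is known only at values of `logB` attained on V. As these fill a
  -- neighbourhood of z₀, a small disc consists of such values.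
  obtain ⟨r, hr, hrS⟩ := Metric.mem_nhds_iff.mp
    (Filter.inter_mem hS (Filter.inter_mem (Metric.ball_mem_nhds _ hr₁) himg))
  refine ⟨r, ψ, V ∩ L ⁻¹' (logB n ⁻¹' Metric.ball z₀ r), hr, fun ζ hζ => (hrS hζ).1,
    ⟨hψa.mono fun ζ hζ => (hrS hζ).2.1, fun ζ hζ => ?_⟩,
    hbV.cont.isOpen_inter_preimage hVo (Metric.isOpen_ball.preimage hlogB), ⟨hu₀V, ?_⟩,
    fun u hu => hVU hu.1, fun u hu => hu.2, fun u hu => hFV u hu.1⟩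
  · obtain ⟨u, hu, rfl⟩ := (hrS hζ).2.2
    exact hode u hu
  · rw [Set.mem_preimage, Set.mem_preimage, hz]
    exact Metric.mem_ball_self hr

end GKZLocalForm

/-! ### The Mellin-Barnes basis of the GKZ solutions -/

section GKZBasis
open Polynomial

variable {n : ℕ} {U : Set (Fin n ⊕ Fin n → ℂ)} {L : (Fin n ⊕ Fin n → ℂ) → (Fin n ⊕ Fin n → ℂ)}

/-- The strip contains singular points of the equation, so the point at which solutions are compared
has to be moved off them. -/
lemma exists_mem_mul_exp_ne_one {W : Set ℂ} (hW : IsOpen W) {z : ℂ} (hz : z ∈ W) (κ : ℂ) :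
    ∃ z' ∈ W, κ * Complex.exp z' ≠ 1 := by
  by_contra! hcon
  obtain ⟨ε, hε, hεW⟩ := Metric.isOpen_iff.mp hW z hz
  have h1 := hcon z hz
  have h2 := hcon (z + ((ε / 2 : ℝ) : ℂ)) (hεW (by
    rw [mem_ball_iff_norm, add_sub_cancel_left, Complex.norm_real, Real.norm_of_nonneg (by linarith)]
    linarith))
  rw [Complex.exp_add, ← mul_assoc, h1, one_mul, ← Complex.ofReal_exp] at h2
  have h3 : Real.exp (ε / 2) = 1 := by exact_mod_cast h2
  rw [Real.exp_eq_one_iff] at h3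
  linarith

/-- The strip in which all the shifted Mellin-Barnes integrals converge. -/
def mbStrip (n : ℕ) : Set ℂ := {z | -(n * Real.pi) < z.im ∧ z.im < -(n * Real.pi) + 2 * Real.pi}

lemma isOpen_mbStrip (n : ℕ) : IsOpen (mbStrip n) :=
  (isOpen_lt continuous_const Complex.continuous_im).inter
    (isOpen_lt Complex.continuous_im continuous_const)

/-- Solutions of the hypergeometric equation on a connected open subset of the strip are
combinations of the shifted Mellin-Barnes integrals. -/
lemma exists_eq_sum_mbInt (hn : 0 < n) {σ : ℝ} (h0 : σ < 0) (h1 : ∀ i, -rho n i < σ) {W : Set ℂ}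
    (hW : IsOpen W) (hWc : IsConnected W) (hWS : W ⊆ mbStrip n) {f : ℂ → ℂ}
    (hf : IsExpODESolution (X ^ n) (rhoPoly n) ((-1) ^ n) W f) :
    ∃ c : Fin n → ℂ, ∀ z ∈ W, f z = ∑ k : Fin n, c k * mbInt n σ (z + 2 * Real.pi * Complex.I * (k : ℕ)) := by
  obtain ⟨z, hz⟩ := hWc.nonempty
  obtain ⟨z', hz', hne⟩ := exists_mem_mul_exp_ne_one hW hz ((-1) ^ n)
  exact hf.exists_eq_sum (fun k => (isExpODESolution_mbInt_shift hn h0 h1 k).mono hWS)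
    (monic_X_pow n) (natDegree_X_pow n) (monic_rhoPoly n) (natDegree_rhoPoly n) hW
    hWc.isPreconnected hz' hne fun c hc => mbInt_shift_independent hn h0 h1 hW ⟨z, hz⟩ hWS hc

lemma gkz_independent (hn : 0 < n) {σ : ℝ} (h0 : σ < 0) (h1 : ∀ i, -rho n i < σ)
    (h : IsLogBranch U L) (hUn : U.Nonempty) (hS : ∀ u ∈ U, logB n (L u) ∈ mbStrip n)
    {c : Fin n → ℂ} (hc : ∀ u ∈ U, ∑ k : Fin n, c k * (Complex.exp (logGamma0 n (L u)) *
      mbInt n σ (logB n (L u) + 2 * Real.pi * Complex.I * (k : ℕ))) = 0) : c = 0 := by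
  obtain ⟨u, hu⟩ := hUn
  have hsub : interior ((fun v => logB n (L v)) '' U) ⊆ (fun v => logB n (L v)) '' U :=
    interior_subset
  refine mbInt_shift_independent hn h0 h1 isOpen_interior
    ⟨_, mem_interior_iff_mem_nhds.mpr (image_logB_mem_nhds hn h hu)⟩ (fun z hz => ?_) (fun z hz => ?_)
  · obtain ⟨v, hv, rfl⟩ := hsub hz
    exact hS v hv
  · obtain ⟨v, hv, rfl⟩ := hsub hz
    apply mul_left_cancel₀ (Complex.exp_ne_zero (logGamma0 n (L v)))
    rw [mul_zero, ← hc v hv, Finset.mul_sum]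
    exact Finset.sum_congr rfl fun k _ => by ring

/-- Locally a solution is u^γ₀ ψ with ψ a combination of the translates of J. By independence on
every non-empty open set, the coefficients agree on overlaps, so they are constant on the connected
set U. -/
lemma isBasisOfSolutions_gkz (hn : 0 < n) {σ : ℝ} (h0 : σ < 0) (h1 : ∀ i, -rho n i < σ)
    (h : IsLogBranch U L) (hUc : IsConnected U) (hS : ∀ u ∈ U, logB n (L u) ∈ mbStrip n) :
    IsBasisOfSolutions (IsGKZSolution (gkzMatrix n) (gkzAlpha n) U) U
      (fun (k : Fin n) u => Complex.exp (logGamma0 n (L u)) *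
        mbInt n σ (logB n (L u) + 2 * Real.pi * Complex.I * (k : ℕ))) := by
  refine ⟨fun k => isGKZSolution_of_isExpODESolution hn h (isExpODESolution_mbInt_shift hn h0 h1 k)
    (isOpen_mbStrip n) hS, fun c hc => gkz_independent hn h0 h1 h hUc.nonempty hS hc, fun F hF => ?_⟩
  obtain ⟨Φ, hΦ⟩ : ∃ Φ : (Fin n → ℂ) → (Fin n ⊕ Fin n → ℂ) → ℂ, Φ = fun c u =>
    ∑ k : Fin n, c k * (Complex.exp (logGamma0 n (L u)) *
      mbInt n σ (logB n (L u) + 2 * Real.pi * Complex.I * (k : ℕ))) := ⟨_, rfl⟩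
  have hloc : ∀ u ∈ U, ∃ (V : Set (Fin n ⊕ Fin n → ℂ)) (c : Fin n → ℂ), IsOpen V ∧ u ∈ V ∧ V ⊆ U ∧
      ∀ v ∈ V, F v = Φ c v := by
    intro u hu
    obtain ⟨r, ψ, V, hr, hball, hψ, hV, huV, hVU, hVr, hFV⟩ := hF.exists_local_form hn h hu
      ((isOpen_mbStrip n).mem_nhds (hS u hu))
    obtain ⟨c, hc⟩ := exists_eq_sum_mbInt hn h0 h1 Metric.isOpen_ball
      ((convex_ball _ r).isConnected ⟨_, Metric.mem_ball_self hr⟩) hball hψ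
    refine ⟨V, c, hV, huV, hVU, fun v hv => ?_⟩
    rw [hFV v hv, hc _ (hVr v hv), hΦ, Finset.mul_sum]
    exact Finset.sum_congr rfl fun k _ => by ring
  obtain ⟨u₀, hu₀⟩ := hUc.nonempty
  obtain ⟨V₀, c, hV₀, hu₀V, hV₀U, hF₀⟩ := hloc u₀ hu₀
  -- The set where the germ of F is that of Φ c is open, and closed relative to U because local
  -- coefficients are unique.
  have hsub : U ⊆ {u | F =ᶠ[𝓝 u] Φ c} := by
    refine hUc.isPreconnected.subset_of_closure_inter_subset isOpen_setOfPred_eventually_nhds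
      ⟨u₀, hu₀, Filter.eventually_of_mem (hV₀.mem_nhds hu₀V) hF₀⟩ ?_
    rintro u ⟨hucl, hu⟩
    obtain ⟨V, c', hV, huV, hVU, hFV⟩ := hloc u hu
    obtain ⟨a, haV, ha⟩ := mem_closure_iff.mp hucl V hV huV
    obtain ⟨O, hO, hOo, haO⟩ := eventually_nhds_iff.mp
      ((ha : F =ᶠ[𝓝 a] Φ c).and (hV.mem_nhds haV))
    have hcc : c - c' = 0 := gkz_independent hn h0 h1 (h.mono hOo fun v hv => hVU (hO v hv).2)
      ⟨a, haO⟩ (fun v hv => hS v (hVU (hO v hv).2)) fun v hv => by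
        have h2 := (hO v hv).1
        rw [hFV v (hO v hv).2, hΦ] at h2
        beta_reduce at h2
        simp only [Pi.sub_apply, sub_mul, Finset.sum_sub_distrib]
        rw [h2, sub_self]
    rw [sub_eq_zero] at hcc
    rw [hcc]
    exact Filter.eventually_of_mem (hV.mem_nhds huV) hFV
  refine ⟨c, fun u hu => ?_⟩
  have := (hsub hu : F =ᶠ[𝓝 u] Φ c).self_of_nhds
  rw [this, hΦ]

end GKZBasis

/-! ### Passage from z to t -/

section TPlane
open Polynomial

variable {n : ℕ}

/-- The covering `z ↦ (-1)^n e^z / C` of the punctured `t`-plane. -/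
noncomputable def expT (n : ℕ) (z : ℂ) : ℂ := (-1) ^ n * Complex.exp z / singC n

/-- The branch of its inverse on the slit plane. -/
noncomputable def lineZ (n : ℕ) (t : ℂ) : ℂ :=
  Complex.log (-((singC n : ℂ) * t)) - ((n : ℂ) - 1) * Real.pi * Complex.I

lemma logB_lineLog (hn : 0 < n) (t : ℂ) : logB n (lineLog n t) = lineZ n t := by
  have h : ∀ i : Fin n, lineLog n t (Sum.inl i) = if i = ⟨0, hn⟩ then lineZ n t else 0 := by
    intro i
    by_cases hi : (i : ℕ) = 0
    · have : i = ⟨0, hn⟩ := Fin.ext hi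
      simp [lineLog, this, lineZ]
    · have : i ≠ ⟨0, hn⟩ := fun h => hi (by rw [h])
      simp [lineLog, hi, this]
  rw [logB_eq]
  simp only [h, Finset.sum_ite_eq', Finset.mem_univ, if_true]
  simp [lineLog]

lemma logGamma0_lineLog (t : ℂ) : logGamma0 n (lineLog n t) = 0 := by
  rw [logGamma0_eq]; simp [lineLog]

lemma mbFunction_eq (hn : 0 < n) (c σ : ℝ) (k : Fin n) (t : ℂ) :
    mbFunction n c σ k t = mbInt n (σ + c) (lineZ n t + 2 * Real.pi * Complex.I * (k : ℕ)) := by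
  rw [mbFunction, mellinBarnes_gkz, logGamma0_shiftLog, logGamma0_lineLog, Complex.exp_zero, one_mul,
    logB_shiftLog hn, logB_lineLog hn]

lemma exp_nat_mul_pi_mul_I (m : ℕ) : Complex.exp ((m : ℂ) * Real.pi * Complex.I) = (-1) ^ m := by
  rw [mul_assoc, Complex.exp_nat_mul, Complex.exp_pi_mul_I]

lemma exp_sub_one_mul_pi_mul_I (n : ℕ) :
    Complex.exp (((n : ℂ) - 1) * Real.pi * Complex.I) = -(-1) ^ n := by
  rw [show ((n : ℂ) - 1) * Real.pi * Complex.I = (n : ℂ) * Real.pi * Complex.I - Real.pi * Complex.I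
    by ring, Complex.exp_sub, exp_nat_mul_pi_mul_I, Complex.exp_pi_mul_I, div_neg, div_one]

lemma neg_one_pow_mul_self (n : ℕ) : ((-1 : ℂ) ^ n) * (-1) ^ n = 1 := by rw [← mul_pow]; simp

lemma slitDomain_ne_zero {t : ℂ} (ht : t ∈ slitDomain) : t ≠ 0 := by
  rintro rfl
  simp [slitDomain, Complex.mem_slitPlane_iff] at ht

lemma neg_singC_mul_mem_slitPlane {t : ℂ} (ht : t ∈ slitDomain) :
    -((singC n : ℂ) * t) ∈ Complex.slitPlane := by
  have ht' : -t ∈ Complex.slitPlane := ht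
  have hC := singC_pos n
  rw [← mul_neg, ← Complex.ofReal_natCast]
  rw [Complex.mem_slitPlane_iff] at ht' ⊢
  rw [Complex.re_ofReal_mul, Complex.im_ofReal_mul]
  exact ht'.imp (mul_pos hC) (mul_ne_zero hC.ne')

lemma exp_lineZ {t : ℂ} (ht : t ≠ 0) : Complex.exp (lineZ n t) = (-1) ^ n * (singC n * t) := by
  rw [lineZ, Complex.exp_sub, exp_sub_one_mul_pi_mul_I,
    Complex.exp_log (neg_ne_zero.mpr (mul_ne_zero (singC_ne_zero n) ht)), neg_div_neg_eq,
    div_eq_iff (pow_ne_zero _ (by norm_num))]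
  linear_combination (-(singC n * t)) * neg_one_pow_mul_self n

lemma expT_lineZ {t : ℂ} (ht : t ≠ 0) : expT n (lineZ n t) = t := by
  have := singC_ne_zero n
  rw [expT, exp_lineZ ht, ← mul_assoc, neg_one_pow_mul_self, one_mul, mul_div_cancel_left₀ _ this]

lemma lineZ_im (t : ℂ) : (lineZ n t).im = (-((singC n : ℂ) * t)).arg - (n - 1) * Real.pi := by
  have h : ((n : ℂ) - 1) * Real.pi * Complex.I = (((n - 1 : ℝ) * Real.pi : ℝ) : ℂ) * Complex.I := by
    push_cast; ring
  rw [lineZ, h, Complex.sub_im, Complex.log_im, Complex.im_ofReal_mul, Complex.I_im, mul_one]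

/-- The argument of -Ct lies strictly between -π and π off the slit; subtracting (n-1)π gives the
strip in which all n translates converge. `lineZ` and `expT` are inverse bijections between slit
plane and strip. -/
lemma lineZ_mem_mbStrip {t : ℂ} (ht : t ∈ slitDomain) : lineZ n t ∈ mbStrip n := by
  have h1 := Complex.neg_pi_lt_arg (-((singC n : ℂ) * t))
  have h2 := lt_of_le_of_ne (Complex.arg_le_pi _)
    (Complex.mem_slitPlane_iff_arg.mp (neg_singC_mul_mem_slitPlane (n := n) ht)).1
  constructor
  · rw [lineZ_im]; linarith
  · rw [lineZ_im]; linarith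

lemma neg_singC_mul_expT (z : ℂ) :
    -((singC n : ℂ) * expT n z) = Complex.exp (z + ((n : ℂ) - 1) * Real.pi * Complex.I) := by
  have := singC_ne_zero n
  rw [Complex.exp_add, exp_sub_one_mul_pi_mul_I, expT]
  field_simp

lemma im_add_mem {z : ℂ} (hz : z ∈ mbStrip n) :
    -Real.pi < (z + ((n : ℂ) - 1) * Real.pi * Complex.I).im ∧
      (z + ((n : ℂ) - 1) * Real.pi * Complex.I).im < Real.pi := by
  have h : ((n : ℂ) - 1) * Real.pi * Complex.I = (((n - 1 : ℝ) * Real.pi : ℝ) : ℂ) * Complex.I := by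
    push_cast; ring
  rw [h, Complex.add_im, Complex.im_ofReal_mul, Complex.I_im, mul_one]
  constructor
  · linarith [hz.1]
  · linarith [hz.2]

lemma lineZ_expT {z : ℂ} (hz : z ∈ mbStrip n) : lineZ n (expT n z) = z := by
  rw [lineZ, neg_singC_mul_expT, Complex.log_exp (im_add_mem hz).1 (im_add_mem hz).2.le]
  ring

lemma hasDerivAt_expT (z : ℂ) : HasDerivAt (expT n) (expT n z) z :=
  ((Complex.hasDerivAt_exp z).const_mul _).div_const _

lemma analyticAt_expT (z : ℂ) : AnalyticAt ℂ (expT n) z :=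
  (show Differentiable ℂ (expT n) from fun z => (hasDerivAt_expT z).differentiableAt).analyticAt z

lemma analyticAt_lineZ {t : ℂ} (ht : t ∈ slitDomain) : AnalyticAt ℂ (lineZ n) t := by
  refine AnalyticAt.fun_sub (AnalyticAt.clog (by fun_prop) (neg_singC_mul_mem_slitPlane ht))
    analyticAt_const

lemma analyticAt_eulerTheta {g : ℂ → ℂ} {t : ℂ} (hg : AnalyticAt ℂ g t) :
    AnalyticAt ℂ (eulerTheta g) t := analyticAt_id.mul hg.deriv

/-- Since the derivative of `expT` is `expT` itself, θ pulls back to d/dz. -/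
lemma eulerTheta_expT {V : Set ℂ} (hV : IsOpen V) {F g : ℂ → ℂ} (hF : AnalyticOnNhd ℂ F V)
    (hg : AnalyticOnNhd ℂ g V) {p : ℂ[X]}
    (hgp : ∀ z, expT n z ∈ V → g (expT n z) = polyD p (fun z => F (expT n z)) z) (a : ℂ) (z : ℂ)
    (hz : expT n z ∈ V) : eulerTheta g (expT n z) + a * g (expT n z) =
      polyD ((X + C a) * p) (fun z => F (expT n z)) z := by
  have hf : AnalyticAt ℂ (fun z => F (expT n z)) z :=
    AnalyticAt.fun_comp (g := F) (hF _ hz) (analyticAt_expT z)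
  have hev : polyD p (fun z => F (expT n z)) =ᶠ[𝓝 z] fun z => g (expT n z) :=
    Filter.eventually_of_mem ((hV.preimage (continuous_iff_continuousAt.mpr
      fun z => (analyticAt_expT z).continuousAt)).mem_nhds hz) fun y hy => (hgp y hy).symm
  have hd : HasDerivAt (fun z => g (expT n z)) (deriv g (expT n z) * expT n z) z :=
    (hg _ hz).differentiableAt.hasDerivAt.comp z (hasDerivAt_expT z)
  rw [polyD_X_add_C_mul hf, hev.deriv_eq, hd.deriv, hgp z hz, eulerTheta, mul_comm (expT n z)]

lemma hypergeometric_expT {V : Set ℂ} (hV : IsOpen V) {F : ℂ → ℂ} (hF : AnalyticOnNhd ℂ F V) {z : ℂ}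
    (hz : expT n z ∈ V) : eulerTheta^[n] F (expT n z) - (singC n : ℂ) * expT n z *
      (List.finRange n).foldr (fun k g => fun t => eulerTheta g t + (rho n k : ℂ) * g t) F (expT n z) =
      polyD (X ^ n) (fun z => F (expT n z)) z -
        (-1) ^ n * Complex.exp z * polyD (rhoPoly n) (fun z => F (expT n z)) z := by
  have h1 : ∀ m : ℕ, AnalyticOnNhd ℂ (eulerTheta^[m] F) V ∧ ∀ z, expT n z ∈ V →
      eulerTheta^[m] F (expT n z) = polyD (X ^ m) (fun z => F (expT n z)) z := by
    intro m
    induction m with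
    | zero => exact ⟨hF, fun z _ => by rw [pow_zero, polyD_one]; rfl⟩
    | succ m ih =>
      rw [Function.iterate_succ_apply']
      refine ⟨fun t ht => analyticAt_eulerTheta (ih.1 t ht), fun z hz => ?_⟩
      have := eulerTheta_expT hV hF ih.1 ih.2 0 z hz
      rwa [zero_mul, add_zero, map_zero, add_zero, ← pow_succ'] at this
  have h2 : ∀ l : List (Fin n), AnalyticOnNhd ℂ
      (l.foldr (fun k g => fun t => eulerTheta g t + (rho n k : ℂ) * g t) F) V ∧ ∀ z, expT n z ∈ V →
      l.foldr (fun k g => fun t => eulerTheta g t + (rho n k : ℂ) * g t) F (expT n z) =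
        polyD ((l.map fun k => X + C (rho n k : ℂ)).prod) (fun z => F (expT n z)) z := by
    intro l
    induction l with
    | nil => exact ⟨hF, fun z _ => by rw [List.map_nil, List.prod_nil, polyD_one]; rfl⟩
    | cons k l ih =>
      refine ⟨fun t ht => (analyticAt_eulerTheta (ih.1 t ht)).fun_add
        (analyticAt_const.fun_mul (ih.1 t ht)), fun z hz => ?_⟩
      rw [List.map_cons, List.prod_cons]
      exact eulerTheta_expT hV hF ih.1 ih.2 _ z hz
  have h3 : (singC n : ℂ) * expT n z = (-1) ^ n * Complex.exp z := by
    rw [expT, mul_div_cancel₀ _ (singC_ne_zero n)]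
  rw [(h1 n).2 z hz, (h2 _).2 z hz, h3, rhoPoly, Fin.prod_univ_def]

/-- On an open subset of the slit plane, the hypergeometric equation is the equation in the
logarithmic variable. -/
lemma isHypergeometricSolution_iff {V : Set ℂ} (hV : IsOpen V) (hVs : V ⊆ slitDomain) {F : ℂ → ℂ} :
    IsHypergeometricSolution n V F ↔ IsExpODESolution (X ^ n) (rhoPoly n) ((-1) ^ n)
      (mbStrip n ∩ expT n ⁻¹' V) (fun z => F (expT n z)) := by
  constructor
  · rintro ⟨h1, h2⟩
    have hF := h1.analyticOnNhd hV
    refine ⟨fun z hz => AnalyticAt.fun_comp (g := F) (hF _ hz.2) (analyticAt_expT z), fun z hz => ?_⟩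
    have := h2 _ hz.2
    rw [hypergeometric_expT hV hF hz.2, sub_eq_zero] at this
    exact this
  · rintro ⟨h1, h2⟩
    have hmem : ∀ t ∈ V, lineZ n t ∈ mbStrip n ∩ expT n ⁻¹' V := fun t ht =>
      ⟨lineZ_mem_mbStrip (hVs ht), by
        rw [Set.mem_preimage, expT_lineZ (slitDomain_ne_zero (hVs ht))]; exact ht⟩
    have hF : AnalyticOnNhd ℂ F V := by
      intro t ht
      have h3 : AnalyticAt ℂ (fun s => F (expT n (lineZ n s))) t :=
        AnalyticAt.fun_comp (g := fun z => F (expT n z)) (h1 _ (hmem t ht)) (analyticAt_lineZ (hVs ht))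
      refine h3.congr (Filter.eventually_of_mem (hV.mem_nhds ht) fun s hs => ?_)
      beta_reduce
      rw [expT_lineZ (slitDomain_ne_zero (hVs hs))]
    refine ⟨hF.differentiableOn, fun t ht => ?_⟩
    have h3 := h2 _ (hmem t ht)
    have h4 := hypergeometric_expT hV hF (hmem t ht).2
    rw [h3, sub_self, expT_lineZ (slitDomain_ne_zero (hVs ht))] at h4
    exact h4

lemma isBasisOfSolutions_mbFunction (hn : 0 < n) {c σ : ℝ} (h0 : σ + c < 0)
    (h1 : ∀ i, -rho n i < σ + c) {V : Set ℂ} (hVs : V ⊆ slitDomain) (hV : IsOpen V)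
    (hVc : IsConnected V) :
    IsBasisOfSolutions (IsHypergeometricSolution n V) V (mbFunction n c σ) := by
  have hW : IsOpen (mbStrip n ∩ expT n ⁻¹' V) := (isOpen_mbStrip n).inter
    (hV.preimage (continuous_iff_continuousAt.mpr fun z => (analyticAt_expT z).continuousAt))
  have himg : mbStrip n ∩ expT n ⁻¹' V = lineZ n '' V := by
    ext z
    constructor
    · exact fun hz => ⟨expT n z, hz.2, lineZ_expT hz.1⟩
    · rintro ⟨t, ht, rfl⟩
      refine ⟨lineZ_mem_mbStrip (hVs ht), ?_⟩
      rw [Set.mem_preimage, expT_lineZ (slitDomain_ne_zero (hVs ht))]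
      exact ht
  have hWc : IsConnected (mbStrip n ∩ expT n ⁻¹' V) := by
    rw [himg]
    exact hVc.image _ fun t ht => (analyticAt_lineZ (hVs ht)).continuousAt.continuousWithinAt
  have hpull : ∀ z ∈ mbStrip n ∩ expT n ⁻¹' V, ∀ k : Fin n, mbFunction n c σ k (expT n z) =
      mbInt n (σ + c) (z + 2 * Real.pi * Complex.I * (k : ℕ)) := fun z hz k => by
    rw [mbFunction_eq hn, lineZ_expT hz.1]
  refine ⟨fun k => ?_, fun a ha => ?_, fun F hF => ?_⟩
  · rw [isHypergeometricSolution_iff hV hVs]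
    exact ((isExpODESolution_mbInt_shift hn h0 h1 k).mono Set.inter_subset_left).congr hW
      fun z hz => (hpull z hz k).symm
  · refine mbInt_shift_independent hn h0 h1 hW hWc.nonempty (fun z hz => hz.1) fun z hz => ?_
    rw [← ha _ hz.2]
    exact Finset.sum_congr rfl fun k _ => by rw [hpull z hz]
  · rw [isHypergeometricSolution_iff hV hVs] at hF
    obtain ⟨a, ha⟩ := exists_eq_sum_mbInt hn h0 h1 hW hWc Set.inter_subset_left hF
    refine ⟨a, fun t ht => ?_⟩
    have hz : lineZ n t ∈ mbStrip n ∩ expT n ⁻¹' V := himg ▸ ⟨t, ht, rfl⟩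
    have h2 := ha _ hz
    rw [expT_lineZ (slitDomain_ne_zero (hVs ht))] at h2
    rw [h2]
    exact Finset.sum_congr rfl fun k _ => by rw [mbFunction_eq hn]

lemma exp_shiftLog_lineLog {t : ℂ} (ht : t ∈ slitDomain) (k : Fin n) (j : Fin n ⊕ Fin n) :
    Complex.exp (shiftLog n k (lineLog n t) j) = linePoint n t j := by
  rcases j with i | i
  · by_cases hi : (i : ℕ) = 0
    · simp only [shiftLog, lineLog, linePoint, hi, if_true]
      have h := exp_lineZ (n := n) (slitDomain_ne_zero ht)
      rw [lineZ] at h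
      rw [Complex.exp_add, h, mul_comm _ (((k : ℕ) : ℂ)), Complex.exp_nat_mul_two_pi_mul_I]
      ring
    · simp [shiftLog, lineLog, linePoint, hi]
  · simp [shiftLog, lineLog, linePoint]

end TPlane

/-! ### The period solves the hypergeometric equation -/

section PeriodEquation
open Polynomial

variable {n : ℕ}

lemma zeroData_G_zero (k : ℕ) : (zeroData n).G k 0 = ((-1) ^ n) ^ k * periodCoeff n k := by
  induction k with
  | zero => simp [FrobeniusData.G, periodCoeff_zero]
  | succ k ih =>
    have hk : ((k : ℂ) + 1) ^ n ≠ 0 := pow_ne_zero _ (by exact_mod_cast Nat.succ_ne_zero k)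
    have h := periodCoeff_succ n k
    rw [← eq_div_iff hk] at h
    rw [FrobeniusData.G, ih, h, Finset.prod_div_distrib]
    simp only [zeroData, Pi.zero_apply, add_zero, sub_zero, sub_neg_eq_add, Finset.prod_const,
      Finset.card_univ, Fintype.card_fin]
    ring

lemma differentiableOn_mirrorPeriod (hn : 0 < n) :
    DifferentiableOn ℂ (mirrorPeriod n) (Metric.ball 0 1) := by
  intro t ht
  rw [mem_ball_zero_iff] at ht
  obtain ⟨r, hr1, hr2⟩ := exists_between ht
  have hr0 : 0 < r := (norm_nonneg t).trans_lt hr1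
  have hsum := (hasSum_mirrorPeriod hn (t := (r : ℂ)) (by
    rw [Complex.norm_real, Real.norm_of_nonneg hr0.le]; exact hr2)).summable.norm
  have hd : DifferentiableOn ℂ
      (fun t => ∑' k, (2 * Real.pi * Complex.I) ^ (n - 1) * (periodCoeff n k * t ^ k))
      (Metric.ball 0 r) := by
    refine Complex.differentiableOn_tsum_of_summable_norm hsum (fun k => by fun_prop) Metric.isOpen_ball ?_
    intro k w hw
    rw [mem_ball_zero_iff] at hw
    simp only [norm_mul, norm_pow, Complex.norm_real, Real.norm_of_nonneg hr0.le]
    gcongr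
  have hmem : Metric.ball (0 : ℂ) r ∈ 𝓝 t := Metric.isOpen_ball.mem_nhds (by
    rw [mem_ball_zero_iff]; exact hr1)
  refine ((hd.differentiableAt hmem).congr_of_eventuallyEq
    (Filter.eventually_of_mem hmem fun w hw => ?_)).differentiableWithinAt
  rw [mem_ball_zero_iff] at hw
  exact (hasSum_mirrorPeriod hn (hw.trans hr2)).tsum_eq.symm

/-- The period is the Frobenius series with weight 1/ε instead of 1/ε^n: only the residue at the
simple pole remains, and P(ε)/ε = ε^(n-1) is still entire. -/
lemma isExpODESolution_mirrorPeriod (hn : 0 < n) :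
    IsExpODESolution (X ^ n) (rhoPoly n) ((-1) ^ n) {z | z.re < 0}
      (fun z => mirrorPeriod n ((-1) ^ n * Complex.exp z)) := by
  have hP : (zeroData n).P = X ^ n := by simp [FrobeniusData.P, zeroData]
  have hR : (zeroData n).R = rhoPoly n := by simp [FrobeniusData.R, zeroData, rhoPoly]
  have hφ : ContinuousOn (fun ε => 1 / (ε - (zeroData n).r ⟨0, hn⟩))
      (Metric.sphere (zeroData n).c (1 / 2)) :=
    continuousOn_const.div (by fun_prop) fun ε hε => (zeroData n).sub_r_ne_zero hε _
  have h := (zeroData n).isExpODESolution_series hφ (f := fun ε => ε ^ (n - 1)) (by fun_prop)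
    fun ε hε => by
      have h0 := (zeroData n).sub_r_ne_zero hε ⟨0, hn⟩
      have h1 : (zeroData n).r ⟨0, hn⟩ = 0 := rfl
      rw [h1, sub_zero] at h0 ⊢
      rw [hP, eval_pow, eval_X, ← Nat.sub_add_cancel hn, pow_succ, Nat.add_sub_cancel]
      field_simp
  rw [hP, hR] at h
  have h2 := isExpODESolution_sum (Finset.univ : Finset (Fin 1)) (fun _ _ => h)
    fun _ => (2 * Real.pi * Complex.I) ^ (n - 1) * (2 * Real.pi * Complex.I)⁻¹
  refine h2.congr FrobeniusData.isOpen_halfPlane fun z hz => ?_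
  have hz' : z.re < 0 := hz
  have hnorm : ‖(-1) ^ n * Complex.exp z‖ < 1 := by
    rw [norm_mul, norm_pow, norm_neg, norm_one, one_pow, one_mul, Complex.norm_exp,
      Real.exp_lt_one_iff]
    exact hz'
  rw [← (hasSum_mirrorPeriod hn hnorm).tsum_eq, Finset.univ_unique, Finset.sum_singleton,
    FrobeniusData.series, ← tsum_mul_left]
  refine tsum_congr fun k => ?_
  rw [(zeroData n).term_div_sub (h := fun _ => 1) (by fun_prop) ⟨0, hn⟩ k z]
  have h1 : (zeroData n).r ⟨0, hn⟩ = 0 := rfl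
  have hpi := Complex.two_pi_I_ne_zero
  rw [h1, zeroData_G_zero, add_zero, Complex.exp_nat_mul]
  field_simp
  rw [mul_pow]
  ring

lemma isHypergeometricSolution_mirrorPeriod (hn : 0 < n) :
    IsHypergeometricSolution n (Metric.ball 0 (1 / (singC n : ℝ)))
      (fun t => mirrorPeriod n ((singC n : ℂ) * t)) := by
  have hC := singC_pos n
  have hd : DifferentiableOn ℂ (fun t => mirrorPeriod n ((singC n : ℂ) * t))
      (Metric.ball 0 (1 / (singC n : ℝ))) := by
    refine DifferentiableOn.fun_comp (t := Metric.ball 0 1) (differentiableOn_mirrorPeriod hn)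
      (by fun_prop) fun t ht => ?_
    rw [mem_ball_zero_iff] at ht ⊢
    rw [norm_mul, Complex.norm_natCast]
    rwa [lt_div_iff₀' hC] at ht
  refine ⟨hd, fun t ht => ?_⟩
  by_cases ht0 : t = 0
  · obtain ⟨m, rfl⟩ : ∃ m, n = m + 1 := ⟨n - 1, by omega⟩
    rw [Function.iterate_succ_apply', eulerTheta, ht0]
    ring
  · have hz : expT n (lineZ n t) = t := expT_lineZ ht0
    have h1 := hypergeometric_expT (n := n) Metric.isOpen_ball (hd.analyticOnNhd Metric.isOpen_ball)
      (z := lineZ n t) (by rw [hz]; exact ht)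
    rw [hz] at h1
    rw [h1, sub_eq_zero]
    have h2 : (fun z => mirrorPeriod n ((singC n : ℂ) * expT n z)) =
        fun z => mirrorPeriod n ((-1) ^ n * Complex.exp z) := by
      funext z
      rw [expT, mul_div_cancel₀ _ (singC_ne_zero n)]
    rw [h2]
    refine (isExpODESolution_mirrorPeriod hn).2 _ ?_
    change (lineZ n t).re < 0
    rw [← Real.exp_lt_one_iff, ← Complex.norm_exp, exp_lineZ ht0]
    rw [mem_ball_zero_iff, lt_div_iff₀' hC] at ht
    simpa using ht

end PeriodEquation

/-! ### Gluing across the positive real axis -/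

section Crossing
open Polynomial

variable {n : ℕ}

lemma isConnected_strip_inter {A : ℝ} (hA : 0 < A) {S : Set ℂ} (hS : Convex ℝ S) {x : ℝ}
    (hx : (x : ℂ) ∈ S) : IsConnected ({z : ℂ | |z.im| < A} ∩ S) := by
  have h : {z : ℂ | |z.im| < A} = {z : ℂ | -A < z.im} ∩ {z : ℂ | z.im < A} := by
    ext z
    exact ⟨fun h => abs_lt.mp (show |z.im| < A from h), fun h => (abs_lt.mpr ⟨h.1, h.2⟩ : |z.im| < A)⟩
  refine Convex.isConnected ?_ ⟨x, ?_, hx⟩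
  · rw [h]
    exact ((convex_halfSpace_im_gt _).inter (convex_halfSpace_im_lt _)).inter hS
  · change |(x : ℂ).im| < A
    simpa using hA

/-- Vectors `y` of functions that are glued, across the positive real axis inside `O`, according to
the matrix `A`. -/
def IsCrossing (y : Fin n → ℂ → ℂ) (A : Matrix (Fin n) (Fin n) ℂ) (O : Set ℂ) : Prop :=
  ∃ G : Fin n → ℂ → ℂ, ∀ i, AnalyticOnNhd ℂ (G i) O ∧ (∀ t ∈ O, t.im < 0 → G i t = y i t) ∧
    ∀ t ∈ O, 0 < t.im → G i t = ∑ j, A i j * y j t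

lemma im_singC_mul (t : ℂ) : ((singC n : ℂ) * t).im = singC n * t.im := by
  rw [← Complex.ofReal_natCast, Complex.im_ofReal_mul]

lemma re_singC_mul (t : ℂ) : ((singC n : ℂ) * t).re = singC n * t.re := by
  rw [← Complex.ofReal_natCast, Complex.re_ofReal_mul]

/-- Log(-Ct) is log(Ct) + πi below the positive axis and log(Ct) - πi above it. This jump by 2πi
raises the index of the branches by one. -/
lemma lineZ_of_im_neg {t : ℂ} (ht : t.im < 0) : lineZ n t =
    Complex.log (singC n * t) - n * Real.pi * Complex.I + 2 * Real.pi * Complex.I := by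
  have h : ((singC n : ℂ) * t).im < 0 := by
    rw [im_singC_mul]; exact mul_neg_of_pos_of_neg (singC_pos n) ht
  rw [lineZ, Complex.log, Complex.log, norm_neg, Complex.arg_neg_eq_arg_add_pi_of_im_neg h]
  push_cast
  ring

lemma lineZ_of_im_pos {t : ℂ} (ht : 0 < t.im) : lineZ n t =
    Complex.log (singC n * t) - n * Real.pi * Complex.I := by
  have h : 0 < ((singC n : ℂ) * t).im := by
    rw [im_singC_mul]; exact mul_pos (singC_pos n) ht
  rw [lineZ, Complex.log, Complex.log, norm_neg, Complex.arg_neg_eq_arg_sub_pi_of_im_pos h]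
  push_cast
  ring

/-- Continued upwards across the axis, the k-th function becomes the (k+1)-st. The last one leaves
the strip where J is given by its integral; there the extension F takes over, and its recurrence
under translation by 2πi expresses it through the n functions above the axis. The matrix is thus the
companion matrix. -/
lemma isCrossing_of_extension {σ : ℝ} {c : ℕ → ℂ} (hc : c n = 1) {S O : Set ℂ}
    {F : ℂ → ℂ} (hF : AnalyticOnNhd ℂ F S)
    (hFJ : ∀ z ∈ S, |z.im| < n * Real.pi → F z = mbInt n σ z)
    (hrel : ∀ z ∈ S, ∑ j ∈ Finset.range (n + 1), c j * F (z + 2 * Real.pi * Complex.I * j) = 0)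
    (hO : ∀ t ∈ O, 0 < t.re)
    (hOS : ∀ t ∈ O, ∀ x : ℝ, Complex.log (singC n * t) + x * Complex.I ∈ S) :
    IsCrossing (fun (k : Fin n) t => mbInt n σ (lineZ n t + 2 * Real.pi * Complex.I * (k : ℕ)))
      (shiftCompanion n c) O := by
  have hpi := Real.pi_pos
  have hC := singC_pos n
  have him : ∀ (t : ℂ) (x : ℝ), (Complex.log (singC n * t) + x * Complex.I).im =
      (singC n * t).arg + x := fun t x => by
    rw [Complex.add_im, Complex.log_im, Complex.im_ofReal_mul, Complex.I_im, mul_one]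
  have hval : ∀ t ∈ O, ∀ x : ℝ, |(singC n * t).arg + x| < n * Real.pi →
      F (Complex.log (singC n * t) + x * Complex.I) =
        mbInt n σ (Complex.log (singC n * t) + x * Complex.I) := fun t ht x hx =>
    hFJ _ (hOS t ht x) (by rw [him]; exact hx)
  have hform : ∀ k : ℕ, ((-(n * Real.pi) + 2 * Real.pi * k : ℝ) : ℂ) * Complex.I =
      -(n * Real.pi * Complex.I) + 2 * Real.pi * Complex.I * k := fun k => by push_cast; ring
  have hup : ∀ t ∈ O, 0 < t.im → ∀ k : ℕ, k < n →
      F (Complex.log (singC n * t) + ((-(n * Real.pi) + 2 * Real.pi * k : ℝ) : ℂ) * Complex.I) =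
        mbInt n σ (lineZ n t + 2 * Real.pi * Complex.I * k) := by
    intro t ht him k hk
    have hre : 0 < ((singC n : ℂ) * t).re := by rw [re_singC_mul]; exact mul_pos hC (hO t ht)
    have him' : 0 < ((singC n : ℂ) * t).im := by rw [im_singC_mul]; exact mul_pos hC him
    have ha1 : 0 < ((singC n : ℂ) * t).arg := by
      refine lt_of_le_of_ne (Complex.arg_nonneg_iff.mpr him'.le) fun h => ?_
      rw [eq_comm, Complex.arg_eq_zero_iff] at h
      exact him'.ne' h.2
    have ha2 := (Complex.abs_arg_lt_pi_div_two_iff.mpr (Or.inl hre))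
    rw [abs_lt] at ha2
    have hk1 : (k : ℝ) + 1 ≤ n := by exact_mod_cast hk
    have hk0 : (0 : ℝ) ≤ k := k.cast_nonneg
    rw [hval t ht _ (abs_lt.mpr ⟨by nlinarith, by nlinarith⟩), hform, lineZ_of_im_pos him]
    congr 1
    ring
  have hdown : ∀ t ∈ O, t.im < 0 → ∀ k : ℕ, k < n →
      F (Complex.log (singC n * t) + ((-(n * Real.pi) + 2 * Real.pi * (k + 1 : ℕ) : ℝ) : ℂ) *
        Complex.I) = mbInt n σ (lineZ n t + 2 * Real.pi * Complex.I * k) := by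
    intro t ht him k hk
    have hre : 0 < ((singC n : ℂ) * t).re := by rw [re_singC_mul]; exact mul_pos hC (hO t ht)
    have him' : ((singC n : ℂ) * t).im < 0 := by
      rw [im_singC_mul]; exact mul_neg_of_pos_of_neg hC him
    have ha1 : ((singC n : ℂ) * t).arg < 0 := Complex.arg_neg_iff.mpr him'
    have ha2 := (Complex.abs_arg_lt_pi_div_two_iff.mpr (Or.inl hre))
    rw [abs_lt] at ha2
    have hk1 : (k : ℝ) + 1 ≤ n := by exact_mod_cast hk
    have hk0 : (0 : ℝ) ≤ k := k.cast_nonneg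
    rw [hval t ht _ (abs_lt.mpr ⟨by push_cast; nlinarith, by push_cast; nlinarith⟩), hform,
      lineZ_of_im_neg him]
    congr 1
    push_cast
    ring
  refine ⟨fun k t => F (Complex.log (singC n * t) +
    ((-(n * Real.pi) + 2 * Real.pi * ((k : ℕ) + 1 : ℕ) : ℝ) : ℂ) * Complex.I), fun i =>
    ⟨fun t ht => ?_, fun t ht him => hdown t ht him i i.2, fun t ht him => ?_⟩⟩
  · refine AnalyticAt.fun_comp (g := F) (hF _ (hOS t ht _))
      ((AnalyticAt.clog (by fun_prop) ?_).fun_add analyticAt_const)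
    rw [Complex.mem_slitPlane_iff, re_singC_mul]
    exact Or.inl (mul_pos hC (hO t ht))
  · beta_reduce
    rw [sum_shiftCompanion n c i fun j => mbInt n σ (lineZ n t + 2 * Real.pi * Complex.I * j)]
    split_ifs with hi
    · exact hup t ht him _ hi
    · have hin : (i : ℕ) + 1 = n := by have := i.2; omega
      -- The recurrence based at log(Ct) - nπi: its terms j < n are the functions above the axis,
      -- its last term is the continuation of the last function from below.
      have h := hrel _ (hOS t ht (-(n * Real.pi) + 2 * Real.pi * (0 : ℕ)))
      rw [Finset.sum_range_succ, hc, one_mul] at h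
      rw [hin, ← sub_eq_zero, sub_neg_eq_add, ← h, add_comm]
      congr 1
      · refine Finset.sum_congr rfl fun j hj => ?_
        rw [← hup t ht him j (Finset.mem_range.mp hj)]
        congr 2
        push_cast
        ring
      · congr 1
        push_cast
        ring

/-- Re z = log|Ct| is negative here, so J is extended over the left half plane, where the
translation satisfies (T - 1)^n = 0. -/
lemma isCrossing_zero (hn : 0 < n) {σ : ℝ} (h0 : σ < 0) (h1 : ∀ i, -rho n i < σ) :
    IsCrossing (fun (k : Fin n) t => mbInt n σ (lineZ n t + 2 * Real.pi * Complex.I * (k : ℕ)))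
      (shiftCompanion n (unipotentCoeff n)) {t : ℂ | 0 < t.re ∧ ‖(singC n : ℂ) * t‖ < 1} := by
  have hA : 0 < n * Real.pi := mul_pos (by exact_mod_cast hn) Real.pi_pos
  obtain ⟨F, hF, hFJ, hrel⟩ := exists_extension_zero
    ((isOpen_strip _).inter (isOpen_lt Complex.continuous_re continuous_const))
    (isConnected_strip_inter hA (convex_halfSpace_re_lt 0) (x := -1) (by simp))
    (fun z hz => hz.2) ((isExpODESolution_mbInt hn h0 h1).mono Set.inter_subset_left)
  refine isCrossing_of_extension (by simp [unipotentCoeff]) hF (fun z hz him => hFJ z ⟨him, hz⟩)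
    hrel (fun t ht => ht.1) fun t ht x => ?_
  have ht0 : (singC n : ℂ) * t ≠ 0 := by
    refine mul_ne_zero (singC_ne_zero n) ?_
    rintro rfl
    simpa using ht.1
  change Complex.re _ < 0
  rw [Complex.add_re, Complex.re_ofReal_mul, Complex.I_re, mul_zero, add_zero, Complex.log_re]
  exact Real.log_neg (norm_pos_iff.mpr ht0) ht.2

/-- Here log|Ct| > 0, and the translation satisfies 1 + T + ... + T^n = 0 on the right half plane.
-/
lemma isCrossing_infty (hn : 0 < n) {σ : ℝ} (h0 : σ < 0) (h1 : ∀ i, -rho n i < σ) :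
    IsCrossing (fun (k : Fin n) t => mbInt n σ (lineZ n t + 2 * Real.pi * Complex.I * (k : ℕ)))
      (shiftCompanion n fun _ => 1) {t : ℂ | 0 < t.re ∧ 1 < ‖(singC n : ℂ) * t‖} := by
  have hA : 0 < n * Real.pi := mul_pos (by exact_mod_cast hn) Real.pi_pos
  obtain ⟨F, hF, hFJ, hrel⟩ := exists_extension_infty
    ((isOpen_strip _).inter (isOpen_lt continuous_const Complex.continuous_re))
    (isConnected_strip_inter hA (convex_halfSpace_re_gt 0) (x := 1) (by simp))
    (fun z hz => hz.2) ((isExpODESolution_mbInt hn h0 h1).mono Set.inter_subset_left)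
  refine isCrossing_of_extension rfl hF (fun z hz him => hFJ z ⟨him, hz⟩)
    (fun z hz => by simpa using hrel z hz) (fun t ht => ht.1) fun t ht x => ?_
  change 0 < Complex.re _
  rw [Complex.add_re, Complex.re_ofReal_mul, Complex.I_re, mul_zero, add_zero, Complex.log_re]
  exact Real.log_pos ht.2

end Crossing

/-! ### Analytic continuation along paths -/

section Continuation

variable {n : ℕ}

/-- Analytic continuation of germs along the path `γ : [a, b] → ℂ`. -/
def ContinuesOn (γ : ℝ → ℂ) (a b : ℝ) (f g : ℂ → ℂ) : Prop :=
  ∃ F : ℝ → ℂ → ℂ,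
    (∀ s ∈ Set.Icc a b, AnalyticAt ℂ (F s) (γ s)) ∧
    (∀ s ∈ Set.Icc a b, ∀ᶠ s' in 𝓝[Set.Icc a b] s, F s' =ᶠ[𝓝 (γ s')] F s) ∧
    F a =ᶠ[𝓝 (γ a)] f ∧ F b =ᶠ[𝓝 (γ b)] g

lemma continuesOn_of_analyticAt {γ : ℝ → ℂ} {a b : ℝ} {f g H : ℂ → ℂ}
    (hH : ∀ s ∈ Set.Icc a b, AnalyticAt ℂ H (γ s)) (ha : H =ᶠ[𝓝 (γ a)] f)
    (hb : H =ᶠ[𝓝 (γ b)] g) : ContinuesOn γ a b f g :=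
  ⟨fun _ => H, hH, fun _ _ => Eventually.of_forall fun _ => EventuallyEq.rfl, ha, hb⟩

lemma ContinuesOn.trans {γ : ℝ → ℂ} (hγ : Continuous γ) {a b c : ℝ} (hab : a ≤ b) (hbc : b ≤ c)
    {f g h : ℂ → ℂ} (h1 : ContinuesOn γ a b f g) (h2 : ContinuesOn γ b c g h) :
    ContinuesOn γ a c f h := by
  obtain ⟨F, hF1, hF2, hF3, hF4⟩ := h1
  obtain ⟨G, hG1, hG2, hG3, hG4⟩ := h2
  simp only [eventually_nhdsWithin_iff] at hF2 hG2
  refine ⟨fun s => if s ≤ b then F s else G s, fun s hs => ?_, fun s hs => ?_, ?_, ?_⟩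
  · rcases le_or_gt s b with hsb | hsb
    · beta_reduce; rw [if_pos hsb]; exact hF1 s ⟨hs.1, hsb⟩
    · beta_reduce; rw [if_neg (not_le.mpr hsb)]; exact hG1 s ⟨hsb.le, hs.2⟩
  · rw [eventually_nhdsWithin_iff]
    rcases lt_trichotomy s b with hsb | rfl | hsb
    · filter_upwards [hF2 s ⟨hs.1, hsb.le⟩, gt_mem_nhds hsb] with s' h3 h4 h5
      rw [if_pos (le_of_lt h4), if_pos hsb.le]
      exact h3 ⟨h5.1, le_of_lt h4⟩
    · have hFG : ∀ᶠ s' in 𝓝 s, F s =ᶠ[𝓝 (γ s')] G s :=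
        hγ.continuousAt.eventually ((hF4.trans hG3.symm).eventuallyEq_nhds)
      filter_upwards [hF2 s ⟨hs.1, le_rfl⟩, hG2 s ⟨le_rfl, hs.2⟩, hFG] with s' h3 h4 h5 h6
      rw [if_pos le_rfl]
      rcases le_or_gt s' s with h7 | h7
      · rw [if_pos h7]; exact h3 ⟨h6.1, h7⟩
      · rw [if_neg (not_le.mpr h7)]; exact (h4 ⟨h7.le, h6.2⟩).trans h5.symm
    · filter_upwards [hG2 s ⟨hsb.le, hs.2⟩, lt_mem_nhds hsb] with s' h3 h4 h5
      rw [if_neg (not_le.mpr h4), if_neg (not_le.mpr hsb)]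
      exact h3 ⟨le_of_lt h4, h5.2⟩
  · beta_reduce; rw [if_pos hab]; exact hF3
  · rcases hbc.eq_or_lt with rfl | hbc
    · beta_reduce; rw [if_pos le_rfl]; exact (hF4.trans hG3.symm).trans hG4
    · beta_reduce; rw [if_neg (not_le.mpr hbc)]; exact hG4

/-- Continuation along a path that meets the positive real axis once, at `γ s₀ ∈ O`. -/
lemma continuesOn_through {γ : ℝ → ℂ} (hγ : Continuous γ) {a b s₀ : ℝ} (ha : a < s₀) (hb : s₀ < b)
    {f g H : ℂ → ℂ} {O P N : Set ℂ} (hO : IsOpen O) (hP : IsOpen P) (hN : IsOpen N)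
    (h₀ : γ s₀ ∈ O) (hH : AnalyticOnNhd ℂ H O) (hf : AnalyticOnNhd ℂ f slitDomain)
    (hg : AnalyticOnNhd ℂ g slitDomain) (hHf : ∀ t ∈ O, t ∈ P → H t = f t)
    (hHg : ∀ t ∈ O, t ∈ N → H t = g t) (hleft : ∀ᶠ s in 𝓝[<] s₀, γ s ∈ P)
    (hright : ∀ᶠ s in 𝓝[>] s₀, γ s ∈ N) (hslit : ∀ s ∈ Set.Icc a b, s ≠ s₀ → γ s ∈ slitDomain) :
    ContinuesOn γ a b f g := by
  obtain ⟨δ, hδ, hδO⟩ := Metric.isOpen_iff.mp (hO.preimage hγ) s₀ h₀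
  have hl : ∀ᶠ s in 𝓝[<] s₀, a < s ∧ s₀ - δ < s ∧ s < s₀ ∧ γ s ∈ P := by
    filter_upwards [hleft, Ioo_mem_nhdsLT ha, Ioo_mem_nhdsLT (sub_lt_self s₀ hδ)] with s h1 h2 h3
    exact ⟨h2.1, h3.1, h3.2, h1⟩
  have hr : ∀ᶠ s in 𝓝[>] s₀, s < b ∧ s < s₀ + δ ∧ s₀ < s ∧ γ s ∈ N := by
    filter_upwards [hright, Ioo_mem_nhdsGT hb, Ioo_mem_nhdsGT (lt_add_of_pos_right s₀ hδ)]
      with s h1 h2 h3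
    exact ⟨h2.2, h3.2, h3.1, h1⟩
  obtain ⟨s₁, h11, h12, h13, h14⟩ := hl.exists
  obtain ⟨s₂, h21, h22, h23, h24⟩ := hr.exists
  have hmem : ∀ s ∈ Set.Icc s₁ s₂, γ s ∈ O := fun s hs => hδO (by
    rw [Metric.mem_ball, Real.dist_eq, abs_lt]
    exact ⟨by linarith [hs.1], by linarith [hs.2]⟩)
  have m1 := hmem s₁ ⟨le_rfl, by linarith⟩
  have m2 := hmem s₂ ⟨by linarith, le_rfl⟩
  have e1 : H =ᶠ[𝓝 (γ s₁)] f :=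
    Filter.eventually_of_mem ((hO.inter hP).mem_nhds ⟨m1, h14⟩) fun t ht => hHf t ht.1 ht.2
  have e2 : H =ᶠ[𝓝 (γ s₂)] g :=
    Filter.eventually_of_mem ((hO.inter hN).mem_nhds ⟨m2, h24⟩) fun t ht => hHg t ht.1 ht.2
  refine ContinuesOn.trans hγ h11.le (by linarith) (g := f) ?_
    (ContinuesOn.trans hγ (b := s₂) (by linarith) h21.le (g := g) ?_ ?_)
  · exact continuesOn_of_analyticAt (fun s hs => hf _ (hslit s ⟨hs.1, by linarith [hs.2]⟩
      (by linarith [hs.2] : s < s₀).ne)) EventuallyEq.rfl EventuallyEq.rfl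
  · exact continuesOn_of_analyticAt (fun s hs => hH _ (hmem s hs)) e1 e2
  · exact continuesOn_of_analyticAt (fun s hs => hg _ (hslit s ⟨by linarith [hs.1], hs.2⟩
      (by linarith [hs.1] : s₀ < s).ne')) EventuallyEq.rfl EventuallyEq.rfl

variable {y : Fin n → ℂ → ℂ} {A : Matrix (Fin n) (Fin n) ℂ} {O : Set ℂ}

lemma analyticOnNhd_sum_mul {O : Set ℂ} {y : Fin n → ℂ → ℂ} (hy : ∀ i, AnalyticOnNhd ℂ (y i) O)
    (v : Fin n → ℂ) : AnalyticOnNhd ℂ (fun t => ∑ i, v i * y i t) O := fun t ht =>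
  Finset.analyticAt_fun_sum _ fun i _ => analyticAt_const.fun_mul (hy i t ht)

lemma sum_mul_sum_mul (v : Fin n → ℂ) (t : ℂ) :
    ∑ i, v i * ∑ j, A i j * y j t = ∑ j, (Matrix.vecMul v A) j * y j t := by
  simp only [Matrix.vecMul, dotProduct, Finset.mul_sum, Finset.sum_mul]
  rw [Finset.sum_comm]
  exact Finset.sum_congr rfl fun j _ => Finset.sum_congr rfl fun i _ => by ring

/-- Continuation is stated for a combination v · y: upwards v becomes v A, downwards v A becomes v.
Successive crossings then multiply matrices on the right. -/
lemma IsCrossing.continuesOn_up (h : IsCrossing y A O) (hO : IsOpen O)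
    (hy : ∀ i, AnalyticOnNhd ℂ (y i) slitDomain) {γ : ℝ → ℂ} (hγ : Continuous γ) {a b s₀ : ℝ}
    (ha : a < s₀) (hb : s₀ < b) (h₀ : γ s₀ ∈ O) (hleft : ∀ᶠ s in 𝓝[<] s₀, (γ s).im < 0)
    (hright : ∀ᶠ s in 𝓝[>] s₀, 0 < (γ s).im)
    (hslit : ∀ s ∈ Set.Icc a b, s ≠ s₀ → γ s ∈ slitDomain) (v : Fin n → ℂ) :
    ContinuesOn γ a b (fun t => ∑ i, v i * y i t) fun t => ∑ j, (Matrix.vecMul v A) j * y j t := by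
  obtain ⟨G, hG⟩ := h
  refine continuesOn_through hγ ha hb hO (isOpen_lt Complex.continuous_im continuous_const)
    (isOpen_lt continuous_const Complex.continuous_im) h₀ (H := fun t => ∑ i, v i * G i t)
    (analyticOnNhd_sum_mul (fun i => (hG i).1) v) (analyticOnNhd_sum_mul hy v)
    (analyticOnNhd_sum_mul hy _) (fun t ht him => ?_) (fun t ht him => ?_) hleft hright hslit
  · exact Finset.sum_congr rfl fun i _ => by rw [(hG i).2.1 t ht him]
  · rw [← sum_mul_sum_mul]
    exact Finset.sum_congr rfl fun i _ => by rw [(hG i).2.2 t ht him]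

lemma IsCrossing.continuesOn_down (h : IsCrossing y A O) (hO : IsOpen O)
    (hy : ∀ i, AnalyticOnNhd ℂ (y i) slitDomain) {γ : ℝ → ℂ} (hγ : Continuous γ) {a b s₀ : ℝ}
    (ha : a < s₀) (hb : s₀ < b) (h₀ : γ s₀ ∈ O) (hleft : ∀ᶠ s in 𝓝[<] s₀, 0 < (γ s).im)
    (hright : ∀ᶠ s in 𝓝[>] s₀, (γ s).im < 0)
    (hslit : ∀ s ∈ Set.Icc a b, s ≠ s₀ → γ s ∈ slitDomain) (v : Fin n → ℂ) :
    ContinuesOn γ a b (fun t => ∑ j, (Matrix.vecMul v A) j * y j t) fun t => ∑ i, v i * y i t := by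
  obtain ⟨G, hG⟩ := h
  refine continuesOn_through hγ ha hb hO (isOpen_lt continuous_const Complex.continuous_im)
    (isOpen_lt Complex.continuous_im continuous_const) h₀ (H := fun t => ∑ i, v i * G i t)
    (analyticOnNhd_sum_mul (fun i => (hG i).1) v) (analyticOnNhd_sum_mul hy _)
    (analyticOnNhd_sum_mul hy v) (fun t ht him => ?_) (fun t ht him => ?_) hleft hright hslit
  · rw [← sum_mul_sum_mul]
    exact Finset.sum_congr rfl fun i _ => by rw [(hG i).2.2 t ht him]
  · exact Finset.sum_congr rfl fun i _ => by rw [(hG i).2.1 t ht him]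

end Continuation

/-! ### The three loops and their crossings -/

section Loops

variable {n : ℕ}

lemma continuous_circleLoop (p z : ℂ) : Continuous (circleLoop p z) := by
  unfold circleLoop
  fun_prop

lemma circleLoop_zero_eq_one (p z : ℂ) : circleLoop p z 0 = circleLoop p z 1 := by
  simp [circleLoop, Complex.exp_two_pi_mul_I]

lemma hasDerivAt_circleLoop_im (p z : ℂ) (s : ℝ) :
    HasDerivAt (fun s => (circleLoop p z s).im)
      (2 * Real.pi * ((circleLoop p z s).re - z.re)) s := by
  have h1 : HasDerivAt (circleLoop p z)
      (2 * Real.pi * Complex.I * (circleLoop p z s - z)) s := by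
    have h := (((hasDerivAt_id s).ofReal_comp.const_mul (2 * Real.pi * Complex.I)).cexp.const_mul
      (p - z)).const_add z
    refine h.congr_deriv ?_
    simp only [circleLoop, id, Complex.ofReal_one]
    ring
  have h2 := Complex.imCLM.hasFDerivAt.comp_hasDerivAt s h1
  refine h2.congr_deriv ?_
  have h3 : 2 * Real.pi * Complex.I * (circleLoop p z s - z) =
      ((2 * Real.pi : ℝ) : ℂ) * (Complex.I * (circleLoop p z s - z)) := by push_cast; ring
  rw [Complex.imCLM_apply, h3, Complex.im_ofReal_mul, Complex.I_mul_im, Complex.sub_re]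

/-- Along a counterclockwise circle the imaginary part has derivative 2π times the horizontal
distance from the centre, so crossings to the right of the centre go upwards and those to the left
go downwards. -/
lemma eventually_circleLoop_im_up {p z : ℂ} {s : ℝ} (h0 : (circleLoop p z s).im = 0)
    (h1 : z.re < (circleLoop p z s).re) : (∀ᶠ x in 𝓝[<] s, (circleLoop p z x).im < 0) ∧
      ∀ᶠ x in 𝓝[>] s, 0 < (circleLoop p z x).im := by
  have h := eventually_nhdsWithin_sign_eq_of_deriv_pos (x₀ := s)
    (by rw [(hasDerivAt_circleLoop_im p z s).deriv]
        exact mul_pos (by positivity) (sub_pos.mpr h1)) h0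
  constructor
  · filter_upwards [h.filter_mono nhdsWithin_le_nhds, self_mem_nhdsWithin] with x h2 h3
    rwa [sign_neg (sub_neg.mpr h3), sign_eq_neg_one_iff] at h2
  · filter_upwards [h.filter_mono nhdsWithin_le_nhds, self_mem_nhdsWithin] with x h2 h3
    rwa [sign_pos (sub_pos.mpr h3), sign_eq_one_iff] at h2

lemma eventually_circleLoop_im_down {p z : ℂ} {s : ℝ} (h0 : (circleLoop p z s).im = 0)
    (h1 : (circleLoop p z s).re < z.re) : (∀ᶠ x in 𝓝[<] s, 0 < (circleLoop p z x).im) ∧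
      ∀ᶠ x in 𝓝[>] s, (circleLoop p z x).im < 0 := by
  have h := eventually_nhdsWithin_sign_eq_of_deriv_neg (x₀ := s)
    (by rw [(hasDerivAt_circleLoop_im p z s).deriv]
        exact mul_neg_of_pos_of_neg (by positivity) (sub_neg.mpr h1)) h0
  constructor
  · filter_upwards [h.filter_mono nhdsWithin_le_nhds, self_mem_nhdsWithin] with x h2 h3
    rwa [sign_pos (sub_pos.mpr h3), sign_eq_one_iff] at h2
  · filter_upwards [h.filter_mono nhdsWithin_le_nhds, self_mem_nhdsWithin] with x h2 h3
    rwa [sign_neg (sub_neg.mpr h3), sign_eq_neg_one_iff] at h2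

/-- In units of 1/(2C) the base point is 1 - i, the singular points are 0 and 2, and the centres of
the loops are 0, 2 and 1 + i. -/
lemma circleLoop_basePoint (a b s : ℝ) :
    circleLoop (basePoint n) ((a + b * Complex.I) / (2 * (singC n : ℂ))) s =
      ((a + (1 - a) * Real.cos (2 * Real.pi * s) + (1 + b) * Real.sin (2 * Real.pi * s) : ℝ) +
        (b - (1 + b) * Real.cos (2 * Real.pi * s) + (1 - a) * Real.sin (2 * Real.pi * s) : ℝ) *
          Complex.I) / (2 * (singC n : ℂ)) := by
  have h : Complex.exp (2 * Real.pi * Complex.I * s) =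
      Complex.cos (2 * Real.pi * s) + Complex.sin (2 * Real.pi * s) * Complex.I := by
    rw [← Complex.exp_mul_I]; congr 1; ring
  rw [circleLoop, basePoint, h, ← sub_div, div_mul_eq_mul_div, ← add_div]
  congr 1
  push_cast
  linear_combination (-(1 + b) * Complex.sin (2 * Real.pi * s)) * Complex.I_sq

lemma re_div_two_singC (z : ℂ) : (z / (2 * (singC n : ℂ))).re = z.re / (2 * singC n) := by
  have : (2 * (singC n : ℂ)) = ((2 * singC n : ℝ) : ℂ) := by push_cast; rfl
  rw [this, Complex.div_ofReal_re]

lemma im_div_two_singC (z : ℂ) : (z / (2 * (singC n : ℂ))).im = z.im / (2 * singC n) := by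
  have : (2 * (singC n : ℂ)) = ((2 * singC n : ℝ) : ℂ) := by push_cast; rfl
  rw [this, Complex.div_ofReal_im]

lemma mem_slitDomain_of {X Y : ℝ} (h : Y = 0 → X < 0) :
    ((X : ℂ) + Y * Complex.I) / (2 * (singC n : ℂ)) ∈ slitDomain := by
  have hC := singC_pos n
  change -_ ∈ Complex.slitPlane
  rw [Complex.mem_slitPlane_iff, Complex.neg_re, Complex.neg_im, re_div_two_singC,
    im_div_two_singC, neg_pos]
  simp only [Complex.add_re, Complex.ofReal_re, Complex.mul_re, Complex.I_re, mul_zero,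
    Complex.ofReal_im, Complex.I_im, Complex.add_im, Complex.mul_im, mul_one, zero_add,
    add_zero, sub_self]
  by_cases hY : Y = 0
  · exact Or.inl (div_neg_of_neg_of_pos (h hY) (by positivity))
  · exact Or.inr (neg_ne_zero.mpr (div_ne_zero hY (by positivity)))

lemma mem_crossing_zero {X : ℝ} (h0 : 0 < X) (h1 : X < 2) : ((X : ℂ) / (2 * (singC n : ℂ))) ∈
    {t : ℂ | 0 < t.re ∧ ‖(singC n : ℂ) * t‖ < 1} := by
  have hC := singC_pos n
  have e : (singC n : ℂ) * (X / (2 * (singC n : ℂ))) = ((X / 2 : ℝ) : ℂ) := by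
    have := singC_ne_zero n
    push_cast
    field_simp
  refine ⟨?_, ?_⟩
  · rw [re_div_two_singC, Complex.ofReal_re]; positivity
  · rw [e, Complex.norm_real, Real.norm_of_nonneg (by positivity)]; linarith

lemma mem_crossing_infty {X : ℝ} (h1 : 2 < X) : ((X : ℂ) / (2 * (singC n : ℂ))) ∈
    {t : ℂ | 0 < t.re ∧ 1 < ‖(singC n : ℂ) * t‖} := by
  have hC := singC_pos n
  have h0 : 0 < X := by linarith
  have e : (singC n : ℂ) * (X / (2 * (singC n : ℂ))) = ((X / 2 : ℝ) : ℂ) := by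
    have := singC_ne_zero n
    push_cast
    field_simp
  refine ⟨?_, ?_⟩
  · rw [re_div_two_singC, Complex.ofReal_re]; positivity
  · rw [e, Complex.norm_real, Real.norm_of_nonneg (by positivity)]; linarith

lemma two_pi_mul_eq_of_cos_eq {s s₀ : ℝ} (h0 : 0 ≤ s) (h1 : s ≤ 1 / 2) (h2 : 0 ≤ s₀)
    (h3 : s₀ ≤ 1 / 2) (h : Real.cos (2 * Real.pi * s) = Real.cos (2 * Real.pi * s₀)) : s = s₀ := by
  have hpi := Real.pi_pos
  have := Real.injOn_cos ⟨by positivity, by nlinarith⟩ ⟨by positivity, by nlinarith⟩ h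
  exact mul_left_cancel₀ (by positivity) this

lemma sin_two_pi_mul_nonneg {s : ℝ} (h0 : 0 ≤ s) (h1 : s ≤ 1 / 2) :
    0 ≤ Real.sin (2 * Real.pi * s) := by
  have hpi := Real.pi_pos
  exact Real.sin_nonneg_of_nonneg_of_le_pi (by positivity) (by nlinarith)

lemma sin_two_pi_mul_nonpos {s : ℝ} (h0 : 1 / 2 ≤ s) (h1 : s ≤ 1) :
    Real.sin (2 * Real.pi * s) ≤ 0 := by
  have h := sin_two_pi_mul_nonneg (s := 1 - s) (by linarith) (by linarith)
  rw [show 2 * Real.pi * (1 - s) = 2 * Real.pi - 2 * Real.pi * s by ring,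
    Real.sin_two_pi_sub] at h
  linarith

lemma sq_sqrt_two_div : (√2 / 2) ^ 2 = 1 / 2 := by
  rw [div_pow, Real.sq_sqrt (by norm_num)]; norm_num

lemma cos_sin_one_eighth : Real.cos (2 * Real.pi * (1 / 8)) = √2 / 2 ∧
    Real.sin (2 * Real.pi * (1 / 8)) = √2 / 2 := by
  rw [show 2 * Real.pi * (1 / 8) = Real.pi / 4 by ring]
  exact ⟨Real.cos_pi_div_four, Real.sin_pi_div_four⟩

lemma cos_sin_three_eighths : Real.cos (2 * Real.pi * (3 / 8)) = -(√2 / 2) ∧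
    Real.sin (2 * Real.pi * (3 / 8)) = √2 / 2 := by
  rw [show 2 * Real.pi * (3 / 8) = Real.pi - Real.pi / 4 by ring, Real.cos_pi_sub, Real.sin_pi_sub]
  exact ⟨by rw [Real.cos_pi_div_four], Real.sin_pi_div_four⟩

lemma cos_sin_seven_eighths : Real.cos (2 * Real.pi * (7 / 8)) = √2 / 2 ∧
    Real.sin (2 * Real.pi * (7 / 8)) = -(√2 / 2) := by
  rw [show 2 * Real.pi * (7 / 8) = 2 * Real.pi - Real.pi / 4 by ring, Real.cos_two_pi_sub,
    Real.sin_two_pi_sub]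
  exact ⟨Real.cos_pi_div_four, by rw [Real.sin_pi_div_four]⟩

lemma cos_sin_one_sixth : Real.cos (2 * Real.pi * (1 / 6)) = 1 / 2 ∧
    Real.sin (2 * Real.pi * (1 / 6)) = √3 / 2 := by
  rw [show 2 * Real.pi * (1 / 6) = Real.pi / 3 by ring]
  exact ⟨Real.cos_pi_div_three, Real.sin_pi_div_three⟩

/-- The data of a crossing of the real axis by the loop with centre `(a + b i)/(2C)`. -/
lemma circleLoop_of_im_eq_zero {a b s X : ℝ}
    (hX : a + (1 - a) * Real.cos (2 * Real.pi * s) + (1 + b) * Real.sin (2 * Real.pi * s) = X)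
    (hY : b - (1 + b) * Real.cos (2 * Real.pi * s) + (1 - a) * Real.sin (2 * Real.pi * s) = 0) :
    circleLoop (basePoint n) ((a + b * Complex.I) / (2 * (singC n : ℂ))) s =
      (X : ℂ) / (2 * (singC n : ℂ)) := by
  rw [circleLoop_basePoint, hX, hY]
  simp

lemma circleLoop_mem_slitDomain {a b s : ℝ}
    (h : b - (1 + b) * Real.cos (2 * Real.pi * s) + (1 - a) * Real.sin (2 * Real.pi * s) = 0 →
      a + (1 - a) * Real.cos (2 * Real.pi * s) + (1 + b) * Real.sin (2 * Real.pi * s) < 0) :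
    circleLoop (basePoint n) ((a + b * Complex.I) / (2 * (singC n : ℂ))) s ∈ slitDomain := by
  rw [circleLoop_basePoint]
  exact mem_slitDomain_of h

lemma crossing_up {a b s X : ℝ} (haX : a < X)
    (h : circleLoop (basePoint n) ((a + b * Complex.I) / (2 * (singC n : ℂ))) s =
      (X : ℂ) / (2 * (singC n : ℂ))) :
    (∀ᶠ x in 𝓝[<] s,
        (circleLoop (basePoint n) ((a + b * Complex.I) / (2 * (singC n : ℂ))) x).im < 0) ∧
      ∀ᶠ x in 𝓝[>] s,
        0 < (circleLoop (basePoint n) ((a + b * Complex.I) / (2 * (singC n : ℂ))) x).im := by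
  have hC := singC_pos n
  refine eventually_circleLoop_im_up ?_ ?_
  · rw [h, im_div_two_singC, Complex.ofReal_im, zero_div]
  · rw [h, re_div_two_singC, re_div_two_singC, Complex.ofReal_re]
    simpa using div_lt_div_of_pos_right haX (by positivity)

lemma crossing_down {a b s X : ℝ} (haX : X < a)
    (h : circleLoop (basePoint n) ((a + b * Complex.I) / (2 * (singC n : ℂ))) s =
      (X : ℂ) / (2 * (singC n : ℂ))) :
    (∀ᶠ x in 𝓝[<] s,
        0 < (circleLoop (basePoint n) ((a + b * Complex.I) / (2 * (singC n : ℂ))) x).im) ∧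
      ∀ᶠ x in 𝓝[>] s,
        (circleLoop (basePoint n) ((a + b * Complex.I) / (2 * (singC n : ℂ))) x).im < 0 := by
  have hC := singC_pos n
  refine eventually_circleLoop_im_down ?_ ?_
  · rw [h, im_div_two_singC, Complex.ofReal_im, zero_div]
  · rw [h, re_div_two_singC, re_div_two_singC, Complex.ofReal_re]
    simpa using div_lt_div_of_pos_right haX (by positivity)

lemma one_lt_sqrt_two_lt : 1 < √2 ∧ √2 < 2 := by
  constructor
  · exact Real.lt_sqrt_of_sq_lt (by norm_num)
  · rw [Real.sqrt_lt' (by norm_num)]; norm_num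

variable {y : Fin n → ℂ → ℂ} {A B : Matrix (Fin n) (Fin n) ℂ}

lemma isOpen_crossing_zero : IsOpen {t : ℂ | 0 < t.re ∧ ‖(singC n : ℂ) * t‖ < 1} :=
  (isOpen_lt continuous_const Complex.continuous_re).inter
    (isOpen_lt (continuous_const.mul continuous_id).norm continuous_const)

lemma isOpen_crossing_infty : IsOpen {t : ℂ | 0 < t.re ∧ 1 < ‖(singC n : ℂ) * t‖} :=
  (isOpen_lt continuous_const Complex.continuous_re).inter
    (isOpen_lt continuous_const (continuous_const.mul continuous_id).norm)

lemma vecMul_single_one (A : Matrix (Fin n) (Fin n) ℂ) (i : Fin n) :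
    Matrix.vecMul (Pi.single i 1) A = A i := by
  rw [Matrix.single_one_vecMul]; rfl

lemma sum_single_one_mul (i : Fin n) (t : ℂ) :
    ∑ j, (Pi.single i (1 : ℂ) : Fin n → ℂ) j * y j t = y i t := by
  simp [Pi.single_apply]

/-- In units of 1/(2C) the circle has radius √2 and meets the positive axis only at √2 < 2, upwards,
at parameter 1/8. -/
lemma hasMonodromy_zero (hA : IsCrossing y A {t : ℂ | 0 < t.re ∧ ‖(singC n : ℂ) * t‖ < 1})
    (hy : ∀ i, AnalyticOnNhd ℂ (y i) slitDomain) :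
    HasMonodromy y (circleLoop (basePoint n) 0) A := by
  have e : (0 : ℂ) = (((0 : ℝ) : ℂ) + ((0 : ℝ) : ℂ) * Complex.I) / (2 * (singC n : ℂ)) := by simp
  refine ⟨circleLoop_zero_eq_one _ _, fun i => ?_⟩
  rw [e]
  obtain ⟨hc, hs⟩ := cos_sin_one_eighth
  obtain ⟨q1, q2⟩ := one_lt_sqrt_two_lt
  have h₀ := circleLoop_of_im_eq_zero (n := n) (a := 0) (b := 0) (s := 1 / 8) (X := √2)
    (by rw [hc, hs]; ring) (by rw [hc, hs]; ring)
  have hup := crossing_up (by linarith) h₀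
  have h := hA.continuesOn_up isOpen_crossing_zero hy (continuous_circleLoop _ _) (a := 0) (b := 1)
    (by norm_num) (by norm_num) (by rw [h₀]; exact mem_crossing_zero (by linarith) q2) hup.1 hup.2
    (fun s hs' hne => circleLoop_mem_slitDomain fun h => ?_) (Pi.single i 1)
  · simp only [vecMul_single_one, sum_single_one_mul] at h
    exact h
  · have h1 := Real.sin_sq_add_cos_sq (2 * Real.pi * s)
    have h2 := sq_sqrt_two_div
    rcases le_total s (1 / 2) with h3 | h3
    · have h4 := sin_two_pi_mul_nonneg hs'.1 h3
      refine absurd (two_pi_mul_eq_of_cos_eq hs'.1 h3 (by norm_num) (by norm_num) ?_) hne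
      rw [hc]
      nlinarith
    · have h4 := sin_two_pi_mul_nonpos h3 hs'.2
      nlinarith

/-- In units of 1/(2C) the circle has centre 1 + i and radius 2. It meets the real axis at 1 + √3 >
2, upwards, at parameter 1/6, and at the negative point 1 - √3, which does not leave the slit plane.
-/
lemma hasMonodromy_infty (hB : IsCrossing y B {t : ℂ | 0 < t.re ∧ 1 < ‖(singC n : ℂ) * t‖})
    (hy : ∀ i, AnalyticOnNhd ℂ (y i) slitDomain) :
    HasMonodromy y (circleLoop (basePoint n) ((1 + Complex.I) / (2 * (singC n : ℂ)))) B := by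
  have e : (1 + Complex.I) / (2 * (singC n : ℂ)) =
      (((1 : ℝ) : ℂ) + ((1 : ℝ) : ℂ) * Complex.I) / (2 * (singC n : ℂ)) := by simp
  refine ⟨circleLoop_zero_eq_one _ _, fun i => ?_⟩
  rw [e]
  obtain ⟨hc, hs⟩ := cos_sin_one_sixth
  have q : 1 < √3 := Real.lt_sqrt_of_sq_lt (by norm_num)
  have h₀ := circleLoop_of_im_eq_zero (n := n) (a := 1) (b := 1) (s := 1 / 6) (X := 1 + √3)
    (by rw [hc, hs]; ring) (by rw [hc, hs]; ring)
  have hup := crossing_up (by linarith) h₀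
  have h := hB.continuesOn_up isOpen_crossing_infty hy (continuous_circleLoop _ _) (a := 0) (b := 1)
    (by norm_num) (by norm_num) (by rw [h₀]; exact mem_crossing_infty (by linarith)) hup.1 hup.2
    (fun s hs' hne => circleLoop_mem_slitDomain fun h => ?_) (Pi.single i 1)
  · simp only [vecMul_single_one, sum_single_one_mul] at h
    exact h
  · have h1 := Real.sin_sq_add_cos_sq (2 * Real.pi * s)
    have h2 : Real.cos (2 * Real.pi * s) = 1 / 2 := by linarith
    rcases le_total s (1 / 2) with h3 | h3
    · exact absurd (two_pi_mul_eq_of_cos_eq hs'.1 h3 (by norm_num) (by norm_num) (h2.trans hc.symm))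
        hne
    · have h4 := sin_two_pi_mul_nonpos h3 hs'.2
      nlinarith

/-- In units of 1/(2C) the circle has centre 2 and radius √2. It crosses upwards at 2 + √2, beyond
the singular point, and downwards at 2 - √2, before it; the second crossing inverts A. -/
lemma hasMonodromy_conifold (hdet : IsUnit A.det)
    (hA : IsCrossing y A {t : ℂ | 0 < t.re ∧ ‖(singC n : ℂ) * t‖ < 1})
    (hB : IsCrossing y B {t : ℂ | 0 < t.re ∧ 1 < ‖(singC n : ℂ) * t‖})
    (hy : ∀ i, AnalyticOnNhd ℂ (y i) slitDomain) :
    HasMonodromy y (circleLoop (basePoint n) (1 / (singC n : ℂ))) (B * A⁻¹) := by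
  have e : 1 / (singC n : ℂ) =
      (((2 : ℝ) : ℂ) + ((0 : ℝ) : ℂ) * Complex.I) / (2 * (singC n : ℂ)) := by
    have := singC_ne_zero n
    push_cast
    field_simp
    ring
  refine ⟨circleLoop_zero_eq_one _ _, fun i => ?_⟩
  rw [e]
  obtain ⟨hc, hs⟩ := cos_sin_three_eighths
  obtain ⟨hc', hs'⟩ := cos_sin_seven_eighths
  obtain ⟨q1, q2⟩ := one_lt_sqrt_two_lt
  have h₀ := circleLoop_of_im_eq_zero (n := n) (a := 2) (b := 0) (s := 3 / 8) (X := 2 + √2)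
    (by rw [hc, hs]; ring) (by rw [hc, hs]; ring)
  have h₀' := circleLoop_of_im_eq_zero (n := n) (a := 2) (b := 0) (s := 7 / 8) (X := 2 - √2)
    (by rw [hc', hs']; ring) (by rw [hc', hs']; ring)
  have hup := crossing_up (by linarith) h₀
  have hdown := crossing_down (by linarith) h₀'
  have hslit : ∀ s, 0 ≤ s → s ≤ 1 → s ≠ 3 / 8 → s ≠ 7 / 8 → circleLoop (basePoint n)
      ((((2 : ℝ) : ℂ) + ((0 : ℝ) : ℂ) * Complex.I) / (2 * (singC n : ℂ))) s ∈ slitDomain := by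
    intro s h0 h1 hne hne'
    refine circleLoop_mem_slitDomain fun h => ?_
    have h1' := Real.sin_sq_add_cos_sq (2 * Real.pi * s)
    have h2 := sq_sqrt_two_div
    rcases le_total s (1 / 2) with h3 | h3
    · have h4 := sin_two_pi_mul_nonneg h0 h3
      refine absurd (two_pi_mul_eq_of_cos_eq h0 h3 (by norm_num) (by norm_num) ?_) hne
      rw [hc]
      nlinarith
    · have h4 := sin_two_pi_mul_nonpos h3 h1
      have h5 : Real.cos (2 * Real.pi * (1 - s)) = Real.cos (2 * Real.pi * (1 / 8)) := by
        rw [show 2 * Real.pi * (1 - s) = 2 * Real.pi - 2 * Real.pi * s by ring,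
          Real.cos_two_pi_sub, cos_sin_one_eighth.1]
        nlinarith
      have := two_pi_mul_eq_of_cos_eq (by linarith) (by linarith) (by norm_num) (by norm_num) h5
      exact absurd (by linarith) hne'
  have h1 := hB.continuesOn_up isOpen_crossing_infty hy (continuous_circleLoop _ _) (a := 0)
    (b := 1 / 2) (by norm_num) (by norm_num) (by rw [h₀]; exact mem_crossing_infty (by linarith))
    hup.1 hup.2 (fun s hs hne => hslit s hs.1 (by linarith [hs.2]) hne (by
      rintro rfl; norm_num at hs)) (Pi.single i 1)
  have h2 := hA.continuesOn_down isOpen_crossing_zero hy (continuous_circleLoop _ _) (a := 1 / 2)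
    (b := 1) (by norm_num) (by norm_num)
    (by rw [h₀']; exact mem_crossing_zero (by linarith) (by linarith))
    hdown.1 hdown.2 (fun s hs hne => hslit s (by linarith [hs.1]) hs.2 (by
      rintro rfl; norm_num at hs) hne) ((B * A⁻¹) i)
  -- After the first crossing the vector is the i-th row of B, rewritten as (B A⁻¹)_i A so that the
  -- downward crossing removes A.
  have h3 : Matrix.vecMul ((B * A⁻¹) i) A = B i := by
    have h4 : Matrix.vecMul ((B * A⁻¹) i) A = (B * A⁻¹ * A) i := rfl
    rw [h4, Matrix.mul_assoc, Matrix.nonsing_inv_mul _ hdet, Matrix.mul_one]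
  rw [h3] at h2
  simp only [vecMul_single_one, sum_single_one_mul] at h1
  exact h1.trans (continuous_circleLoop _ _) (by norm_num) (by norm_num) h2

end Loops

/-! ### The monodromy matrices -/

section Monodromy

variable {n : ℕ}

lemma intertwiner_conj_mConifold (n : ℕ) :
    intertwiner n * mConifold n * (intertwiner n)⁻¹ =
      shiftCompanion n (fun _ => 1) * (shiftCompanion n (unipotentCoeff n))⁻¹ := by
  rw [← intertwiner_conj_mZero, ← intertwiner_conj_mInfty, Matrix.mul_inv_rev, Matrix.mul_inv_rev,
    Matrix.nonsing_inv_nonsing_inv _ (isUnit_det_intertwiner n), mConifold]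
  simp only [Matrix.mul_assoc]
  rw [Matrix.nonsing_inv_mul_cancel_left _ _ (isUnit_det_intertwiner n)]

lemma isUnit_det_mZero (n : ℕ) : IsUnit (mZero n).det := by
  rw [← Matrix.isUnit_iff_isUnit_det, ← sub_add_cancel (mZero n) 1]
  exact IsNilpotent.isUnit_add_one ⟨n, mZero_sub_one_pow_eq_zero n⟩

lemma isUnit_det_shiftCompanion_unipotentCoeff (n : ℕ) :
    IsUnit (shiftCompanion n (unipotentCoeff n)).det := by
  rw [← intertwiner_conj_mZero, Matrix.det_mul, Matrix.det_mul]
  exact ((isUnit_det_intertwiner n).mul (isUnit_det_mZero n)).mul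
    (Matrix.isUnit_nonsing_inv_det _ (isUnit_det_intertwiner n))

lemma analyticOnNhd_mbInt_lineZ (hn : 0 < n) {σ : ℝ} (h0 : σ < 0) (h1 : ∀ i, -rho n i < σ)
    (k : Fin n) : AnalyticOnNhd ℂ
      (fun t => mbInt n σ (lineZ n t + 2 * Real.pi * Complex.I * (k : ℕ))) slitDomain :=
  fun _ ht => AnalyticAt.fun_comp
    (g := fun z => mbInt n σ (z + 2 * Real.pi * Complex.I * (k : ℕ)))
    ((isExpODESolution_mbInt_shift hn h0 h1 k).1 _ (lineZ_mem_mbStrip ht)) (analyticAt_lineZ ht)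

/-- The crossing matrices are the two companion matrices, and `intertwiner` conjugates m₀ and m_∞
into them at once; it serves as Q for every choice of c and σ. -/
lemma hasMonodromy_mbFunction (hn : 0 < n) {c σ : ℝ} (h0 : σ + c < 0)
    (h1 : ∀ i, -rho n i < σ + c) :
    HasMonodromy (mbFunction n c σ) (circleLoop (basePoint n) 0)
        (intertwiner n * mZero n * (intertwiner n)⁻¹) ∧
      HasMonodromy (mbFunction n c σ) (circleLoop (basePoint n) (1 / (singC n : ℂ)))
        (intertwiner n * mConifold n * (intertwiner n)⁻¹) ∧
      HasMonodromy (mbFunction n c σ)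
        (circleLoop (basePoint n) ((1 + Complex.I) / (2 * (singC n : ℂ))))
        (intertwiner n * mInfty n * (intertwiner n)⁻¹) := by
  have hmb : mbFunction n c σ = fun (k : Fin n) t =>
      mbInt n (σ + c) (lineZ n t + 2 * Real.pi * Complex.I * (k : ℕ)) :=
    funext fun k => funext fun t => mbFunction_eq hn c σ k t
  have hy := analyticOnNhd_mbInt_lineZ hn h0 h1
  have hA := isCrossing_zero hn h0 h1
  have hB := isCrossing_infty hn h0 h1
  rw [hmb, intertwiner_conj_mZero, intertwiner_conj_mConifold, intertwiner_conj_mInfty]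
  exact ⟨hasMonodromy_zero hA hy,
    hasMonodromy_conifold (isUnit_det_shiftCompanion_unipotentCoeff n) hA hB hy,
    hasMonodromy_infty hB hy⟩

end Monodromy

/-! ### Assembly of the theorem -/

theorem mainTheorem10 (n : ℕ) (hn : 2 ≤ n) :
    -- the fibration of the mirror family obtained by the mixed twist with invariant (1, n, 1)
    (∀ (x : Fin n → ℂ) (v t : ℂ), v = x ⟨n - 1, by omega⟩ → v ≠ 0 → v ≠ -1 →
      mirrorPoly n x t =
        v * (v + 1) ^ n *
          mirrorPoly (n - 1) (fun i => x (Fin.castLE (Nat.sub_le n 1) i) / (v + 1))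
            (functionalInvariant 1 n t v)) ∧
    -- the induced iterative relation of the periods
    (∀ t : ℂ, ‖t‖ < 1 →
      mirrorPeriod n t =
        circleIntegral (fun v => mirrorPeriod (n - 1) (functionalInvariant 1 n t v) / (v * (v + 1)))
          0 (1 / ((n : ℝ) + 1))) ∧
    -- the period is the A-hypergeometric Euler integral with the data (A, α)
    (∀ t : ℂ, ‖t‖ < 1 →
      IntegrableOn (eulerIntegrand (gkzMatrix n) (gkzAlpha n) (eulerCoeffs n t))
        (Set.univ.pi fun _ => Set.Ioo (0 : ℝ) 1) ∧
      (∏ i : Fin (n - 1),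
          Complex.Gamma (rho n (Fin.castLE (Nat.sub_le n 1) i)) *
            Complex.Gamma (1 - rho n (Fin.castLE (Nat.sub_le n 1) i))) * mirrorPeriod n t =
        (2 * Real.pi * Complex.I) ^ (n - 1) *
          ∫ z in Set.univ.pi fun _ : Fin (n - 1) => Set.Ioo (0 : ℝ) 1,
            eulerIntegrand (gkzMatrix n) (gkzAlpha n) (eulerCoeffs n t) z) ∧
    -- and, in the rescaled variable, it satisfies the hypergeometric equation
    IsHypergeometricSolution n (Metric.ball 0 (1 / (singC n : ℝ)))
      (fun t => mirrorPeriod n ((singC n : ℂ) * t)) ∧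
    -- the GKZ data; they are non-resonant
    IsGKZConfiguration (gkzMatrix n) ∧
    (∀ ℓ : Fin n ⊕ Fin n → ℤ, (gkzMatrix n).mulVec ℓ = 0 ↔ ∃ c : ℤ, ℓ = c • gkzB n) ∧
    (∀ i, gkzAlpha n i = ∑ j, (gkzMatrix n i j : ℂ) * (gkzGamma0 n j : ℂ)) ∧
    IsNonResonant (gkzMatrix n) (gkzAlpha n) ∧
    -- the Mellin-Barnes integrals
    (∀ c σ : ℝ,
      (∀ i, gkzGamma n c (Sum.inr i) < σ ∧ σ < -gkzGamma n c (Sum.inl i)) →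
      -- they converge absolutely
      (∀ w : Fin n ⊕ Fin n → ℂ, |(∑ j, (gkzB n j : ℂ) * w j).im| < n * Real.pi →
        Integrable fun y : ℝ => Complex.I *
          mellinBarnesIntegrand (gkzB n) (gkzGamma n c) w ((σ : ℂ) + (y : ℂ) * Complex.I)) ∧
      -- they solve the GKZ system
      (∀ (U : Set (Fin n ⊕ Fin n → ℂ)) (L : (Fin n ⊕ Fin n → ℂ) → (Fin n ⊕ Fin n → ℂ)),
        IsOpen U → ContinuousOn L U → (∀ u ∈ U, ∀ j, Complex.exp (L u j) = u j) →
        (∀ u ∈ U, |(∑ j, (gkzB n j : ℂ) * L u j).im| < n * Real.pi) →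
        IsGKZSolution (gkzMatrix n) (gkzAlpha n) U
          (fun u => mellinBarnes (gkzB n) (gkzGamma n c) σ (L u))) ∧
      -- n branches of them are a basis of its solutions
      (∀ (U : Set (Fin n ⊕ Fin n → ℂ)) (L : (Fin n ⊕ Fin n → ℂ) → (Fin n ⊕ Fin n → ℂ)),
        IsOpen U → IsConnected U → ContinuousOn L U →
        (∀ u ∈ U, ∀ j, Complex.exp (L u j) = u j) →
        (∀ u ∈ U, -(n * Real.pi) < (∑ j, (gkzB n j : ℂ) * L u j).im ∧
          (∑ j, (gkzB n j : ℂ) * L u j).im < -(n * Real.pi) + 2 * Real.pi) →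
        IsBasisOfSolutions (IsGKZSolution (gkzMatrix n) (gkzAlpha n) U) U
          (fun (k : Fin n) u => mellinBarnes (gkzB n) (gkzGamma n c) σ (shiftLog n k (L u)))) ∧
      -- restricted to the line u = ((-1)^n C t, 1, …, 1), they are a basis of solutions of the
      -- hypergeometric equation
      (∀ t ∈ slitDomain, ∀ j (k : Fin n),
        Complex.exp (shiftLog n k (lineLog n t) j) = linePoint n t j) ∧
      (∀ V : Set ℂ, V ⊆ slitDomain → IsOpen V → IsConnected V →
        IsBasisOfSolutions (IsHypergeometricSolution n V) V (mbFunction n c σ)) ∧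
      -- their monodromy around 0, 1/C and ∞ is, up to a common conjugation, m₀, m_{1/C}, m_∞
      ∃ Q : Matrix (Fin n) (Fin n) ℂ, IsUnit Q.det ∧
        HasMonodromy (mbFunction n c σ) (circleLoop (basePoint n) 0) (Q * mZero n * Q⁻¹) ∧
        HasMonodromy (mbFunction n c σ) (circleLoop (basePoint n) (1 / (singC n : ℂ)))
          (Q * mConifold n * Q⁻¹) ∧
        HasMonodromy (mbFunction n c σ)
          (circleLoop (basePoint n) ((1 + Complex.I) / (2 * (singC n : ℂ))))
          (Q * mInfty n * Q⁻¹)) ∧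
    -- P̃ is invertible and m₀ is maximally unipotent
    IsUnit (transitionP n).det ∧ (mZero n - 1) ^ n = 0 ∧ (mZero n - 1) ^ (n - 1) ≠ 0 := by
  have hn0 : 0 < n := by omega
  refine ⟨fun x v t hv h0 h1 => mirrorPoly_eq_mul hn x v t hv h0 h1,
    fun t ht => mirrorPeriod_eq_circleIntegral hn ht,
    fun t ht => mirrorPeriod_eq_eulerIntegral hn ht,
    isHypergeometricSolution_mirrorPeriod hn0, isGKZConfiguration_gkzMatrix hn0,
    gkzMatrix_mulVec_eq_zero_iff hn0, gkzAlpha_eq hn0, isNonResonant_gkz hn0, fun c σ h => ?_,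
    isUnit_det_transitionP n, mZero_sub_one_pow_eq_zero n, mZero_sub_one_pow_ne_zero hn0⟩
  -- From here c and σ matter only through the abscissa σ + c of the contour.
  obtain ⟨h0, h1⟩ := gkzGamma_bounds hn0 h
  refine ⟨fun w hw => integrable_mellinBarnesIntegrand hn0 h0 h1 hw, fun U L hU hL hexp hS => ?_,
    fun U L hU hUc hL hexp hS => ?_, fun t ht j k => exp_shiftLog_lineLog ht k j,
    fun V hVs hV hVc => isBasisOfSolutions_mbFunction hn0 h0 h1 hVs hV hVc,
    intertwiner n, isUnit_det_intertwiner n, hasMonodromy_mbFunction hn0 h0 h1⟩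
  · simp only [mellinBarnes_gkz]
    exact isGKZSolution_of_isExpODESolution hn0 ⟨hU, hL, hexp⟩ (isExpODESolution_mbInt hn0 h0 h1)
      (isOpen_strip _) hS
  · simp only [mellinBarnes_gkz, logB_shiftLog hn0, logGamma0_shiftLog]
    exact isBasisOfSolutions_gkz hn0 h0 h1 ⟨hU, hL, hexp⟩ hUc hS
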